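/- **Setting.** Let $d\ge 1$ and let $U\subset\mathbb R^d$ be open, convex and bounded. For compact $K\subset U$ put $D_K^U=\mathrm{dist}(K,\partial U)$; for $\rho>0$ put $U^{\rho}=\{x\in U:\mathrm{dist}(x,\partial U)>\rho\}$; $\mathrm{co}(K)$ is the convex hull of $K$. For $\varphi\in\mathcal D(B(0,1))$ let $\varphi_x^\lambda(y)=\lambda^{-d}\varphi(\lambda^{-1}(y-x))$, and let $\mathcal B^q$ be the set of $\varphi\in\mathcal D(B(0,1))$ with $\|\varphi\|_{C^q}\le 1$. *Coherent germs.* A germ on $U$ is a family $F=(F_x)_{x\in U}\subset\mathcal D'(U)$ such that $x\mapsto F_x(\varphi)$ is measurable for every $\varphi\in\mathcal D(U)$. Let $\gamma\in\mathbb R$, and for every compact $K\subset U$ let $\alpha_K\le\min\{0,\gamma\}$ and $r_K\in\mathbb N_0$. $\mathcal G^{\alpha_\gamma}_r(U)$ is the space of germs such that for every compact $K\subset U$ and $\bar\lambda\in(0,D_K^U)$ $$\|F\|_{K,\bar\lambda}=\sup_{\lambda\in(0,\bar\lambda],\;x,y\in K,\;\varphi\in\mathcal B^{r_K}}\frac{|(F_x-F_y)(\varphi_x^\lambda)|}{\lambda^{\alpha_K}(\lambda+|x-y|)^{\gamma-\alpha_K}}<\infty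 .$$ *Reconstruction.* For compact $\tilde K$ put $m_{\tilde K}=\max\{\lfloor-\alpha_{\tilde K}+1\rfloor,\,r_{\tilde K}+d+1\}$. A distribution $f\in\mathcal D'(U)$ is a $\gamma$-reconstruction of $F$ ($\gamma\ne0$) if for every compact $K\subset U$ and $\bar\lambda\in(0,D^U_K)$ there are a compact $\tilde K$ with $K\subset\tilde K\subset U$ and $C$ such that $|(f-F_z)(\varphi_z^\lambda)|\le C\lambda^\gamma$ for $z\in K$, $\lambda\in(0,\bar\lambda]$, $\varphi\in\mathcal B^{m_{\tilde K}}$. A reconstruction operator is a linear map $\mathcal R^\gamma:\mathcal G^{\alpha_\gamma}_r(U)\to\mathcal D'(U)$ such that for all such $K,\bar\lambda$ there are $\tilde K$ as above, $\tilde\lambda\in(0,D^U_{\tilde K})$ and $C$ for which this bound holds for $f=\mathcal R^\gamma F$ with constant $C\|F\|_{\tilde K,\tilde\lambda}$, for all $F$. *Kernels.* Let $\beta,\rho>0$, $m,r\in\mathbb N_0$. A $\beta$-regularizing kernel of order $(m,r)$ with range $\rho$ on $U$ is $\mathsf K=\sum_{n\ge0}\mathsf K_n$ (a.e. on $U\times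 U$) with $\mathsf K_n\in C^{m,r}(U\times U)$, $\mathrm{supp}\,\mathsf K_n\subset\{|x-y|\le\rho2^{-n}\}$ and, for every compact $K\subset U$, some $c_K$ such that for all $n$: $|\partial_1^k\partial_2^\ell\mathsf K_n(x,y)|\le c_K2^{(d-\beta+|\ell|+|k|)n}$ for $x,y\in K$, $|k|\le m$, $|\ell|\le r$; and $|\int_U(y-x)^\ell\partial_2^k\mathsf K_n(x,y)\,dx|\le c_K2^{-\beta n}$ (with integrable integrand) for $y\in K$, $|k|,|\ell|\le r$. For $f\in\mathcal D'(U)$, "$\mathsf Kf\in\mathcal D'(U^{2\rho})$" means that $\mathsf Kf(\psi)=\sum_n f(\mathsf K_n^*\psi)$, $\mathsf K_n^*\psi(y)=\int\mathsf K_n(x,y)\psi(x)\,dx$, is well-defined for all $\psi\in\mathcal D(U^{2\rho})$ and is a distribution; here $f(g)$, for a function $g$ that need not be smooth, is the common limit of $f(g*\eta_\varepsilon)$, $\varepsilon\to0$, over all mollifiers $\eta$. The pointwise derivative $D^kg(x)$ of a distribution $g$ is the number $c$ such that $(D^kg)(\eta_x^\varepsilon)\to c\int\eta$ as $\varepsilon\to0$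 for all $\eta\in\mathcal D(B(0,1))$. **Proposition.** Let $\gamma\neq0$, $\beta>0$, $\alpha_K\le\min\{0,\gamma\}$ and $\alpha_K+\beta\ne0$ for all compact $K\subset U$, $\gamma+\beta\notin\mathbb N_0$, $m>\gamma+\beta$, and $r>-\alpha_K$ for all compact $K\subset U$. There are numbers $\tilde\alpha_K\le\min\{0,\gamma+\beta\}$ ($K\subset U^{2\rho}$ compact) such that the following holds for every $\beta$-regularizing kernel $\mathsf K$ of order $(m,r)$ with range $\rho$ on $U$ and every reconstruction operator $\mathcal R^\gamma$. Let $\mathcal W\subset\mathcal G^{\alpha_\gamma}_r(U)$ be any linear subspace (for instance the whole space) with $\mathsf K(\mathcal R^\gamma F)\in\mathcal D'(U^{2\rho})$ for all $F\in\mathcal W$. Then for $F\in\mathcal W$ and $x\in U^{2\rho}$ the distributions $\mathsf KF_x$, $\mathsf K(F_x-\mathcal R^\gamma F)$ on $U^{2\rho}$ and the pointwise derivatives in $$(\mathcal K^{\gamma,\beta}F)_x=\mathsf KF_x-\sum_{0\le|k|\le\lfloor\gamma+\beta\rfloor}D^k\big(\mathsf K\{F_x-\mathcal R^\gamma F\}\big)(x)\,\frac{(\cdot-x)^k}{k!}$$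 are well-defined, and: 1. $F\mapsto\mathcal K^{\gamma,\beta}F$ is a linear map from $\mathcal W$ into $\mathcal G^{\tilde\alpha_{\gamma+\beta}}_{\bar r'}(U^{2\rho})$, $\bar r'_K=r_{\mathrm{co}(K)}$, and it is continuous: for every compact $K\subset U^{2\rho}$ there is a compact $\tilde K'$ with $\mathrm{co}(K)\subset\tilde K'\subset U$ such that for every $\bar\lambda\in(0,D_K^{U^{2\rho}})$ there are $\lambda_1\in(0,D^U_{\mathrm{co}(K)})$, $\lambda_2\in(0,D^U_{\tilde K'})$ and $C$ with, for all $F\in\mathcal W$, $$\|\mathcal K^{\gamma,\beta}F\|_{K,\bar\lambda}\le C\big(\|F\|_{\mathrm{co}(K),\lambda_1}+\|F\|_{\tilde K',\lambda_2}\big),$$ and, if $r_{\tilde K'}\le r_{\mathrm{co}(K)}$ (for instance if the family of orders is constant), even $\|\mathcal K^{\gamma,\beta}F\|_{K,\bar\lambda}\le C\|F\|_{\tilde K',\lambda_2}$. 2. $\mathcal R^{\gamma+\beta}(\mathcal K^{\gamma,\beta}F)=\mathsf K(\mathcal R^\gamma F)$ on $U^{2\rho}$, i.e. $\mathsf K(\mathcal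 R^\gamma F)$ is a $(\gamma+\beta)$-reconstruction of $\mathcal K^{\gamma,\beta}F$; if $\gamma+\beta>0$ it is the only one. -/

import Mathlib

open Set Filter Topology MeasureTheory TopologicalSpace
open scoped Distributions LineDeriv ENNReal NNReal

noncomputable section

namespace Germs

/-- Euclidean space `ℝ^d`. -/
abbrev Sp (d : ℕ) := EuclideanSpace ℝ (Fin d)

variable {d : ℕ}

/-! ### Multi-indices and partial derivatives -/

/-- The length `|k| = k_1 + ... + k_d` of a multi-index. -/
def len (k : Fin d → ℕ) : ℕ := ∑ i, k i

/-- The coordinate directions of a multi-index: each basis vector `e_i` is listed `k_i` times. -/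
def dirs (k : Fin d → ℕ) : Fin (∑ i, k i) → Sp d :=
  fun j => EuclideanSpace.single (finSigmaFinEquiv.symm j).1 (1 : ℝ)

/-- The partial derivative `∂^k f (x)` of a function. -/
def pd (k : Fin d → ℕ) (f : Sp d → ℝ) (x : Sp d) : ℝ :=
  iteratedFDeriv ℝ (∑ i, k i) f x (dirs k)

/-- The monomial `(y - x)^k`. -/
def mono (k : Fin d → ℕ) (x y : Sp d) : ℝ := ∏ i, (y i - x i) ^ k i

/-- The multi-indices `k` with `0 ≤ |k| ≤ N`; there are none if `N < 0`. -/
def multiIndices (d : ℕ) (N : ℤ) : Finset (Fin d → ℕ) :=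
  (Fintype.piFinset fun _ : Fin d => Finset.range (N.toNat + 1)).filter fun k => (len k : ℤ) ≤ N

/-! ### Test functions, rescaling, distances to the boundary -/

/-- The open unit ball `B(0,1)`. -/
def unitBall (d : ℕ) : Opens (Sp d) := ⟨Metric.ball 0 1, Metric.isOpen_ball⟩

/-- The class of test functions on the unit ball whose `C^q` norm is at most one. -/
def testBall (d q : ℕ) : Set 𝓓(unitBall d, ℝ) :=
  {φ | ∀ k : Fin d → ℕ, len k ≤ q → ∀ x, |pd k φ x| ≤ 1}

/-- The rescaled and recentred function `φ_x^l (y) = l^{-d} φ (l^{-1} (y - x))`. -/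
def rescale (φ : Sp d → ℝ) (x : Sp d) (l : ℝ) (y : Sp d) : ℝ :=
  (l ^ d)⁻¹ * φ (l⁻¹ • (y - x))

/-- The distance `D_K^U = dist (K, ∂U)`, with value `∞` if `K` or `∂U` is empty. -/
def distBdry (K U : Set (Sp d)) : ℝ≥0∞ := ⨅ x ∈ K, Metric.infEDist x (frontier U)

/-- The admissible maximal scales: `l ∈ (0, D_K^U)`. -/
def AdmScale (K U : Set (Sp d)) (l : ℝ) : Prop := 0 < l ∧ ENNReal.ofReal l < distBdry K U

/-- The restriction `U^ρ = {x ∈ U | dist (x, ∂U) > ρ}`. -/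
def shrink (U : Opens (Sp d)) (ρ : ℝ) : Opens (Sp d) :=
  ⟨{x | x ∈ U ∧ ENNReal.ofReal ρ < Metric.infEDist x (frontier (U : Set (Sp d)))},
    U.isOpen.inter (isOpen_lt continuous_const Metric.continuous_infEDist)⟩

lemma shrink_le (U : Opens (Sp d)) (ρ : ℝ) : shrink U ρ ≤ U := fun _ hx => hx.1

/-! ### Germs of distributions and coherence -/

/-- Germs of distributions on `U`: measurable families `(F_x)` of distributions on `U`. -/
def germs (U : Opens (Sp d)) : Submodule ℝ (U → 𝓓'(U, ℝ)) where
  carrier := {F | ∀ φ : 𝓓(U, ℝ), Measurable fun x => F x φ}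
  add_mem' hF hG φ := (hF φ).add (hG φ)
  zero_mem' _ := measurable_const
  smul_mem' c _ hF φ := (hF φ).const_mul c

/-- The coherence seminorm on the set `K`, with exponents `a`, `γ`, order `q` and scales in
`(0, lb]`. -/
def cohNorm (U : Opens (Sp d)) (a γ : ℝ) (q : ℕ) (K : Set (Sp d)) (lb : ℝ)
    (F : U → 𝓓'(U, ℝ)) : ℝ≥0∞ :=
  ⨆ (x : U) (y : U) (_ : (x : Sp d) ∈ K) (_ : (y : Sp d) ∈ K) (l : ℝ) (_ : l ∈ Ioc 0 lb)
    (φ : 𝓓(unitBall d, ℝ)) (_ : φ ∈ testBall d q)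
    (χ : 𝓓(U, ℝ)) (_ : ∀ z, χ z = rescale φ x l z),
    ENNReal.ofReal (|(F x - F y) χ| / (l ^ a * (l + dist (x : Sp d) y) ^ (γ - a)))

lemma cohNorm_le_iff (U : Opens (Sp d)) (a γ : ℝ) (q : ℕ) (K : Set (Sp d)) (lb : ℝ)
    (F : U → 𝓓'(U, ℝ)) (C : ℝ≥0∞) :
    cohNorm U a γ q K lb F ≤ C ↔ ∀ (x y : U), (x : Sp d) ∈ K → (y : Sp d) ∈ K →
      ∀ l ∈ Ioc 0 lb, ∀ φ ∈ testBall d q, ∀ χ : 𝓓(U, ℝ), (∀ z, χ z = rescale φ x l z) →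
      ENNReal.ofReal (|(F x - F y) χ| / (l ^ a * (l + dist (x : Sp d) y) ^ (γ - a))) ≤ C := by
  simp only [cohNorm, iSup_le_iff]

lemma cohNorm_add_le (U : Opens (Sp d)) (a γ : ℝ) (q : ℕ) (K : Set (Sp d)) (lb : ℝ)
    (F G : U → 𝓓'(U, ℝ)) :
    cohNorm U a γ q K lb (F + G) ≤ cohNorm U a γ q K lb F + cohNorm U a γ q K lb G := by
  rw [cohNorm_le_iff]
  intro x y hx hy l hl φ hφ χ hχ
  have h1 := (cohNorm_le_iff U a γ q K lb F _).1 le_rfl x y hx hy l hl φ hφ χ hχ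
  have h2 := (cohNorm_le_iff U a γ q K lb G _).1 le_rfl x y hx hy l hl φ hφ χ hχ
  refine le_trans ?_ (add_le_add h1 h2)
  have hl0 : 0 < l := hl.1
  have hd : 0 ≤ dist (x : Sp d) y := dist_nonneg
  have hpos : 0 < l ^ a * (l + dist (x : Sp d) y) ^ (γ - a) := by positivity
  rw [← ENNReal.ofReal_add (by positivity) (by positivity), ← add_div]
  refine ENNReal.ofReal_le_ofReal (div_le_div_of_nonneg_right ?_ hpos.le)
  have : ((F + G) x - (F + G) y) χ = (F x - F y) χ + (G x - G y) χ := by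
    have e : (F + G) x - (F + G) y = (F x - F y) + (G x - G y) := by
      simp only [Pi.add_apply]; abel
    rw [e]; rfl
  rw [this]
  exact abs_add_le _ _

lemma cohNorm_smul_le (U : Opens (Sp d)) (a γ : ℝ) (q : ℕ) (K : Set (Sp d)) (lb : ℝ)
    (c : ℝ) (F : U → 𝓓'(U, ℝ)) :
    cohNorm U a γ q K lb (c • F) ≤ ENNReal.ofReal |c| * cohNorm U a γ q K lb F := by
  rw [cohNorm_le_iff]
  intro x y hx hy l hl φ hφ χ hχ
  have h1 := (cohNorm_le_iff U a γ q K lb F _).1 le_rfl x y hx hy l hl φ hφ χ hχ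
  refine le_trans (le_of_eq ?_) (mul_le_mul_right h1 _)
  have : ((c • F) x - (c • F) y) χ = c * (F x - F y) χ := by
    have e : (c • F) x - (c • F) y = c • (F x - F y) := by
      simp only [Pi.smul_apply, smul_sub]
    rw [e]; rfl
  rw [this, abs_mul, mul_div_assoc, ENNReal.ofReal_mul (abs_nonneg c)]

lemma cohNorm_zero (U : Opens (Sp d)) (a γ : ℝ) (q : ℕ) (K : Set (Sp d)) (lb : ℝ) :
    cohNorm U a γ q K lb 0 = 0 := by
  refine le_antisymm ?_ bot_le
  have := cohNorm_smul_le U a γ q K lb 0 0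
  simpa using this

/-- The space of `(α, γ)`-coherent germs of order `r` on `U`; the families `α` and `r` are indexed
by the compact subsets of `U` (their values on other sets play no role). -/
def coherentGerms (U : Opens (Sp d)) (α : Set (Sp d) → ℝ) (γ : ℝ) (r : Set (Sp d) → ℕ) :
    Submodule ℝ (U → 𝓓'(U, ℝ)) where
  carrier := {F | F ∈ germs U ∧ ∀ K : Set (Sp d), IsCompact K → K ⊆ U → ∀ lb, AdmScale K U lb →
    cohNorm U (α K) γ (r K) K lb F < ∞}
  add_mem' hF hG := ⟨add_mem hF.1 hG.1, fun K hK hKU lb hlb =>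
    (cohNorm_add_le ..).trans_lt (ENNReal.add_lt_top.2 ⟨hF.2 K hK hKU lb hlb, hG.2 K hK hKU lb hlb⟩)⟩
  zero_mem' := ⟨zero_mem _, fun K _ _ lb _ => by rw [cohNorm_zero]; exact ENNReal.zero_lt_top⟩
  smul_mem' c _ hF := ⟨(germs U).smul_mem c hF.1, fun K hK hKU lb hlb =>
    (cohNorm_smul_le ..).trans_lt (ENNReal.mul_lt_top ENNReal.ofReal_lt_top (hF.2 K hK hKU lb hlb))⟩

/-! ### Reconstruction -/

/-- The rate of the reconstruction bound. -/
def recRate (γ l : ℝ) : ℝ := if γ = 0 then Real.log (1 + 1 / l) else l ^ γ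

/-- The order of the test functions in the reconstruction bound, computed from the exponents on the
enlarged compact set `Kt`. -/
def recOrder (α : Set (Sp d) → ℝ) (r : Set (Sp d) → ℕ) (Kt : Set (Sp d)) : ℕ :=
  max ⌊-α Kt + 1⌋₊ (r Kt + d + 1)

/-- `f` is a `γ`-reconstruction of the germ `F`: locally uniformly in the base point `z`, one has
`|(f - F_z)(φ_z^l)| ≤ C l^γ` (with a logarithm for `γ = 0`). -/
def IsReconstruction (U : Opens (Sp d)) (α : Set (Sp d) → ℝ) (γ : ℝ) (r : Set (Sp d) → ℕ)
    (F : U → 𝓓'(U, ℝ)) (f : 𝓓'(U, ℝ)) : Prop :=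
  ∀ K : Set (Sp d), IsCompact K → K ⊆ U → ∀ lb, AdmScale K U lb →
    ∃ Kt : Set (Sp d), IsCompact Kt ∧ K ⊆ Kt ∧ Kt ⊆ U ∧ ∃ C : ℝ,
      ∀ z : U, (z : Sp d) ∈ K → ∀ l ∈ Ioc 0 lb, ∀ φ ∈ testBall d (recOrder α r Kt),
        ∀ χ : 𝓓(U, ℝ), (∀ y, χ y = rescale φ z l y) → |(f - F z) χ| ≤ C * recRate γ l

/-- A (linear) reconstruction operator `R^γ`: a linear choice of reconstructions for which the
constants are controlled by the coherence seminorms of the germ on an enlarged compact set. -/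
def IsReconstructionOperator (U : Opens (Sp d)) (α : Set (Sp d) → ℝ) (γ : ℝ)
    (r : Set (Sp d) → ℕ) (R : coherentGerms U α γ r →ₗ[ℝ] 𝓓'(U, ℝ)) : Prop :=
  ∀ K : Set (Sp d), IsCompact K → K ⊆ U → ∀ lb, AdmScale K U lb →
    ∃ Kt : Set (Sp d), IsCompact Kt ∧ K ⊆ Kt ∧ Kt ⊆ U ∧ ∃ lt, AdmScale Kt U lt ∧ ∃ C : ℝ≥0,
      ∀ F : coherentGerms U α γ r,
      ∀ z : U, (z : Sp d) ∈ K → ∀ l ∈ Ioc 0 lb, ∀ φ ∈ testBall d (recOrder α r Kt),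
        ∀ χ : 𝓓(U, ℝ), (∀ y, χ y = rescale φ z l y) →
        ENNReal.ofReal |(R F - (F : U → 𝓓'(U, ℝ)) z) χ| ≤
          C * cohNorm U (α Kt) γ (r Kt) Kt lt F * ENNReal.ofReal (recRate γ l)

/-! ### Regularizing kernels and their action on distributions -/

/-- `G ∈ C^{m,p}(U × U)`: `m` times continuously differentiable in the first and `p` times in the
second variable, with all mixed derivatives continuous on `U × U`. -/
structure IsCmp (U : Opens (Sp d)) (m p : ℕ) (G : Sp d → Sp d → ℝ) : Prop where
  fst : ∀ y ∈ U, ContDiffOn ℝ m (fun x => G x y) U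
  snd : ∀ x ∈ U, ∀ k : Fin d → ℕ, len k ≤ m →
    ContDiffOn ℝ p (fun y => pd k (fun x' => G x' y) x) U
  mixed : ∀ k l : Fin d → ℕ, len k ≤ m → len l ≤ p →
    ContinuousOn (fun q : Sp d × Sp d => pd l (fun y => pd k (fun x => G x y) q.1) q.2)
      ((U : Set (Sp d)) ×ˢ (U : Set (Sp d)))

/-- A `β`-regularizing kernel on `U` of order `(m, p)` with range `ρ`, together with its
decomposition `κ = ∑ₙ κₙ`. Only the values on `U × U` matter. -/
structure RegKernel (U : Opens (Sp d)) (β : ℝ) (m p : ℕ) (ρ : ℝ) where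
  /-- the kernel -/
  ker : Sp d → Sp d → ℝ
  /-- the dyadic pieces -/
  piece : ℕ → Sp d → Sp d → ℝ
  hasSum_ae : ∀ᵐ q ∂(volume.restrict ((U : Set (Sp d)) ×ˢ (U : Set (Sp d)))),
    HasSum (fun n => piece n q.1 q.2) (ker q.1 q.2)
  regular : ∀ n, IsCmp U m p (piece n)
  supp : ∀ n, ∀ x ∈ U, ∀ y ∈ U, piece n x y ≠ 0 → dist x y ≤ ρ * 2 ^ (-(n : ℝ))
  bound : ∀ K : Set (Sp d), IsCompact K → K ⊆ U → ∃ c : ℝ, ∀ n, ∀ k l : Fin d → ℕ,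
    len k ≤ m → len l ≤ p → ∀ x ∈ K, ∀ y ∈ K,
      |pd l (fun y' => pd k (fun x' => piece n x' y') x) y| ≤
        c * 2 ^ (((d : ℝ) - β + len l + len k) * n)
  moment_integrable : ∀ n, ∀ k l : Fin d → ℕ, len k ≤ p → len l ≤ p → ∀ y ∈ U,
    IntegrableOn (fun x => mono l x y * pd k (fun y' => piece n x y') y) U
  moment : ∀ K : Set (Sp d), IsCompact K → K ⊆ U → ∃ c : ℝ, ∀ n, ∀ k l : Fin d → ℕ,
    len k ≤ p → len l ≤ p → ∀ y ∈ K,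
      |∫ x in (U : Set (Sp d)), mono l x y * pd k (fun y' => piece n x y') y| ≤
        c * 2 ^ (-β * n)

/-- The extended pairing `f(g) = c` of a distribution `f` on `U` with a compactly supported,
possibly non-smooth function `g`: for every mollifier `η`, the numbers `f (g * η_ε)` converge to
`c` as `ε → 0`. For `g` smooth this is the usual pairing, and for a distribution of finite order
`q` and `g` of class `C^q` it is the value of the continuous extension. -/
def HasPairing {U : Opens (Sp d)} (f : 𝓓'(U, ℝ)) (g : Sp d → ℝ) (c : ℝ) : Prop :=
  ∀ η : 𝓓(unitBall d, ℝ), ∫ y, η y = 1 → ∀ δ > 0, ∃ ε₀ > 0, ∀ ε ∈ Ioo 0 ε₀,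
    ∃ χ : 𝓓(U, ℝ), (∀ y, χ y = ∫ z, g z * rescale η z ε y) ∧ |f χ - c| < δ

/-- The transposed action of the `n`-th piece of a kernel on a test function `ψ`:
`(κₙ^* ψ)(y) = ∫ κₙ(x, y) ψ(x) dx` for `y ∈ U`. -/
def RegKernel.dual {U : Opens (Sp d)} {β : ℝ} {m p : ℕ} {ρ : ℝ} (κ : RegKernel U β m p ρ)
    (n : ℕ) (ψ : Sp d → ℝ) : Sp d → ℝ :=
  (U : Set (Sp d)).indicator fun y => ∫ x in (U : Set (Sp d)), κ.piece n x y * ψ x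

/-- `κ f` is well-defined as a distribution on `V` and equals `T`: for all test functions `ψ`
on `V`, `T ψ = ∑ₙ f (κₙ^* ψ)`. -/
def HasImage {U V : Opens (Sp d)} {β : ℝ} {m p : ℕ} {ρ : ℝ} (κ : RegKernel U β m p ρ)
    (f : 𝓓'(U, ℝ)) (T : 𝓓'(V, ℝ)) : Prop :=
  ∀ ψ : 𝓓(V, ℝ), ∃ c : ℕ → ℝ, (∀ n, HasPairing f (κ.dual n ψ) (c n)) ∧
    Tendsto (fun N => ∑ n ∈ Finset.range N, c n) atTop (𝓝 (T ψ))

open Classical in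
/-- The distribution `κ f` on `V` (zero if it is not well-defined). -/
def image {U : Opens (Sp d)} (V : Opens (Sp d)) {β : ℝ} {m p : ℕ} {ρ : ℝ}
    (κ : RegKernel U β m p ρ) (f : 𝓓'(U, ℝ)) : 𝓓'(V, ℝ) :=
  if h : ∃ T : 𝓓'(V, ℝ), HasImage κ f T then h.choose else 0

/-- The distribution `f` has the pointwise derivative `D^k f (x) = c`: for every test function `η`,
`(D^k f)(η_x^ε) → c ∫ η` as `ε → 0`. -/
def HasPtDeriv {V : Opens (Sp d)} (f : 𝓓'(V, ℝ)) (k : Fin d → ℕ) (x : V) (c : ℝ) : Prop :=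
  ∀ η : 𝓓(unitBall d, ℝ), ∀ δ > 0, ∃ ε₀ > 0, ∀ ε ∈ Ioo 0 ε₀,
    ∃ χ : 𝓓(V, ℝ), (∀ y, χ y = rescale η x ε y) ∧ |(∂^{dirs k} f) χ - c * ∫ y, η y| < δ

open Classical in
/-- The pointwise derivative `D^k f (x)` (zero if it does not exist). -/
def ptDeriv {V : Opens (Sp d)} (f : 𝓓'(V, ℝ)) (k : Fin d → ℕ) (x : V) : ℝ :=
  if h : ∃ c, HasPtDeriv f k x c then h.choose else 0

/-- The monomial `y ↦ (y - x)^k` as a distribution on `V`. -/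
def monoDist (V : Opens (Sp d)) (k : Fin d → ℕ) (x : Sp d) : 𝓓'(V, ℝ) :=
  (TestFunction.integralAgainstBilinCLM (ContinuousLinearMap.mul ℝ ℝ) volume (mono k x) :
    𝓓(V, ℝ) →L[ℝ] ℝ)

/-- The lifted germ
`x ↦ κ F_x - ∑_{0 ≤ |k| ≤ ⌊s⌋} D^k (κ (F_x - f)) (x) (· - x)^k / k!` on `V ⊆ U`. -/
def lift {U V : Opens (Sp d)} (hVU : V ≤ U) {β : ℝ} {m p : ℕ} {ρ : ℝ}
    (κ : RegKernel U β m p ρ) (s : ℝ) (f : 𝓓'(U, ℝ)) (F : U → 𝓓'(U, ℝ)) : V → 𝓓'(V, ℝ) :=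
  fun x => image V κ (F ⟨x, hVU x.2⟩) -
    ∑ k ∈ multiIndices d ⌊s⌋,
      (ptDeriv (image V κ (F ⟨x, hVU x.2⟩ - f)) k x / ∏ i, ((k i).factorial : ℝ)) •
        monoDist V k x

end Germs

end

/-! Write `f` for the reconstruction of `F` and `V` for the set of points of `U` at distance more
than `2ρ` from the boundary. Subtracting the image of `f` from the lifted germ at `x` and testing
with `ψ` leaves the sum over `n` of the pairings of `F x - f` with the superposition, weighted by
`ψ(z)`, of the functions `K_n(z,·) - ∑_{|k| ≤ ⌊γ+β⌋} (z-x)^k/k! ∂₁^k K_n(x,·)`; this is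
`hasSum_liftGerm`. Coherence of the lift (subtract the identities at `x` and at `y`) and its
reconstruction bound thereby become estimates of single terms, summed over dyadic scales.

The basic input is that `F x - f`, tested on a function of scale `L` around `x`, has size `L^γ`
(`exists_pair_rec`), and that `F x - F y` obeys the coherence bound (`exists_pair_coh`). The
hypotheses give this only for smooth rescaled test functions, whereas the functions `K_n(x,·)` are
merely `C^p`. A mollifier with vanishing moments closes the gap: mollify `g` along a dyadic sequence
of scales and telescope. The step at scale `ε` gains `ε^p` from the moments and contributes `ε^a`
from the distribution, and `a + p > 0` makes the series converge (`abs_apply_le_of_moll`). Hence `F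
x - f` has order at most `p` away from the boundary, although nothing of the kind is shown for `F x`
or `f` alone, and its pairing with `C^p` functions is the limit along mollifications
(`FinOrder.tendsto_pair`).

For `ψ` of scale `l` there are two regimes. If `2^{-n} ≥ l`, the function above is a Taylor
remainder of degree `N = ⌊γ+β⌋ + 1` (or `0` if this is negative), and its pairing has size `l^N
2^{-n(γ+β-N)}`. If `2^{-n} < l`, the two parts are estimated separately: the Taylor coefficients are
`O(2^{-n(γ+β-|k|)})`, while the moment conditions keep the dual piece applied to `ψ` at scale `l`
with amplitude `2^{-βn}` (`exists_scaled_dual`). Since `γ+β` is not a natural number, everything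
decays geometrically away from `2^{-n} ~ l`; this is recorded by `peak`, whose sum is bounded
uniformly in `l` (`exists_tsum_peak_le`). For coherence the dividing scale is `l + |x-y|`; in the
window between `l` and `l + |x-y|` the coherence of `F` enters, and the negative exponent of the new
germ supplies the decay (`exists_abs_remTerm_sub_le`).

The image of `F x` exists as the image of `F x - f` plus that of `f`. The pointwise derivatives come
from integrating by parts and passing to the limit under the sum (`hasPtDeriv`).

Boundedness of `U` lets a single compact set, containing all points at distance `ρ/2` from the
boundary, serve for all `K`. The new exponent is the constant `min (-p) (γ+β) - 1`, so negative that
the reconstruction bound only concerns test functions with at least `p` controlled derivatives. In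
the coherence bound fewer derivatives may be controlled; then the pairing estimate is proved again
with that number, by localizing to smaller scales (`exists_pair_coh_of_order`) or directly from
coherence on the convex hull of `K` (`exists_pair_coh_of_compact`). For `γ+β > 0` two
reconstructions differ by a distribution that vanishes in the limit of small scales. -/

noncomputable section

namespace Germs

variable {d : ℕ}

/-! ### Families of functions depending continuously on a parameter; differentiation under the
integral -/

section SmoothFamilies

variable {E : Type*} [NormedAddCommGroup E] [NormedSpace ℝ E]
  {F : Type*} [NormedAddCommGroup F] [NormedSpace ℝ F]
  {P : Type*} [TopologicalSpace P] {Q : Type*} [TopologicalSpace Q]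

/-- A family of `C^n` functions whose derivatives up to order `n` depend continuously on the
parameter and the point. -/
def SmoothFam (n : ℕ∞) (H : P → E → F) : Prop :=
  (∀ p, ContDiff ℝ n (H p)) ∧
    ∀ j : ℕ, (j : ℕ∞) ≤ n → Continuous fun q : P × E => iteratedFDeriv ℝ j (H q.1) q.2

lemma SmoothFam.continuous {n : ℕ∞} {H : P → E → F} (h : SmoothFam n H) :
    Continuous fun q : P × E => H q.1 q.2 := by
  have h0 := h.2 0 (by simp)
  have : (fun q : P × E => H q.1 q.2) =
      fun q => (continuousMultilinearCurryFin0 ℝ E F) (iteratedFDeriv ℝ 0 (H q.1) q.2) := by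
    ext q; simp
  rw [this]
  exact (LinearIsometryEquiv.continuous _).comp h0

lemma SmoothFam.comp {n : ℕ∞} {H : P → E → F} (h : SmoothFam n H) {f : Q → P}
    (hf : Continuous f) : SmoothFam n (fun q => H (f q)) :=
  ⟨fun q => h.1 (f q), fun j hj => (h.2 j hj).comp ((hf.comp continuous_fst).prodMk continuous_snd)⟩

lemma SmoothFam.const {n : ℕ∞} {g : E → F} (h : ContDiff ℝ n g) :
    SmoothFam n (fun _ : P => g) :=
  ⟨fun _ => h, fun j hj => (h.continuous_iteratedFDeriv (by exact_mod_cast hj)).comp continuous_snd⟩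

lemma SmoothFam.add {n : ℕ∞} {H G : P → E → F} (h : SmoothFam n H) (g : SmoothFam n G) :
    SmoothFam n (fun p y => H p y + G p y) := by
  refine ⟨fun p => (h.1 p).add (g.1 p), fun j hj => ?_⟩
  have : (fun q : P × E => iteratedFDeriv ℝ j (fun y => H q.1 y + G q.1 y) q.2) =
      fun q => iteratedFDeriv ℝ j (H q.1) q.2 + iteratedFDeriv ℝ j (G q.1) q.2 := by
    ext1 q
    exact iteratedFDeriv_add_apply (((h.1 q.1).of_le (by exact_mod_cast hj)).contDiffAt)
      (((g.1 q.1).of_le (by exact_mod_cast hj)).contDiffAt)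
  rw [this]
  exact (h.2 j hj).add (g.2 j hj)

lemma SmoothFam.smul {n : ℕ∞} {H : P → E → F} (h : SmoothFam n H) {c : P → ℝ}
    (hc : Continuous c) : SmoothFam n (fun p y => c p • H p y) := by
  refine ⟨fun p => contDiff_const.smul (h.1 p), fun j hj => ?_⟩
  have : (fun q : P × E => iteratedFDeriv ℝ j (fun y => c q.1 • H q.1 y) q.2) =
      fun q => c q.1 • iteratedFDeriv ℝ j (H q.1) q.2 := by
    ext1 q
    exact iteratedFDeriv_const_smul_apply (((h.1 q.1).of_le (by exact_mod_cast hj)).contDiffAt)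
  rw [this]
  exact (hc.comp continuous_fst).smul (h.2 j hj)

lemma SmoothFam.sum {n : ℕ∞} {ι : Type*} (s : Finset ι) {H : ι → P → E → F}
    (h : ∀ i ∈ s, SmoothFam n (H i)) : SmoothFam n (fun p y => ∑ i ∈ s, H i p y) := by
  classical
  induction s using Finset.induction_on with
  | empty => simpa using SmoothFam.const (P := P) (contDiff_const (c := (0 : F)))
  | insert a s ha ih =>
    simp only [Finset.sum_insert ha]
    exact (h a (by simp)).add (ih fun i hi => h i (by simp [hi]))

/-- Translation of a family. -/
lemma SmoothFam.sub_right {n : ℕ∞} {H : P → E → F} (h : SmoothFam n H) {v : P → E}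
    (hv : Continuous v) : SmoothFam n (fun p y => H p (y - v p)) := by
  refine ⟨fun p => (h.1 p).comp (contDiff_id.sub contDiff_const), fun j hj => ?_⟩
  simp only [iteratedFDeriv_comp_sub]
  exact (h.2 j hj).comp (continuous_fst.prodMk (continuous_snd.sub (hv.comp continuous_fst)))

section Integral

variable [ProperSpace E] [CompleteSpace F]
  {S : Type*} [TopologicalSpace S] [MeasurableSpace S] [OpensMeasurableSpace S]
  [SecondCountableTopology S] {μ : Measure S} [IsLocallyFiniteMeasure μ]

/-- Joint continuity bounds the next derivative by a constant on the compact product of a closed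
ball with `A`, and this constant is the integrable majorant for differentiating under the integral.
The order `n` may be finite, because the pieces of the kernel have only finitely many derivatives.
-/
lemma SmoothFam.hasFTaylorSeries_integral {n : ℕ∞} {H : P × S → E → F} (h : SmoothFam n H)
    {A : Set S} (hA : IsCompact A) (p : P) :
    HasFTaylorSeriesUpTo (n : WithTop ℕ∞) (fun y => ∫ s in A, H (p, s) y ∂μ)
      (fun y j => ∫ s in A, iteratedFDeriv ℝ j (H (p, s)) y ∂μ) := by
  have hcont : ∀ j : ℕ, (j : ℕ∞) ≤ n →
      Continuous fun q : E × S => iteratedFDeriv ℝ j (H (p, q.2)) q.1 := fun j hj =>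
    (h.2 j hj).comp ((continuous_const.prodMk continuous_snd).prodMk continuous_fst)
  have hfin : IsFiniteMeasure (μ.restrict A) := ⟨by simpa using hA.measure_lt_top⟩
  have hint : ∀ j : ℕ, (j : ℕ∞) ≤ n → ∀ y,
      Integrable (fun s => iteratedFDeriv ℝ j (H (p, s)) y) (μ.restrict A) := by
    intro j hj y
    have hc : Continuous fun s => iteratedFDeriv ℝ j (H (p, s)) y :=
      (hcont j hj).comp (continuous_const.prodMk continuous_id)
    obtain ⟨M, hM⟩ := hA.exists_bound_of_continuousOn hc.continuousOn
    refine Integrable.of_bound hc.aestronglyMeasurable M ?_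
    rw [ae_restrict_iff (isClosed_le hc.norm continuous_const).measurableSet]
    exact Eventually.of_forall hM
  refine ⟨fun y => ?_, fun j hj y => ?_, fun j hj => ?_⟩
  · let L : (E [×0]→L[ℝ] F) →L[ℝ] F :=
      ((continuousMultilinearCurryFin0 ℝ E F).toContinuousLinearEquiv :
        (E [×0]→L[ℝ] F) →L[ℝ] F)
    have := L.integral_comp_comm (hint 0 (by simp) y)
    exact this.symm
  · have hj' : (j : ℕ∞) < n := by exact_mod_cast hj
    have hj1 : ((j + 1 : ℕ) : ℕ∞) ≤ n := by
      push_cast; exact Order.add_one_le_of_lt hj'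
    obtain ⟨M, hM⟩ := ((isCompact_closedBall y 1).prod hA).exists_bound_of_continuousOn
      (hcont (j + 1) hj1).continuousOn
    let L : (E [×(j + 1)]→L[ℝ] F) →L[ℝ] (E →L[ℝ] E [×j]→L[ℝ] F) :=
      ((continuousMultilinearCurryLeftEquiv ℝ (fun _ : Fin (j + 1) => E)
        F).toContinuousLinearEquiv :
          (E [×(j + 1)]→L[ℝ] F) →L[ℝ] (E →L[ℝ] E [×j]→L[ℝ] F))
    have e := ContinuousLinearMap.integral_comp_comm (𝕜 := ℝ)
      (Fₗ := E →L[ℝ] E [×j]→L[ℝ] F) L (hint (j + 1) hj1 y)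
    have e' : (∫ s in A, iteratedFDeriv ℝ (j + 1) (H (p, s)) y ∂μ).curryLeft =
        ∫ s in A, (iteratedFDeriv ℝ (j + 1) (H (p, s)) y).curryLeft ∂μ := e.symm
    change HasFDerivAt (fun y => ∫ s in A, iteratedFDeriv ℝ j (H (p, s)) y ∂μ)
      (∫ s in A, iteratedFDeriv ℝ (j + 1) (H (p, s)) y ∂μ).curryLeft y
    rw [e']
    refine hasFDerivAt_integral_of_dominated_of_fderiv_le (𝕜 := ℝ) (μ := μ.restrict A)
      (bound := fun _ => M) (F := fun x s => iteratedFDeriv ℝ j (H (p, s)) x)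
      (F' := fun x s => (iteratedFDeriv ℝ (j + 1) (H (p, s)) x).curryLeft)
      (Metric.closedBall_mem_nhds y one_pos) ?_ (hint j hj'.le y) ?_ ?_ (integrable_const M) ?_
    · exact Eventually.of_forall fun x => (hint j hj'.le x).aestronglyMeasurable
    · exact (((continuousMultilinearCurryLeftEquiv ℝ (fun _ : Fin (j + 1) => E) F).continuous.comp
        ((hcont (j + 1) hj1).comp (continuous_const.prodMk continuous_id)))).aestronglyMeasurable
    · simp only [ContinuousMultilinearMap.curryLeft_norm]
      have hcl : IsClosed {s | ∀ x ∈ Metric.closedBall y 1,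
          ‖iteratedFDeriv ℝ (j + 1) (H (p, s)) x‖ ≤ M} := by
        simp only [Set.ofPred_forall]
        refine isClosed_biInter fun x _ => isClosed_le ?_ continuous_const
        exact ((hcont (j + 1) hj1).comp (continuous_const.prodMk continuous_id)).norm
      rw [ae_restrict_iff hcl.measurableSet]
      exact Eventually.of_forall fun s hs x hx => hM (x, s) ⟨hx, hs⟩
    · refine Eventually.of_forall fun s x _ => ?_
      exact ((h.1 (p, s)).ftaylorSeries.fderiv j (by exact_mod_cast hj') x)
  · have hj' : (j : ℕ∞) ≤ n := by exact_mod_cast hj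
    exact continuous_parametric_integral_of_continuous
      (f := fun y s => iteratedFDeriv ℝ j (H (p, s)) y) (hcont j hj') hA

lemma SmoothFam.iteratedFDeriv_integral {n : ℕ∞} {H : P × S → E → F} (h : SmoothFam n H)
    {A : Set S} (hA : IsCompact A) (p : P) {j : ℕ} (hj : (j : ℕ∞) ≤ n) (y : E) :
    iteratedFDeriv ℝ j (fun y => ∫ s in A, H (p, s) y ∂μ) y =
      ∫ s in A, iteratedFDeriv ℝ j (H (p, s)) y ∂μ :=
  ((h.hasFTaylorSeries_integral hA p).eq_iteratedFDeriv (by exact_mod_cast hj) y).symm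

lemma SmoothFam.integral [FirstCountableTopology P] [LocallyCompactSpace P] {n : ℕ∞} {H : P × S → E → F} (h : SmoothFam n H)
    {A : Set S} (hA : IsCompact A) :
    SmoothFam n (fun p y => ∫ s in A, H (p, s) y ∂μ) := by
  refine ⟨fun p => (h.hasFTaylorSeries_integral hA p).contDiff, fun j hj => ?_⟩
  simp only [h.iteratedFDeriv_integral hA _ hj]
  refine continuous_parametric_integral_of_continuous
    (f := fun (q : P × E) s => iteratedFDeriv ℝ j (H (q.1, s)) q.2) ?_ hA
  exact (h.2 j hj).comp (((continuous_fst.comp continuous_fst).prodMk continuous_snd).prodMk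
    (continuous_snd.comp continuous_fst))

lemma SmoothFam.norm_iteratedFDeriv_integral_le {n : ℕ∞} {H : P × S → E → F} (h : SmoothFam n H)
    {A : Set S} (hA : IsCompact A) (p : P) {j : ℕ} (hj : (j : ℕ∞) ≤ n) (y : E) :
    ‖iteratedFDeriv ℝ j (fun y => ∫ s in A, H (p, s) y ∂μ) y‖ ≤
      ∫ s in A, ‖iteratedFDeriv ℝ j (H (p, s)) y‖ ∂μ := by
  rw [h.iteratedFDeriv_integral hA p hj y]
  exact norm_integral_le_integral_norm _

end Integral

end SmoothFamilies

/-! ### Test functions handled as plain functions -/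

/-- A function that is the underlying function of a test function on `U`. -/
structure IsTest (U : Opens (Sp d)) (f : Sp d → ℝ) : Prop where
  contDiff : ContDiff ℝ (⊤ : ℕ∞) f
  hasCompactSupport : HasCompactSupport f
  tsupport_subset : tsupport f ⊆ U

lemma isTest_coe {U : Opens (Sp d)} (ψ : 𝓓(U, ℝ)) : IsTest U ψ :=
  ⟨ψ.contDiff, ψ.hasCompactSupport, ψ.tsupport_subset⟩

lemma IsTest.of_support_subset {U : Opens (Sp d)} {f : Sp d → ℝ} (hf : ContDiff ℝ (⊤ : ℕ∞) f)
    {Q : Set (Sp d)} (hQ : IsCompact Q) (hQU : Q ⊆ U) (hs : Function.support f ⊆ Q) :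
    IsTest U f :=
  ⟨hf, HasCompactSupport.of_support_subset_isCompact hQ hs,
    (closure_minimal hs hQ.isClosed).trans hQU⟩

open Classical in
/-- The test function on `U` with underlying function `f` (zero if there is none). -/
def toTest (U : Opens (Sp d)) (f : Sp d → ℝ) : 𝓓(U, ℝ) :=
  if h : IsTest U f then ⟨f, h.1, h.2, h.3⟩ else 0

lemma toTest_apply {U : Opens (Sp d)} {f : Sp d → ℝ} (h : IsTest U f) (y : Sp d) :
    toTest U f y = f y := by
  simp only [toTest, h, dite_true]; rfl

lemma toTest_eq {U : Opens (Sp d)} {f : Sp d → ℝ} (ψ : 𝓓(U, ℝ)) (h : ∀ y, ψ y = f y) :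
    toTest U f = ψ := by
  have : f = ψ := funext fun y => (h y).symm
  subst this
  ext y
  exact toTest_apply (isTest_coe ψ) y

lemma toTest_coe {U : Opens (Sp d)} (ψ : 𝓓(U, ℝ)) : toTest U ψ = ψ := toTest_eq ψ fun _ => rfl

lemma IsTest.add {U : Opens (Sp d)} {f g : Sp d → ℝ} (hf : IsTest U f) (hg : IsTest U g) :
    IsTest U (fun y => f y + g y) := by
  have := isTest_coe (toTest U f + toTest U g)
  convert this using 1
  ext y
  rw [add_apply, toTest_apply hf, toTest_apply hg]

lemma IsTest.smul {U : Opens (Sp d)} {f : Sp d → ℝ} (hf : IsTest U f) (c : ℝ) :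
    IsTest U (fun y => c * f y) := by
  have := isTest_coe (c • toTest U f)
  convert this using 1
  ext y
  rw [smul_apply, toTest_apply hf, smul_eq_mul]

lemma toTest_add {U : Opens (Sp d)} {f g : Sp d → ℝ} (hf : IsTest U f) (hg : IsTest U g) :
    toTest U (fun y => f y + g y) = toTest U f + toTest U g := by
  refine toTest_eq _ fun y => ?_
  rw [add_apply, toTest_apply hf, toTest_apply hg]

lemma toTest_smul {U : Opens (Sp d)} {f : Sp d → ℝ} (hf : IsTest U f) (c : ℝ) :
    toTest U (fun y => c * f y) = c • toTest U f := by
  refine toTest_eq _ fun y => ?_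
  rw [smul_apply, toTest_apply hf, smul_eq_mul]

lemma IsTest.sub {U : Opens (Sp d)} {f g : Sp d → ℝ} (hf : IsTest U f) (hg : IsTest U g) :
    IsTest U (fun y => f y - g y) := by
  have := hf.add (hg.smul (-1))
  simpa [sub_eq_add_neg] using this

lemma toTest_sub {U : Opens (Sp d)} {f g : Sp d → ℝ} (hf : IsTest U f) (hg : IsTest U g) :
    toTest U (fun y => f y - g y) = toTest U f - toTest U g := by
  refine toTest_eq _ fun y => ?_
  rw [sub_apply, toTest_apply hf, toTest_apply hg]

lemma IsTest.sum {U : Opens (Sp d)} {ι : Type*} (s : Finset ι) {f : ι → Sp d → ℝ}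
    (hf : ∀ i ∈ s, IsTest U (f i)) : IsTest U (fun y => ∑ i ∈ s, f i y) := by
  classical
  induction s using Finset.induction_on with
  | empty =>
    have := isTest_coe (0 : 𝓓(U, ℝ))
    convert this using 1
    ext y
    simp
  | insert a s ha ih =>
    simp only [Finset.sum_insert ha]
    exact (hf a (by simp)).add (ih fun i hi => hf i (by simp [hi]))

/-! ### Distributions along smooth families of test functions -/

section Families

variable {P : Type*} [TopologicalSpace P]

/-- The family of test functions supported in `Q` given by a smooth family. -/
def famIn (Q : Compacts (Sp d)) (H : P → Sp d → ℝ) (hH : SmoothFam ⊤ H)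
    (hs : ∀ p, Function.support (H p) ⊆ Q) (p : P) : 𝓓_{Q}(Sp d, ℝ) :=
  .of_support_subset (hH.1 p) (hs p)

/-- The topology for a fixed compact support is given by the sup norms of all derivatives. On the
compact set `Q`, joint continuity gives uniform closeness by a tube argument, and off `Q` all
derivatives vanish. -/
lemma continuous_famIn {Q : Compacts (Sp d)} {H : P → Sp d → ℝ} (hH : SmoothFam ⊤ H)
    (hs : ∀ p, Function.support (H p) ⊆ Q) : Continuous (famIn Q H hH hs) := by
  rw [ContDiffMapSupportedIn.continuous_iff_comp]
  intro i
  rw [Metric.continuous_iff']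
  intro p ε hε
  have hi := hH.2 i le_top
  have key : ∀ᶠ q in 𝓝 p, ∀ y ∈ (Q : Set (Sp d)),
      dist (iteratedFDeriv ℝ i (H q) y) (iteratedFDeriv ℝ i (H p) y) < ε / 2 := by
    refine Q.isCompact.eventually_forall_of_forall_eventually fun y _ => ?_
    have h1 : Continuous fun z : P × Sp d =>
        dist (iteratedFDeriv ℝ i (H z.1) z.2) (iteratedFDeriv ℝ i (H p) z.2) :=
      hi.dist (hi.comp (continuous_const.prodMk continuous_snd))
    have h2 := h1.tendsto (p, y)
    simp only [dist_self] at h2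
    exact h2.eventually_lt_const (half_pos hε)
  filter_upwards [key] with q hq
  refine lt_of_le_of_lt ((BoundedContinuousFunction.dist_le (half_pos hε).le).2 fun y => ?_)
    (half_lt_self hε)
  simp only [Function.comp_apply, ContDiffMapSupportedIn.structureMapCLM_top_apply]
  by_cases hy : y ∈ (Q : Set (Sp d))
  · exact (hq y hy).le
  · have e1 := (famIn Q H hH hs q).iteratedFDeriv_zero_on_compl (i := i) hy
    have e2 := (famIn Q H hH hs p).iteratedFDeriv_zero_on_compl (i := i) hy
    rw [e1, e2]
    simp only [Pi.zero_apply, dist_self]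
    exact (half_pos hε).le

lemma toTest_eq_ofSupportedIn {U : Opens (Sp d)} {Q : Compacts (Sp d)} (hQ : (Q : Set (Sp d)) ⊆ U)
    {H : P → Sp d → ℝ} (hH : SmoothFam ⊤ H) (hs : ∀ p, Function.support (H p) ⊆ Q) (p : P) :
    toTest U (H p) = TestFunction.ofSupportedIn hQ (famIn Q H hH hs p) :=
  toTest_eq _ fun _ => rfl

/-- A distribution is continuous along smooth families of test functions. -/
lemma continuous_apply_toTest {U : Opens (Sp d)} (G : 𝓓'(U, ℝ)) {Q : Set (Sp d)}
    (hQ : IsCompact Q) (hQU : Q ⊆ U) {H : P → Sp d → ℝ} (hH : SmoothFam ⊤ H)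
    (hs : ∀ p, Function.support (H p) ⊆ Q) : Continuous fun p => G (toTest U (H p)) := by
  have := (map_continuous G).comp ((TestFunction.continuous_ofSupportedIn (K := ⟨Q, hQ⟩) hQU).comp
    (continuous_famIn (Q := ⟨Q, hQ⟩) hH hs))
  refine this.congr fun p => ?_
  simp only [Function.comp_apply]
  rw [toTest_eq_ofSupportedIn (Q := ⟨Q, hQ⟩) hQU hH hs]

/-- Tuples of bounded continuous functions that hold the derivatives of order at most `N`. -/
def JetSpace (d N : ℕ) : Type :=
  Π i : Fin (N + 1), BoundedContinuousFunction (Sp d) (Sp d [×(i : ℕ)]→L[ℝ] ℝ)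

instance (N : ℕ) : NormedAddCommGroup (JetSpace d N) :=
  inferInstanceAs (NormedAddCommGroup
    (Π i : Fin (N + 1), BoundedContinuousFunction (Sp d) (Sp d [×(i : ℕ)]→L[ℝ] ℝ)))

instance (N : ℕ) : NormedSpace ℝ (JetSpace d N) :=
  inferInstanceAs (NormedSpace ℝ
    (Π i : Fin (N + 1), BoundedContinuousFunction (Sp d) (Sp d [×(i : ℕ)]→L[ℝ] ℝ)))

instance (N : ℕ) : CompleteSpace (JetSpace d N) :=
  inferInstanceAs (CompleteSpace
    (Π i : Fin (N + 1), BoundedContinuousFunction (Sp d) (Sp d [×(i : ℕ)]→L[ℝ] ℝ)))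

/-- The jet of a function supported in `Q`. -/
def jet (N : ℕ) {Q : Compacts (Sp d)} (f : 𝓓_{Q}(Sp d, ℝ)) : JetSpace d N :=
  fun i => ContDiffMapSupportedIn.structureMapCLM ℝ ⊤ (i : ℕ) f

/-- The evaluation of the `i`-th entry of a jet at a point. -/
def jetEval {N : ℕ} (i : Fin (N + 1)) (y : Sp d) : JetSpace d N →L[ℝ] (Sp d [×(i : ℕ)]→L[ℝ] ℝ) :=
  (BoundedContinuousFunction.evalCLM ℝ y).comp (ContinuousLinearMap.proj (R := ℝ)
      (φ := fun i : Fin (N + 1) => BoundedContinuousFunction (Sp d) (Sp d [×(i : ℕ)]→L[ℝ] ℝ)) i)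

lemma jetEval_jet {N : ℕ} (i : Fin (N + 1)) (y : Sp d) {Q : Compacts (Sp d)}
    (f : 𝓓_{Q}(Sp d, ℝ)) : jetEval i y (jet N f) = iteratedFDeriv ℝ i f y := by
  change (ContDiffMapSupportedIn.structureMapCLM ℝ ⊤ (i : ℕ) f) y = _
  rw [ContDiffMapSupportedIn.structureMapCLM_top_apply]

lemma JetSpace.ext {N : ℕ} {u v : JetSpace d N} (h : ∀ i y, jetEval i y u = jetEval i y v) :
    u = v := by
  funext i
  exact BoundedContinuousFunction.ext fun y => h i y

lemma continuous_jet (N : ℕ) {Q : Compacts (Sp d)} :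
    Continuous (jet N : 𝓓_{Q}(Sp d, ℝ) → JetSpace d N) :=
  continuous_pi fun i => map_continuous (ContDiffMapSupportedIn.structureMapCLM ℝ ⊤ (i : ℕ))

/-- A distribution factors, on functions supported in a compact set, through a bounded functional
on finitely many bounded continuous functions. -/
lemma exists_extension_bcf {U : Opens (Sp d)} (G : 𝓓'(U, ℝ)) (Q : Compacts (Sp d))
    (hQ : (Q : Set (Sp d)) ⊆ U) :
    ∃ (N : ℕ) (Φ : JetSpace d N →L[ℝ] ℝ),
      ∀ f : 𝓓_{Q}(Sp d, ℝ), G (TestFunction.ofSupportedIn hQ f) = Φ (jet N f) := by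
  let g : 𝓓_{Q}(Sp d, ℝ) →ₗ[ℝ] ℝ :=
    { toFun := fun f => G (TestFunction.ofSupportedIn hQ f)
      map_add' := fun a b => map_add G (TestFunction.ofSupportedIn hQ a)
        (TestFunction.ofSupportedIn hQ b)
      map_smul' := fun c b => map_smul G c (TestFunction.ofSupportedIn hQ b) }
  have hg : Continuous g :=
    (map_continuous G).comp (TestFunction.continuous_ofSupportedIn hQ)
  obtain ⟨s, C, -, hC⟩ := Seminorm.bound_of_continuous
    (ContDiffMapSupportedIn.withSeminorms ℝ (Sp d) ℝ ⊤ Q)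
    ((normSeminorm ℝ ℝ).comp g) (by exact hg.norm)
  obtain ⟨N, hN⟩ := s.exists_le
  let J : 𝓓_{Q}(Sp d, ℝ) →ₗ[ℝ] JetSpace d N :=
    { toFun := jet N
      map_add' := fun a b => funext fun i =>
        map_add (ContDiffMapSupportedIn.structureMapCLM ℝ ⊤ (i : ℕ)) a b
      map_smul' := fun c b => funext fun i =>
        map_smul (ContDiffMapSupportedIn.structureMapCLM ℝ ⊤ (i : ℕ)) c b }
  have hJ : Function.Injective J := fun a b hab =>
    ContDiffMapSupportedIn.structureMapCLM_zero_injective ℝ (congrFun hab 0)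
  have hb : ∀ f, |g f| ≤ C * ‖J f‖ := by
    intro f
    have h1 := hC f
    have h2 : (s.sup (ContDiffMapSupportedIn.seminorm ℝ (Sp d) ℝ ⊤ Q)) f ≤ ‖J f‖ := by
      refine Seminorm.finset_sup_apply_le (norm_nonneg _) fun i hi => ?_
      exact norm_le_pi_norm (J f) ⟨i, Nat.lt_succ_of_le (hN i hi)⟩
    calc |g f| ≤ (C • s.sup (ContDiffMapSupportedIn.seminorm ℝ (Sp d) ℝ ⊤ Q)) f := h1
      _ = C * (s.sup (ContDiffMapSupportedIn.seminorm ℝ (Sp d) ℝ ⊤ Q)) f := rfl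
      _ ≤ _ := by gcongr
  -- The map `J` is injective, its zeroth component being the function itself, so `g` descends to
  -- the range of `J`. It is bounded there, and Hahn-Banach extends it to the whole Banach space.
  let e := LinearEquiv.ofInjective J hJ
  let g' : LinearMap.range J →L[ℝ] ℝ := (g ∘ₗ e.symm.toLinearMap).mkContinuous C (by
    intro x
    have := hb (e.symm x)
    have e2 : J (e.symm x) = x := congrArg Subtype.val (e.apply_symm_apply x)
    rw [e2] at this
    exact this)
  obtain ⟨Φ, hΦ, -⟩ := exists_extension_norm_eq (LinearMap.range J) g'
  refine ⟨N, Φ, fun f => ?_⟩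
  have := hΦ (e f)
  have e3 : g' (e f) = g f := by
    change g (e.symm (e f)) = g f
    rw [e.symm_apply_apply]
  rw [e3] at this
  exact this.symm

end Families

/-- A distribution commutes with integrals of smooth families of test functions. -/
lemma apply_toTest_integral {S : Type*} [TopologicalSpace S] [MeasurableSpace S]
    [OpensMeasurableSpace S] [SecondCountableTopology S] [T2Space S] {μ : Measure S}
    [IsLocallyFiniteMeasure μ] {U : Opens (Sp d)} (G : 𝓓'(U, ℝ)) {Q : Set (Sp d)}
    (hQ : IsCompact Q) (hQU : Q ⊆ U) {H : S → Sp d → ℝ} (hH : SmoothFam ⊤ H)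
    (hs : ∀ s, Function.support (H s) ⊆ Q) {A : Set S} (hA : IsCompact A) :
    G (toTest U fun y => ∫ s in A, H s y ∂μ) = ∫ s in A, G (toTest U (H s)) ∂μ := by
  have hH' : SmoothFam ⊤ fun p : Unit × S => H p.2 := hH.comp continuous_snd
  have hI : SmoothFam ⊤ fun (_ : Unit) y => ∫ s in A, H s y ∂μ := hH'.integral hA
  have hIs : ∀ u : Unit, Function.support (fun y => ∫ s in A, H s y ∂μ) ⊆ Q := by
    intro _ y hy
    by_contra hyQ
    apply hy
    have : ∀ s, H s y = 0 := fun s => by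
      by_contra h; exact hyQ (hs s h)
    simp [this]
  -- Test functions supported in `Q` do not form a Banach space, so the integral is taken in
  -- `JetSpace d N` instead, where the bounded functional `Φ` commutes with it. The two jets are
  -- then compared by point evaluations, where the claim is differentiation under the integral.
  obtain ⟨N, Φ, hΦ⟩ := exists_extension_bcf G ⟨Q, hQ⟩ hQU
  have e1 := toTest_eq_ofSupportedIn (Q := ⟨Q, hQ⟩) hQU hI hIs ()
  have e2 := fun s => toTest_eq_ofSupportedIn (Q := ⟨Q, hQ⟩) hQU hH hs s
  simp only [e1, e2, hΦ]
  have hint := ((continuous_jet N).comp (continuous_famIn hH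
    (Q := ⟨Q, hQ⟩) hs)).continuousOn.integrableOn_compact (μ := μ) hA
  refine Eq.trans ?_ (ContinuousLinearMap.integral_comp_comm Φ hint).symm
  congr 1
  refine JetSpace.ext fun i y => ?_
  rw [← ContinuousLinearMap.integral_comp_comm (jetEval i y) hint, jetEval_jet]
  simp only [Function.comp_apply, jetEval_jet]
  exact hH'.iteratedFDeriv_integral (μ := μ) hA () (j := i) le_top y

/-! ### Symmetry of iterated derivatives -/

section Symmetry

universe u

variable {E : Type u} [NormedAddCommGroup E] [NormedSpace ℝ E]

/-- Adjacent transpositions generate the symmetric group. Those avoiding the last slot are handled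
by induction applied to `fderiv ℝ f`, the remaining one by symmetry of second derivatives. The
target space varies in the induction and shares the universe of `E`, so that `E →L[ℝ] F` is again
admissible. -/
lemma iteratedFDeriv_comp_perm_of_contDiffAt {n : ℕ} :
    ∀ {F : Type u} [NormedAddCommGroup F] [NormedSpace ℝ F] {f : E → F} {x : E},
      ContDiffAt ℝ n f x → ∀ (v : Fin n → E) (σ : Equiv.Perm (Fin n)),
      iteratedFDeriv ℝ n f x (v ∘ σ) = iteratedFDeriv ℝ n f x v := by
  induction n with
  | zero => intro F _ _ f x _ v σ; congr 1; ext i; exact i.elim0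
  | succ n ih =>
    intro F _ _ f x hf v σ
    have hf' : ContDiffAt ℝ n (fderiv ℝ f) x := hf.fderiv_right (by norm_cast)
    have key : ∀ τ ∈ Submonoid.closure
        (Set.range fun i : Fin n => Equiv.swap i.castSucc i.succ), ∀ v : Fin (n + 1) → E,
        iteratedFDeriv ℝ (n + 1) f x (v ∘ τ) = iteratedFDeriv ℝ (n + 1) f x v := by
      intro τ hτ
      induction hτ using Submonoid.closure_induction with
      | mem τ h =>
        obtain ⟨i, rfl⟩ := h
        intro v
        cases n with
        | zero => exact i.elim0
        | succ n =>
          -- Derivatives are peeled off from the right, so the last slot belongs to the innermost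
          -- derivative; the question is whether the transposition touches it.
          rcases Fin.eq_castSucc_or_eq_last i with ⟨i, rfl⟩ | rfl
          · rw [iteratedFDeriv_succ_apply_right (n := n + 1) (m := v),
              iteratedFDeriv_succ_apply_right (n := n + 1)]
            have h1 : Fin.init (v ∘ Equiv.swap i.castSucc.castSucc i.castSucc.succ) =
                Fin.init v ∘ Equiv.swap i.castSucc i.succ := by
              ext1 a
              simp only [Fin.init, Function.comp_apply]
              congr 1
              have h3 : i.castSucc.succ = i.succ.castSucc := rfl
              rw [h3]
              simp only [Equiv.swap_apply_def, Fin.castSucc_inj]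
              split_ifs <;> rfl
            have h2 : (v ∘ Equiv.swap i.castSucc.castSucc i.castSucc.succ) (Fin.last _) =
                v (Fin.last _) := by
              simp only [Function.comp_apply]
              rw [Equiv.swap_apply_of_ne_of_ne]
              · exact (Fin.castSucc_lt_last _).ne'
              · have h3 : i.castSucc.succ = i.succ.castSucc := rfl
                rw [h3]; exact (Fin.castSucc_lt_last _).ne'
            rw [h1, h2]
            exact congrArg (fun L => L (v (Fin.last (n + 1)))) (ih hf' (Fin.init v) _)
          -- Symmetry of the second derivative is needed on a neighbourhood, since `n` further
          -- derivatives are taken afterwards.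
          · have h2 : ∀ᶠ y in 𝓝 x, ContDiffAt ℝ ((n + 1 + 1 : ℕ) : WithTop ℕ∞) f y :=
              hf.eventually (by simp)
            have hsymm : fderiv ℝ (fderiv ℝ f) =ᶠ[𝓝 x] fun y =>
                (ContinuousLinearMap.flipₗᵢ ℝ E E F) (fderiv ℝ (fderiv ℝ f) y) := by
              filter_upwards [h2] with y hy
              have := (hy.of_le (m := 2) (by norm_cast; omega)).isSymmSndFDerivAt (by simp)
              ext a b
              exact this a b
            let flip : (E →L[ℝ] E →L[ℝ] F) ≃L[ℝ] (E →L[ℝ] E →L[ℝ] F) :=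
              (ContinuousLinearMap.flipₗᵢ ℝ E E F).toContinuousLinearEquiv
            have e : iteratedFDeriv ℝ n (fderiv ℝ (fderiv ℝ f)) x =
                iteratedFDeriv ℝ n (flip ∘ fderiv ℝ (fderiv ℝ f)) x :=
              (hsymm.iteratedFDeriv ℝ n).eq_of_nhds
            have e' := ContinuousLinearEquiv.iteratedFDeriv_comp_left (𝕜 := ℝ) (E := E)
              (F := E →L[ℝ] E →L[ℝ] F) (G := E →L[ℝ] E →L[ℝ] F) (f := fderiv ℝ (fderiv ℝ f))
              (x := x) flip (i := n)
            rw [e'] at e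
            have expand : ∀ w : Fin (n + 1 + 1) → E, iteratedFDeriv ℝ (n + 1 + 1) f x w =
                iteratedFDeriv ℝ n (fderiv ℝ (fderiv ℝ f)) x (Fin.init (Fin.init w))
                  (Fin.init w (Fin.last n)) (w (Fin.last (n + 1))) := by
              intro w
              rw [iteratedFDeriv_succ_apply_right, iteratedFDeriv_succ_apply_right]
            rw [expand, expand]
            have hlast : (Fin.last n).succ = Fin.last (n + 1) := rfl
            have h3 : Fin.init (Fin.init (v ∘ Equiv.swap (Fin.last n).castSucc (Fin.last n).succ)) =
                Fin.init (Fin.init v) := by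
              ext1 a
              simp only [Fin.init, Function.comp_apply]
              rw [Equiv.swap_apply_of_ne_of_ne]
              · intro h
                have := congrArg Fin.val h
                simp at this
                omega
              · intro h
                have := congrArg Fin.val h
                simp at this
                omega
            rw [h3, e]
            simp only [Fin.init, Function.comp_apply, hlast, Equiv.swap_apply_left,
              Equiv.swap_apply_right]
            rw [← e]
            conv_rhs => rw [e]
            rfl
      | one => intro v; rfl
      | mul a b _ _ ha hb =>
        intro v
        have : v ∘ (a * b : Equiv.Perm _) = (v ∘ a) ∘ b := rfl
        rw [this, hb, ha]
    exact key σ (by rw [Equiv.Perm.mclosure_swap_castSucc_succ]; trivial) v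

end Symmetry

/-! ### Coordinates -/

/-- The multi-index that counts how often each coordinate occurs in a sequence. -/
def cnt {j : ℕ} (f : Fin j → Fin d) : Fin d → ℕ :=
  fun i => Fintype.card {a // f a = i}

lemma sum_cnt {j : ℕ} (f : Fin j → Fin d) : ∑ i, cnt f i = j := by
  have := Fintype.card_congr (Equiv.sigmaFiberEquiv f)
  simpa [cnt] using this

lemma len_cnt {j : ℕ} (f : Fin j → Fin d) : len (cnt f) = j := sum_cnt f

lemma prod_cnt {j : ℕ} (f : Fin j → Fin d) {M : Type*} [CommMonoid M] (c : Fin d → M) :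
    ∏ a, c (f a) = ∏ i, c i ^ cnt f i := by
  rw [← Fintype.prod_fiberwise f]
  refine Finset.prod_congr rfl fun i _ => ?_
  rw [Finset.prod_congr rfl (g := fun _ => c i) (fun a _ => by rw [a.2])]
  simp [cnt]

lemma mono_cnt {j : ℕ} (f : Fin j → Fin d) (x y : Sp d) :
    mono (cnt f) x y = ∏ a, (y - x) (f a) := by
  rw [prod_cnt f (fun i => (y - x) i)]
  rfl

/-- Standard basis vectors. -/
def bv (i : Fin d) : Sp d := EuclideanSpace.single i (1 : ℝ)

lemma norm_bv (i : Fin d) : ‖bv i‖ = 1 := by simp [bv]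

lemma norm_dirs (k : Fin d → ℕ) (j : Fin (∑ i, k i)) : ‖dirs k j‖ = 1 := by simp [dirs]

/-- The sequence `f` and the sorted sequence behind `dirs (cnt f)` list the same basis vectors;
grouping the positions by the fibres of `f` gives the permutation between them, and iterated
derivatives are symmetric. -/
lemma iteratedFDeriv_bv_eq_pd {j : ℕ} (f : Fin j → Fin d) {g : Sp d → ℝ} {x : Sp d}
    (hg : ContDiffAt ℝ j g x) :
    iteratedFDeriv ℝ j g x (fun a => bv (f a)) = pd (cnt f) g x := by
  have hcast : ∀ {n : ℕ} (h : n = j) (v : Fin n → Sp d),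
      iteratedFDeriv ℝ n g x v = iteratedFDeriv ℝ j g x (v ∘ Fin.cast h.symm) := by
    intro n h v; subst h; rfl
  unfold pd
  rw [hcast (sum_cnt f)]
  let e : Fin j ≃ Fin (∑ i, cnt f i) :=
    ((Equiv.sigmaFiberEquiv f).symm.trans
      (Equiv.sigmaCongrRight fun i => Fintype.equivFin {a // f a = i})).trans finSigmaFinEquiv
  have he : ∀ a, (finSigmaFinEquiv.symm (e a)).1 = f a := by
    intro a
    have h : finSigmaFinEquiv.symm (e a) = ⟨f a, Fintype.equivFin _ ⟨a, rfl⟩⟩ :=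
      finSigmaFinEquiv.symm_apply_apply _
    rw [h]
  let σ : Equiv.Perm (Fin j) := e.trans (finCongr (sum_cnt f))
  rw [← iteratedFDeriv_comp_perm_of_contDiffAt hg (dirs (cnt f) ∘ _) σ]
  congr 1
  ext1 a
  have h1 : (Fin.cast (sum_cnt f).symm) (σ a) = e a := by
    simp [σ]
  simp only [Function.comp_apply, h1, dirs, he, bv]

/-- The multilinear map `v ↦ ∏ a, v_a (f a)`. -/
def coordML {j : ℕ} (f : Fin j → Fin d) : Sp d [×j]→L[ℝ] ℝ :=
  (ContinuousMultilinearMap.mkPiAlgebra ℝ (Fin j) ℝ).compContinuousLinearMap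
    fun a => EuclideanSpace.proj (f a)

lemma coordML_apply {j : ℕ} (f : Fin j → Fin d) (v : Fin j → Sp d) :
    coordML f v = ∏ a, v a (f a) := by
  simp [coordML]

lemma eq_sum_coordML {j : ℕ} (T : Sp d [×j]→L[ℝ] ℝ) :
    T = ∑ f : Fin j → Fin d, T (fun a => bv (f a)) • coordML f := by
  ext v
  have h1 : v = fun a => ∑ i, v a i • bv i := by
    ext1 a
    have := (EuclideanSpace.basisFun (Fin d) ℝ).sum_repr (v a)
    simpa [bv] using this.symm
  have h2 : T v = T (fun a => ∑ i, v a i • bv i) := by rw [← h1]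
  have h3 := T.toMultilinearMap.map_sum (fun a (i : Fin d) => v a i • bv i)
  simp only [ContinuousMultilinearMap.coe_coe] at h3
  rw [h2, h3]
  simp only [sum_apply, smul_apply, smul_eq_mul, coordML_apply]
  refine Finset.sum_congr rfl fun f _ => ?_
  have h4 := T.map_smul_univ (fun a => v a (f a)) (fun a => bv (f a))
  rw [h4, smul_eq_mul, mul_comm]

/-- A constant that bounds norms of `j`-linear forms by their values on basis vectors. -/
def coordConst (d j : ℕ) : ℝ := ∑ f : Fin j → Fin d, ‖coordML f‖

lemma coordConst_nonneg (d j : ℕ) : 0 ≤ coordConst d j :=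
  Finset.sum_nonneg fun _ _ => norm_nonneg _

lemma norm_le_of_coord {j : ℕ} (T : Sp d [×j]→L[ℝ] ℝ) {A : ℝ}
    (h : ∀ f : Fin j → Fin d, |T (fun a => bv (f a))| ≤ A) : ‖T‖ ≤ coordConst d j * A := by
  rw [eq_sum_coordML T, coordConst, Finset.sum_mul]
  refine (norm_sum_le _ _).trans (Finset.sum_le_sum fun f _ => ?_)
  rw [norm_smul, mul_comm]
  exact mul_le_mul_of_nonneg_left (h f) (norm_nonneg _)

lemma abs_pd_le (k : Fin d → ℕ) (g : Sp d → ℝ) (x : Sp d) :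
    |pd k g x| ≤ ‖iteratedFDeriv ℝ (len k) g x‖ := by
  have := (iteratedFDeriv ℝ (∑ i, k i) g x).le_opNorm (dirs k)
  simp only [norm_dirs, Finset.prod_const_one, mul_one] at this
  exact this

lemma norm_iteratedFDeriv_le_of_pd {j : ℕ} {g : Sp d → ℝ} {x : Sp d} (hg : ContDiffAt ℝ j g x)
    {A : ℝ} (h : ∀ k : Fin d → ℕ, len k = j → |pd k g x| ≤ A) :
    ‖iteratedFDeriv ℝ j g x‖ ≤ coordConst d j * A :=
  norm_le_of_coord _ fun f => by
    rw [iteratedFDeriv_bv_eq_pd f hg]; exact h _ (len_cnt f)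

lemma norm_iteratedFDeriv_le_of_mem_testBall {q j : ℕ} {φ : 𝓓(unitBall d, ℝ)}
    (h : φ ∈ testBall d q) (hj : j ≤ q) (x : Sp d) :
    ‖iteratedFDeriv ℝ j φ x‖ ≤ coordConst d j := by
  have := norm_iteratedFDeriv_le_of_pd (j := j) (g := φ) (x := x) (A := 1)
    ((φ.contDiff.of_le (by exact_mod_cast le_top)).contDiffAt)
    (fun k hk => h k (hk ▸ hj) x)
  simpa using this

lemma mem_testBall_of_norm {q : ℕ} {φ : 𝓓(unitBall d, ℝ)}
    (h : ∀ j ≤ q, ∀ x, ‖iteratedFDeriv ℝ j φ x‖ ≤ 1) : φ ∈ testBall d q :=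
  fun k hk x => (abs_pd_le k φ x).trans (h _ hk x)

/-- The multinomial form of the homogeneous Taylor polynomials. -/
lemma sum_multiIndices_eq (N : ℕ) (a : (Fin d → ℕ) → ℝ) (v : Fin d → ℝ) :
    ∑ k ∈ multiIndices d ((N : ℤ) - 1), a k / (∏ i, ((k i).factorial : ℝ)) * ∏ i, v i ^ k i =
      ∑ j ∈ Finset.range N, ((j.factorial : ℝ))⁻¹ *
        ∑ f : Fin j → Fin d, a (cnt f) * ∏ b, v (f b) := by
  classical
  have h1 : multiIndices d ((N : ℤ) - 1) =
      (Finset.range N).biUnion fun j => Finset.piAntidiag Finset.univ j := by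
    ext k
    rw [multiIndices, Finset.mem_filter, Fintype.mem_piFinset]
    simp only [Finset.mem_range, Finset.mem_biUnion, Finset.mem_piAntidiag]
    have hlen : len k = ∑ i, k i := rfl
    rw [hlen]
    constructor
    · rintro ⟨-, h⟩
      exact ⟨∑ i, k i, by omega, rfl, by simp⟩
    · rintro ⟨j, hj, hk, -⟩
      have : ∑ i, k i = j := hk
      refine ⟨fun i => ?_, by omega⟩
      have := Finset.single_le_sum (f := k) (fun i _ => Nat.zero_le _) (Finset.mem_univ i)
      omega
  rw [h1, Finset.sum_biUnion]
  · refine Finset.sum_congr rfl fun j _ => ?_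
    -- The functional `Λ` replaces each monomial `X^k` by `a k`. Applied to the `j`-th power of `∑
    -- v_i X_i`, expanded once as a sum over index sequences and once by the multinomial theorem, it
    -- gives both sides.
    let Λ : MvPolynomial (Fin d) ℝ →ₗ[ℝ] ℝ :=
      (MvPolynomial.basisMonomials (Fin d) ℝ).constr ℝ fun k => a k
    have hΛ : ∀ k : Fin d →₀ ℕ, Λ (MvPolynomial.monomial k 1) = a k := fun k => by
      have := (MvPolynomial.basisMonomials (Fin d) ℝ).constr_basis ℝ (fun k => a k) k
      rwa [MvPolynomial.coe_basisMonomials] at this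
    have hmon : ∀ k : Fin d → ℕ, ∏ i, (MvPolynomial.X i : MvPolynomial (Fin d) ℝ) ^ k i =
        MvPolynomial.monomial (Finsupp.equivFunOnFinite.symm k) 1 := fun k => by
      rw [MvPolynomial.monomial_eq, Finsupp.prod_fintype _ _ (by simp)]
      simp
    have hΛ' : ∀ (k : Fin d → ℕ) (c : ℝ),
        Λ (c • ∏ i, (MvPolynomial.X i : MvPolynomial (Fin d) ℝ) ^ k i) = c * a k := fun k c => by
      rw [map_smul, hmon, hΛ, smul_eq_mul]
      rfl
    let p : MvPolynomial (Fin d) ℝ := ∑ i, v i • MvPolynomial.X i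
    have e1 : Λ (p ^ j) = ∑ f : Fin j → Fin d, a (cnt f) * ∏ b, v (f b) := by
      simp only [p]
      rw [Fintype.sum_pow, map_sum]
      refine Finset.sum_congr rfl fun f _ => ?_
      rw [Finset.prod_smul, prod_cnt f (fun i => (MvPolynomial.X i : MvPolynomial (Fin d) ℝ)),
        hΛ', mul_comm]
    have e2 : Λ (p ^ j) = ∑ k ∈ Finset.piAntidiag Finset.univ j,
        (j.factorial : ℝ) * (a k / (∏ i, ((k i).factorial : ℝ)) * ∏ i, v i ^ k i) := by
      simp only [p]
      rw [Finset.sum_pow_eq_sum_piAntidiag, map_sum]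
      refine Finset.sum_congr rfl fun k hk => ?_
      rw [Finset.mem_piAntidiag] at hk
      have h2 := Nat.multinomial_spec Finset.univ k
      rw [hk.1] at h2
      have h3 : (∏ i, ((k i).factorial : ℝ)) * (Nat.multinomial Finset.univ k : ℝ) =
          (j.factorial : ℝ) := by exact_mod_cast h2
      have h4 : (∏ i, ((k i).factorial : ℝ)) ≠ 0 :=
        Finset.prod_ne_zero_iff.2 fun i _ => by positivity
      simp only [smul_pow, Finset.prod_smul]
      rw [← nsmul_eq_mul, map_nsmul, hΛ', nsmul_eq_mul, ← h3]
      field_simp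
    rw [← e1, e2, Finset.mul_sum]
    refine Finset.sum_congr rfl fun k _ => ?_
    rw [inv_mul_cancel_left₀ (by positivity)]
  · intro i _ j _ hij
    simp only [Function.onFun]
    rw [Finset.disjoint_left]
    intro k hk hk'
    rw [Finset.mem_piAntidiag] at hk hk'
    exact hij (hk.1.symm.trans hk'.1)

/-! ### Taylor's formula -/

section Taylor

variable {E : Type*} [NormedAddCommGroup E] [NormedSpace ℝ E]

lemma hasDerivAt_iteratedFDeriv_line {N : ℕ} {f : E → ℝ} {x v : E} {t : ℝ}
    (hf : ContDiffAt ℝ (N + 1 : ℕ) f (x + t • v)) :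
    HasDerivAt (fun t => iteratedFDeriv ℝ N f (x + t • v) fun _ => v)
      (iteratedFDeriv ℝ (N + 1) f (x + t • v) fun _ => v) t := by
  have h1 : DifferentiableAt ℝ (iteratedFDeriv ℝ N f) (x + t • v) :=
    hf.differentiableAt_iteratedFDeriv (by exact_mod_cast Nat.lt_succ_self N)
  have h2 : HasDerivAt (fun t : ℝ => x + t • v) v t := by
    simpa using ((hasDerivAt_id t).smul_const v).const_add x
  have h3 := h1.hasFDerivAt.comp_hasDerivAt t h2
  have h4 := (ContinuousMultilinearMap.apply ℝ (fun _ : Fin N => E) ℝ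
    (fun _ => v)).hasFDerivAt.comp_hasDerivAt t h3
  rw [iteratedFDeriv_succ_apply_left]
  exact h4

/-- Taylor's formula with integral remainder. -/
lemma taylor_segment {f : E → ℝ} {x v : E} (n : ℕ)
    (hf : ∀ t ∈ Icc (0 : ℝ) 1, ContDiffAt ℝ (n + 1 : ℕ) f (x + t • v)) :
    f (x + v) = ∑ i ∈ Finset.range (n + 1), ((i.factorial : ℝ))⁻¹ *
        iteratedFDeriv ℝ i f x (fun _ => v) +
      ∫ t in (0 : ℝ)..1, (1 - t) ^ n / n.factorial *
        iteratedFDeriv ℝ (n + 1) f (x + t • v) (fun _ => v) := by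
  have hline : Continuous fun t : ℝ => x + t • v := by fun_prop
  have hcont : ∀ N : ℕ, (∀ t ∈ Icc (0 : ℝ) 1, ContDiffAt ℝ N f (x + t • v)) →
      ContinuousOn (fun t : ℝ => iteratedFDeriv ℝ N f (x + t • v) fun _ => v) (Icc 0 1) := by
    intro N hN t ht
    have h1 : ContinuousAt (iteratedFDeriv ℝ N f) (x + t • v) :=
      (hN t ht).continuousAt_iteratedFDeriv le_rfl
    have h2 : ContinuousAt (fun t : ℝ => iteratedFDeriv ℝ N f (x + t • v)) t :=
      ContinuousAt.comp (f := fun t : ℝ => x + t • v) h1 hline.continuousAt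
    exact (((ContinuousMultilinearMap.apply ℝ (fun _ : Fin N => E) ℝ
      (fun _ => v)).continuous.continuousAt.comp h2)).continuousWithinAt
  induction n with
  | zero =>
    have := intervalIntegral.integral_eq_sub_of_hasDerivAt (a := 0) (b := 1)
      (f := fun t : ℝ => iteratedFDeriv ℝ 0 f (x + t • v) fun _ => v)
      (f' := fun t : ℝ => iteratedFDeriv ℝ 1 f (x + t • v) fun _ => v)
      (fun t ht => hasDerivAt_iteratedFDeriv_line (hf t (by simpa using ht)))
      ((hcont 1 hf).intervalIntegrable_of_Icc zero_le_one)
    have e : ∀ t : ℝ, (1 - t) ^ 0 / ((Nat.factorial 0 : ℕ) : ℝ) *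
        iteratedFDeriv ℝ (0 + 1) f (x + t • v) (fun _ => v) =
        iteratedFDeriv ℝ 1 f (x + t • v) fun _ => v := fun t => by simp
    simp only [e, this]
    simp
  | succ n ih =>
    have hf' : ∀ t ∈ Icc (0 : ℝ) 1, ContDiffAt ℝ (n + 1 : ℕ) f (x + t • v) := fun t ht =>
      (hf t ht).of_le (by exact_mod_cast Nat.le_succ _)
    rw [ih hf', Finset.sum_range_succ _ (n + 1), add_assoc]
    congr 1
    have hder : ∀ t : ℝ, HasDerivAt (fun t : ℝ => -((1 - t) ^ (n + 1) / (n + 1).factorial))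
        ((1 - t) ^ n / n.factorial) t := by
      intro t
      have h1 : HasDerivAt (fun t : ℝ => 1 - t) (-1) t := by
        simpa using (hasDerivAt_id t).const_sub 1
      have h2 := ((h1.pow (n + 1)).div_const ((n + 1).factorial : ℝ)).neg
      refine h2.congr_deriv ?_
      rw [Nat.factorial_succ]
      push_cast
      have : (n.factorial : ℝ) ≠ 0 := by positivity
      have : (n : ℝ) + 1 ≠ 0 := by positivity
      field_simp
    -- Integrating the remainder by parts raises its order; the boundary term at `0` is the new
    -- Taylor term, and the one at `1` vanishes.
    have hparts := intervalIntegral.integral_mul_deriv_eq_deriv_mul (a := 0) (b := 1)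
      (u := fun t : ℝ => iteratedFDeriv ℝ (n + 1) f (x + t • v) fun _ => v)
      (u' := fun t : ℝ => iteratedFDeriv ℝ (n + 1 + 1) f (x + t • v) fun _ => v)
      (v := fun t : ℝ => -((1 - t) ^ (n + 1) / (n + 1).factorial))
      (v' := fun t : ℝ => (1 - t) ^ n / n.factorial)
      (fun t ht => hasDerivAt_iteratedFDeriv_line (hf t (by simpa using ht)))
      (fun t _ => hder t)
      ((hcont _ hf).intervalIntegrable_of_Icc zero_le_one)
      (Continuous.intervalIntegrable (by fun_prop) _ _)
    have e1 : ∫ t in (0 : ℝ)..1, (1 - t) ^ n / n.factorial *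
        iteratedFDeriv ℝ (n + 1) f (x + t • v) (fun _ => v) =
        ∫ t in (0 : ℝ)..1, iteratedFDeriv ℝ (n + 1) f (x + t • v) (fun _ => v) *
          ((1 - t) ^ n / n.factorial) := by simp only [mul_comm]
    have e2 : ∫ t in (0 : ℝ)..1, (1 - t) ^ (n + 1) / (n + 1).factorial *
        iteratedFDeriv ℝ (n + 1 + 1) f (x + t • v) (fun _ => v) =
        -∫ t in (0 : ℝ)..1, iteratedFDeriv ℝ (n + 1 + 1) f (x + t • v) (fun _ => v) *
          -((1 - t) ^ (n + 1) / (n + 1).factorial) := by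
      rw [← intervalIntegral.integral_neg]
      refine intervalIntegral.integral_congr fun t _ => ?_
      ring
    rw [e1, e2, hparts]
    simp only [sub_self, zero_smul, add_zero, sub_zero, one_pow]
    rw [zero_pow (Nat.succ_ne_zero n)]
    ring

/-- The Taylor polynomial of a smooth function, minus the function, is bounded by the derivatives
of the next order. -/
lemma abs_sub_taylor_le {f : E → ℝ} {x v : E} (N : ℕ) {A : ℝ}
    (hf : ∀ t ∈ Icc (0 : ℝ) 1, ContDiffAt ℝ N f (x + t • v))
    (hA : ∀ t ∈ Icc (0 : ℝ) 1, ‖iteratedFDeriv ℝ N f (x + t • v)‖ ≤ A) :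
    |f (x + v) - ∑ i ∈ Finset.range N, ((i.factorial : ℝ))⁻¹ *
        iteratedFDeriv ℝ i f x (fun _ => v)| ≤ A * ‖v‖ ^ N := by
  cases N with
  | zero =>
    have := hA 1 (by simp)
    simpa using this
  | succ n =>
    rw [taylor_segment n hf, add_sub_cancel_left]
    have hA0 : 0 ≤ A := (norm_nonneg _).trans (hA 0 (by simp))
    have h := intervalIntegral.norm_integral_le_of_norm_le_const (a := (0 : ℝ)) (b := 1)
      (f := fun t : ℝ => (1 - t) ^ n / n.factorial *
        iteratedFDeriv ℝ (n + 1) f (x + t • v) (fun _ => v)) (C := A * ‖v‖ ^ (n + 1)) (by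
      intro t ht
      rw [uIoc_of_le zero_le_one] at ht
      have ht' : t ∈ Icc (0 : ℝ) 1 := ⟨ht.1.le, ht.2⟩
      rw [norm_mul]
      have h1 : ‖(1 - t) ^ n / (n.factorial : ℝ)‖ ≤ 1 := by
        rw [Real.norm_of_nonneg (by have := ht.2; have : 0 ≤ 1 - t := by linarith
                                    positivity)]
        refine div_le_one_of_le₀ ?_ (by positivity)
        calc (1 - t) ^ n ≤ 1 := pow_le_one₀ (by linarith [ht.2]) (by linarith [ht.1])
          _ ≤ n.factorial := by exact_mod_cast Nat.succ_le_of_lt n.factorial_pos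
      have h2 := (iteratedFDeriv ℝ (n + 1) f (x + t • v)).le_opNorm fun _ => v
      simp only [Finset.prod_const, Finset.card_univ, Fintype.card_fin] at h2
      calc _ ≤ 1 * (A * ‖v‖ ^ (n + 1)) := mul_le_mul h1 (h2.trans (by gcongr; exact hA t ht'))
              (norm_nonneg _) zero_le_one
        _ = _ := one_mul _)
    simpa using h

end Taylor

/-! ### Mollification -/

/-- The mollification `y ↦ ∫ g (y - ε w) η(w) dw`. -/
def moll (η : 𝓓(unitBall d, ℝ)) (ε : ℝ) (g : Sp d → ℝ) (y : Sp d) : ℝ :=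
  ∫ w in Metric.closedBall (0 : Sp d) 1, η w * g (y - ε • w)

lemma support_unitBall (η : 𝓓(unitBall d, ℝ)) :
    Function.support η ⊆ Metric.ball (0 : Sp d) 1 := (subset_tsupport _).trans η.tsupport_subset

lemma moll_fam_integrand {n : ℕ∞} {P : Type*} [TopologicalSpace P] (η : 𝓓(unitBall d, ℝ))
    {H : P → Sp d → ℝ} (hH : SmoothFam n H) :
    SmoothFam n fun (q : (ℝ × P) × Sp d) y => η q.2 * H q.1.2 (y - q.1.1 • q.2) :=
  (((hH.comp (f := fun q : (ℝ × P) × Sp d => q.1.2) (by fun_prop)).sub_right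
    (v := fun q => q.1.1 • q.2) (by fun_prop)).smul (c := fun q => η q.2)
      (η.continuous.comp continuous_snd))

/-- Mollifying a smooth family gives a smooth family, also with respect to the scale. -/
lemma SmoothFam.moll {n : ℕ∞} {P : Type*} [TopologicalSpace P] [FirstCountableTopology P]
    [LocallyCompactSpace P] (η : 𝓓(unitBall d, ℝ)) {H : P → Sp d → ℝ} (hH : SmoothFam n H) :
    SmoothFam n fun (q : ℝ × P) => moll η q.1 (H q.2) :=
  (moll_fam_integrand η hH).integral (isCompact_closedBall 0 1)

lemma iteratedFDeriv_moll {n : ℕ∞} (η : 𝓓(unitBall d, ℝ)) (ε : ℝ) {g : Sp d → ℝ}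
    (hg : ContDiff ℝ n g) {j : ℕ} (hj : (j : ℕ∞) ≤ n) (y : Sp d) :
    iteratedFDeriv ℝ j (moll η ε g) y =
      ∫ w in Metric.closedBall (0 : Sp d) 1, η w • iteratedFDeriv ℝ j g (y - ε • w) := by
  have hg' : SmoothFam n fun (_ : Unit) => g := SmoothFam.const hg
  have h := (moll_fam_integrand η hg').iteratedFDeriv_integral (μ := volume)
    (isCompact_closedBall (0 : Sp d) 1) (ε, ()) hj y
  refine h.trans (integral_congr_ae (Eventually.of_forall fun w => ?_))
  have h1 : ContDiff ℝ j fun y => g (y - ε • w) :=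
    (hg.of_le (by exact_mod_cast hj)).comp (contDiff_id.sub contDiff_const)
  have h2 := iteratedFDeriv_const_smul_apply (a := η w) (x := y) (h1.contDiffAt)
  simp only [smul_eq_mul, Pi.smul_def] at h2
  refine Eq.trans h2 ?_
  rw [iteratedFDeriv_comp_sub]

lemma contDiff_moll {n : ℕ∞} (η : 𝓓(unitBall d, ℝ)) (ε : ℝ) {g : Sp d → ℝ}
    (hg : ContDiff ℝ n g) : ContDiff ℝ n (moll η ε g) :=
  ((SmoothFam.const (P := Unit) hg).moll η).1 (ε, ())

/-- The `L^1` norm of a mollifier. -/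
def l1 (η : 𝓓(unitBall d, ℝ)) : ℝ := ∫ w in Metric.closedBall (0 : Sp d) 1, |η w|

lemma l1_nonneg (η : 𝓓(unitBall d, ℝ)) : 0 ≤ l1 η := integral_nonneg fun _ => abs_nonneg _

lemma norm_integral_smul_le {F : Type*} [NormedAddCommGroup F] [NormedSpace ℝ F]
    (η : 𝓓(unitBall d, ℝ)) {h : Sp d → F} {A : ℝ} (hA : ∀ w, ‖w‖ ≤ 1 → ‖h w‖ ≤ A) :
    ‖∫ w in Metric.closedBall (0 : Sp d) 1, η w • h w‖ ≤ A * l1 η := by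
  rw [l1, ← integral_const_mul]
  refine norm_integral_le_of_norm_le ?_ ?_
  · exact ((η.continuous.abs.const_mul A).continuousOn.integrableOn_compact
      (isCompact_closedBall 0 1))
  · rw [ae_restrict_iff' measurableSet_closedBall]
    refine Eventually.of_forall fun w hw => ?_
    rw [norm_smul, mul_comm, Real.norm_eq_abs]
    exact mul_le_mul_of_nonneg_right (hA w (by simpa using hw)) (abs_nonneg _)

lemma norm_iteratedFDeriv_moll_le {n : ℕ∞} (η : 𝓓(unitBall d, ℝ)) (ε : ℝ) {g : Sp d → ℝ}
    (hg : ContDiff ℝ n g) {j : ℕ} (hj : (j : ℕ∞) ≤ n) {A : ℝ}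
    (hA : ∀ y, ‖iteratedFDeriv ℝ j g y‖ ≤ A) (y : Sp d) :
    ‖iteratedFDeriv ℝ j (moll η ε g) y‖ ≤ A * l1 η := by
  rw [iteratedFDeriv_moll η ε hg hj]
  exact norm_integral_smul_le η fun w _ => hA _

lemma support_moll_subset (η : 𝓓(unitBall d, ℝ)) {ε : ℝ} {g : Sp d → ℝ}
    {Q : Set (Sp d)} (hQ : Function.support g ⊆ Q) {r : ℝ} (hr : |ε| ≤ r) :
    Function.support (moll η ε g) ⊆ Metric.cthickening r Q := by
  intro y hy
  by_contra hyQ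
  apply hy
  have : ∀ w ∈ Metric.closedBall (0 : Sp d) 1, η w * g (y - ε • w) = 0 := by
    intro w hw
    by_contra h
    apply hyQ
    refine Metric.mem_cthickening_of_dist_le y (y - ε • w) r Q (hQ (right_ne_zero_of_mul h)) ?_
    rw [dist_eq_norm, sub_sub_cancel, norm_smul, Real.norm_eq_abs]
    have hw' : ‖w‖ ≤ 1 := by simpa using hw
    nlinarith [abs_nonneg ε, norm_nonneg w]
  rw [moll, setIntegral_congr_fun measurableSet_closedBall this]
  simp

lemma setIntegral_mul_unitBall (η : 𝓓(unitBall d, ℝ)) (h : Sp d → ℝ) :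
    ∫ w in Metric.closedBall (0 : Sp d) 1, η w * h w = ∫ w, η w * h w := by
  refine setIntegral_eq_integral_of_forall_compl_eq_zero fun w hw => ?_
  have : η w = 0 := by
    by_contra h
    exact hw (Metric.ball_subset_closedBall (support_unitBall η h))
  rw [this, zero_mul]

/-- Integrating over `w` instead of convolving keeps the mollification meaningful at scale `0`.
Convergence as the scale tends to `0` thus becomes continuity of a smooth family at `0`. -/
lemma moll_zero (η : 𝓓(unitBall d, ℝ)) (g : Sp d → ℝ) (y : Sp d) :
    moll η 0 g y = (∫ w, η w) * g y := by
  rw [moll, setIntegral_mul_unitBall η fun w => g (y - (0 : ℝ) • w)]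
  simp only [zero_smul, sub_zero]
  rw [integral_mul_const]

lemma moll_eq_conv (η : 𝓓(unitBall d, ℝ)) {ε : ℝ} (hε : 0 < ε) (g : Sp d → ℝ) (y : Sp d) :
    moll η ε g y = ∫ z, g z * rescale η z ε y := by
  rw [moll, setIntegral_mul_unitBall η fun w => g (y - ε • w)]
  have h1 := integral_sub_left_eq_self (μ := (volume : Measure (Sp d)))
    (fun z => g (y - z) * rescale η (y - z) ε y) y
  simp only [sub_sub_cancel] at h1
  rw [h1]
  have h2 := Measure.integral_comp_smul (volume : Measure (Sp d))
    (fun z => g (y - z) * rescale η (y - z) ε y) ε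
  simp only [rescale, sub_sub_cancel, smul_smul, inv_mul_cancel₀ hε.ne', one_smul,
    finrank_euclideanSpace_fin] at h2
  have h3 : ∀ w, η w * g (y - ε • w) = ε ^ d * (g (y - ε • w) * ((ε ^ d)⁻¹ * η w)) := fun w => by
    field_simp
  simp only [h3]
  rw [integral_const_mul, h2, smul_eq_mul, abs_of_pos (by positivity), ← mul_assoc,
    mul_inv_cancel₀ (by positivity), one_mul]
  simp only [rescale, sub_sub_cancel]

/-! ### Rescaled test functions -/

lemma support_rescale_subset (η : 𝓓(unitBall d, ℝ)) (z : Sp d) {ε : ℝ} (hε : 0 < ε) :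
    Function.support (rescale η z ε) ⊆ Metric.ball z ε := by
  intro y hy
  have h1 : η (ε⁻¹ • (y - z)) ≠ 0 := right_ne_zero_of_mul hy
  have h2 := support_unitBall η h1
  rw [mem_ball_zero_iff, norm_smul, norm_inv, Real.norm_of_nonneg hε.le, inv_mul_lt_iff₀ hε,
    mul_one] at h2
  rwa [Metric.mem_ball, dist_eq_norm]

lemma contDiff_rescale (η : 𝓓(unitBall d, ℝ)) (z : Sp d) (ε : ℝ) :
    ContDiff ℝ (⊤ : ℕ∞) (rescale η z ε) :=
  contDiff_const.mul (η.contDiff.comp ((contDiff_id.sub contDiff_const).const_smul _))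

lemma isTest_rescale {U : Opens (Sp d)} (η : 𝓓(unitBall d, ℝ)) {z : Sp d} {ε : ℝ} (hε : 0 < ε)
    (hz : Metric.closedBall z ε ⊆ U) : IsTest U (rescale η z ε) :=
  IsTest.of_support_subset (contDiff_rescale η z ε) (isCompact_closedBall z ε) hz
    ((support_rescale_subset η z hε).trans Metric.ball_subset_closedBall)

lemma smoothFam_rescale (η : 𝓓(unitBall d, ℝ)) (ε : ℝ) :
    SmoothFam ⊤ fun z : Sp d => rescale η z ε := by
  have h : ContDiff ℝ (⊤ : ℕ∞) fun y : Sp d => (ε ^ d)⁻¹ * η (ε⁻¹ • y) :=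
    contDiff_const.mul (η.contDiff.comp (contDiff_id.const_smul _))
  exact (SmoothFam.const (P := Sp d) h).sub_right continuous_id

lemma smoothFam_mul_rescale (η : 𝓓(unitBall d, ℝ)) (ε : ℝ) {P : Type*} [TopologicalSpace P]
    {h : P → ℝ} {v : P → Sp d} (hh : Continuous h) (hv : Continuous v) :
    SmoothFam ⊤ fun p y => h p * rescale η (v p) ε y :=
  ((smoothFam_rescale η ε).comp hv).smul hh

lemma cthickening_subset_of_closedBall {Q W : Set (Sp d)} (hQ : IsCompact Q) {r : ℝ}
    (hr : 0 ≤ r) (h : ∀ x ∈ Q, Metric.closedBall x r ⊆ W) : Metric.cthickening r Q ⊆ W := by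
  rw [hQ.cthickening_eq_biUnion_closedBall hr]
  exact iUnion₂_subset h

lemma closedBall_subset_cthickening' {Q : Set (Sp d)} {x : Sp d} (hx : x ∈ Q) (r : ℝ) :
    Metric.closedBall x r ⊆ Metric.cthickening r Q :=
  Metric.closedBall_subset_cthickening hx r

/-- Smoothness and support of mollifications of continuous functions. -/
lemma moll_eq_setIntegral (η : 𝓓(unitBall d, ℝ)) {ε : ℝ} (hε : 0 < ε) {h : Sp d → ℝ}
    {Q : Set (Sp d)} (hs : Function.support h ⊆ Q) :
    moll η ε h = fun y => ∫ z in Q, h z * rescale η z ε y := by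
  ext y
  rw [moll_eq_conv η hε]
  refine (setIntegral_eq_integral_of_forall_compl_eq_zero fun z hz => ?_).symm
  have : h z = 0 := by by_contra h'; exact hz (hs h')
  rw [this, zero_mul]

lemma contDiff_moll_of_continuous (η : 𝓓(unitBall d, ℝ)) {ε : ℝ} (hε : 0 < ε) {h : Sp d → ℝ}
    (hh : Continuous h) {Q : Set (Sp d)} (hQ : IsCompact Q) (hs : Function.support h ⊆ Q) :
    ContDiff ℝ (⊤ : ℕ∞) (moll η ε h) := by
  rw [moll_eq_setIntegral η hε hs]
  have := (smoothFam_mul_rescale η ε (P := Unit × Sp d) (h := fun p => h p.2) (v := Prod.snd)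
    (hh.comp continuous_snd) continuous_snd).integral (μ := volume) hQ
  exact this.1 ()

lemma isTest_moll {U : Opens (Sp d)} (η : 𝓓(unitBall d, ℝ)) {ε : ℝ} (hε : 0 < ε) {h : Sp d → ℝ}
    (hh : Continuous h) {Q : Set (Sp d)} (hQ : IsCompact Q) (hs : Function.support h ⊆ Q)
    (hU : Metric.cthickening ε Q ⊆ U) : IsTest U (moll η ε h) :=
  IsTest.of_support_subset (contDiff_moll_of_continuous η hε hh hQ hs) hQ.cthickening hU
    (support_moll_subset η hs (abs_of_pos hε).le)

/-- The pairing of a distribution with a mollified function. -/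
lemma apply_moll {U : Opens (Sp d)} (G : 𝓓'(U, ℝ)) (η : 𝓓(unitBall d, ℝ)) {ε : ℝ} (hε : 0 < ε)
    {h : Sp d → ℝ} (hh : Continuous h) {Q : Set (Sp d)} (hQ : IsCompact Q)
    (hs : Function.support h ⊆ Q) (hU : Metric.cthickening ε Q ⊆ U) :
    G (toTest U (moll η ε h)) = ∫ z in Q, h z * G (toTest U (rescale η z ε)) := by
  rw [moll_eq_setIntegral η hε hs]
  have hsupp : ∀ z, Function.support (fun y => h z * rescale η z ε y) ⊆
      Metric.cthickening ε Q := by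
    intro z y hy
    have hz : z ∈ Q := hs (left_ne_zero_of_mul hy)
    exact closedBall_subset_cthickening' hz ε (Metric.ball_subset_closedBall
      (support_rescale_subset η z hε (right_ne_zero_of_mul hy)))
  have := apply_toTest_integral (H := fun z y => h z * rescale η z ε y) (μ := volume) G
    hQ.cthickening hU (smoothFam_mul_rescale η ε hh continuous_id) hsupp hQ
  rw [this]
  refine setIntegral_congr_fun hQ.measurableSet fun z hz => ?_
  rw [toTest_smul (isTest_rescale η hε ((closedBall_subset_cthickening' hz ε).trans hU)), map_smul,
    smul_eq_mul]

/-- Fubini. It allows consecutive terms of the telescoping sequence to be written with the same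
outer scale. -/
lemma moll_comm (η η' : 𝓓(unitBall d, ℝ)) (a b : ℝ) {g : Sp d → ℝ} (hg : Continuous g) :
    moll η a (moll η' b g) = moll η' b (moll η a g) := by
  ext y
  simp only [moll, ← integral_const_mul]
  rw [integral_integral_swap]
  · refine integral_congr_ae (Eventually.of_forall fun w => integral_congr_ae
      (Eventually.of_forall fun w' => ?_))
    simp only
    rw [sub_right_comm]
    ring
  · have hη := η.continuous
    have hη' := η'.continuous
    rw [Measure.prod_restrict, ← Measure.volume_eq_prod]
    exact ContinuousOn.integrableOn_compact
      ((isCompact_closedBall (0 : Sp d) 1).prod (isCompact_closedBall (0 : Sp d) 1))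
      (Continuous.continuousOn (by simp only [Function.uncurry_def]; fun_prop))

/-! ### Mollifiers with vanishing moments -/

/-- By homogeneity, rescaling by `l` multiplies moments of order `j` by `l^j`, so a linear
combination of rescalings can be chosen to annihilate prescribed moments. -/
lemma integral_comp_inv_smul_mul {g : Sp d → ℝ} {l : ℝ} (hl : 0 < l) {j : ℕ}
    (M : Sp d [×j]→L[ℝ] ℝ) :
    ∫ w, rescale g 0 l w * M (fun _ => w) = l ^ j * ∫ w, g w * M fun _ => w := by
  have h2 := Measure.integral_comp_smul (volume : Measure (Sp d))
    (fun w => rescale g 0 l w * M (fun _ => w)) l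
  have h3 : ∀ w, M (fun _ => l • w) = l ^ j * M fun _ => w := fun w => by
    have := M.map_smul_univ (fun _ => l) (fun _ => w)
    simpa using this
  simp only [rescale, sub_zero, smul_smul, inv_mul_cancel₀ hl.ne', one_smul,
    finrank_euclideanSpace_fin, h3] at h2
  have h4 : ∀ w, (l ^ d)⁻¹ * g w * (l ^ j * M fun _ => w) =
      (l ^ d)⁻¹ * l ^ j * (g w * M fun _ => w) := fun w => by ring
  simp only [h4, integral_const_mul, smul_eq_mul] at h2
  rw [abs_of_pos (by positivity), mul_assoc] at h2
  have h5 := mul_left_cancel₀ (inv_ne_zero (by positivity : l ^ d ≠ 0)) h2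
  simp only [rescale, sub_zero]
  exact h5.symm

/-- There are mollifiers with vanishing moments up to any given order. -/
lemma exists_mollifier (d p : ℕ) : ∃ θ : 𝓓(unitBall d, ℝ), ∫ w, θ w = 1 ∧
    ∀ j, 1 ≤ j → j ≤ p → ∀ M : Sp d [×j]→L[ℝ] ℝ, ∫ w, θ w * M (fun _ => w) = 0 := by
  classical
  let b : ContDiffBump (0 : Sp d) := ⟨1 / 4, 1 / 2, by norm_num, by norm_num⟩
  let φ : Sp d → ℝ := b.normed volume
  have hφs : Function.support φ ⊆ Metric.ball 0 (1 / 2) := (b.support_normed_eq).le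
  have hφc : ContDiff ℝ (⊤ : ℕ∞) φ := b.contDiff_normed
  have hφ1 : ∫ w, φ w = 1 := b.integral_normed
  let s := Finset.range (p + 1)
  let v : ℕ → ℝ := fun i => ((i : ℝ) + 1)⁻¹
  have hv0 : ∀ i, 0 < v i := fun i => by positivity
  have hv1 : ∀ i, v i ≤ 1 := fun i => inv_le_one_of_one_le₀ (by linarith [Nat.cast_nonneg (α := ℝ) i])
  have hinj : Set.InjOn v s := by
    intro i _ j _ hij
    have := inv_injective hij
    exact_mod_cast add_right_cancel this
  -- These weights evaluate interpolation polynomials at `0`. Interpolation at `p + 1` nodes is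
  -- exact on `X^j` for `j ≤ p`, so the weighted sum of the powers `v i ^ j` is `0 ^ j`: total mass
  -- one and vanishing moments.
  let c : ℕ → ℝ := fun i => (Lagrange.basis s v i).eval 0
  have hc : ∀ j ≤ p, ∑ i ∈ s, c i * v i ^ j = (0 : ℝ) ^ j := by
    intro j hj
    have h1 : (Polynomial.X ^ j : Polynomial ℝ) = Lagrange.interpolate s v fun i => v i ^ j := by
      refine Lagrange.eq_interpolate_of_eval_eq _ hinj ?_ fun i _ => by simp
      rw [Polynomial.degree_X_pow]
      simp only [s, Finset.card_range]
      exact_mod_cast Nat.lt_succ_of_le hj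
    have h2 := congrArg (Polynomial.eval 0) h1
    rw [Lagrange.interpolate_apply, Polynomial.eval_finsetSum] at h2
    simp only [Polynomial.eval_pow, Polynomial.eval_X, Polynomial.eval_mul,
      Polynomial.eval_C] at h2
    rw [h2]
    exact Finset.sum_congr rfl fun i _ => mul_comm _ _
  have hsupp : ∀ i, Function.support (rescale φ 0 (v i)) ⊆ Metric.closedBall 0 (1 / 2) := by
    intro i y hy
    have h1 : φ ((v i)⁻¹ • (y - 0)) ≠ 0 := right_ne_zero_of_mul hy
    have h2 := hφs h1
    rw [mem_ball_zero_iff, norm_smul, norm_inv, Real.norm_of_nonneg (hv0 i).le,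
      inv_mul_lt_iff₀ (hv0 i), sub_zero] at h2
    rw [mem_closedBall_zero_iff]
    nlinarith [hv1 i, hv0 i]
  have hsm : ∀ i, ContDiff ℝ (⊤ : ℕ∞) (rescale φ 0 (v i)) := fun i =>
    contDiff_const.mul (hφc.comp ((contDiff_id.sub contDiff_const).const_smul _))
  have hT : ∀ i ∈ s, IsTest (unitBall d) fun w => c i * rescale φ 0 (v i) w := fun i _ =>
    (IsTest.of_support_subset (hsm i) (isCompact_closedBall 0 (1 / 2))
      (Metric.closedBall_subset_ball (by norm_num)) (hsupp i)).smul (c i)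
  have hθ : ∀ j ≤ p, ∀ M : Sp d [×j]→L[ℝ] ℝ,
      ∫ w, toTest (unitBall d) (fun w => ∑ i ∈ s, c i * rescale φ 0 (v i) w) w *
        M (fun _ => w) = 0 ^ j * ∫ w, φ w * M fun _ => w := by
    intro j hj M
    have hM : Continuous fun w : Sp d => M fun _ => w := by
      exact M.cont.comp (continuous_pi fun _ => continuous_id)
    have hint : ∀ i ∈ s, Integrable fun w => c i * (rescale φ 0 (v i) w * M fun _ => w) := by
      intro i _
      refine Integrable.const_mul ?_ _
      refine Continuous.integrable_of_hasCompactSupport ((hsm i).continuous.mul hM) ?_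
      exact (HasCompactSupport.of_support_subset_isCompact (isCompact_closedBall 0 (1 / 2))
        (hsupp i)).mul_right
    simp only [toTest_apply (IsTest.sum s hT), Finset.sum_mul, mul_assoc]
    rw [integral_finsetSum _ hint]
    simp only [integral_const_mul, integral_comp_inv_smul_mul (hv0 _)]
    rw [← hc j hj, Finset.sum_mul]
    exact Finset.sum_congr rfl fun i _ => by ring
  refine ⟨toTest (unitBall d) fun w => ∑ i ∈ s, c i * rescale φ 0 (v i) w, ?_,
    fun j hj1 hj M => ?_⟩
  · have := hθ 0 (Nat.zero_le _) (ContinuousMultilinearMap.constOfIsEmpty ℝ _ 1)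
    simpa [hφ1] using this
  · rw [hθ j hj M, zero_pow (by omega), zero_mul]

/-! ### Approximation by mollifiers with vanishing moments -/

/-- `θ` has integral one and vanishing moments of the orders `1, ..., p`. -/
structure IsMoll (p : ℕ) (θ : 𝓓(unitBall d, ℝ)) : Prop where
  integral_eq : ∫ w, θ w = 1
  moments : ∀ j, 1 ≤ j → j ≤ p → ∀ M : Sp d [×j]→L[ℝ] ℝ, ∫ w, θ w * M (fun _ => w) = 0

lemma exists_isMoll (d p : ℕ) : ∃ θ : 𝓓(unitBall d, ℝ), IsMoll p θ :=
  let ⟨θ, h1, h2⟩ := exists_mollifier d p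
  ⟨θ, h1, h2⟩

/-- Insert the Taylor expansion of `g` at `y` of degree below `p`. The vanishing moments remove
every term except the value `g y`, and the remainder has size `|ε|^p`. The condition `1 ≤ p` ensures
that the constant term belongs to the expansion. -/
lemma abs_moll_sub_le {p : ℕ} (hp : 1 ≤ p) {θ : 𝓓(unitBall d, ℝ)} (hθ : IsMoll p θ) (ε : ℝ)
    {g : Sp d → ℝ} (hg : ContDiff ℝ p g) {A : ℝ} (hA : ∀ y, ‖iteratedFDeriv ℝ p g y‖ ≤ A)
    (y : Sp d) : |moll θ ε g y - g y| ≤ A * |ε| ^ p * l1 θ := by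
  have hA0 : 0 ≤ A := (norm_nonneg _).trans (hA y)
  let M : ∀ i : ℕ, Sp d [×i]→L[ℝ] ℝ := fun i =>
    ((i.factorial : ℝ)⁻¹ * (-ε) ^ i) • iteratedFDeriv ℝ i g y
  have hM : ∀ i w, M i (fun _ => w) =
      (i.factorial : ℝ)⁻¹ * iteratedFDeriv ℝ i g y fun _ => -(ε • w) := by
    intro i w
    have := (iteratedFDeriv ℝ i g y).map_smul_univ (fun _ => -ε) (fun _ => w)
    simp only [Finset.prod_const, Finset.card_univ, Fintype.card_fin, neg_smul, smul_eq_mul] at this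
    simp only [M, smul_apply, smul_eq_mul, this]
    ring
  have hcont : ∀ i, Continuous fun w : Sp d => θ w * M i fun _ => w := fun i =>
    θ.continuous.mul ((M i).cont.comp (continuous_pi fun _ => continuous_id))
  have hint : ∀ f : Sp d → ℝ, Continuous f →
      IntegrableOn f (Metric.closedBall (0 : Sp d) 1) := fun f hf =>
    hf.continuousOn.integrableOn_compact (isCompact_closedBall 0 1)
  have hsum : ∫ w in Metric.closedBall (0 : Sp d) 1, θ w * ∑ i ∈ Finset.range p, M i (fun _ => w) =
      g y := by
    simp only [Finset.mul_sum]
    rw [integral_finsetSum _ fun i _ => hint _ (hcont i), Finset.sum_eq_single_of_mem 0]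
    · rw [setIntegral_mul_unitBall θ fun w => M 0 fun _ => w]
      have : ∀ w : Sp d, M 0 (fun _ => w) = g y := fun w => by simp [M]
      simp only [this]
      rw [integral_mul_const, hθ.integral_eq, one_mul]
    · exact Finset.mem_range.2 hp
    · intro i hi hi0
      rw [setIntegral_mul_unitBall θ fun w => M i fun _ => w]
      exact hθ.moments i (Nat.one_le_iff_ne_zero.2 hi0) (Finset.mem_range.1 hi).le _
  have hgc : Continuous fun w : Sp d => θ w * g (y - ε • w) :=
    θ.continuous.mul (hg.continuous.comp (by fun_prop))
  have hsc : Continuous fun w : Sp d => θ w * ∑ i ∈ Finset.range p, M i fun _ => w := by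
    simp only [Finset.mul_sum]
    exact continuous_finsetSum _ fun i _ => hcont i
  have key : moll θ ε g y - g y = ∫ w in Metric.closedBall (0 : Sp d) 1,
      θ w • (g (y - ε • w) - ∑ i ∈ Finset.range p, M i fun _ => w) := by
    conv_lhs => rw [← hsum]
    rw [moll, ← integral_sub (hint _ hgc) (hint _ hsc)]
    simp only [smul_eq_mul, mul_sub]
  rw [key, ← Real.norm_eq_abs]
  refine norm_integral_smul_le θ fun w hw => ?_
  have := abs_sub_taylor_le (f := g) (x := y) (v := -(ε • w)) p (A := A)
    (fun t _ => hg.contDiffAt) (fun t _ => hA _)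
  simp only [hM]
  rw [Real.norm_eq_abs]
  refine (by simpa [sub_eq_add_neg] using this : _ ≤ A * ‖-(ε • w)‖ ^ p).trans ?_
  rw [norm_neg, norm_smul, Real.norm_eq_abs]
  gcongr
  exact mul_le_of_le_one_right (abs_nonneg _) hw

lemma abs_moll_le (η : 𝓓(unitBall d, ℝ)) (ε : ℝ) {g : Sp d → ℝ} {A : ℝ} (hA : ∀ y, |g y| ≤ A)
    (y : Sp d) : |moll η ε g y| ≤ A * l1 η :=
  norm_integral_smul_le η (h := fun w => g (y - ε • w)) fun w _ => hA (y - ε • w)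

/-- The twice mollified function is a smooth family in the scale on `[0, ε₀]`, with common compact
support and value `g` at scale `0`; a distribution is continuous along such a family. -/
lemma tendsto_apply_moll_moll {U : Opens (Sp d)} (G : 𝓓'(U, ℝ)) {θ : 𝓓(unitBall d, ℝ)}
    (hθ : ∫ w, θ w = 1) {g : Sp d → ℝ} (hg : ContDiff ℝ (⊤ : ℕ∞) g) {S : Set (Sp d)}
    (hS : IsCompact S) (hgS : Function.support g ⊆ S) {ε₀ : ℝ} (hε₀ : 0 < ε₀)
    (hU : Metric.cthickening (2 * ε₀) S ⊆ U) {e : ℕ → ℝ} (he : ∀ j, e j ∈ Icc 0 ε₀)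
    (he0 : Tendsto e atTop (𝓝 0)) :
    Tendsto (fun j => G (toTest U (moll θ (e j / 2) (moll θ (e j) g)))) atTop
      (𝓝 (G (toTest U g))) := by
  have h1 : SmoothFam ⊤ fun q : Icc (0 : ℝ) ε₀ => moll θ ((q : ℝ) / 2) (moll θ q g) :=
    (((SmoothFam.const (P := Unit) hg).moll θ).moll θ).comp
      (f := fun q : Icc (0 : ℝ) ε₀ => ((q : ℝ) / 2, ((q : ℝ), ()))) (by fun_prop)
  have h2 : ∀ q : Icc (0 : ℝ) ε₀, Function.support (moll θ ((q : ℝ) / 2) (moll θ q g)) ⊆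
      Metric.cthickening (2 * ε₀) S := by
    intro q
    have ha := support_moll_subset θ hgS (ε := q) (r := ε₀) (by rw [abs_of_nonneg q.2.1]; exact q.2.2)
    have hb := support_moll_subset θ ha (ε := (q : ℝ) / 2) (r := ε₀) (by
      rw [abs_of_nonneg (by linarith [q.2.1])]; linarith [q.2.1, q.2.2])
    refine hb.trans ?_
    rw [two_mul]
    exact Metric.cthickening_cthickening_subset hε₀.le hε₀.le S
  have h3 := continuous_apply_toTest G hS.cthickening hU h1 h2
  have h4 : Tendsto (fun j => (⟨e j, he j⟩ : Icc (0 : ℝ) ε₀)) atTop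
      (𝓝 ⟨0, left_mem_Icc.2 hε₀.le⟩) := tendsto_subtype_rng.2 he0
  have h5 := (h3.tendsto _).comp h4
  have h6 : moll θ ((0 : ℝ) / 2) (moll θ 0 g) = g := by
    ext y
    rw [zero_div, moll_zero, moll_zero, hθ, one_mul, one_mul]
  simp only [h6] at h5
  exact h5

/-- Bounds on the values of a distribution at rescalings of a mollifier with vanishing moments
give bounds on its values at all test functions. -/
lemma abs_apply_le_of_moll {U : Opens (Sp d)} (G : 𝓓'(U, ℝ)) {p : ℕ} (hp : 1 ≤ p)
    {θ : 𝓓(unitBall d, ℝ)} (hθ : IsMoll p θ) {a : ℝ} (ha : 0 < a + p) {S : Set (Sp d)}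
    (hS : IsCompact S) {ε₀ : ℝ} (hε₀ : 0 < ε₀) (hU : Metric.cthickening (2 * ε₀) S ⊆ U) {B : ℝ}
    (hB : ∀ z ∈ Metric.cthickening ε₀ S, ∀ l ∈ Ioc 0 ε₀,
      |G (toTest U (rescale θ z l))| ≤ B * l ^ a)
    {g : Sp d → ℝ} (hg : ContDiff ℝ (⊤ : ℕ∞) g) (hgS : Function.support g ⊆ S) {A₀ A₁ : ℝ}
    (hA₀ : ∀ y, |g y| ≤ A₀) (hA₁ : ∀ y, ‖iteratedFDeriv ℝ p g y‖ ≤ A₁) :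
    |G (toTest U g)| ≤ l1 θ * (2⁻¹ : ℝ) ^ a * (1 + 2 / (1 - (2⁻¹ : ℝ) ^ (a + p))) *
      (B * volume.real (Metric.cthickening ε₀ S) * (ε₀ ^ a * A₀ + ε₀ ^ (a + p) * A₁)) := by
  set Q := Metric.cthickening ε₀ S with hQdef
  have hQ : IsCompact Q := hS.cthickening
  have hA₀0 : 0 ≤ A₀ := (abs_nonneg _).trans (hA₀ 0)
  have hA₁0 : 0 ≤ A₁ := (norm_nonneg _).trans (hA₁ 0)
  have hl1 := l1_nonneg θ
  have hQU : ∀ l ∈ Ioc 0 ε₀, Metric.cthickening l Q ⊆ U := fun l hl => by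
    refine (Metric.cthickening_mono hl.2 Q).trans (Subset.trans ?_ hU)
    rw [two_mul]
    exact Metric.cthickening_cthickening_subset hε₀.le hε₀.le S
  -- The empty set is split off because `0 ≤ B` is obtained from the hypothesis at a point of `S`.
  by_cases hSe : S = ∅
  · have hg0 : toTest U g = 0 := by
      rw [← toTest_eq (U := U) (f := g) 0 fun y => ?_]
      have : g y = 0 := by
        by_contra h
        simpa [hSe] using hgS h
      rw [this]; rfl
    rw [hg0, map_zero, abs_zero, hQdef, hSe]
    simp
  obtain ⟨z₀, hz₀⟩ := nonempty_iff_ne_empty.2 hSe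
  have hB0 : 0 ≤ B := by
    have := (abs_nonneg _).trans (hB z₀ (Metric.self_subset_cthickening _ hz₀) ε₀ ⟨hε₀, le_rfl⟩)
    exact nonneg_of_mul_nonneg_left this (by positivity)
  -- the pairing of a mollified continuous function
  have hpair : ∀ l ∈ Ioc 0 ε₀, ∀ h : Sp d → ℝ, Continuous h → Function.support h ⊆ Q → ∀ A : ℝ,
      (∀ y, |h y| ≤ A) →
      |G (toTest U (moll θ l h))| ≤ A * (B * l ^ a) * volume.real Q := by
    intro l hl h hh hhs A hA
    rw [apply_moll G θ hl.1 hh hQ hhs (hQU l hl)]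
    rw [← Real.norm_eq_abs]
    refine norm_setIntegral_le_of_norm_le_const hQ.measure_lt_top fun z hz => ?_
    rw [norm_mul, Real.norm_eq_abs, Real.norm_eq_abs]
    exact mul_le_mul (hA z) (hB z hz l hl) (abs_nonneg _) ((abs_nonneg _).trans (hA z))
  have hgp : ContDiff ℝ p g := hg.of_le (by exact_mod_cast le_top)
  have hmc : ∀ ε, Continuous (moll θ ε g) := fun ε => (contDiff_moll θ ε hg).continuous
  have hms : ∀ ε ∈ Ioc 0 ε₀, Function.support (moll θ ε g) ⊆ Q := fun ε hε =>
    support_moll_subset θ hgS (by rw [abs_of_pos hε.1]; exact hε.2)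
  set e : ℕ → ℝ := fun j => ε₀ * 2⁻¹ ^ j with hedef
  have he : ∀ j, e j ∈ Ioc 0 ε₀ := fun j =>
    ⟨by positivity, mul_le_of_le_one_right hε₀.le (pow_le_one₀ (by norm_num) (by norm_num))⟩
  have he2 : ∀ j, e j / 2 ∈ Ioc 0 ε₀ := fun j => ⟨half_pos (he j).1, by
    linarith [(he j).1, (he j).2]⟩
  have he4 : ∀ j, e j / 2 / 2 ∈ Ioc 0 ε₀ := fun j => ⟨half_pos (he2 j).1, by
    linarith [(he2 j).1, (he2 j).2]⟩
  have hes : ∀ j, e (j + 1) = e j / 2 := fun j => by simp only [hedef, pow_succ]; ring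
  have hlim := tendsto_apply_moll_moll G hθ.integral_eq hg hS hgS hε₀ hU
    (fun j => ⟨(he j).1.le, (he j).2⟩) (by
      have := (tendsto_pow_atTop_nhds_zero_of_lt_one (r := (2⁻¹ : ℝ)) (by norm_num)
        (by norm_num)).const_mul ε₀
      rwa [mul_zero] at this)
  set T : ℕ → ℝ := fun j => G (toTest U (moll θ (e j / 2) (moll θ (e j) g))) with hT
  set r : ℝ := (2⁻¹ : ℝ) ^ (a + p) with hr
  have hr1 : r < 1 := Real.rpow_lt_one (by norm_num) (by norm_num) ha
  set C₁ : ℝ := 2 * A₁ * l1 θ * (B * (2⁻¹ : ℝ) ^ a) * volume.real Q * ε₀ ^ (a + p) with hC₁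
  -- After commuting mollifications, both terms are paired at the outer scale `e j / 2`. The inner
  -- functions differ by `O((e j)^p)` by the vanishing moments, and the pairing contributes `(e j /
  -- 2)^a`, hence the ratio `2^{-(a+p)} < 1`.
  have hdist : ∀ j, dist (T j) (T (j + 1)) ≤ C₁ * r ^ j := by
    intro j
    have e1 : T (j + 1) = G (toTest U (moll θ (e j / 2) (moll θ (e j / 2 / 2) g))) := by
      simp only [hT, hes, moll_comm θ θ (e j / 2) (e j / 2 / 2) hg.continuous]
    have hI : ∀ ε ∈ Ioc 0 ε₀, IsTest U (moll θ (e j / 2) (moll θ ε g)) := fun ε hε =>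
      isTest_moll θ (he2 j).1 (hmc _) hQ (hms ε hε) (hQU _ (he2 j))
    have e2 : T (j + 1) - T j = G (toTest U (moll θ (e j / 2)
        fun y => moll θ (e j / 2 / 2) g y - moll θ (e j) g y)) := by
      rw [e1, hT, ← map_sub, ← toTest_sub (hI _ (he4 j)) (hI _ (he j))]
      congr 2
      ext y
      simp only [moll]
      rw [← integral_sub]
      · simp only [mul_sub]
      all_goals
        refine ContinuousOn.integrableOn_compact (isCompact_closedBall 0 1)
          (Continuous.continuousOn ?_)
        exact θ.continuous.mul ((hmc _).comp (by fun_prop))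
    rw [dist_comm, Real.dist_eq, e2]
    have h4 : ∀ y, |moll θ (e j / 2 / 2) g y - moll θ (e j) g y| ≤ 2 * A₁ * (e j) ^ p * l1 θ := by
      intro y
      have ha1 := abs_moll_sub_le hp hθ (e j / 2 / 2) hgp hA₁ y
      have hb1 := abs_moll_sub_le hp hθ (e j) hgp hA₁ y
      rw [abs_of_pos (he j).1] at hb1
      rw [abs_of_pos (he4 j).1] at ha1
      have hc1 : A₁ * (e j / 2 / 2) ^ p * l1 θ ≤ A₁ * e j ^ p * l1 θ := by
        have := he4 j
        gcongr
        linarith [(he j).1]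
      have := abs_sub_le (moll θ (e j / 2 / 2) g y) (g y) (moll θ (e j) g y)
      rw [abs_sub_comm (g y)] at this
      linarith
    refine (hpair _ (he2 j) _ ((hmc _).sub (hmc _)) ?_ _ h4).trans (le_of_eq ?_)
    · intro y hy
      by_contra hyQ
      apply hy
      have h1 : moll θ (e j / 2 / 2) g y = 0 := by
        by_contra h; exact hyQ (hms _ (he4 j) h)
      have h2 : moll θ (e j) g y = 0 := by
        by_contra h; exact hyQ (hms _ (he j) h)
      exact sub_eq_zero.2 (h1.trans h2.symm)
    · have h5 : (e j) ^ p * (e j / 2) ^ a = (2⁻¹ : ℝ) ^ a * (ε₀ ^ (a + p) * r ^ j) := by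
        rw [div_eq_mul_inv, Real.mul_rpow (he j).1.le (by norm_num), ← Real.rpow_natCast (e j) p,
          mul_comm (e j ^ a), mul_left_comm, ← Real.rpow_add (he j).1, add_comm (p : ℝ) a, hedef, hr,
          Real.mul_rpow hε₀.le (by positivity), ← Real.rpow_natCast (2⁻¹ : ℝ) j, ← Real.rpow_mul
          (by norm_num), mul_comm (j : ℝ), Real.rpow_mul (by norm_num), Real.rpow_natCast]
      calc 2 * A₁ * e j ^ p * l1 θ * (B * (e j / 2) ^ a) * volume.real Q
          = 2 * A₁ * l1 θ * B * volume.real Q * (e j ^ p * (e j / 2) ^ a) := by ring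
        _ = _ := by rw [h5, hC₁]; ring
  have h0 := dist_le_of_le_geometric_of_tendsto₀ r C₁ hr1 hdist hlim
  have h1 : |T 0| ≤ A₀ * l1 θ * (B * (2⁻¹ : ℝ) ^ a * ε₀ ^ a) * volume.real Q := by
    have := hpair _ (he2 0) _ (hmc (e 0)) (hms _ (he 0)) _ (abs_moll_le θ (e 0) hA₀)
    refine this.trans (le_of_eq ?_)
    have e0 : e 0 = ε₀ := by simp [hedef]
    rw [e0, div_eq_mul_inv, Real.mul_rpow hε₀.le (by norm_num)]
    ring
  have h2 : |G (toTest U g)| ≤ |T 0| + C₁ / (1 - r) := by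
    rw [Real.dist_eq, abs_sub_comm] at h0
    linarith [abs_sub_abs_le_abs_sub (G (toTest U g)) (T 0)]
  refine h2.trans ((add_le_add h1 le_rfl).trans ?_)
  have hv : 0 ≤ volume.real Q := measureReal_nonneg
  have h1r : 0 ≤ 2 / (1 - r) := div_nonneg (by norm_num) (by linarith)
  have h3 : 0 ≤ l1 θ * (2⁻¹ : ℝ) ^ a * (B * volume.real Q * (ε₀ ^ (a + p) * A₁)) := by positivity
  have h4 : 0 ≤ l1 θ * (2⁻¹ : ℝ) ^ a * (2 / (1 - r)) * (B * volume.real Q * (ε₀ ^ a * A₀)) := by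
    positivity
  have h5 : C₁ / (1 - r) = l1 θ * (2⁻¹ : ℝ) ^ a * (2 / (1 - r)) *
      (B * volume.real Q * (ε₀ ^ (a + p) * A₁)) := by
    rw [hC₁]; ring
  rw [h5]
  nlinarith [h3, h4]

/-! ### The pairing of distributions of finite order with functions of finite regularity -/

lemma support_iteratedFDeriv_subset_of_isClosed {f : Sp d → ℝ} {Q : Set (Sp d)} (hQ : IsClosed Q)
    (hf : Function.support f ⊆ Q) (j : ℕ) {y : Sp d} (hy : y ∉ Q) : iteratedFDeriv ℝ j f y = 0 := by
  by_contra h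
  exact hy ((closure_minimal hf hQ) (support_iteratedFDeriv_subset (𝕜 := ℝ) j h))

/-- Uniform continuity of the derivatives of a smooth family with common compact support. -/
lemma SmoothFam.eventually_norm_sub_le {P : Type*} [TopologicalSpace P] {n : ℕ∞}
    {H : P → Sp d → ℝ} (hH : SmoothFam n H) {Q : Set (Sp d)} (hQ : IsCompact Q) {p₀ : P}
    (hs : ∀ᶠ p in 𝓝 p₀, Function.support (H p) ⊆ Q) {j : ℕ} (hj : (j : ℕ∞) ≤ n) {δ : ℝ}
    (hδ : 0 < δ) :
    ∀ᶠ p in 𝓝 p₀, ∀ y, ‖iteratedFDeriv ℝ j (fun y => H p y - H p₀ y) y‖ ≤ δ := by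
  have hsub : ∀ p y, iteratedFDeriv ℝ j (fun y => H p y - H p₀ y) y =
      iteratedFDeriv ℝ j (H p) y - iteratedFDeriv ℝ j (H p₀) y := fun p y => by
    have h1 : ContDiff ℝ j (H p) := (hH.1 p).of_le (by exact_mod_cast hj)
    have h2 : ContDiff ℝ j (H p₀) := (hH.1 p₀).of_le (by exact_mod_cast hj)
    exact iteratedFDeriv_sub_apply h1.contDiffAt h2.contDiffAt
  simp only [hsub]
  have h1 : ∀ᶠ p in 𝓝 p₀, ∀ y ∈ Q,
      ‖iteratedFDeriv ℝ j (H p) y - iteratedFDeriv ℝ j (H p₀) y‖ ≤ δ := by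
    refine hQ.eventually_forall_of_forall_eventually fun y _ => ?_
    have hc : Continuous fun q : P × Sp d =>
        ‖iteratedFDeriv ℝ j (H q.1) q.2 - iteratedFDeriv ℝ j (H p₀) q.2‖ :=
      ((hH.2 j hj).sub ((hH.2 j hj).comp (continuous_const.prodMk continuous_snd))).norm
    have := hc.tendsto (p₀, y)
    simp only [sub_self, norm_zero] at this
    exact this.eventually (ge_mem_nhds hδ)
  filter_upwards [h1, hs] with p hp hps y
  by_cases hy : y ∈ Q
  · exact hp y hy
  · rw [support_iteratedFDeriv_subset_of_isClosed hQ.isClosed hps j hy,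
      support_iteratedFDeriv_subset_of_isClosed hQ.isClosed hs.self_of_nhds j hy]
    simpa using hδ.le

lemma exists_stdMoll (d : ℕ) : ∃ η : 𝓓(unitBall d, ℝ), ∫ w, η w = 1 ∧ l1 η = 1 := by
  let b : ContDiffBump (0 : Sp d) := ⟨1 / 4, 1 / 2, by norm_num, by norm_num⟩
  have hs : Function.support (b.normed volume) ⊆ Metric.closedBall 0 (1 / 2) :=
    (b.support_normed_eq).le.trans Metric.ball_subset_closedBall
  have hT : IsTest (unitBall d) (b.normed volume) :=
    IsTest.of_support_subset b.contDiff_normed (isCompact_closedBall 0 (1 / 2))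
      (Metric.closedBall_subset_ball (by norm_num)) hs
  have h1 : ∫ w, toTest (unitBall d) (b.normed volume) w = 1 := by
    simp only [toTest_apply hT]
    exact b.integral_normed
  refine ⟨_, h1, ?_⟩
  have h2 := setIntegral_mul_unitBall (toTest (unitBall d) (b.normed volume)) fun _ => 1
  simp only [mul_one, h1] at h2
  refine Eq.trans (integral_congr_ae (Eventually.of_forall fun w => ?_)) h2
  simp only [toTest_apply hT]
  exact abs_of_nonneg (b.nonneg_normed w)

/-- A fixed nonnegative mollifier. -/
def stdMoll (d : ℕ) : 𝓓(unitBall d, ℝ) := (exists_stdMoll d).choose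

lemma integral_stdMoll (d : ℕ) : ∫ w, stdMoll d w = 1 := (exists_stdMoll d).choose_spec.1

lemma l1_stdMoll (d : ℕ) : l1 (stdMoll d) = 1 := (exists_stdMoll d).choose_spec.2

/-- The extended pairing. -/
def pair {U : Opens (Sp d)} (G : 𝓓'(U, ℝ)) (g : Sp d → ℝ) : ℝ :=
  limUnder (𝓝[>] (0 : ℝ)) fun ε => G (toTest U (moll (stdMoll d) ε g))

/-- For small scales the support of the mollified function stays inside `U`, so the test function
demanded by `HasPairing` exists and is `toTest U (moll η ε g)`; only a one-sided limit remains. -/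
lemma hasPairing_iff {U : Opens (Sp d)} {G : 𝓓'(U, ℝ)} {g : Sp d → ℝ} {c : ℝ}
    (hg : Continuous g) {S : Set (Sp d)} (hS : IsCompact S) (hgS : Function.support g ⊆ S)
    (hSU : S ⊆ U) : HasPairing G g c ↔ ∀ η : 𝓓(unitBall d, ℝ), ∫ y, η y = 1 →
      Tendsto (fun ε => G (toTest U (moll η ε g))) (𝓝[>] (0 : ℝ)) (𝓝 c) := by
  obtain ⟨r, hr, hrU⟩ := hS.exists_cthickening_subset_open U.isOpen hSU
  have htest : ∀ η : 𝓓(unitBall d, ℝ), ∀ ε ∈ Ioc 0 r, IsTest U (moll η ε g) := fun η ε hε =>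
    isTest_moll η hε.1 hg hS hgS ((Metric.cthickening_mono hε.2 S).trans hrU)
  refine forall₂_congr fun η hη => ?_
  rw [Metric.tendsto_nhdsWithin_nhds]
  refine ⟨fun h δ hδ => ?_, fun h δ hδ => ?_⟩
  · obtain ⟨ε₀, h0, h⟩ := h δ hδ
    refine ⟨ε₀, h0, fun {ε} hε hε' => ?_⟩
    have hε1 : 0 < ε := hε
    obtain ⟨χ, h1, h2⟩ := h ε ⟨hε, by
      rwa [Real.dist_eq, sub_zero, abs_of_pos hε1] at hε'⟩
    rwa [Real.dist_eq, toTest_eq χ fun y => (h1 y).trans (moll_eq_conv η hε g y).symm]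
  · obtain ⟨ε₀, h0, h⟩ := h δ hδ
    refine ⟨min ε₀ r, lt_min h0 hr, fun ε hε => ⟨toTest U (moll η ε g), fun y => ?_, ?_⟩⟩
    · rw [toTest_apply (htest η ε ⟨hε.1, (hε.2.trans_le (min_le_right _ _)).le⟩),
        moll_eq_conv η hε.1]
    · have := h (x := ε) hε.1 (by
        rw [Real.dist_eq, sub_zero, abs_of_pos hε.1]; exact hε.2.trans_le (min_le_left _ _))
      rwa [Real.dist_eq] at this

lemma HasPairing.unique {U : Opens (Sp d)} {G : 𝓓'(U, ℝ)} {g : Sp d → ℝ} {c c' : ℝ}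
    (h : HasPairing G g c) (h' : HasPairing G g c') : c = c' := by
  by_contra hne
  have hδ : 0 < |c - c'| / 2 := half_pos (abs_pos.2 (sub_ne_zero.2 hne))
  obtain ⟨ε₁, h1, H1⟩ := h (stdMoll d) (integral_stdMoll d) _ hδ
  obtain ⟨ε₂, h2, H2⟩ := h' (stdMoll d) (integral_stdMoll d) _ hδ
  have hm : 0 < min ε₁ ε₂ := lt_min h1 h2
  obtain ⟨χ, a1, a2⟩ := H1 (min ε₁ ε₂ / 2) ⟨half_pos hm, by
    linarith [half_lt_self hm, min_le_left ε₁ ε₂]⟩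
  obtain ⟨χ', b1, b2⟩ := H2 (min ε₁ ε₂ / 2) ⟨half_pos hm, by
    linarith [half_lt_self hm, min_le_right ε₁ ε₂]⟩
  have : χ = χ' := by ext y; rw [a1, b1]
  subst this
  have := abs_sub_le c (G χ) c'
  rw [abs_sub_comm c (G χ)] at this
  linarith

lemma HasPairing.add {U : Opens (Sp d)} {G G' : 𝓓'(U, ℝ)} {g : Sp d → ℝ} {c c' : ℝ}
    (h : HasPairing G g c) (h' : HasPairing G' g c') : HasPairing (G + G') g (c + c') := by
  intro η hη δ hδ
  obtain ⟨ε₁, h1, H1⟩ := h η hη _ (half_pos hδ)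
  obtain ⟨ε₂, h2, H2⟩ := h' η hη _ (half_pos hδ)
  refine ⟨min ε₁ ε₂, lt_min h1 h2, fun ε hε => ?_⟩
  obtain ⟨χ, a1, a2⟩ := H1 ε ⟨hε.1, hε.2.trans_le (min_le_left _ _)⟩
  obtain ⟨χ', b1, b2⟩ := H2 ε ⟨hε.1, hε.2.trans_le (min_le_right _ _)⟩
  have : χ = χ' := by ext y; rw [a1, b1]
  subst this
  refine ⟨χ, a1, ?_⟩
  have e : (G + G') χ - (c + c') = (G χ - c) + (G' χ - c') := by
    have : (G + G') χ = G χ + G' χ := rfl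
    rw [this]; ring
  rw [e]
  linarith [abs_add_le (G χ - c) (G' χ - c')]

lemma HasPairing.smul {U : Opens (Sp d)} {G : 𝓓'(U, ℝ)} {g : Sp d → ℝ} {c : ℝ}
    (h : HasPairing G g c) (a : ℝ) : HasPairing (a • G) g (a * c) := by
  intro η hη δ hδ
  obtain ⟨ε₁, h1, H1⟩ := h η hη (δ / (|a| + 1)) (by positivity)
  refine ⟨ε₁, h1, fun ε hε => ?_⟩
  obtain ⟨χ, a1, a2⟩ := H1 ε hε
  refine ⟨χ, a1, ?_⟩
  have e : (a • G) χ - a * c = a * (G χ - c) := by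
    have : (a • G) χ = a * G χ := rfl
    rw [this]; ring
  rw [e, abs_mul]
  rw [lt_div_iff₀ (by positivity)] at a2
  nlinarith [abs_nonneg (G χ - c), abs_nonneg a]

/-- The distribution `G` has order at most `p` for test functions supported in `Q`. -/
def FinOrder {U : Opens (Sp d)} (G : 𝓓'(U, ℝ)) (p : ℕ) (Q : Set (Sp d)) : Prop :=
  ∃ C : ℝ, ∀ g, IsTest U g → Function.support g ⊆ Q → ∀ A, (∀ y, |g y| ≤ A) →
    (∀ y, ‖iteratedFDeriv ℝ p g y‖ ≤ A) → |G (toTest U g)| ≤ C * A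

lemma FinOrder.sub {U : Opens (Sp d)} {G G' : 𝓓'(U, ℝ)} {p : ℕ} {Q : Set (Sp d)}
    (h : FinOrder G p Q) (h' : FinOrder G' p Q) : FinOrder (G - G') p Q := by
  obtain ⟨C, hC⟩ := h
  obtain ⟨C', hC'⟩ := h'
  refine ⟨C + C', fun g hg hgQ A h1 h2 => ?_⟩
  have e : (G - G') (toTest U g) = G (toTest U g) - G' (toTest U g) := rfl
  rw [e, add_mul]
  exact (abs_sub _ _).trans (add_le_add (hC g hg hgQ A h1 h2) (hC' g hg hgQ A h1 h2))

/-- The functions of class `C^p` with compact support well inside `Q`. -/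
structure IsCp (p : ℕ) (Q : Set (Sp d)) (g : Sp d → ℝ) : Prop where
  contDiff : ContDiff ℝ p g
  supp : ∃ S, IsCompact S ∧ Function.support g ⊆ S ∧ ∃ r > 0, Metric.cthickening r S ⊆ Q

lemma IsCp.of_support {p : ℕ} {Q S : Set (Sp d)} {g : Sp d → ℝ} (hg : ContDiff ℝ p g)
    (hS : IsCompact S) (hs : Function.support g ⊆ S) {r : ℝ} (hr : 0 < r)
    (h : Metric.cthickening r S ⊆ Q) : IsCp p Q g := ⟨hg, S, hS, hs, r, hr, h⟩

lemma IsCp.smul {p : ℕ} {Q : Set (Sp d)} {g : Sp d → ℝ} (hg : IsCp p Q g) (c : ℝ) :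
    IsCp p Q fun y => c * g y := by
  obtain ⟨h, S, hS, hgS, r, hr, hrQ⟩ := hg
  exact ⟨contDiff_const.mul h, S, hS, fun y hy => hgS (right_ne_zero_of_mul hy), r, hr, hrQ⟩

lemma cthickening_union_subset {S T Q : Set (Sp d)} (hS : IsCompact S) (hT : IsCompact T) {r t : ℝ}
    (hr : 0 < r) (ht : 0 < t) (h : Metric.cthickening r S ⊆ Q) (h' : Metric.cthickening t T ⊆ Q) :
    Metric.cthickening (min r t) (S ∪ T) ⊆ Q := by
  refine cthickening_subset_of_closedBall (hS.union hT) (lt_min hr ht).le ?_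
  rintro x (hx | hx)
  · exact (Metric.closedBall_subset_closedBall (min_le_left _ _)).trans
      ((closedBall_subset_cthickening' hx r).trans h)
  · exact (Metric.closedBall_subset_closedBall (min_le_right _ _)).trans
      ((closedBall_subset_cthickening' hx t).trans h')

lemma IsCp.add {p : ℕ} {Q : Set (Sp d)} {f g : Sp d → ℝ} (hf : IsCp p Q f) (hg : IsCp p Q g) :
    IsCp p Q fun y => f y + g y := by
  obtain ⟨h, S, hS, hgS, r, hr, hrQ⟩ := hf
  obtain ⟨h', T, hT, hgT, t, ht, htQ⟩ := hg
  refine ⟨h.add h', S ∪ T, hS.union hT, fun y hy => ?_, min r t, lt_min hr ht,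
    cthickening_union_subset hS hT hr ht hrQ htQ⟩
  by_contra hy'
  rw [mem_union, not_or] at hy'
  have h1 : f y = 0 := by by_contra h; exact hy'.1 (hgS h)
  have h2 : g y = 0 := by by_contra h; exact hy'.2 (hgT h)
  exact hy (by simp only [h1, h2, add_zero])

lemma IsCp.zero {p : ℕ} {Q : Set (Sp d)} : IsCp p Q fun _ : Sp d => (0 : ℝ) :=
  ⟨contDiff_const, ∅, isCompact_empty, by simp, 1, one_pos, by simp⟩

lemma IsCp.sum {p : ℕ} {Q : Set (Sp d)} {ι : Type*} (s : Finset ι) {f : ι → Sp d → ℝ}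
    (hf : ∀ i ∈ s, IsCp p Q (f i)) : IsCp p Q fun y => ∑ i ∈ s, f i y := by
  classical
  induction s using Finset.induction_on with
  | empty => simpa using IsCp.zero
  | insert i s hi ih =>
    simp only [Finset.sum_insert hi]
    exact (hf i (Finset.mem_insert_self i s)).add
      (ih fun j hj => hf j (Finset.mem_insert_of_mem hj))

lemma isTest_moll_sub {U : Opens (Sp d)} {S : Set (Sp d)} (hS : IsCompact S) {r : ℝ}
    (hSU : Metric.cthickening r S ⊆ U) {g : Sp d → ℝ} (hg : Continuous g)
    (hgS : Function.support g ⊆ S) (η : 𝓓(unitBall d, ℝ)) {ε : ℝ} (hε : ε ∈ Ioc 0 r) :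
    IsTest U (moll η ε g) ∧ Function.support (moll η ε g) ⊆ Metric.cthickening r S :=
  ⟨isTest_moll η hε.1 hg hS hgS ((Metric.cthickening_mono hε.2 S).trans hSU),
    support_moll_subset η hgS (by rw [abs_of_pos hε.1]; exact hε.2)⟩

lemma eventually_norm_moll_sub_le {p : ℕ} {S : Set (Sp d)} (hS : IsCompact S) {g : Sp d → ℝ}
    (hg : ContDiff ℝ p g) (hgS : Function.support g ⊆ S) {η : 𝓓(unitBall d, ℝ)}
    (hη : ∫ w, η w = 1) {j : ℕ} (hj : j ≤ p) {δ : ℝ} (hδ : 0 < δ) :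
    ∀ᶠ ε in 𝓝 (0 : ℝ), ∀ y, ‖iteratedFDeriv ℝ j (fun y => moll η ε g y - g y) y‖ ≤ δ := by
  have hg' : ContDiff ℝ ((p : ℕ∞) : WithTop ℕ∞) g := hg
  have h1 : SmoothFam p fun ε : ℝ => moll η ε g :=
    ((SmoothFam.const (P := Unit) hg').moll η).comp (f := fun ε : ℝ => (ε, ())) (by fun_prop)
  have h2 : ∀ᶠ ε in 𝓝 (0 : ℝ), Function.support (moll η ε g) ⊆ Metric.cthickening 1 S := by
    filter_upwards [Metric.closedBall_mem_nhds (0 : ℝ) one_pos] with ε hε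
    exact support_moll_subset η hgS (by simpa using hε)
  have h3 := h1.eventually_norm_sub_le hS.cthickening h2 (j := j) (by exact_mod_cast hj) hδ
  have h4 : moll η 0 g = g := by ext y; rw [moll_zero, hη, one_mul]
  rwa [h4] at h3

lemma abs_sub_iteratedFDeriv_le {j : ℕ} {f g h : Sp d → ℝ} (hf : ContDiff ℝ j f)
    (hg : ContDiff ℝ j g) (hh : ContDiff ℝ j h) {a b : ℝ}
    (h1 : ∀ y, ‖iteratedFDeriv ℝ j (fun y => f y - h y) y‖ ≤ a)
    (h2 : ∀ y, ‖iteratedFDeriv ℝ j (fun y => g y - h y) y‖ ≤ b) (y : Sp d) :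
    ‖iteratedFDeriv ℝ j (fun y => f y - g y) y‖ ≤ a + b := by
  have e : (fun y => f y - g y) = (fun y => f y - h y) - fun y => g y - h y := by
    ext y; simp
  rw [e, iteratedFDeriv_sub_apply (hf.sub hh).contDiffAt (hg.sub hh).contDiffAt]
  exact (norm_sub_le _ _).trans (add_le_add (h1 y) (h2 y))

/-- Mollifications of a `C^p` function converge to it in `C^p`, whichever mollifiers are used, and
finite order turns closeness of the functions and of their `p`-th derivatives into closeness of the
values. Allowing two mollifiers and two independent scales gives the Cauchy criterion and
independence of the mollifier at once. -/
lemma FinOrder.eventually_abs_sub_le {U : Opens (Sp d)} {G : 𝓓'(U, ℝ)} {p : ℕ} {Q : Set (Sp d)}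
    (hG : FinOrder G p Q) (hQ : Q ⊆ U) {g : Sp d → ℝ} (hg : IsCp p Q g)
    {η η' : 𝓓(unitBall d, ℝ)} (hη : ∫ w, η w = 1) (hη' : ∫ w, η' w = 1) {δ : ℝ} (hδ : 0 < δ) :
    ∀ᶠ q in 𝓝[>] (0 : ℝ) ×ˢ 𝓝[>] (0 : ℝ),
      |G (toTest U (moll η q.1 g)) - G (toTest U (moll η' q.2 g))| ≤ δ := by
  obtain ⟨C, hC⟩ := hG
  obtain ⟨hgc, S, hS, hgS, r, hr, hrQ⟩ := hg
  set δ' := δ / (2 * (|C| + 1)) with hδ'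
  have hδ'0 : 0 < δ' := by positivity
  have key : ∀ η : 𝓓(unitBall d, ℝ), ∫ w, η w = 1 → ∀ᶠ ε in 𝓝[>] (0 : ℝ), ε ∈ Ioc 0 r ∧
      (∀ y, ‖iteratedFDeriv ℝ 0 (fun y => moll η ε g y - g y) y‖ ≤ δ') ∧
      ∀ y, ‖iteratedFDeriv ℝ p (fun y => moll η ε g y - g y) y‖ ≤ δ' := fun η hη => by
    have h1 := eventually_norm_moll_sub_le hS hgc hgS hη (Nat.zero_le p) hδ'0
    have h2 := eventually_norm_moll_sub_le hS hgc hgS hη le_rfl hδ'0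
    have h3 : ∀ᶠ ε in 𝓝[>] (0 : ℝ), ε ∈ Ioc 0 r := Ioc_mem_nhdsGT hr
    filter_upwards [h1.filter_mono nhdsWithin_le_nhds, h2.filter_mono nhdsWithin_le_nhds, h3]
      with ε a b c using ⟨c, a, b⟩
  refine ((key η hη).prod_mk (key η' hη')).mono ?_
  rintro ⟨ε, ε'⟩ ⟨⟨he, h0, hp⟩, he', h0', hp'⟩
  obtain ⟨t1, s1⟩ := isTest_moll_sub hS (hrQ.trans hQ) hgc.continuous hgS η he
  obtain ⟨t2, s2⟩ := isTest_moll_sub hS (hrQ.trans hQ) hgc.continuous hgS η' he'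
  have c1 := contDiff_moll η ε (n := p) hgc
  have c2 := contDiff_moll η' ε' (n := p) hgc
  have hgc' : ContDiff ℝ ((0 : ℕ) : WithTop ℕ∞) g := hgc.of_le (by exact_mod_cast Nat.zero_le p)
  rw [← map_sub, ← toTest_sub t1 t2]
  refine (hC _ (t1.sub t2) ?_ (δ' + δ') ?_ ?_).trans ?_
  · intro y hy
    by_contra hyQ
    have h1 : moll η ε g y = 0 := by by_contra h; exact hyQ (hrQ (s1 h))
    have h2 : moll η' ε' g y = 0 := by by_contra h; exact hyQ (hrQ (s2 h))
    exact hy (by simp only [h1, h2, sub_zero])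
  · intro y
    have := abs_sub_iteratedFDeriv_le (c1.of_le (by exact_mod_cast Nat.zero_le p))
      (c2.of_le (by exact_mod_cast Nat.zero_le p)) hgc' h0 h0' y
    rwa [norm_iteratedFDeriv_zero, Real.norm_eq_abs] at this
  · exact abs_sub_iteratedFDeriv_le c1 c2 hgc hp hp'
  · rw [hδ', ← add_div, div_mul_eq_div_div, ← mul_div_assoc]
    rw [div_le_iff₀ (by positivity)]
    nlinarith [le_abs_self C, abs_nonneg C]

/-- For the fixed mollifier the limit exists by completeness; comparing any other mollifier with it
at equal scales shows that the limit is the same. -/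
lemma FinOrder.tendsto_pair {U : Opens (Sp d)} {G : 𝓓'(U, ℝ)} {p : ℕ} {Q : Set (Sp d)}
    (hG : FinOrder G p Q) (hQ : Q ⊆ U) {g : Sp d → ℝ} (hg : IsCp p Q g)
    {η : 𝓓(unitBall d, ℝ)} (hη : ∫ w, η w = 1) :
    Tendsto (fun ε => G (toTest U (moll η ε g))) (𝓝[>] (0 : ℝ)) (𝓝 (pair G g)) := by
  have h1 : ∃ c, Tendsto (fun ε => G (toTest U (moll (stdMoll d) ε g))) (𝓝[>] (0 : ℝ)) (𝓝 c) := by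
    rw [← cauchy_map_iff_exists_tendsto, cauchy_map_iff]
    refine ⟨inferInstance, ?_⟩
    rw [Metric.uniformity_basis_dist_le.tendsto_right_iff]
    intro δ hδ
    exact hG.eventually_abs_sub_le hQ hg (integral_stdMoll d) (integral_stdMoll d) hδ
  have h2 := h1.choose_spec
  have h3 : pair G g = h1.choose := h2.limUnder_eq
  rw [h3]
  refine (tendsto_iff_of_dist ?_).2 h2
  rw [Metric.tendsto_nhds]
  intro δ hδ
  have h4 := (hG.eventually_abs_sub_le hQ hg hη (integral_stdMoll d) (half_pos hδ))
  have h5 : Tendsto (fun ε : ℝ => (ε, ε)) (𝓝[>] 0) (𝓝[>] 0 ×ˢ 𝓝[>] 0) := tendsto_id.prodMk tendsto_id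
  filter_upwards [h5.eventually h4] with ε hε
  rw [dist_zero_right, Real.norm_eq_abs, abs_of_nonneg dist_nonneg, Real.dist_eq]
  exact hε.trans_lt (half_lt_self hδ)

lemma IsCp.exists_compact {p : ℕ} {Q : Set (Sp d)} {g : Sp d → ℝ} (hg : IsCp p Q g) :
    ∃ S, IsCompact S ∧ Function.support g ⊆ S ∧ S ⊆ Q :=
  let ⟨_, S, hS, hgS, _, _, hrQ⟩ := hg
  ⟨S, hS, hgS, (Metric.self_subset_cthickening S).trans hrQ⟩

lemma FinOrder.hasPairing {U : Opens (Sp d)} {G : 𝓓'(U, ℝ)} {p : ℕ} {Q : Set (Sp d)}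
    (hG : FinOrder G p Q) (hQ : Q ⊆ U) {g : Sp d → ℝ} (hg : IsCp p Q g) :
    HasPairing G g (pair G g) := by
  obtain ⟨S, hS, hgS, hSQ⟩ := hg.exists_compact
  rw [hasPairing_iff hg.contDiff.continuous hS hgS (hSQ.trans hQ)]
  exact fun η hη => hG.tendsto_pair hQ hg hη

lemma FinOrder.eventually_isTest {U : Opens (Sp d)} {p : ℕ} {Q : Set (Sp d)} (hQ : Q ⊆ U)
    {g : Sp d → ℝ} (hg : IsCp p Q g) (η : 𝓓(unitBall d, ℝ)) :
    ∀ᶠ ε in 𝓝[>] (0 : ℝ), IsTest U (moll η ε g) ∧ Function.support (moll η ε g) ⊆ Q := by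
  obtain ⟨hgc, S, hS, hgS, r, hr, hrQ⟩ := hg
  filter_upwards [Ioc_mem_nhdsGT hr] with ε hε
  have := isTest_moll_sub hS (hrQ.trans hQ) hgc.continuous hgS η hε
  exact ⟨this.1, this.2.trans hrQ⟩

lemma moll_add (η : 𝓓(unitBall d, ℝ)) (ε : ℝ) {f g : Sp d → ℝ} (hf : Continuous f)
    (hg : Continuous g) : moll η ε (fun y => f y + g y) = fun y => moll η ε f y + moll η ε g y := by
  ext y
  simp only [moll]
  rw [← integral_add]
  · simp only [mul_add]
  all_goals
    refine ContinuousOn.integrableOn_compact (isCompact_closedBall 0 1)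
      (Continuous.continuousOn ?_)
    exact η.continuous.mul (by fun_prop)

lemma moll_smul (η : 𝓓(unitBall d, ℝ)) (ε c : ℝ) (f : Sp d → ℝ) :
    moll η ε (fun y => c * f y) = fun y => c * moll η ε f y := by
  ext y
  simp only [moll, ← integral_const_mul]
  congr 1
  ext w
  ring

lemma FinOrder.pair_add {U : Opens (Sp d)} {G : 𝓓'(U, ℝ)} {p : ℕ} {Q : Set (Sp d)}
    (hG : FinOrder G p Q) (hQ : Q ⊆ U) {f g : Sp d → ℝ} (hf : IsCp p Q f) (hg : IsCp p Q g) :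
    pair G (fun y => f y + g y) = pair G f + pair G g := by
  refine tendsto_nhds_unique (hG.tendsto_pair hQ (hf.add hg) (integral_stdMoll d)) ?_
  refine ((hG.tendsto_pair hQ hf (integral_stdMoll d)).add
    (hG.tendsto_pair hQ hg (integral_stdMoll d))).congr' ?_
  filter_upwards [FinOrder.eventually_isTest hQ hf (stdMoll d),
    FinOrder.eventually_isTest hQ hg (stdMoll d)] with ε h1 h2
  rw [moll_add _ _ hf.contDiff.continuous hg.contDiff.continuous, toTest_add h1.1 h2.1, map_add]

lemma FinOrder.pair_smul {U : Opens (Sp d)} {G : 𝓓'(U, ℝ)} {p : ℕ} {Q : Set (Sp d)}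
    (hG : FinOrder G p Q) (hQ : Q ⊆ U) {f : Sp d → ℝ} (hf : IsCp p Q f) (c : ℝ) :
    pair G (fun y => c * f y) = c * pair G f := by
  refine tendsto_nhds_unique (hG.tendsto_pair hQ (hf.smul c) (integral_stdMoll d)) ?_
  refine ((hG.tendsto_pair hQ hf (integral_stdMoll d)).const_mul c).congr' ?_
  filter_upwards [FinOrder.eventually_isTest hQ hf (stdMoll d)] with ε h1
  rw [moll_smul, toTest_smul h1.1, map_smul, smul_eq_mul]

lemma FinOrder.pair_sub {U : Opens (Sp d)} {G : 𝓓'(U, ℝ)} {p : ℕ} {Q : Set (Sp d)}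
    (hG : FinOrder G p Q) (hQ : Q ⊆ U) {f g : Sp d → ℝ} (hf : IsCp p Q f) (hg : IsCp p Q g) :
    pair G (fun y => f y - g y) = pair G f - pair G g := by
  have := hG.pair_add hQ hf (hg.smul (-1))
  rw [hG.pair_smul hQ hg] at this
  simpa [sub_eq_add_neg] using this

lemma FinOrder.pair_sum {U : Opens (Sp d)} {G : 𝓓'(U, ℝ)} {p : ℕ} {Q : Set (Sp d)}
    (hG : FinOrder G p Q) (hQ : Q ⊆ U) {ι : Type*} (s : Finset ι) {f : ι → Sp d → ℝ}
    (hf : ∀ i ∈ s, IsCp p Q (f i)) :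
    pair G (fun y => ∑ i ∈ s, f i y) = ∑ i ∈ s, pair G (f i) := by
  classical
  induction s using Finset.induction_on with
  | empty =>
    have := hG.pair_smul hQ (IsCp.zero (p := p) (Q := Q)) 0
    simpa using this
  | insert i s hi ih =>
    simp only [Finset.sum_insert hi]
    rw [hG.pair_add hQ (hf i (Finset.mem_insert_self i s))
      (IsCp.sum s fun j hj => hf j (Finset.mem_insert_of_mem hj)),
      ih fun j hj => hf j (Finset.mem_insert_of_mem hj)]

lemma FinOrder.pair_sub_left {U : Opens (Sp d)} {G G' : 𝓓'(U, ℝ)} {p : ℕ} {Q : Set (Sp d)}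
    (hG : FinOrder G p Q) (hG' : FinOrder G' p Q) (hQ : Q ⊆ U) {g : Sp d → ℝ} (hg : IsCp p Q g) :
    pair (G - G') g = pair G g - pair G' g :=
  tendsto_nhds_unique ((hG.sub hG').tendsto_pair hQ hg (integral_stdMoll d))
    ((hG.tendsto_pair hQ hg (integral_stdMoll d)).sub
      (hG'.tendsto_pair hQ hg (integral_stdMoll d)))

lemma FinOrder.abs_pair_le_of_eventually {U : Opens (Sp d)} {G : 𝓓'(U, ℝ)} {p : ℕ}
    {Q : Set (Sp d)} (hG : FinOrder G p Q) (hQ : Q ⊆ U) {g : Sp d → ℝ} (hg : IsCp p Q g) {B : ℝ}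
    (h : ∀ᶠ ε in 𝓝[>] (0 : ℝ), |G (toTest U (moll (stdMoll d) ε g))| ≤ B) : |pair G g| ≤ B :=
  le_of_tendsto (hG.tendsto_pair hQ hg (integral_stdMoll d)).abs h

lemma norm_iteratedFDeriv_stdMoll_le {p : ℕ} {g : Sp d → ℝ} (hg : ContDiff ℝ p g) {j : ℕ}
    (hj : j ≤ p) {A : ℝ} (hA : ∀ y, ‖iteratedFDeriv ℝ j g y‖ ≤ A) (ε : ℝ) (y : Sp d) :
    ‖iteratedFDeriv ℝ j (moll (stdMoll d) ε g) y‖ ≤ A := by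
  have := norm_iteratedFDeriv_moll_le (stdMoll d) ε (n := p) hg (j := j) (by exact_mod_cast hj) hA y
  rwa [l1_stdMoll, mul_one] at this

lemma FinOrder.exists_abs_pair_le {U : Opens (Sp d)} {G : 𝓓'(U, ℝ)} {p : ℕ} {Q : Set (Sp d)}
    (hG : FinOrder G p Q) (hQ : Q ⊆ U) : ∃ C : ℝ, ∀ g, IsCp p Q g → ∀ A, (∀ y, |g y| ≤ A) →
      (∀ y, ‖iteratedFDeriv ℝ p g y‖ ≤ A) → |pair G g| ≤ C * A := by
  obtain ⟨C, hC⟩ := id hG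
  refine ⟨C, fun g hg A h0 h1 => hG.abs_pair_le_of_eventually hQ hg ?_⟩
  filter_upwards [FinOrder.eventually_isTest hQ hg (stdMoll d)] with ε hε
  refine hC _ hε.1 hε.2 A (fun y => ?_) (norm_iteratedFDeriv_stdMoll_le hg.contDiff le_rfl h1 ε)
  have := norm_iteratedFDeriv_stdMoll_le hg.contDiff (Nat.zero_le p) (A := A)
    (fun y => by rw [norm_iteratedFDeriv_zero]; exact h0 y) ε y
  rwa [norm_iteratedFDeriv_zero] at this

/-- The pairing is continuous along smooth families with common compact support. -/
lemma FinOrder.continuousAt_pair {U : Opens (Sp d)} {G : 𝓓'(U, ℝ)} {p : ℕ} {Q : Set (Sp d)}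
    (hG : FinOrder G p Q) (hQ : Q ⊆ U) {P : Type*} [TopologicalSpace P] {H : P → Sp d → ℝ}
    (hH : SmoothFam p H) {S : Set (Sp d)} (hS : IsCompact S) {p₀ : P}
    (hs : ∀ᶠ q in 𝓝 p₀, Function.support (H q) ⊆ S) {r : ℝ} (hr : 0 < r)
    (hrQ : Metric.cthickening r S ⊆ Q) : ContinuousAt (fun q => pair G (H q)) p₀ := by
  obtain ⟨C, hC⟩ := hG.exists_abs_pair_le hQ
  rw [Metric.continuousAt_iff']
  intro δ hδ
  have hδ' : 0 < δ / (2 * (|C| + 1)) := by positivity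
  filter_upwards [hH.eventually_norm_sub_le hS hs (j := 0) (by simp) hδ',
    hH.eventually_norm_sub_le hS hs (j := p) le_rfl hδ', hs] with q h0 h1 hq
  have c1 : IsCp p Q (H q) := IsCp.of_support (hH.1 q) hS hq hr hrQ
  have c0 : IsCp p Q (H p₀) := IsCp.of_support (hH.1 p₀) hS hs.self_of_nhds hr hrQ
  have c2 : IsCp p Q fun y => H q y - H p₀ y := by
    simpa [sub_eq_add_neg] using c1.add (c0.smul (-1))
  rw [Real.dist_eq, ← hG.pair_sub hQ c1 c0]
  refine (hC _ c2 _ (fun y => ?_) h1).trans_lt ?_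
  · have := h0 y
    rwa [norm_iteratedFDeriv_zero] at this
  · rw [← mul_div_assoc, div_lt_iff₀ (by positivity)]
    nlinarith [le_abs_self C, abs_nonneg C]

/-! ### Geometry -/

/-- By Carathéodory's theorem the hull is the continuous image of the compact product of a
`d`-simplex with `d + 1` copies of `K`. -/
lemma isCompact_convexHull {K : Set (Sp d)} (hK : IsCompact K) : IsCompact (convexHull ℝ K) := by
  classical
  have h1 : convexHull ℝ K = (fun q : (Fin (d + 1) → ℝ) × (Fin (d + 1) → Sp d) =>
      ∑ i, q.1 i • q.2 i) '' (stdSimplex ℝ (Fin (d + 1)) ×ˢ Set.univ.pi fun _ => K) := by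
    ext x
    constructor
    · intro hx
      obtain ⟨ι, _, z, w, hz, hai, hw, hw1, hx⟩ := eq_pos_convex_span_of_mem_convexHull hx
      have hcard : Fintype.card ι ≤ Fintype.card (Fin (d + 1)) := by
        have := hai.card_le_finrank_succ
        have h2 := Submodule.finrank_le (vectorSpan ℝ (Set.range z))
        rw [finrank_euclideanSpace_fin] at h2
        rw [Fintype.card_fin]
        omega
      obtain ⟨e⟩ := Function.Embedding.nonempty_of_card_le hcard
      have : Nonempty ι := by
        by_contra h
        rw [not_nonempty_iff] at h
        simp at hw1
      obtain ⟨i₀⟩ := this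
      -- Carathéodory may give fewer than `d + 1` points; the unused slots get weight zero and an
      -- arbitrary point of `K`.
      let z' : Fin (d + 1) → Sp d := fun a => if h : ∃ i, e i = a then z h.choose else z i₀
      let w' : Fin (d + 1) → ℝ := fun a => if h : ∃ i, e i = a then w h.choose else 0
      have hc : ∀ i, (⟨i, rfl⟩ : ∃ j, e j = e i).choose = i := fun i =>
        e.injective (⟨i, rfl⟩ : ∃ j, e j = e i).choose_spec
      have hz' : ∀ i, z' (e i) = z i := fun i => by
        simp only [z', dif_pos (⟨i, rfl⟩ : ∃ j, e j = e i), hc]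
      have hw' : ∀ i, w' (e i) = w i := fun i => by
        simp only [w', dif_pos (⟨i, rfl⟩ : ∃ j, e j = e i), hc]
      have hw0 : ∀ a, a ∉ Set.range e → w' a = 0 := fun a ha => dif_neg ha
      refine ⟨(w', z'), ⟨⟨fun a => ?_, ?_⟩, fun a _ => ?_⟩, ?_⟩
      · by_cases h : ∃ i, e i = a
        · simp only [w', dif_pos h]; exact (hw _).le
        · simp only [w', dif_neg h]; exact le_rfl
      · rw [← hw1, ← Fintype.sum_of_injective e e.injective w w' (fun a ha => hw0 a ha)
          fun i => (hw' i).symm]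
      · simp only [z']
        split_ifs
        · exact hz ⟨_, rfl⟩
        · exact hz ⟨_, rfl⟩
      · rw [← hx]
        exact (Fintype.sum_of_injective e e.injective (fun i => w i • z i)
          (fun a => w' a • z' a) (fun a ha => by simp [hw0 a ha])
          fun i => by simp [hw', hz']).symm
    · rintro ⟨⟨w, z⟩, ⟨hw, hz⟩, rfl⟩
      exact (convex_convexHull ℝ K).sum_mem (fun i _ => hw.1 i) hw.2 fun i _ =>
        subset_convexHull ℝ K (hz i (mem_univ i))
  rw [h1]
  exact ((isCompact_stdSimplex ℝ _).prod (isCompact_univ_pi fun _ => hK)).image (by fun_prop)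

/-- The points of `U` at distance at least `s` from the complement of `U`. -/
def innerSet (U : Opens (Sp d)) (s : ℝ) : Set (Sp d) := {x | Metric.ball x s ⊆ U}

lemma innerSet_subset {U : Opens (Sp d)} {s : ℝ} (hs : 0 < s) : innerSet U s ⊆ U :=
  fun _ hx => hx (Metric.mem_ball_self hs)

lemma innerSet_anti {U : Opens (Sp d)} {s t : ℝ} (hst : s ≤ t) : innerSet U t ⊆ innerSet U s :=
  fun _ hx => (Metric.ball_subset_ball hst).trans hx

lemma mem_innerSet_of_dist {U : Opens (Sp d)} {s r : ℝ} {x z : Sp d} (hx : x ∈ innerSet U s)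
    (hz : dist z x ≤ r) : z ∈ innerSet U (s - r) := by
  refine (Metric.ball_subset_ball' ?_).trans hx
  linarith

lemma cthickening_innerSet_subset {U : Opens (Sp d)} {s r : ℝ} (hr : 0 ≤ r) {S : Set (Sp d)}
    (hS : IsCompact S) (hSs : S ⊆ innerSet U s) : Metric.cthickening r S ⊆ innerSet U (s - r) :=
  cthickening_subset_of_closedBall hS hr fun _ hx _ hz => mem_innerSet_of_dist (hSs hx) hz

lemma isClosed_innerSet (U : Opens (Sp d)) (s : ℝ) : IsClosed (innerSet U s) := by
  rw [← isOpen_compl_iff, Metric.isOpen_iff]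
  intro x hx
  obtain ⟨y, hy, hyU⟩ := Set.not_subset.1 hx
  refine ⟨s - dist y x, by simpa using hy, fun z hz hzU => hyU (hzU ?_)⟩
  rw [Metric.mem_ball] at hz ⊢
  have := dist_triangle y x z
  rw [dist_comm x z] at this
  linarith

lemma isCompact_innerSet {U : Opens (Sp d)} (hb : Bornology.IsBounded (U : Set (Sp d))) {s : ℝ}
    (hs : 0 < s) : IsCompact (innerSet U s) :=
  Metric.isCompact_of_isClosed_isBounded (isClosed_innerSet U s) (hb.subset (innerSet_subset hs))

/-- A point within `s` of a convex combination of `x` and `y` is the same combination of the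
translates of `x` and `y` by the same small vector, and these lie in `U`. -/
lemma convex_innerSet {U : Opens (Sp d)} (hU : Convex ℝ (U : Set (Sp d))) (s : ℝ) :
    Convex ℝ (innerSet U s) := by
  intro x hx y hy a b ha hb hab w hw
  have h1 : ∀ u : Sp d, u ∈ innerSet U s → u + (w - (a • x + b • y)) ∈ U := fun u hu => hu (by
    rwa [Metric.mem_ball, dist_eq_norm, add_sub_cancel_left, ← dist_eq_norm])
  have h2 := hU (h1 x hx) (h1 y hy) ha hb hab
  have e : a • (x + (w - (a • x + b • y))) + b • (y + (w - (a • x + b • y))) = w := by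
    have : a • (x + (w - (a • x + b • y))) + b • (y + (w - (a • x + b • y))) =
      (a • x + b • y) + (a + b) • (w - (a • x + b • y)) := by
      simp only [smul_add, add_smul]; abel
    rw [this, hab, one_smul]; abel
  rwa [e] at h2

/-- A ball is connected and meets `O` in its centre; to leave `O` it would have to contain a
frontier point. -/
lemma closedBall_subset_of_lt_infEDist {O : Opens (Sp d)} {x : Sp d} (hx : x ∈ O) {s : ℝ}
    (hs : 0 ≤ s) (h : ENNReal.ofReal s < Metric.infEDist x (frontier (O : Set (Sp d)))) :
    Metric.closedBall x s ⊆ O := by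
  refine (convex_closedBall x s).isPreconnected.subset_of_closure_inter_subset O.isOpen
    ⟨x, Metric.mem_closedBall_self hs, hx⟩ ?_
  rintro y ⟨hy, hyB⟩
  by_contra hyO
  have h1 : y ∈ frontier (O : Set (Sp d)) := by
    rw [O.isOpen.frontier_eq]; exact ⟨hy, hyO⟩
  refine absurd (h.trans_le (Metric.infEDist_le_edist_of_mem h1)) (not_lt.2 ?_)
  rw [edist_comm, edist_dist]
  exact ENNReal.ofReal_le_ofReal hyB

lemma le_infEDist_of_ball_subset {O : Opens (Sp d)} {x : Sp d} {s : ℝ}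
    (h : Metric.ball x s ⊆ O) :
    ENNReal.ofReal s ≤ Metric.infEDist x (frontier (O : Set (Sp d))) := by
  refine Metric.le_infEDist.2 fun y hy => ?_
  rw [O.isOpen.frontier_eq] at hy
  by_contra hlt
  rw [not_le, edist_comm, edist_dist, ENNReal.ofReal_lt_ofReal_iff'] at hlt
  exact hy.2 (h hlt.1)

lemma closedBall_subset_of_mem_shrink {U : Opens (Sp d)} {s : ℝ} (hs : 0 ≤ s) {x : Sp d}
    (hx : x ∈ shrink U s) : Metric.closedBall x s ⊆ U :=
  closedBall_subset_of_lt_infEDist hx.1 hs hx.2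

lemma shrink_subset_innerSet {U : Opens (Sp d)} {s : ℝ} (hs : 0 ≤ s) :
    (shrink U s : Set (Sp d)) ⊆ innerSet U s :=
  fun _ hx => Metric.ball_subset_closedBall.trans (closedBall_subset_of_mem_shrink hs hx)

/-- The strict inequality in `shrink` leaves a little room. It exhibits `shrink U s` as an
increasing union of the sets `innerSet U t`, which makes its convexity visible. -/
lemma mem_shrink_iff {U : Opens (Sp d)} {s : ℝ} (hs : 0 < s) {x : Sp d} :
    x ∈ shrink U s ↔ ∃ t, s < t ∧ x ∈ innerSet U t := by
  constructor
  · rintro ⟨hx, h⟩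
    obtain ⟨t, h1, h2⟩ := ENNReal.lt_iff_exists_nnreal_btwn.1 h
    have h3 : ENNReal.ofReal t < Metric.infEDist x (frontier (U : Set (Sp d))) := by
      rwa [ENNReal.ofReal_coe_nnreal]
    refine ⟨t, ?_, Metric.ball_subset_closedBall.trans
      (closedBall_subset_of_lt_infEDist hx t.2 h3)⟩
    have := (ENNReal.ofReal_lt_iff_lt_toReal hs.le (by simp)).1 h1
    simpa using this
  · rintro ⟨t, hst, ht⟩
    refine ⟨innerSet_subset (hs.trans hst) ht, lt_of_lt_of_le ?_ (le_infEDist_of_ball_subset ht)⟩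
    exact (ENNReal.ofReal_lt_ofReal_iff (hs.trans hst)).2 hst

lemma convex_shrink {U : Opens (Sp d)} (hU : Convex ℝ (U : Set (Sp d))) {s : ℝ} (hs : 0 < s) :
    Convex ℝ (shrink U s : Set (Sp d)) := by
  intro x hx y hy a b ha hb hab
  obtain ⟨t, hst, ht⟩ := (mem_shrink_iff hs).1 hx
  obtain ⟨t', hst', ht'⟩ := (mem_shrink_iff hs).1 hy
  exact (mem_shrink_iff hs).2 ⟨min t t', lt_min hst hst',
    convex_innerSet hU _ (innerSet_anti (min_le_left _ _) ht) (innerSet_anti (min_le_right _ _) ht')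
      ha hb hab⟩

lemma AdmScale.lt_infEDist {K O : Set (Sp d)} {l : ℝ} (h : AdmScale K O l) {x : Sp d}
    (hx : x ∈ K) : ENNReal.ofReal l < Metric.infEDist x (frontier O) :=
  h.2.trans_le (iInf₂_le x hx)

lemma AdmScale.closedBall_subset {K : Set (Sp d)} {O : Opens (Sp d)} {l : ℝ}
    (h : AdmScale K O l) (hK : K ⊆ O) {x : Sp d} (hx : x ∈ K) : Metric.closedBall x l ⊆ O :=
  closedBall_subset_of_lt_infEDist (hK hx) h.1.le (h.lt_infEDist hx)

lemma admScale_of_subset_innerSet {K : Set (Sp d)} {U : Opens (Sp d)} {s l : ℝ} (hl : 0 < l)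
    (hls : l < s) (hK : K ⊆ innerSet U s) : AdmScale K U l := by
  refine ⟨hl, lt_of_lt_of_le ?_ (le_iInf₂ fun x hx => le_infEDist_of_ball_subset (hK hx))⟩
  exact (ENNReal.ofReal_lt_ofReal_iff (hl.trans hls)).2 hls

/-- Margins add up: a point at distance more than `t` from `x` is reached by travelling distance `t`
inside `V` along the segment and then less than `s` inside `U`. -/
lemma ball_subset_innerSet_add {V U : Opens (Sp d)} {s t : ℝ} (hs : 0 < s) (ht : 0 ≤ t) {x : Sp d}
    (hV : (V : Set (Sp d)) ⊆ innerSet U s) (hx : Metric.closedBall x t ⊆ V) :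
    x ∈ innerSet U (s + t) := by
  intro y hy
  rw [Metric.mem_ball, dist_comm] at hy
  by_cases hyt : dist x y ≤ t
  · exact innerSet_subset hs (hV (hx (by rwa [Metric.mem_closedBall, dist_comm])))
  · rw [not_le] at hyt
    have hpos : 0 < dist x y := ht.trans_lt hyt
    set c := t / dist x y with hc
    have hc0 : 0 ≤ c := div_nonneg ht hpos.le
    have hc1 : c < 1 := (div_lt_one hpos).2 hyt
    have hct : c * dist x y = t := div_mul_cancel₀ _ hpos.ne'
    set w := x + c • (y - x) with hw
    have h1 : dist w x ≤ t := by
      rw [hw, dist_eq_norm, add_sub_cancel_left, norm_smul, Real.norm_of_nonneg hc0,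
        ← dist_eq_norm, dist_comm, hct]
    have h2 : dist y w < s := by
      have e : y - w = (1 - c) • (y - x) := by rw [hw, sub_smul, one_smul]; abel
      rw [dist_eq_norm, e, norm_smul, Real.norm_of_nonneg (by linarith), ← dist_eq_norm, dist_comm]
      nlinarith
    exact hV (hx h1) h2

/-- The margin of `K` in the smaller set and the margin `s` of that set add, and sets of points with
a given margin in `U` are convex, so the hull inherits it. Strict admissibility provides `l' > l`,
which is why the endpoint `l + s` is allowed. -/
lemma AdmScale.convexHull_shrink {U : Opens (Sp d)} (hU : Convex ℝ (U : Set (Sp d))) {s l : ℝ}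
    (hs : 0 < s) {K : Set (Sp d)} (hK : K ⊆ shrink U s) (h : AdmScale K (shrink U s) l) {t : ℝ}
    (ht : 0 < t) (hts : t ≤ l + s) : AdmScale (convexHull ℝ K) U t := by
  obtain ⟨l', h1, h2⟩ := ENNReal.lt_iff_exists_nnreal_btwn.1 h.2
  have hl' : l < l' := by
    have := (ENNReal.ofReal_lt_iff_lt_toReal h.1.le (by simp)).1 h1
    simpa using this
  have h' : AdmScale K (shrink U s) l' := ⟨h.1.trans hl', by rwa [ENNReal.ofReal_coe_nnreal]⟩
  refine admScale_of_subset_innerSet (s := s + l') ht (by linarith)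
    (convexHull_min (fun x hx => ?_) (convex_innerSet hU _))
  exact ball_subset_innerSet_add hs l'.2 (shrink_subset_innerSet hs.le) (h'.closedBall_subset hK hx)

/-! ### Distributions tested at a given scale -/

lemma iteratedFDeriv_comp_scale {f : Sp d → ℝ} {j : ℕ} (hf : ContDiff ℝ j f) (x : Sp d) (l : ℝ)
    (w : Sp d) : iteratedFDeriv ℝ j (fun w => f (x + l • w)) w =
      l ^ j • iteratedFDeriv ℝ j f (x + l • w) := by
  have h1 : ContDiff ℝ j fun v => f (x + v) := hf.comp (contDiff_const.add contDiff_id)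
  have h2 := ContinuousLinearMap.iteratedFDeriv_comp_right (l • ContinuousLinearMap.id ℝ (Sp d))
    h1 w le_rfl
  have h3 : (fun v => f (x + v)) ∘ (l • ContinuousLinearMap.id ℝ (Sp d)) =
    fun w => f (x + l • w) := rfl
  rw [h3] at h2
  rw [h2]
  ext m
  rw [ContinuousMultilinearMap.compContinuousLinearMap_apply, iteratedFDeriv_comp_add_left]
  have h4 := (iteratedFDeriv ℝ j f (x + l • w)).map_smul_univ (fun _ => l) m
  simpa using h4

lemma toTest_eq_zero {U : Opens (Sp d)} {f : Sp d → ℝ} (hf : ∀ y, f y = 0) : toTest U f = 0 :=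
  toTest_eq 0 fun y => (hf y).symm

/-- A bound on the rescaled test functions of `C^q` norm at most one gives a bound for all test
functions living at this scale. -/
lemma abs_apply_le_of_rescale {U : Opens (Sp d)} (G : 𝓓'(U, ℝ)) {q : ℕ} {z : Sp d} {l L : ℝ}
    (hL : 0 < L) (hLl : L < l) {B : ℝ}
    (hB : ∀ φ ∈ testBall d q, ∀ χ : 𝓓(U, ℝ), (∀ y, χ y = rescale φ z l y) → |G χ| ≤ B)
    {ψ : Sp d → ℝ} (hψ : IsTest U ψ) (hs : Function.support ψ ⊆ Metric.closedBall z L) {A : ℝ}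
    (hA : ∀ j ≤ q, ∀ y, ‖iteratedFDeriv ℝ j ψ y‖ ≤ A * (l ^ (d + j))⁻¹) :
    |G (toTest U ψ)| ≤ A * B := by
  have hl : 0 < l := hL.trans hLl
  have hA0 : 0 ≤ A := by
    have := (norm_nonneg _).trans (hA 0 (Nat.zero_le q) z)
    exact nonneg_of_mul_nonneg_left this (by positivity)
  rcases hA0.eq_or_lt with rfl | hA0
  · have : ∀ y, ψ y = 0 := fun y => by
      have := hA 0 (Nat.zero_le q) y
      rw [zero_mul, norm_iteratedFDeriv_zero] at this
      simpa using this
    rw [toTest_eq_zero this]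
    simp
  -- Undo the rescaling and normalize by `A`. Its support has radius `L / l < 1`, so it is compactly
  -- contained in the open unit ball, which is why `L < l` must be strict.
  set f : Sp d → ℝ := fun w => A⁻¹ * (l ^ d * ψ (z + l • w)) with hf
  have hsc : ContDiff ℝ (⊤ : ℕ∞) fun w => ψ (z + l • w) :=
    hψ.contDiff.comp (contDiff_const.add (contDiff_id.const_smul l))
  have hfs : Function.support f ⊆ Metric.closedBall 0 (L / l) := by
    intro w hw
    have h1 : ψ (z + l • w) ≠ 0 := right_ne_zero_of_mul (right_ne_zero_of_mul hw)
    have h2 := hs h1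
    rw [Metric.mem_closedBall, dist_eq_norm, add_sub_cancel_left, norm_smul,
      Real.norm_of_nonneg hl.le] at h2
    rw [mem_closedBall_zero_iff, le_div_iff₀ hl]
    linarith
  have hfT : IsTest (unitBall d) f :=
    IsTest.of_support_subset (contDiff_const.mul (contDiff_const.mul hsc))
      (isCompact_closedBall 0 (L / l)) (Metric.closedBall_subset_ball ((div_lt_one hl).2 hLl)) hfs
  have hφ : ⇑(toTest (unitBall d) f) = f := funext (toTest_apply hfT)
  have h1 : toTest (unitBall d) f ∈ testBall d q := by
    refine mem_testBall_of_norm fun j hj w => ?_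
    have hψj : ContDiff ℝ j ψ := hψ.contDiff.of_le (by exact_mod_cast le_top)
    have e : f = (A⁻¹ * l ^ d) • fun w => ψ (z + l • w) := by
      ext w; simp only [hf, Pi.smul_apply, smul_eq_mul]; ring
    rw [hφ, e, iteratedFDeriv_const_smul_apply
      ((hsc.of_le (by exact_mod_cast le_top)).contDiffAt), iteratedFDeriv_comp_scale hψj,
      norm_smul, norm_smul, Real.norm_of_nonneg (by positivity), Real.norm_of_nonneg (by positivity)]
    calc A⁻¹ * l ^ d * (l ^ j * ‖iteratedFDeriv ℝ j ψ (z + l • w)‖)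
        ≤ A⁻¹ * l ^ d * (l ^ j * (A * (l ^ (d + j))⁻¹)) := by
          gcongr
          exact hA j hj _
      _ = 1 := by rw [pow_add]; field_simp
  have h2 := hB _ h1 (A⁻¹ • toTest U ψ) fun y => by
    have : (A⁻¹ • toTest U ψ) y = A⁻¹ * toTest U ψ y := rfl
    rw [this, toTest_apply hψ, hφ, rescale, hf]
    simp only [smul_smul, mul_inv_cancel₀ hl.ne', one_smul, add_sub_cancel]
    field_simp
  rw [map_smul, smul_eq_mul, abs_mul, abs_of_pos (inv_pos.2 hA0), inv_mul_le_iff₀ hA0] at h2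
  exact h2

lemma cohNorm_bound {U : Opens (Sp d)} {a γ : ℝ} {q : ℕ} {K : Set (Sp d)} {lb : ℝ}
    {F : U → 𝓓'(U, ℝ)} (hF : cohNorm U a γ q K lb F < ∞) {x y : U} (hx : (x : Sp d) ∈ K)
    (hy : (y : Sp d) ∈ K) {l : ℝ} (hl : l ∈ Ioc 0 lb) {φ : 𝓓(unitBall d, ℝ)}
    (hφ : φ ∈ testBall d q) {χ : 𝓓(U, ℝ)} (hχ : ∀ z, χ z = rescale φ x l z) :
    |(F x - F y) χ| ≤ (cohNorm U a γ q K lb F).toReal *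
      (l ^ a * (l + dist (x : Sp d) y) ^ (γ - a)) := by
  have h := (cohNorm_le_iff U a γ q K lb F _).1 le_rfl x y hx hy l hl φ hφ χ hχ
  have hl0 : 0 < l := hl.1
  have hd : 0 ≤ dist (x : Sp d) y := dist_nonneg
  rw [ENNReal.ofReal_le_iff_le_toReal hF.ne] at h
  rwa [div_le_iff₀ (by positivity)] at h

/-- The coherence bound for test functions living at the scale `l` around `x`. -/
lemma abs_apply_le_cohNorm {U : Opens (Sp d)} {a γ : ℝ} {q : ℕ} {K : Set (Sp d)} {lb : ℝ}
    {F : U → 𝓓'(U, ℝ)} (hF : cohNorm U a γ q K lb F < ∞) {x y : U} (hx : (x : Sp d) ∈ K)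
    (hy : (y : Sp d) ∈ K) {l L : ℝ} (hL : 0 < L) (hLl : L < l) (hl : l ≤ lb) {ψ : Sp d → ℝ}
    (hψ : IsTest U ψ) (hs : Function.support ψ ⊆ Metric.closedBall (x : Sp d) L) {A : ℝ}
    (hA : ∀ j ≤ q, ∀ y, ‖iteratedFDeriv ℝ j ψ y‖ ≤ A * (l ^ (d + j))⁻¹) :
    |(F x - F y) (toTest U ψ)| ≤ A * ((cohNorm U a γ q K lb F).toReal *
      (l ^ a * (l + dist (x : Sp d) y) ^ (γ - a))) :=
  abs_apply_le_of_rescale _ hL hLl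
    (fun _ hφ _ hχ => cohNorm_bound hF hx hy ⟨hL.trans hLl, hl⟩ hφ hχ) hψ hs hA

/-! ### Bounds at small scales -/

lemma exists_iteratedFDeriv_bound {g : Sp d → ℝ} (hg : ContDiff ℝ (⊤ : ℕ∞) g)
    (hc : HasCompactSupport g) (q : ℕ) : ∃ c, 0 < c ∧ ∀ j ≤ q, ∀ y, ‖iteratedFDeriv ℝ j g y‖ ≤ c := by
  have h : ∀ j : ℕ, ∃ c, ∀ y, ‖iteratedFDeriv ℝ j g y‖ ≤ c := fun j =>
    (hc.iteratedFDeriv (𝕜 := ℝ) j).exists_bound_of_continuous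
      (hg.continuous_iteratedFDeriv (by exact_mod_cast le_top))
  choose c hc using h
  have hc0 : ∀ j, 0 ≤ c j := fun j => (norm_nonneg _).trans (hc j 0)
  refine ⟨1 + ∑ j ∈ Finset.range (q + 1), c j, ?_, fun j hj y => (hc j y).trans ?_⟩
  · have := Finset.sum_nonneg fun j (_ : j ∈ Finset.range (q + 1)) => hc0 j
    linarith
  · have := Finset.single_le_sum (fun j _ => hc0 j) (Finset.mem_range.2 (Nat.lt_succ_of_le hj))
    linarith

/-- Bounds for test functions in the unit `C^q` ball give bounds for every test function. -/
lemma exists_abs_apply_rescale_le (φ : 𝓓(unitBall d, ℝ)) (q : ℕ) : ∃ c, 0 < c ∧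
    ∀ (U : Opens (Sp d)) (G : 𝓓'(U, ℝ)) (z : Sp d) (l B : ℝ), 0 < l → Metric.closedBall z l ⊆ U →
      (∀ φ ∈ testBall d q, ∀ χ : 𝓓(U, ℝ), (∀ y, χ y = rescale φ z l y) → |G χ| ≤ B) →
      |G (toTest U (rescale φ z l))| ≤ c * B := by
  obtain ⟨c, hc, h⟩ := exists_iteratedFDeriv_bound φ.contDiff φ.hasCompactSupport q
  refine ⟨c, hc, fun U G z l B hl hzU hB => ?_⟩
  have hT := isTest_rescale φ hl hzU
  have e : ⇑(c⁻¹ • φ) = fun y => c⁻¹ * φ y := rfl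
  have h1 : c⁻¹ • φ ∈ testBall d q := by
    refine mem_testBall_of_norm fun j hj x => ?_
    have : ⇑(c⁻¹ • φ) = c⁻¹ • ⇑φ := rfl
    rw [this, iteratedFDeriv_const_smul_apply ((φ.contDiff.of_le
      (by exact_mod_cast le_top)).contDiffAt), norm_smul, Real.norm_of_nonneg (inv_pos.2 hc).le,
      inv_mul_le_iff₀ hc, mul_one]
    exact h j hj x
  have h2 := hB _ h1 (c⁻¹ • toTest U (rescale φ z l)) fun y => by
    have : (c⁻¹ • toTest U (rescale φ z l)) y = c⁻¹ * toTest U (rescale φ z l) y := rfl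
    rw [this, toTest_apply hT, e, rescale, rescale]
    ring
  rwa [map_smul, smul_eq_mul, abs_mul, abs_of_pos (inv_pos.2 hc), inv_mul_le_iff₀ hc] at h2

/-- A mollifier with vanishing moments. -/
def theta (d p : ℕ) : 𝓓(unitBall d, ℝ) := (exists_isMoll d p).choose

lemma isMoll_theta (d p : ℕ) : IsMoll p (theta d p) := (exists_isMoll d p).choose_spec

lemma volume_closedBall_le (x : Sp d) {L : ℝ} (hL : 0 ≤ L) :
    volume.real (Metric.closedBall x L) = L ^ d * volume.real (Metric.closedBall (0 : Sp d) 1) := by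
  rw [measureReal_def, Measure.addHaar_closedBall' volume x hL, finrank_euclideanSpace_fin,
    ENNReal.toReal_mul, ENNReal.toReal_ofReal (by positivity), ← measureReal_def]

/-- Bounds on the values of a distribution at rescalings of the mollifier near a ball give bounds
on its values at test functions supported in this ball. -/
lemma exists_abs_apply_le_ball (d p : ℕ) (hp : 1 ≤ p) {a : ℝ} (ha : 0 < a + p) {l₀ Lm s : ℝ}
    (hl₀ : 0 < l₀) (hl₀s : 2 * l₀ < s) (hLm : 0 < Lm) :
    ∃ C : ℝ, 0 ≤ C ∧ ∀ (U : Opens (Sp d)) (G : 𝓓'(U, ℝ)) (x : Sp d) (L B A : ℝ),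
      0 < L → L ≤ Lm → 0 ≤ B →
      (∀ z ∈ innerSet U (s - l₀), dist z x ≤ 2 * L → ∀ l ∈ Ioc 0 l₀, l ≤ L →
        |G (toTest U (rescale (theta d p) z l))| ≤ B * l ^ a) →
      ∀ g : Sp d → ℝ, ContDiff ℝ (⊤ : ℕ∞) g →
      Function.support g ⊆ Metric.closedBall x L ∩ innerSet U s →
      (∀ y, |g y| ≤ A * (L ^ d)⁻¹) → (∀ y, ‖iteratedFDeriv ℝ p g y‖ ≤ A * (L ^ (d + p))⁻¹) →
      |G (toTest U g)| ≤ C * (B * A * L ^ a) := by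
  have hθ := isMoll_theta d p
  -- Mollifying at scale `c * L`, a fixed fraction of `L`, makes the final constant scale invariant;
  -- `c` is small enough that `c * L ≤ l₀` for all `L ≤ Lm`.
  set c : ℝ := min 1 (l₀ / Lm) with hc
  have hc0 : 0 < c := lt_min one_pos (by positivity)
  have hc1 : c ≤ 1 := min_le_left _ _
  have hr1 : (2⁻¹ : ℝ) ^ (a + p) < 1 := Real.rpow_lt_one (by norm_num) (by norm_num) ha
  set D : ℝ := l1 (theta d p) * (2⁻¹ : ℝ) ^ a * (1 + 2 / (1 - (2⁻¹ : ℝ) ^ (a + p))) with hD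
  have hD0 : 0 ≤ D := by
    have : 0 ≤ 2 / (1 - (2⁻¹ : ℝ) ^ (a + p)) := div_nonneg (by norm_num) (by linarith)
    have := l1_nonneg (theta d p)
    positivity
  set v := volume.real (Metric.closedBall (0 : Sp d) 1)
  have hv0 : 0 ≤ v := measureReal_nonneg
  refine ⟨D * (2 ^ d * v * (c ^ a + c ^ (a + p))), by positivity,
    fun U G x L B A hL hLm' hB0 hB g hg hgs hA0 hA1 => ?_⟩
  have hcl : c * L ≤ l₀ := by
    have : c * L ≤ l₀ / Lm * Lm := mul_le_mul (min_le_right _ _) hLm' hL.le (by positivity)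
    rwa [div_mul_cancel₀ _ hLm.ne'] at this
  have hcL : c * L ≤ L := mul_le_of_le_one_left hL.le hc1
  have hcL0 : 0 < c * L := by positivity
  set S := Metric.closedBall x L ∩ innerSet U s with hS
  have hSc : IsCompact S := (isCompact_closedBall x L).inter_right (isClosed_innerSet U s)
  have h1 : Metric.cthickening (c * L) S ⊆ innerSet U (s - c * L) :=
    cthickening_innerSet_subset hcL0.le hSc inter_subset_right
  have h2 : Metric.cthickening (2 * (c * L)) S ⊆ innerSet U (s - 2 * (c * L)) :=
    cthickening_innerSet_subset (by positivity) hSc inter_subset_right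
  have h3 : Metric.cthickening (c * L) S ⊆ Metric.closedBall x (2 * L) := by
    refine cthickening_subset_of_closedBall hSc hcL0.le fun y hy z hz => ?_
    have ha := Metric.mem_closedBall.1 hy.1
    have hb := Metric.mem_closedBall.1 hz
    rw [Metric.mem_closedBall]
    linarith [dist_triangle z y x]
  have hA00 : 0 ≤ A := nonneg_of_mul_nonneg_left ((abs_nonneg _).trans (hA0 x)) (by positivity)
  have key := abs_apply_le_of_moll G hp hθ ha hSc hcL0
    (h2.trans (innerSet_subset (by linarith))) (B := B)
    (fun z hz l hl => hB z (innerSet_anti (by linarith) (h1 hz)) (h3 hz) l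
      ⟨hl.1, hl.2.trans hcl⟩ (hl.2.trans hcL)) hg hgs hA0 hA1
  rw [← hD] at key
  have hvol : volume.real (Metric.cthickening (c * L) S) ≤ 2 ^ d * L ^ d * v := by
    refine (measureReal_mono h3 (isCompact_closedBall x (2 * L)).measure_lt_top.ne).trans ?_
    rw [volume_closedBall_le x (by positivity), mul_pow]
  refine key.trans ?_
  have e1 : (c * L) ^ a * (A * (L ^ d)⁻¹) + (c * L) ^ (a + p) * (A * (L ^ (d + p))⁻¹) =
      A * (L ^ d)⁻¹ * L ^ a * (c ^ a + c ^ (a + p)) := by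
    rw [Real.mul_rpow hc0.le hL.le, Real.mul_rpow hc0.le hL.le, Real.rpow_add hL, pow_add,
      Real.rpow_natCast]
    field_simp
  rw [e1]
  calc D * (B * volume.real (Metric.cthickening (c * L) S) *
        (A * (L ^ d)⁻¹ * L ^ a * (c ^ a + c ^ (a + p))))
      ≤ D * (B * (2 ^ d * L ^ d * v) * (A * (L ^ d)⁻¹ * L ^ a * (c ^ a + c ^ (a + p)))) := by
        gcongr
    _ = D * (2 ^ d * v * (c ^ a + c ^ (a + p))) * (B * A * L ^ a) := by
        field_simp

/-! ### Pairings of coherent germs -/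

/-- Derivatives in the second variable are joint derivatives composed with the injection of the
second factor. -/
lemma SmoothFam.of_contDiff {n : ℕ∞} {H : Sp d → Sp d → ℝ}
    (hH : ContDiff ℝ n fun q : Sp d × Sp d => H q.1 q.2) : SmoothFam n H := by
  refine ⟨fun z => hH.comp (contDiff_const.prodMk contDiff_id), fun j hj => ?_⟩
  have h : ∀ z y, iteratedFDeriv ℝ j (H z) y =
      ContinuousMultilinearMap.compContinuousLinearMapL (fun _ => ContinuousLinearMap.inr ℝ _ _)
        (iteratedFDeriv ℝ j (fun q : Sp d × Sp d => H q.1 q.2) (z, y)) := by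
    intro z y
    have hj' : (j : WithTop ℕ∞) ≤ n := by exact_mod_cast hj
    have h1 : ContDiff ℝ n fun q : Sp d × Sp d => H ((z, (0 : Sp d)) + q).1 ((z, (0 : Sp d)) + q).2 :=
      hH.comp (contDiff_const.add contDiff_id)
    have h2 := ContinuousLinearMap.iteratedFDeriv_comp_right
      (ContinuousLinearMap.inr ℝ (Sp d) (Sp d)) h1 y hj'
    have h3 : (fun q : Sp d × Sp d => H ((z, (0 : Sp d)) + q).1 ((z, (0 : Sp d)) + q).2) ∘
        (ContinuousLinearMap.inr ℝ (Sp d) (Sp d)) = H z := by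
      ext v; simp
    rw [h3] at h2
    rw [h2, iteratedFDeriv_comp_add_left j (z, (0 : Sp d)) (f := fun q : Sp d × Sp d => H q.1 q.2)]
    simp
  simp only [h]
  exact (ContinuousLinearMap.continuous _).comp
    (hH.continuous_iteratedFDeriv (by exact_mod_cast hj))

lemma integral_rescale_base (η : 𝓓(unitBall d, ℝ)) {ε : ℝ} (hε : 0 < ε) (y : Sp d) :
    ∫ z, rescale η z ε y = ∫ w, η w := by
  have h1 := moll_eq_conv η hε (fun _ => 1) y
  simp only [one_mul] at h1
  rw [← h1, moll, setIntegral_mul_unitBall η fun _ => 1]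
  simp

lemma norm_iteratedFDeriv_rescale {η : 𝓓(unitBall d, ℝ)} {c : ℝ} {j : ℕ}
    (h : ∀ y, ‖iteratedFDeriv ℝ j η y‖ ≤ c) {s : ℝ} (hs : 0 < s) (z y : Sp d) :
    ‖iteratedFDeriv ℝ j (rescale η z s) y‖ ≤ c * (s ^ (d + j))⁻¹ := by
  have hη : ContDiff ℝ j η := η.contDiff.of_le (by exact_mod_cast le_top)
  have h0 : ContDiff ℝ j fun y => η (-(s⁻¹ • z) + s⁻¹ • y) :=
    hη.comp (contDiff_const.add (contDiff_id.const_smul _))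
  have e : rescale η z s = (s ^ d)⁻¹ • fun y => η (-(s⁻¹ • z) + s⁻¹ • y) := by
    ext y
    simp only [rescale, Pi.smul_apply, smul_eq_mul, smul_sub]
    rw [sub_eq_neg_add]
  rw [e, iteratedFDeriv_const_smul_apply h0.contDiffAt, iteratedFDeriv_comp_scale hη, norm_smul,
    norm_smul, norm_inv, norm_pow, norm_pow, norm_inv, Real.norm_of_nonneg hs.le, pow_add, mul_inv,
    inv_pow, ← mul_assoc, mul_comm]
  gcongr
  exact h _

/-- By the Leibniz rule and `s ≤ L`, a derivative falling on `f` costs at most as much as one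
falling on the bump. The product thus behaves like a function of scale `s`, and `f` only contributes
its amplitude `A L^{-d}`. -/
lemma norm_iteratedFDeriv_mul_rescale_le {f : Sp d → ℝ} {q : ℕ} (hf : ContDiff ℝ q f) {A L s c : ℝ}
    (hL : 0 < L) (hs : 0 < s) (hsL : s ≤ L) (hc : 0 ≤ c) {η : 𝓓(unitBall d, ℝ)}
    (hη : ∀ j ≤ q, ∀ y, ‖iteratedFDeriv ℝ j η y‖ ≤ c)
    (hA : ∀ j ≤ q, ∀ y, ‖iteratedFDeriv ℝ j f y‖ ≤ A * (L ^ (d + j))⁻¹) (z : Sp d) {j : ℕ}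
    (hj : j ≤ q) (y : Sp d) :
    ‖iteratedFDeriv ℝ j (fun y => f y * rescale η z s y) y‖ ≤
      2 ^ q * c * A * (L ^ d)⁻¹ * (s ^ (d + j))⁻¹ := by
  have hr : ContDiff ℝ q (rescale η z s) := (contDiff_rescale η z s).of_le (by exact_mod_cast le_top)
  have hA0 : 0 ≤ A := nonneg_of_mul_nonneg_left
    ((norm_nonneg _).trans (hA 0 (Nat.zero_le q) z)) (by positivity)
  refine (norm_iteratedFDeriv_mul_le hf hr y (n := j) (by exact_mod_cast hj)).trans ?_
  have : ∀ i ∈ Finset.range (j + 1), (j.choose i : ℝ) * ‖iteratedFDeriv ℝ i f y‖ *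
      ‖iteratedFDeriv ℝ (j - i) (rescale η z s) y‖ ≤
      (j.choose i : ℝ) * (c * A * (L ^ d)⁻¹ * (s ^ (d + j))⁻¹) := by
    intro i hi
    have hi' : i ≤ j := Nat.lt_succ_iff.1 (Finset.mem_range.1 hi)
    have h1 := hA i (hi'.trans hj) y
    have h2 := norm_iteratedFDeriv_rescale (hη (j - i) ((Nat.sub_le _ _).trans hj)) hs z y
    rw [mul_assoc]
    refine mul_le_mul_of_nonneg_left ?_ (Nat.cast_nonneg _)
    calc ‖iteratedFDeriv ℝ i f y‖ * ‖iteratedFDeriv ℝ (j - i) (rescale η z s) y‖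
        ≤ (A * (L ^ (d + i))⁻¹) * (c * (s ^ (d + (j - i)))⁻¹) := by gcongr
      _ ≤ (A * ((L ^ d)⁻¹ * (s ^ i)⁻¹)) * (c * (s ^ (d + (j - i)))⁻¹) := by
          rw [pow_add L, mul_inv]
          gcongr
      _ = c * A * (L ^ d)⁻¹ * (s ^ (d + j))⁻¹ := by
          have : s ^ (d + j) = s ^ i * s ^ (d + (j - i)) := by
            rw [← pow_add]; congr 1; omega
          rw [this, mul_inv]
          ring
  refine (Finset.sum_le_sum this).trans ?_
  rw [← Finset.sum_mul, ← Nat.cast_sum, Nat.sum_range_choose]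
  have h2 : ((2 ^ j : ℕ) : ℝ) ≤ 2 ^ q := by
    push_cast
    exact pow_le_pow_right₀ (by norm_num) hj
  calc ((2 ^ j : ℕ) : ℝ) * (c * A * (L ^ d)⁻¹ * (s ^ (d + j))⁻¹)
      ≤ 2 ^ q * (c * A * (L ^ d)⁻¹ * (s ^ (d + j))⁻¹) := by gcongr
    _ = _ := by ring

/-- The data of the problem that do not depend on the germ: an open set, a compact subset `Kt` on
which coherence is measured, the exponents and the orders. -/
structure Setup (d : ℕ) where
  U : Opens (Sp d)
  Kt : Set (Sp d)
  ρ : ℝ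
  γ : ℝ
  a : ℝ
  lt : ℝ
  CR : ℝ
  p : ℕ
  qt : ℕ
  qR : ℕ
  bdd : Bornology.IsBounded (U : Set (Sp d))
  ρ_pos : 0 < ρ
  a_nonpos : a ≤ 0
  a_le : a ≤ γ
  a_add_pos : 0 < a + p
  Kt_subset : Kt ⊆ U
  -- The margins to the boundary are nested. Test functions live at distance `2ρ`, the cut-off
  -- vanishes below distance `15ρ/8`, and the supports of the pieces then stay at distance `7ρ/8`.
  -- Mollification enlarges them at most to distance `3ρ/4`, and the centres of mollifiers meeting
  -- them stay at distance `ρ/2`, where the reconstruction and coherence bounds are available.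
  subset_Kt : innerSet U (ρ / 2) ⊆ Kt
  lt_pos : 0 < lt
  closedBall_subset : ∀ z ∈ Kt, Metric.closedBall z lt ⊆ U
  CR_nonneg : 0 ≤ CR

namespace Setup

variable (S : Setup d)

/-- The largest scale used for mollifiers. -/
def l₀ : ℝ := min S.lt (S.ρ / 16)

lemma l₀_pos : 0 < S.l₀ := lt_min S.lt_pos (by have := S.ρ_pos; positivity)

lemma one_le_p : 1 ≤ S.p := by
  by_contra h
  have h1 : S.p = 0 := by omega
  have := S.a_add_pos
  rw [h1] at this
  push_cast at this
  linarith [S.a_nonpos]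

/-- The compact set in which supports are allowed. -/
def Q : Set (Sp d) := innerSet S.U (3 * S.ρ / 4)

lemma Q_subset : S.Q ⊆ S.U := innerSet_subset (by have := S.ρ_pos; positivity)

/-- The bounds for a germ `F` and its reconstruction `f`. -/
structure Bd (F : S.U → 𝓓'(S.U, ℝ)) (f : 𝓓'(S.U, ℝ)) (M : ℝ) : Prop where
  M_nonneg : 0 ≤ M
  coh : ∀ x y : S.U, (x : Sp d) ∈ S.Kt → (y : Sp d) ∈ S.Kt → ∀ l ∈ Ioc 0 S.lt,
    ∀ φ ∈ testBall d S.qt, ∀ χ : 𝓓(S.U, ℝ), (∀ z, χ z = rescale φ x l z) →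
    |(F x - F y) χ| ≤ M * (l ^ S.a * (l + dist (x : Sp d) y) ^ (S.γ - S.a))
  recon : ∀ z : S.U, (z : Sp d) ∈ innerSet S.U (S.ρ / 2) → ∀ l ∈ Ioc 0 (S.ρ / 4),
    ∀ φ ∈ testBall d S.qR, ∀ χ : 𝓓(S.U, ℝ), (∀ y, χ y = rescale φ z l y) →
    |(f - F z) χ| ≤ S.CR * M * l ^ S.γ

/-- Coherence requires the test function to be centred at one of the two base points. Inserting `F
z` between `F x` and `F y` achieves this for a mollifier centred at a third point. -/
lemma exists_theta_coh : ∃ C : ℝ, 0 ≤ C ∧ ∀ F f M, S.Bd F f M → ∀ x y z : S.U,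
    (x : Sp d) ∈ S.Kt → (y : Sp d) ∈ S.Kt → (z : Sp d) ∈ S.Kt → ∀ l ∈ Ioc 0 S.l₀,
    |(F x - F y) (toTest S.U (rescale (theta d S.p) z l))| ≤ C * M * (l ^ S.a *
      ((l + dist (z : Sp d) x) ^ (S.γ - S.a) + (l + dist (z : Sp d) y) ^ (S.γ - S.a))) := by
  obtain ⟨c, hc, h⟩ := exists_abs_apply_rescale_le (theta d S.p) S.qt
  refine ⟨c, hc.le, fun F f M hB x y z hx hy hz l hl => ?_⟩
  have hl' : l ∈ Ioc 0 S.lt := ⟨hl.1, hl.2.trans (min_le_left _ _)⟩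
  have hball : Metric.closedBall (z : Sp d) l ⊆ S.U :=
    (Metric.closedBall_subset_closedBall hl'.2).trans (S.closedBall_subset z hz)
  have key : ∀ w : S.U, (w : Sp d) ∈ S.Kt →
      |(F z - F w) (toTest S.U (rescale (theta d S.p) z l))| ≤
        c * (M * (l ^ S.a * (l + dist (z : Sp d) w) ^ (S.γ - S.a))) := fun w hw =>
    h S.U (F z - F w) z l _ hl.1 hball fun φ hφ χ hχ => hB.coh z w hz hw l hl' φ hφ χ hχ
  set χ := toTest S.U (rescale (theta d S.p) z l)
  have e : (F x - F y) χ = (F z - F y) χ - (F z - F x) χ := by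
    have : ∀ G G' : 𝓓'(S.U, ℝ), (G - G') χ = G χ - G' χ := fun _ _ => rfl
    simp only [this]; ring
  rw [e]
  refine (abs_sub _ _).trans ((add_le_add (key y hy) (key x hx)).trans (le_of_eq ?_))
  ring

/-- Insert `F z` between `F x` and `f`: coherence bounds one difference and the reconstruction
property the other. The resulting `l^γ` is absorbed since `l ≤ l + |z - x|` and `a ≤ γ`. -/
lemma exists_theta_rec : ∃ C : ℝ, 0 ≤ C ∧ ∀ F f M, S.Bd F f M → ∀ x z : S.U,
    (x : Sp d) ∈ S.Kt → (z : Sp d) ∈ innerSet S.U (S.ρ / 2) → ∀ l ∈ Ioc 0 S.l₀,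
    |(F x - f) (toTest S.U (rescale (theta d S.p) z l))| ≤
      C * M * (l ^ S.a * (l + dist (z : Sp d) x) ^ (S.γ - S.a)) := by
  obtain ⟨c, hc, h⟩ := exists_abs_apply_rescale_le (theta d S.p) S.qt
  obtain ⟨c', hc', h'⟩ := exists_abs_apply_rescale_le (theta d S.p) S.qR
  have hCR := S.CR_nonneg
  refine ⟨c + c' * S.CR, by positivity, fun F f M hB x z hx hz l hl => ?_⟩
  have hM := hB.M_nonneg
  have hl0 : 0 < l := hl.1
  have hl' : l ∈ Ioc 0 S.lt := ⟨hl.1, hl.2.trans (min_le_left _ _)⟩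
  have hl'' : l ∈ Ioc 0 (S.ρ / 4) :=
    ⟨hl.1, (hl.2.trans (min_le_right _ _)).trans (by have := S.ρ_pos; linarith)⟩
  have hball : Metric.closedBall (z : Sp d) l ⊆ S.U :=
    (Metric.closedBall_subset_closedBall hl'.2).trans (S.closedBall_subset z (S.subset_Kt hz))
  have k1 := h S.U (F z - F x) z l _ hl.1 hball fun φ hφ χ hχ =>
    hB.coh z x (S.subset_Kt hz) hx l hl' φ hφ χ hχ
  have k2 := h' S.U (f - F z) z l _ hl.1 hball fun φ hφ χ hχ => hB.recon z hz l hl'' φ hφ χ hχ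
  set χ := toTest S.U (rescale (theta d S.p) z l)
  have e : (F x - f) χ = -((F z - F x) χ + (f - F z) χ) := by
    have : ∀ G G' : 𝓓'(S.U, ℝ), (G - G') χ = G χ - G' χ := fun _ _ => rfl
    simp only [this]; ring
  have hd : 0 ≤ dist (z : Sp d) x := dist_nonneg
  have hpow : l ^ S.γ ≤ l ^ S.a * (l + dist (z : Sp d) x) ^ (S.γ - S.a) := by
    have : l ^ S.γ = l ^ S.a * l ^ (S.γ - S.a) := by rw [← Real.rpow_add hl0]; congr 1; ring
    rw [this]
    gcongr
    · have := S.a_le; linarith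
    · linarith
  rw [e, abs_neg]
  refine (abs_add_le _ _).trans ((add_le_add k1 k2).trans ?_)
  calc _ ≤ c * (M * (l ^ S.a * (l + dist (z : Sp d) x) ^ (S.γ - S.a))) +
        c' * (S.CR * M * (l ^ S.a * (l + dist (z : Sp d) x) ^ (S.γ - S.a))) := by gcongr
    _ = _ := by ring

lemma exists_ball_bound {Lm : ℝ} (hLm : 0 < Lm) :
    ∃ C : ℝ, 0 ≤ C ∧ ∀ (G : 𝓓'(S.U, ℝ)) (x : Sp d) (L B A : ℝ), 0 < L → L ≤ Lm → 0 ≤ B →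
      (∀ z ∈ innerSet S.U (S.ρ / 2), dist z x ≤ 2 * L → ∀ l ∈ Ioc 0 S.l₀, l ≤ L →
        |G (toTest S.U (rescale (theta d S.p) z l))| ≤ B * l ^ S.a) →
      ∀ g : Sp d → ℝ, ContDiff ℝ (⊤ : ℕ∞) g →
      Function.support g ⊆ Metric.closedBall x L ∩ S.Q →
      (∀ y, |g y| ≤ A * (L ^ d)⁻¹) → (∀ y, ‖iteratedFDeriv ℝ S.p g y‖ ≤ A * (L ^ (d + S.p))⁻¹) →
      |G (toTest S.U g)| ≤ C * (B * A * L ^ S.a) := by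
  have hρ := S.ρ_pos
  have h1 : S.l₀ ≤ S.ρ / 16 := min_le_right _ _
  obtain ⟨C, hC, h⟩ := exists_abs_apply_le_ball d S.p S.one_le_p S.a_add_pos (s := 3 * S.ρ / 4)
    S.l₀_pos (by linarith) hLm
  refine ⟨C, hC, fun G x L B A hL hLL hB hz => h S.U G x L B A hL hLL hB fun z hz' =>
    hz z (innerSet_anti (by linarith) hz')⟩

/-- As `U` is bounded, one ball of radius `L ≥ 1` contains every support that occurs, and the powers
of `L` in the estimate become constants. -/
lemma finOrder_of_theta {G : 𝓓'(S.U, ℝ)} {B : ℝ} (hB : 0 ≤ B)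
    (h : ∀ z ∈ innerSet S.U (S.ρ / 2), ∀ l ∈ Ioc 0 S.l₀,
        |G (toTest S.U (rescale (theta d S.p) z l))| ≤ B * l ^ S.a) : FinOrder G S.p S.Q := by
  obtain ⟨R, hR⟩ := (Metric.isBounded_iff_subset_closedBall (0 : Sp d)).1 S.bdd
  set L := max R 1 with hL
  have hL0 : 0 < L := lt_max_of_lt_right one_pos
  obtain ⟨C, hC, hb⟩ := S.exists_ball_bound hL0
  refine ⟨C * (B * (L ^ (d + S.p)) * L ^ S.a), fun g hg hgQ A h0 h1 => ?_⟩
  have hA : 0 ≤ A := (abs_nonneg _).trans (h0 0)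
  have hL1 : 1 ≤ L := le_max_right _ _
  have := hb G 0 L B (A * L ^ (d + S.p)) hL0 le_rfl hB (fun z hz _ l hl _ => h z hz l hl) g
    hg.contDiff (fun y hy => ⟨Metric.closedBall_subset_closedBall (le_max_left _ _)
      (hR (S.Q_subset (hgQ hy))), hgQ hy⟩) (fun y => (h0 y).trans ?_) fun y => (h1 y).trans ?_
  · exact this.trans (le_of_eq (by ring))
  · rw [pow_add]
    have : 1 ≤ L ^ S.p := one_le_pow₀ hL1
    rw [mul_assoc, mul_comm (L ^ d), mul_assoc, mul_inv_cancel₀ (by positivity), mul_one]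
    exact le_mul_of_one_le_right hA this
  · rw [mul_assoc, mul_inv_cancel₀ (by positivity), mul_one]

variable {S}

/-- Distances to `x` are bounded in `U`, so the bound on mollifiers is uniform in their centre. This
finite order of the difference is what makes its pairings with the merely `C^p` kernel pieces exist;
nothing is claimed about `F x` or `f` separately. -/
lemma Bd.finOrder {F : S.U → 𝓓'(S.U, ℝ)} {f : 𝓓'(S.U, ℝ)} {M : ℝ} (hB : S.Bd F f M) {x : S.U}
    (hx : (x : Sp d) ∈ S.Kt) : FinOrder (F x - f) S.p S.Q := by
  obtain ⟨C, hC, h⟩ := S.exists_theta_rec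
  obtain ⟨R, hR⟩ := Metric.isBounded_iff.1 S.bdd
  have hM := hB.M_nonneg
  have hl₀ := S.l₀_pos
  have hγa : 0 ≤ S.γ - S.a := by have := S.a_le; linarith
  refine S.finOrder_of_theta (B := C * M * (S.l₀ + max R 0) ^ (S.γ - S.a)) (by positivity)
    fun z hz l hl => ?_
  have hzU : z ∈ S.U := S.Kt_subset (S.subset_Kt hz)
  refine (h F f M hB x ⟨z, hzU⟩ hx hz l hl).trans ?_
  have h1 : dist z x ≤ max R 0 := (hR hzU x.2).trans (le_max_left _ _)
  have hl0 : 0 < l := hl.1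
  have hd : 0 ≤ dist z x := dist_nonneg
  calc C * M * (l ^ S.a * (l + dist z x) ^ (S.γ - S.a))
      ≤ C * M * (l ^ S.a * (S.l₀ + max R 0) ^ (S.γ - S.a)) := by
        gcongr
        exact hl.2
    _ = _ := by ring

lemma Bd.finOrder_sub {F : S.U → 𝓓'(S.U, ℝ)} {f : 𝓓'(S.U, ℝ)} {M : ℝ} (hB : S.Bd F f M)
    {x y : S.U} (hx : (x : Sp d) ∈ S.Kt) (hy : (y : Sp d) ∈ S.Kt) :
    FinOrder (F x - F y) S.p S.Q := by
  have := (hB.finOrder hx).sub (hB.finOrder hy)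
  rwa [sub_sub_sub_cancel_right] at this

variable (S)

/-- Transfer of bounds from test functions to functions of class `C^p`. -/
lemma pair_transfer {P : ℕ → Prop} (hq : ∀ j, P j → j ≤ S.p) {G : 𝓓'(S.U, ℝ)}
    (hG : FinOrder G S.p S.Q) {x : Sp d} {L T : ℝ} (hL : 0 < L) {A : ℝ} {κ : ℝ} (hκ : 1 < κ)
    (h : ∀ g : Sp d → ℝ, IsTest S.U g → Function.support g ⊆ Metric.closedBall x (κ * L) ∩ S.Q →
      (∀ j, P j → ∀ y, ‖iteratedFDeriv ℝ j g y‖ ≤ A * (L ^ (d + j))⁻¹) → |G (toTest S.U g)| ≤ T)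
    {g : Sp d → ℝ} (hg : IsCp S.p S.Q g) (hgs : Function.support g ⊆ Metric.closedBall x L)
    (hA : ∀ j, P j → ∀ y, ‖iteratedFDeriv ℝ j g y‖ ≤ A * (L ^ (d + j))⁻¹) : |pair G g| ≤ T := by
  refine hG.abs_pair_le_of_eventually S.Q_subset hg ?_
  have h1 : 0 < κ * L - L := by nlinarith
  filter_upwards [FinOrder.eventually_isTest S.Q_subset hg (stdMoll d), Ioc_mem_nhdsGT h1]
    with ε h2 hε
  refine h _ h2.1 (fun y hy => ⟨?_, h2.2 hy⟩) fun j hj =>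
    norm_iteratedFDeriv_stdMoll_le hg.contDiff (hq j hj) (hA j hj) ε
  have h3 := support_moll_subset (stdMoll d) hgs (ε := ε) (abs_of_pos hε.1).le hy
  rw [cthickening_closedBall hε.1.le hL.le] at h3
  exact Metric.closedBall_subset_closedBall (by linarith [hε.2]) h3

end Setup

/-- The function `g` satisfies the bounds of a `C^q` function at the scale `L`. -/
def Scaled (q : ℕ) (A L : ℝ) (g : Sp d → ℝ) : Prop :=
  ∀ j, j ≤ q → ∀ y, ‖iteratedFDeriv ℝ j g y‖ ≤ A * (L ^ (d + j))⁻¹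

lemma Scaled.nonneg {q : ℕ} {A L : ℝ} {g : Sp d → ℝ} (h : Scaled q A L g) (hL : 0 < L) : 0 ≤ A :=
  nonneg_of_mul_nonneg_left ((norm_nonneg _).trans (h 0 (Nat.zero_le q) 0)) (by positivity)

lemma Scaled.mono {q : ℕ} {A A' L : ℝ} {g : Sp d → ℝ} (h : Scaled q A L g) (hL : 0 < L)
    (hA : A ≤ A') : Scaled q A' L g := fun j hj y =>
  (h j hj y).trans (mul_le_mul_of_nonneg_right hA (by positivity))

lemma Scaled.enlarge {q : ℕ} {A L κ : ℝ} {g : Sp d → ℝ} (h : Scaled q A L g) (hL : 0 < L)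
    (hκ : 1 ≤ κ) : Scaled q (A * κ ^ (d + q)) (κ * L) g := fun j hj y => by
  have hA := h.nonneg hL
  refine (h j hj y).trans ?_
  have hκ0 : 0 < κ := by linarith
  rw [mul_pow, mul_inv, mul_assoc, ← mul_assoc (κ ^ (d + q))]
  have h1 : 1 ≤ κ ^ (d + q) * (κ ^ (d + j))⁻¹ := by
    rw [← div_eq_mul_inv, one_le_div (by positivity)]
    exact pow_le_pow_right₀ hκ (by omega)
  refine mul_le_mul_of_nonneg_left ?_ hA
  exact le_mul_of_one_le_left (by positivity) h1

namespace Setup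

variable (S : Setup d)

/-- Mollifiers meeting the enlarged ball of radius `2L` have centre within `4L` of `x` and scale at
most `2L`, which gives the factor `(6L)^(γ-a)`. Together with the `L^a` of the general estimate this
makes `L^γ`. -/
lemma exists_pair_rec {Lm : ℝ} (hLm : 0 < Lm) : ∃ C : ℝ, 0 ≤ C ∧ ∀ F f M, S.Bd F f M →
    ∀ x : S.U, (x : Sp d) ∈ S.Kt → ∀ L A, 0 < L → L ≤ Lm → ∀ g, IsCp S.p S.Q g →
    Function.support g ⊆ Metric.closedBall (x : Sp d) L → Scaled S.p A L g →
    |pair (F x - f) g| ≤ C * M * A * L ^ S.γ := by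
  obtain ⟨C₁, hC₁, h₁⟩ := S.exists_theta_rec
  obtain ⟨C₂, hC₂, h₂⟩ := S.exists_ball_bound (Lm := 2 * Lm) (by positivity)
  have hγa : 0 ≤ S.γ - S.a := by have := S.a_le; linarith
  refine ⟨C₂ * C₁ * 6 ^ (S.γ - S.a) * 2 ^ (d + S.p) * 2 ^ S.a, by positivity,
    fun F f M hB x hx L A hL hLm' g hg hgs hA => ?_⟩
  have hM := hB.M_nonneg
  refine S.pair_transfer (P := fun j => j ≤ S.p) (fun j hj => hj) (hB.finOrder hx) hL
    (κ := 2) (by norm_num) (fun g' hg' hgs' hA' => ?_) hg hgs hA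
  have hA2 : Scaled S.p (A * 2 ^ (d + S.p)) (2 * L) g' := Scaled.enlarge hA' hL (by norm_num)
  refine (h₂ (F x - f) x (2 * L) (C₁ * M * (6 * L) ^ (S.γ - S.a)) (A * 2 ^ (d + S.p))
    (by positivity) (by linarith) (by positivity) (fun z hz hzx l hl hlL => ?_) g' hg'.contDiff hgs'
    (fun y => ?_) fun y => hA2 S.p le_rfl y).trans (le_of_eq ?_)
  · have hl0 : 0 < l := hl.1
    have hd : 0 ≤ dist z x := dist_nonneg
    refine (h₁ F f M hB x ⟨z, S.Kt_subset (S.subset_Kt hz)⟩ hx hz l hl).trans ?_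
    rw [mul_comm (l ^ S.a), ← mul_assoc]
    gcongr
    simp only
    linarith
  · have := hA2 0 (Nat.zero_le _) y
    rwa [norm_iteratedFDeriv_zero, add_zero] at this
  · have : L ^ S.γ = L ^ (S.γ - S.a) * L ^ S.a := by rw [← Real.rpow_add hL]; congr 1; ring
    rw [Real.mul_rpow (by norm_num) hL.le, Real.mul_rpow (by norm_num) hL.le, this]
    ring

/-- As for the reconstruction, except that the distance of the mollifier centres to `y` adds `dist x
y` to the scale. -/
lemma exists_pair_coh {Lm : ℝ} (hLm : 0 < Lm) : ∃ C : ℝ, 0 ≤ C ∧ ∀ F f M, S.Bd F f M →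
    ∀ x y : S.U, (x : Sp d) ∈ S.Kt → (y : Sp d) ∈ S.Kt → ∀ L A, 0 < L → L ≤ Lm →
    ∀ g, IsCp S.p S.Q g →
    Function.support g ⊆ Metric.closedBall (x : Sp d) L → Scaled S.p A L g →
    |pair (F x - F y) g| ≤ C * M * A * (L ^ S.a * (L + dist (x : Sp d) y) ^ (S.γ - S.a)) := by
  obtain ⟨C₁, hC₁, h₁⟩ := S.exists_theta_coh
  obtain ⟨C₂, hC₂, h₂⟩ := S.exists_ball_bound (Lm := 2 * Lm) (by positivity)
  have hγa : 0 ≤ S.γ - S.a := by have := S.a_le; linarith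
  refine ⟨C₂ * (2 * C₁) * 6 ^ (S.γ - S.a) * 2 ^ (d + S.p) * 2 ^ S.a, by positivity,
    fun F f M hB x y hx hy L A hL hLm' g hg hgs hA => ?_⟩
  have hM := hB.M_nonneg
  set δ := dist (x : Sp d) y with hδ
  have hδ0 : 0 ≤ δ := dist_nonneg
  refine S.pair_transfer (P := fun j => j ≤ S.p) (fun j hj => hj) (hB.finOrder_sub hx hy) hL
    (κ := 2) (by norm_num) (fun g' hg' hgs' hA' => ?_) hg hgs hA
  have hA2 : Scaled S.p (A * 2 ^ (d + S.p)) (2 * L) g' := Scaled.enlarge hA' hL (by norm_num)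
  refine (h₂ (F x - F y) x (2 * L) (2 * C₁ * M * (6 * (L + δ)) ^ (S.γ - S.a)) (A * 2 ^ (d + S.p))
    (by positivity) (by linarith) (by positivity) (fun z hz hzx l hl hlL => ?_) g' hg'.contDiff hgs'
    (fun y => ?_) fun y => hA2 S.p le_rfl y).trans (le_of_eq ?_)
  · have hl0 : 0 < l := hl.1
    have hd : 0 ≤ dist z x := dist_nonneg
    have hd' : 0 ≤ dist z y := dist_nonneg
    have htri := dist_triangle z x y
    refine (h₁ F f M hB x y ⟨z, S.Kt_subset (S.subset_Kt hz)⟩ hx hy (S.subset_Kt hz) l hl).trans ?_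
    have k1 : (l + dist z x) ^ (S.γ - S.a) ≤ (6 * (L + δ)) ^ (S.γ - S.a) := by
      gcongr; linarith
    have k2 : (l + dist z y) ^ (S.γ - S.a) ≤ (6 * (L + δ)) ^ (S.γ - S.a) := by
      gcongr; linarith
    calc C₁ * M * (l ^ S.a * ((l + dist z x) ^ (S.γ - S.a) + (l + dist z y) ^ (S.γ - S.a)))
        ≤ C₁ * M * (l ^ S.a * ((6 * (L + δ)) ^ (S.γ - S.a) + (6 * (L + δ)) ^ (S.γ - S.a))) := by
          gcongr
      _ = _ := by ring
  · have := hA2 0 (Nat.zero_le _) y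
    rwa [norm_iteratedFDeriv_zero, add_zero] at this
  · rw [Real.mul_rpow (by norm_num) (by positivity), Real.mul_rpow (by norm_num) hL.le]
    ring

/-- Here the coherence seminorm on `K` is applied directly, with no telescoping, so that only `q`
derivatives of the test function are needed. The slack `κ > 1` is shared between the enlargement of
the support by mollification, up to `(1 + κ)/2`, and the strict inclusion of the support at scale `κ
L`. -/
lemma exists_pair_coh_of_compact {b : ℝ} {q : ℕ} (hq : q ≤ S.p) (hb : b ≤ S.γ) {K : Set (Sp d)}
    (hK : K ⊆ S.Kt) {lb κ : ℝ} (hκ : 1 < κ) : ∃ C : ℝ, 0 ≤ C ∧ ∀ F f M, S.Bd F f M →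
    cohNorm S.U b S.γ q K lb F < ∞ →
    ∀ x y : S.U, (x : Sp d) ∈ K → (y : Sp d) ∈ K → ∀ L A, 0 < L → κ * L ≤ lb →
    ∀ g, IsCp S.p S.Q g →
    Function.support g ⊆ Metric.closedBall (x : Sp d) L → Scaled q A L g →
    |pair (F x - F y) g| ≤ C * (cohNorm S.U b S.γ q K lb F).toReal * A *
      (L ^ b * (L + dist (x : Sp d) y) ^ (S.γ - b)) := by
  have hγb : 0 ≤ S.γ - b := by linarith
  have hκ0 : 0 < κ := by linarith
  refine ⟨κ ^ (d + q) * κ ^ b * κ ^ (S.γ - b), by positivity,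
    fun F f M hB hF x y hx hy L A hL hLm' g hg hgs hA => ?_⟩
  set δ := dist (x : Sp d) y with hδ
  have hδ0 : 0 ≤ δ := dist_nonneg
  set N := (cohNorm S.U b S.γ q K lb F).toReal
  have hN : 0 ≤ N := ENNReal.toReal_nonneg
  refine S.pair_transfer (P := fun j => j ≤ q) (fun j hj => hj.trans hq)
    (hB.finOrder_sub (hK hx) (hK hy)) hL
    (κ := (1 + κ) / 2) (by linarith) (fun g' hg' hgs' hA' => ?_) hg hgs hA
  have hA2 : Scaled q (A * κ ^ (d + q)) (κ * L) g' := Scaled.enlarge hA' hL hκ.le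
  have hA0 := hA.nonneg hL
  refine (abs_apply_le_cohNorm hF hx hy (L := (1 + κ) / 2 * L) (l := κ * L) (by positivity)
    (by nlinarith) hLm' hg' (hgs'.trans inter_subset_left) hA2).trans ?_
  calc A * κ ^ (d + q) * (N * ((κ * L) ^ b * (κ * L + δ) ^ (S.γ - b)))
      ≤ A * κ ^ (d + q) * (N * ((κ * L) ^ b * (κ * (L + δ)) ^ (S.γ - b))) := by
        gcongr
        nlinarith
    _ = _ := by
        rw [Real.mul_rpow hκ0.le hL.le, Real.mul_rpow hκ0.le (by positivity)]
        ring

/-- Test functions with only `S.qt` controlled derivatives can be fed to coherence on `S.Kt`, but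
only at scales up to `S.lt`, whereas `L` may be larger. So `g` is decomposed as an integral of
localized pieces at a scale comparable to `L`, and coherence is used at the centre of each piece. -/
lemma exists_pair_coh_of_order (hq : S.qt ≤ S.p) {Lm : ℝ} (hLm : 0 < Lm) :
    ∃ C : ℝ, 0 ≤ C ∧ ∀ F f M, S.Bd F f M →
    ∀ x y : S.U, (x : Sp d) ∈ S.Kt → (y : Sp d) ∈ S.Kt → ∀ L A, 0 < L → L ≤ Lm →
    ∀ g, IsCp S.p S.Q g →
    Function.support g ⊆ Metric.closedBall (x : Sp d) L → Scaled S.qt A L g →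
    |pair (F x - F y) g| ≤ C * M * A * (L ^ S.a * (L + dist (x : Sp d) y) ^ (S.γ - S.a)) := by
  have hρ := S.ρ_pos
  have hlt := S.lt_pos
  have hγa : 0 ≤ S.γ - S.a := by have := S.a_le; linarith
  obtain ⟨cφ, hcφ, hφ⟩ := exists_iteratedFDeriv_bound (stdMoll d).contDiff
    (stdMoll d).hasCompactSupport S.qt
  -- With `s = c * L` the pieces, viewed at scale `2 * s`, are within the range of coherence, and
  -- their centres keep distance `ρ/2` from the boundary.
  set c : ℝ := min 1 (min (S.lt / 2) (S.ρ / 4) / Lm) with hc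
  have hc0 : 0 < c := lt_min one_pos (by positivity)
  have hc1 : c ≤ 1 := min_le_left _ _
  set v := volume.real (Metric.closedBall (0 : Sp d) 1)
  have hv0 : 0 ≤ v := measureReal_nonneg
  refine ⟨2 ^ S.qt * cφ * 2 ^ (d + S.qt) * 2 ^ (d + S.qt) * 4 ^ d * v * 2 ^ S.a * c ^ S.a *
    (2 * 6 ^ (S.γ - S.a)), by positivity, fun F f M hB x y hx hy L A hL hLm' g hg hgs hA => ?_⟩
  have hM := hB.M_nonneg
  have hA0 := hA.nonneg hL
  set δ := dist (x : Sp d) y with hδ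
  have hδ0 : 0 ≤ δ := dist_nonneg
  set s := c * L with hs
  have hs0 : 0 < s := by positivity
  have hsL : s ≤ L := mul_le_of_le_one_left hL.le hc1
  have hsm : s ≤ min (S.lt / 2) (S.ρ / 4) := by
    have : c * L ≤ min (S.lt / 2) (S.ρ / 4) / Lm * Lm :=
      mul_le_mul (min_le_right _ _) hLm' hL.le (by positivity)
    rwa [div_mul_cancel₀ _ hLm.ne'] at this
  have hs1 : 2 * s ≤ S.lt := by linarith [hsm.trans (min_le_left _ _)]
  have hs2 : s ≤ S.ρ / 4 := hsm.trans (min_le_right _ _)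
  refine S.pair_transfer (P := fun j => j ≤ S.qt) (fun j hj => hj.trans hq)
    (hB.finOrder_sub hx hy) hL (κ := 2) (by norm_num) (fun g' hg' hgs' hA' => ?_) hg hgs hA
  have hA2 : Scaled S.qt (A * 2 ^ (d + S.qt)) (2 * L) g' := Scaled.enlarge hA' hL (by norm_num)
  set B := Metric.closedBall (x : Sp d) (2 * L) ∩ S.Q with hBdef
  have hBc : IsCompact B := (isCompact_closedBall _ _).inter_right (isClosed_innerSet _ _)
  set Z := Metric.cthickening s B with hZ
  have hZc : IsCompact Z := hBc.cthickening
  have hZin : Z ⊆ innerSet S.U (S.ρ / 2) :=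
    (cthickening_innerSet_subset hs0.le hBc inter_subset_right).trans (innerSet_anti (by linarith))
  have hZball : Z ⊆ Metric.closedBall (x : Sp d) (4 * L) := by
    refine cthickening_subset_of_closedBall hBc hs0.le fun y hy z hz => ?_
    have ha := Metric.mem_closedBall.1 hy.1
    have hb := Metric.mem_closedBall.1 hz
    rw [Metric.mem_closedBall]
    linarith [dist_triangle z y x]
  set H : Sp d → Sp d → ℝ := fun z y => g' y * rescale (stdMoll d) z s y with hH
  have hHfam : SmoothFam ⊤ H := by
    refine SmoothFam.of_contDiff ?_
    refine (hg'.contDiff.comp contDiff_snd).mul ?_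
    exact contDiff_const.mul ((stdMoll d).contDiff.comp
      ((contDiff_snd.sub contDiff_fst).const_smul _))
  have hHs : ∀ z, Function.support (H z) ⊆ B := fun z y hy => hgs' (left_ne_zero_of_mul hy)
  have hBU : B ⊆ S.U := inter_subset_right.trans S.Q_subset
  -- A continuous partition of unity: the bumps centred at `z` integrate to one over `z`, and `Z`
  -- contains every centre whose bump meets the support of `g'`.
  have hint : (fun y => ∫ z in Z, H z y) = g' := by
    ext y
    simp only [hH]
    rw [integral_const_mul]
    by_cases hy : g' y = 0
    · rw [hy, zero_mul]
    · have : ∫ z in Z, rescale (stdMoll d) z s y = ∫ z, rescale (stdMoll d) z s y := by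
        refine setIntegral_eq_integral_of_forall_compl_eq_zero fun z hz => ?_
        by_contra h
        have h1 := support_rescale_subset (stdMoll d) z hs0 h
        rw [Metric.mem_ball] at h1
        refine hz (Metric.mem_cthickening_of_dist_le z y s B (hgs' hy) ?_)
        rw [dist_comm]; exact h1.le
      rw [this, integral_rescale_base _ hs0, integral_stdMoll, mul_one]
  have hswap := apply_toTest_integral (μ := volume) (F x - F y) hBc hBU hHfam hHs hZc
  rw [hint] at hswap
  rw [hswap]
  have hpt : ∀ z ∈ Z, ‖(F x - F y) (toTest S.U (H z))‖ ≤
      2 ^ S.qt * cφ * (A * 2 ^ (d + S.qt)) * ((2 * L) ^ d)⁻¹ * 2 ^ (d + S.qt) *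
        (M * ((2 * s) ^ S.a * (2 * (6 * (L + δ)) ^ (S.γ - S.a)))) := by
    intro z hz
    have hzKt := S.subset_Kt (hZin hz)
    have hzU := S.Kt_subset hzKt
    have hT : IsTest S.U (H z) := IsTest.of_support_subset (hHfam.1 z) hBc hBU (hHs z)
    have hsupp : Function.support (H z) ⊆ Metric.closedBall z s := fun y hy =>
      Metric.ball_subset_closedBall (support_rescale_subset _ z hs0 (right_ne_zero_of_mul hy))
    have hsc : Scaled S.qt (2 ^ S.qt * cφ * (A * 2 ^ (d + S.qt)) * ((2 * L) ^ d)⁻¹) s (H z) :=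
      fun j hj y => norm_iteratedFDeriv_mul_rescale_le (hg'.contDiff.of_le (by exact_mod_cast le_top))
        (by positivity) hs0 (by linarith) hcφ.le hφ hA2 z hj y
    have hsc2 := hsc.enlarge hs0 (κ := 2) (by norm_num)
    have key : ∀ w : S.U, (w : Sp d) ∈ S.Kt → dist z w ≤ 4 * L + δ →
        |(F ⟨z, hzU⟩ - F w) (toTest S.U (H z))| ≤
        2 ^ S.qt * cφ * (A * 2 ^ (d + S.qt)) * ((2 * L) ^ d)⁻¹ * 2 ^ (d + S.qt) *
          (M * ((2 * s) ^ S.a * (6 * (L + δ)) ^ (S.γ - S.a))) := by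
      intro w hw hzw
      have hd : 0 ≤ dist z w := dist_nonneg
      refine (abs_apply_le_of_rescale (F ⟨z, hzU⟩ - F w) (z := z) (l := 2 * s) hs0 (by linarith)
        (fun φ hφ χ hχ => hB.coh ⟨z, hzU⟩ w hzKt hw (2 * s) ⟨by positivity, hs1⟩ φ hφ χ hχ)
        hT hsupp hsc2).trans ?_
      gcongr
      simp only
      linarith
    have hzx : dist z x ≤ 4 * L := hZball hz
    have k1 := key x hx (by linarith)
    have k2 := key y hy (by linarith [dist_triangle z x y])
    have e : (F x - F y) (toTest S.U (H z)) =
        (F ⟨z, hzU⟩ - F y) (toTest S.U (H z)) - (F ⟨z, hzU⟩ - F x) (toTest S.U (H z)) := by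
      have : ∀ G G' : 𝓓'(S.U, ℝ), ∀ χ, (G - G') χ = G χ - G' χ := fun _ _ _ => rfl
      simp only [this]; ring
    rw [e, Real.norm_eq_abs]
    refine (abs_sub _ _).trans ((add_le_add k2 k1).trans (le_of_eq ?_))
    ring
  rw [← Real.norm_eq_abs]
  refine (norm_setIntegral_le_of_norm_le_const hZc.measure_lt_top hpt).trans ?_
  have hvol : volume.real Z ≤ 4 ^ d * L ^ d * v := by
    refine (measureReal_mono hZball (isCompact_closedBall _ _).measure_lt_top.ne).trans ?_
    rw [volume_closedBall_le _ (by positivity), mul_pow]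
  refine (mul_le_mul_of_nonneg_left hvol (by positivity)).trans ?_
  have h2d : ((2 * L) ^ d)⁻¹ ≤ (L ^ d)⁻¹ := by gcongr; linarith
  calc _ ≤ 2 ^ S.qt * cφ * (A * 2 ^ (d + S.qt)) * (L ^ d)⁻¹ * 2 ^ (d + S.qt) *
        (M * ((2 * s) ^ S.a * (2 * (6 * (L + δ)) ^ (S.γ - S.a)))) * (4 ^ d * L ^ d * v) := by
        gcongr
    _ = _ := by
        rw [hs, Real.mul_rpow (by norm_num) (by positivity), Real.mul_rpow hc0.le hL.le,
          Real.mul_rpow (by norm_num) (by positivity)]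
        field_simp

end Setup

/-! ### The pieces of a regularizing kernel -/

/-- A continuous cutoff function that is one at distance `2ρ` from the boundary of `U`. -/
def cut (U : Opens (Sp d)) {ρ : ℝ} (hρ : 0 < ρ) (x : Sp d) : ℝ :=
  (thickenedIndicator (show 0 < ρ / 8 by positivity) (innerSet U (2 * ρ)) x : ℝ≥0)

lemma continuous_cut (U : Opens (Sp d)) {ρ : ℝ} (hρ : 0 < ρ) : Continuous (cut U hρ) :=
  NNReal.continuous_coe.comp (thickenedIndicator _ _).continuous

lemma cut_nonneg (U : Opens (Sp d)) {ρ : ℝ} (hρ : 0 < ρ) (x : Sp d) : 0 ≤ cut U hρ x :=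
  NNReal.coe_nonneg _

lemma cut_le_one (U : Opens (Sp d)) {ρ : ℝ} (hρ : 0 < ρ) (x : Sp d) : cut U hρ x ≤ 1 := by
  exact_mod_cast thickenedIndicator_le_one _ _ x

lemma cut_eq_one {U : Opens (Sp d)} {ρ : ℝ} (hρ : 0 < ρ) {x : Sp d} (hx : x ∈ innerSet U (2 * ρ)) :
    cut U hρ x = 1 := by
  simp only [cut, thickenedIndicator_one _ _ hx, NNReal.coe_one]

lemma cut_eq_zero {U : Opens (Sp d)} {ρ : ℝ} (hρ : 0 < ρ) {x : Sp d}
    (hx : x ∉ innerSet U (15 * ρ / 8)) : cut U hρ x = 0 := by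
  have : x ∉ Metric.thickening (ρ / 8) (innerSet U (2 * ρ)) := by
    intro h
    obtain ⟨z, hz, hxz⟩ := Metric.mem_thickening_iff.1 h
    refine hx (innerSet_anti ?_ (mem_innerSet_of_dist hz hxz.le))
    linarith
  simp only [cut, thickenedIndicator_zero _ _ this, NNReal.coe_zero]

lemma two_rpow_neg_le_one (n : ℕ) : (2 : ℝ) ^ (-(n : ℝ)) ≤ 1 :=
  Real.rpow_le_one_of_one_le_of_nonpos (by norm_num) (by simp)

lemma two_rpow_neg_pos (n : ℕ) : 0 < (2 : ℝ) ^ (-(n : ℝ)) := by positivity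

lemma pd_congr {k : Fin d → ℕ} {f g : Sp d → ℝ} {x : Sp d} (h : f =ᶠ[𝓝 x] g) :
    pd k f x = pd k g x := by
  rw [pd, pd, (h.iteratedFDeriv ℝ _).eq_of_nhds]

lemma pd_const_zero (k : Fin d → ℕ) (x : Sp d) : pd k (fun _ => (0 : ℝ)) x = 0 := by
  rw [pd]
  have : (fun _ : Sp d => (0 : ℝ)) = 0 := rfl
  rw [this, iteratedFDeriv_zero]
  rfl

lemma pd_zero_eq (f : Sp d → ℝ) (x : Sp d) : pd 0 f x = f x := by
  have h0 : ∀ n (hn : n = 0) (v : Fin n → Sp d), iteratedFDeriv ℝ n f x v = f x := by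
    rintro n rfl v; simp
  exact h0 _ (by simp) _

namespace RegKernel

variable {U : Opens (Sp d)} {β ρ : ℝ} {m p : ℕ} (κ : RegKernel U β m p ρ) (hρ : 0 < ρ)

/-- The partial derivatives of the pieces in the first variable, cut off near the boundary in the
first variable and extended by zero in the second one. -/
def cutPiece (n : ℕ) (k : Fin d → ℕ) (x y : Sp d) : ℝ :=
  cut U hρ x * (U : Set (Sp d)).indicator (fun y => pd k (fun x' => κ.piece n x' y) x) y

/-- The scale of the `n`-th piece. -/
def range (_ : RegKernel U β m p ρ) (n : ℕ) : ℝ := ρ * 2 ^ (-(n : ℝ))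

lemma range_pos (hρ : 0 < ρ) (n : ℕ) : 0 < κ.range n := mul_pos hρ (two_rpow_neg_pos n)

lemma range_le (hρ : 0 < ρ) (n : ℕ) : κ.range n ≤ ρ := mul_le_of_le_one_right hρ.le (two_rpow_neg_le_one n)

lemma pd_piece_eq_zero {n : ℕ} {k : Fin d → ℕ} {x y : Sp d} (hx : x ∈ U) (hy : y ∈ U)
    (h : κ.range n < dist x y) : pd k (fun x' => κ.piece n x' y) x = 0 := by
  rw [← pd_const_zero k x]
  refine pd_congr ?_
  have h1 : ∀ᶠ x' in 𝓝 x, κ.range n < dist x' y :=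
    (continuous_id.dist continuous_const).continuousAt.eventually_const_lt h
  filter_upwards [h1, U.isOpen.mem_nhds hx] with x' h2 h3
  by_contra h4
  exact absurd (κ.supp n x' h3 y hy h4) (not_le.2 h2)

lemma cutPiece_eq_zero {n : ℕ} {k : Fin d → ℕ} {x y : Sp d} (h : κ.range n < dist x y) :
    κ.cutPiece hρ n k x y = 0 := by
  by_cases hx : x ∈ innerSet U (15 * ρ / 8)
  · have hxU : x ∈ U := innerSet_subset (by positivity) hx
    by_cases hy : y ∈ U
    · rw [cutPiece, Set.indicator_of_mem hy, κ.pd_piece_eq_zero hxU hy h, mul_zero]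
    · rw [cutPiece, Set.indicator_of_notMem hy, mul_zero]
  · rw [cutPiece, cut_eq_zero hρ hx, zero_mul]

lemma cutPiece_eq_zero_of_notMem {n : ℕ} {k : Fin d → ℕ} {x : Sp d}
    (hx : x ∉ innerSet U (15 * ρ / 8)) (y : Sp d) : κ.cutPiece hρ n k x y = 0 := by
  rw [cutPiece, cut_eq_zero hρ hx, zero_mul]

lemma support_cutPiece (n : ℕ) (k : Fin d → ℕ) (x : Sp d) :
    Function.support (κ.cutPiece hρ n k x) ⊆
      Metric.closedBall x (κ.range n) ∩ innerSet U (7 * ρ / 8) := by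
  intro y hy
  have h1 : dist y x ≤ κ.range n := by
    by_contra h
    rw [not_le, dist_comm] at h
    exact hy (κ.cutPiece_eq_zero hρ h)
  refine ⟨h1, ?_⟩
  have h2 : x ∈ innerSet U (15 * ρ / 8) := by
    by_contra h
    exact hy (κ.cutPiece_eq_zero_of_notMem hρ h y)
  refine innerSet_anti ?_ (mem_innerSet_of_dist h2 (h1.trans (κ.range_le hρ n)))
  linarith

/-- The three open sets on which the pieces have explicit expressions. -/
lemma cases_mem (hρ : 0 < ρ) (n : ℕ) (x y : Sp d) : (x ∈ U ∧ y ∈ U) ∨ x ∉ innerSet U (15 * ρ / 8) ∨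
    κ.range n < dist x y := by
  by_cases hx : x ∈ innerSet U (15 * ρ / 8)
  · by_cases hy : y ∈ U
    · exact Or.inl ⟨innerSet_subset (by positivity) hx, hy⟩
    · refine Or.inr (Or.inr ((κ.range_le hρ n).trans_lt ?_))
      by_contra h
      exact hy (hx (by rw [Metric.mem_ball, dist_comm]; linarith))
  · exact Or.inr (Or.inl hx)

lemma cutPiece_eventuallyEq {n : ℕ} {k : Fin d → ℕ} (x : Sp d) {y : Sp d} (hy : y ∈ U) :
    κ.cutPiece hρ n k x =ᶠ[𝓝 y] cut U hρ x • fun y => pd k (fun x' => κ.piece n x' y) x := by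
  filter_upwards [U.isOpen.mem_nhds hy] with y' hy'
  rw [cutPiece, Set.indicator_of_mem hy']
  rfl

lemma contDiff_cutPiece {n : ℕ} {k : Fin d → ℕ} (hk : len k ≤ m) (x : Sp d) :
    ContDiff ℝ p (κ.cutPiece hρ n k x) := by
  rw [contDiff_iff_contDiffAt]
  intro y
  rcases κ.cases_mem hρ n x y with ⟨hx, hy⟩ | hx | h
  · refine ContDiffAt.congr_of_eventuallyEq ?_ (κ.cutPiece_eventuallyEq hρ x hy)
    have h1 : ContDiffAt ℝ p (fun y => pd k (fun x' => κ.piece n x' y) x) y :=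
      ((κ.regular n).snd x hx k hk).contDiffAt (U.isOpen.mem_nhds hy)
    exact contDiffAt_const.smul h1
  · have : κ.cutPiece hρ n k x = fun _ => 0 :=
      funext (κ.cutPiece_eq_zero_of_notMem hρ hx)
    rw [this]
    exact contDiffAt_const
  · refine ContDiffAt.congr_of_eventuallyEq (f := fun _ => (0 : ℝ)) contDiffAt_const ?_
    filter_upwards [(continuous_const.dist continuous_id).continuousAt.eventually_const_lt h]
      with y' h' using κ.cutPiece_eq_zero hρ h'

lemma iteratedFDeriv_cutPiece {n : ℕ} {k : Fin d → ℕ} (hk : len k ≤ m) {x y : Sp d} (hx : x ∈ U)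
    (hy : y ∈ U) {j : ℕ} (hj : j ≤ p) : iteratedFDeriv ℝ j (κ.cutPiece hρ n k x) y =
      cut U hρ x • ∑ f : Fin j → Fin d,
        pd (cnt f) (fun y' => pd k (fun x' => κ.piece n x' y') x) y • coordML f := by
  have h1 : ContDiffAt ℝ j (fun y' => pd k (fun x' => κ.piece n x' y') x) y :=
    (((κ.regular n).snd x hx k hk).contDiffAt (U.isOpen.mem_nhds hy)).of_le (by exact_mod_cast hj)
  rw [((κ.cutPiece_eventuallyEq hρ x hy).iteratedFDeriv ℝ j).eq_of_nhds, iteratedFDeriv_const_smul_apply h1]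
  congr 1
  rw [eq_sum_coordML (iteratedFDeriv ℝ j (fun y' => pd k (fun x' => κ.piece n x' y') x) y)]
  simp only [iteratedFDeriv_bv_eq_pd _ h1]

/-- On `U × U` the derivatives are continuous because the mixed derivatives are; on the other two
open sets the function vanishes identically. Only derivatives in the second variable are involved,
so the cut-off in the first one need only be continuous. -/
lemma smoothFam_cutPiece {n : ℕ} {k : Fin d → ℕ} (hk : len k ≤ m) :
    SmoothFam p (κ.cutPiece hρ n k) := by
  refine ⟨κ.contDiff_cutPiece hρ hk, fun j hj => ?_⟩
  have hj' : j ≤ p := by exact_mod_cast hj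
  rw [continuous_iff_continuousAt]
  rintro ⟨x, y⟩
  rcases κ.cases_mem hρ n x y with ⟨hx, hy⟩ | hx | h
  · have hO : (U : Set (Sp d)) ×ˢ (U : Set (Sp d)) ∈ 𝓝 (x, y) :=
      (U.isOpen.prod U.isOpen).mem_nhds ⟨hx, hy⟩
    have h1 : (fun q : Sp d × Sp d => iteratedFDeriv ℝ j (κ.cutPiece hρ n k q.1) q.2) =ᶠ[𝓝 (x, y)]
        fun q => cut U hρ q.1 • ∑ f : Fin j → Fin d,
          pd (cnt f) (fun y' => pd k (fun x' => κ.piece n x' y') q.1) q.2 • coordML f := by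
      filter_upwards [hO] with q hq using κ.iteratedFDeriv_cutPiece hρ hk hq.1 hq.2 hj'
    refine ContinuousAt.congr ?_ h1.symm
    refine ((continuous_cut U hρ).comp continuous_fst).continuousAt.smul ?_
    refine tendsto_finsetSum _ fun f _ => ?_
    have h2 := ((κ.regular n).mixed k (cnt f) hk (by rw [len_cnt]; exact hj')).continuousAt hO
    exact Tendsto.smul h2 tendsto_const_nhds
  · have h1 : (fun q : Sp d × Sp d => iteratedFDeriv ℝ j (κ.cutPiece hρ n k q.1) q.2) =ᶠ[𝓝 (x, y)]
        fun _ => 0 := by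
      have : (innerSet U (15 * ρ / 8))ᶜ ∈ 𝓝 x := (isClosed_innerSet U _).isOpen_compl.mem_nhds hx
      filter_upwards [continuous_fst.continuousAt.preimage_mem_nhds this] with q hq
      have : κ.cutPiece hρ n k q.1 = 0 := funext (κ.cutPiece_eq_zero_of_notMem hρ hq)
      rw [this, iteratedFDeriv_zero]
      rfl
    exact ContinuousAt.congr continuousAt_const h1.symm
  · have h1 : (fun q : Sp d × Sp d => iteratedFDeriv ℝ j (κ.cutPiece hρ n k q.1) q.2) =ᶠ[𝓝 (x, y)]
        fun _ => 0 := by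
      have hO : IsOpen {q : Sp d × Sp d | κ.range n < dist q.1 q.2} :=
        isOpen_lt continuous_const (continuous_fst.dist continuous_snd)
      filter_upwards [hO.mem_nhds h] with q hq
      have : κ.cutPiece hρ n k q.1 =ᶠ[𝓝 q.2] 0 := by
        filter_upwards [(continuous_const.dist continuous_id).continuousAt.eventually_const_lt hq]
          with y' h' using κ.cutPiece_eq_zero hρ h'
      rw [(this.iteratedFDeriv ℝ j).eq_of_nhds, iteratedFDeriv_zero]
      rfl
    exact ContinuousAt.congr continuousAt_const h1.symm

/-- The kernel bounds are local, but the supports lie in the fixed compact set `innerSet U (7 * ρ /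
8)`, which turns them into global ones. -/
lemma exists_norm_iteratedFDeriv_cutPiece_le (hb : Bornology.IsBounded (U : Set (Sp d))) :
    ∃ C : ℝ, 0 ≤ C ∧ ∀ n k, len k ≤ m → ∀ j, j ≤ p → ∀ x y,
      ‖iteratedFDeriv ℝ j (κ.cutPiece hρ n k x) y‖ ≤
        C * 2 ^ (((d : ℝ) - β + j + len k) * n) := by
  obtain ⟨c, hc⟩ := κ.bound (innerSet U (7 * ρ / 8)) (isCompact_innerSet hb (by positivity))
    (innerSet_subset (by positivity))
  have hD : ∀ j ∈ Finset.range (p + 1), 0 ≤ coordConst d j := fun j _ => coordConst_nonneg d j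
  refine ⟨(∑ j ∈ Finset.range (p + 1), coordConst d j) * |c|,
    mul_nonneg (Finset.sum_nonneg hD) (abs_nonneg c), fun n k hk j hj x y => ?_⟩
  have hmain : coordConst d j * (|c| * 2 ^ (((d : ℝ) - β + j + len k) * n)) ≤
      (∑ j ∈ Finset.range (p + 1), coordConst d j) * |c| *
        2 ^ (((d : ℝ) - β + j + len k) * n) := by
    rw [← mul_assoc]
    have := Finset.single_le_sum hD (Finset.mem_range.2 (Nat.lt_succ_of_le hj))
    gcongr
  refine le_trans ?_ hmain
  by_cases hy : y ∈ innerSet U (7 * ρ / 8)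
  swap
  · rw [support_iteratedFDeriv_subset_of_isClosed (isClosed_innerSet U _)
      ((κ.support_cutPiece hρ n k x).trans inter_subset_right) j hy, norm_zero]
    have := coordConst_nonneg d j
    positivity
  by_cases hx : x ∈ innerSet U (15 * ρ / 8)
  swap
  · have : κ.cutPiece hρ n k x = 0 := funext (κ.cutPiece_eq_zero_of_notMem hρ hx)
    rw [this, iteratedFDeriv_zero, Pi.zero_apply, norm_zero]
    have := coordConst_nonneg d j
    positivity
  have hyU : y ∈ U := innerSet_subset (by positivity) hy
  have hxU : x ∈ U := innerSet_subset (by positivity) hx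
  rw [((κ.cutPiece_eventuallyEq hρ x hyU).iteratedFDeriv ℝ j).eq_of_nhds]
  have h1 : ContDiffAt ℝ j (fun y' => pd k (fun x' => κ.piece n x' y') x) y :=
    (((κ.regular n).snd x hxU k hk).contDiffAt (U.isOpen.mem_nhds hyU)).of_le
      (by exact_mod_cast hj)
  rw [iteratedFDeriv_const_smul_apply h1, norm_smul, Real.norm_of_nonneg (cut_nonneg U hρ x)]
  refine (mul_le_of_le_one_left (norm_nonneg _) (cut_le_one U hρ x)).trans ?_
  refine norm_iteratedFDeriv_le_of_pd h1 fun l hl => ?_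
  have := hc n k l hk (hl ▸ hj) x (innerSet_anti (by linarith) hx) y hy
  rw [hl] at this
  refine this.trans ?_
  gcongr
  exact le_abs_self c

end RegKernel

/-! ### Superpositions of a smooth family -/

/-- The superposition `∫ ψ(x) H_x dx` of the functions `H_x`. -/
def superpose (ψ : Sp d → ℝ) (H : Sp d → Sp d → ℝ) (y : Sp d) : ℝ := ∫ x, ψ x * H x y

lemma superpose_eq {ψ : Sp d → ℝ} {H : Sp d → Sp d → ℝ} {A : Set (Sp d)}
    (hs : Function.support ψ ⊆ A) : superpose ψ H = fun y => ∫ x in A, ψ x * H x y := by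
  ext y
  refine (setIntegral_eq_integral_of_forall_compl_eq_zero fun x hx => ?_).symm
  have : ψ x = 0 := by by_contra h; exact hx (hs h)
  rw [this, zero_mul]

lemma smoothFam_superpose {n : ℕ∞} {P : Type*} [TopologicalSpace P] [FirstCountableTopology P]
    [LocallyCompactSpace P] {H : P → Sp d → Sp d → ℝ}
    (hH : SmoothFam n fun q : P × Sp d => H q.1 q.2)
    {ψ : P → Sp d → ℝ} (hψ : Continuous fun q : P × Sp d => ψ q.1 q.2) {A : Set (Sp d)}
    (hA : IsCompact A) (hs : ∀ q, Function.support (ψ q) ⊆ A) :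
    SmoothFam n fun q => superpose (ψ q) (H q) := by
  have h1 : SmoothFam n fun (q : P × Sp d) y => ψ q.1 q.2 * H q.1 q.2 y := hH.smul hψ
  have h2 := h1.integral (μ := volume) hA
  have h3 : (fun q => superpose (ψ q) (H q)) = fun q y => ∫ x in A, ψ q x * H q x y :=
    funext fun q => superpose_eq (hs q)
  rw [h3]
  exact h2

lemma contDiff_superpose {n : ℕ∞} {H : Sp d → Sp d → ℝ} (hH : SmoothFam n H) {ψ : Sp d → ℝ}
    (hψ : Continuous ψ) {A : Set (Sp d)} (hA : IsCompact A) (hs : Function.support ψ ⊆ A) :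
    ContDiff ℝ n (superpose ψ H) :=
  (smoothFam_superpose (P := Unit) (H := fun _ => H) (ψ := fun _ => ψ)
    (hH.comp (f := fun q : Unit × Sp d => q.2) continuous_snd)
    (hψ.comp continuous_snd) hA fun _ => hs).1 ()

lemma iteratedFDeriv_superpose {n : ℕ∞} {H : Sp d → Sp d → ℝ} (hH : SmoothFam n H) {ψ : Sp d → ℝ}
    (hψ : Continuous ψ) {A : Set (Sp d)} (hA : IsCompact A) (hs : Function.support ψ ⊆ A) {j : ℕ}
    (hj : (j : ℕ∞) ≤ n) (y : Sp d) : iteratedFDeriv ℝ j (superpose ψ H) y =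
      ∫ x in A, ψ x • iteratedFDeriv ℝ j (H x) y := by
  have h1 : SmoothFam n fun (q : Unit × Sp d) y => ψ q.2 * H q.2 y :=
    (hH.comp (f := fun q : Unit × Sp d => q.2) continuous_snd).smul
      (c := fun q => ψ q.2) (hψ.comp continuous_snd)
  rw [superpose_eq hs]
  refine (h1.iteratedFDeriv_integral (μ := volume) hA () hj y).trans ?_
  refine integral_congr_ae (Eventually.of_forall fun x => ?_)
  have h2 : ContDiff ℝ j (H x) := (hH.1 x).of_le (by exact_mod_cast hj)
  have h3 := iteratedFDeriv_const_smul_apply (a := ψ x) (h2.contDiffAt (x := y))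
  exact h3

lemma norm_iteratedFDeriv_superpose_le {n : ℕ∞} {H : Sp d → Sp d → ℝ} (hH : SmoothFam n H)
    {ψ : Sp d → ℝ} (hψ : Continuous ψ) {A : Set (Sp d)} (hA : IsCompact A)
    (hs : Function.support ψ ⊆ A) {j : ℕ} (hj : (j : ℕ∞) ≤ n) {B : ℝ} (y : Sp d)
    (hB : ∀ x ∈ A, ‖iteratedFDeriv ℝ j (H x) y‖ ≤ B) :
    ‖iteratedFDeriv ℝ j (superpose ψ H) y‖ ≤ B * ∫ x, |ψ x| := by
  have h0 : ∫ x, |ψ x| = ∫ x in A, |ψ x| := by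
    refine (setIntegral_eq_integral_of_forall_compl_eq_zero fun x hx => ?_).symm
    have : ψ x = 0 := by by_contra h; exact hx (hs h)
    rw [this, abs_zero]
  rw [iteratedFDeriv_superpose hH hψ hA hs hj, h0, ← integral_const_mul]
  refine norm_integral_le_of_norm_le ((hψ.abs.const_mul B).continuousOn.integrableOn_compact hA) ?_
  rw [ae_restrict_iff' hA.measurableSet]
  refine Eventually.of_forall fun x hx => ?_
  rw [norm_smul, mul_comm, Real.norm_eq_abs]
  exact mul_le_mul_of_nonneg_right (hB x hx) (abs_nonneg _)

lemma superpose_const_mul (c : ℝ) (ψ : Sp d → ℝ) (H : Sp d → Sp d → ℝ) :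
    superpose (fun x => c * ψ x) H = fun y => c * superpose ψ H y := by
  ext y
  simp only [superpose, mul_assoc, integral_const_mul]

lemma integrable_mul_fam {n : ℕ∞} {H : Sp d → Sp d → ℝ} (hH : SmoothFam n H) {ψ : Sp d → ℝ}
    (hψ : Continuous ψ) {A : Set (Sp d)} (hA : IsCompact A) (hs : Function.support ψ ⊆ A)
    (y : Sp d) : Integrable fun x => ψ x * H x y := by
  have hc : Continuous fun x => ψ x * H x y :=
    hψ.mul (hH.continuous.comp (continuous_id.prodMk continuous_const))
  exact hc.integrable_of_hasCompactSupport (HasCompactSupport.of_support_subset_isCompact hA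
    fun x hx => hs (left_ne_zero_of_mul hx))

namespace RegKernel

variable {U : Opens (Sp d)} {β ρ : ℝ} {m p : ℕ} (κ : RegKernel U β m p ρ) (hρ : 0 < ρ)

lemma support_superpose_cutPiece {n : ℕ} {k : Fin d → ℕ} {ψ : Sp d → ℝ} {A : Set (Sp d)}
    (hs : Function.support ψ ⊆ A) :
    Function.support (superpose ψ (κ.cutPiece hρ n k)) ⊆
      Metric.cthickening (κ.range n) A ∩ innerSet U (7 * ρ / 8) := by
  intro y hy
  obtain ⟨x, hx⟩ : ∃ x, ψ x * κ.cutPiece hρ n k x y ≠ 0 := by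
    by_contra h
    push Not at h
    exact hy (by simp only [superpose, h, integral_zero])
  have h1 := κ.support_cutPiece hρ n k x (right_ne_zero_of_mul hx)
  exact ⟨closedBall_subset_cthickening' (hs (left_ne_zero_of_mul hx)) _ h1.1, h1.2⟩

lemma isCp_of_support_subset {g : Sp d → ℝ} (hg : ContDiff ℝ p g) {B : Set (Sp d)}
    (hB : IsCompact B) (hs : Function.support g ⊆ B ∩ innerSet U (7 * ρ / 8)) (hρ : 0 < ρ) :
    IsCp p (innerSet U (3 * ρ / 4)) g := by
  have hc : IsCompact (B ∩ innerSet U (7 * ρ / 8)) := hB.inter_right (isClosed_innerSet _ _)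
  refine IsCp.of_support hg hc hs (r := ρ / 8) (by positivity) ?_
  refine (cthickening_innerSet_subset (by positivity) hc inter_subset_right).trans
    (innerSet_anti (by linarith))

lemma isCp_cutPiece {n : ℕ} {k : Fin d → ℕ} (hk : len k ≤ m) (x : Sp d) :
    IsCp p (innerSet U (3 * ρ / 4)) (κ.cutPiece hρ n k x) :=
  isCp_of_support_subset (κ.contDiff_cutPiece hρ hk x) (isCompact_closedBall _ _)
    (κ.support_cutPiece hρ n k x) hρ

lemma isCp_superpose {n : ℕ} {k : Fin d → ℕ} (hk : len k ≤ m) {ψ : Sp d → ℝ} (hψ : Continuous ψ)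
    {A : Set (Sp d)} (hA : IsCompact A) (hs : Function.support ψ ⊆ A) :
    IsCp p (innerSet U (3 * ρ / 4)) (superpose ψ (κ.cutPiece hρ n k)) :=
  isCp_of_support_subset (contDiff_superpose (κ.smoothFam_cutPiece hρ hk) hψ hA hs)
    hA.cthickening (κ.support_superpose_cutPiece hρ hs) hρ

/-- The transposed action of a piece in terms of the cut off pieces. -/
lemma dual_eq {n : ℕ} {ψ : Sp d → ℝ} (hs : Function.support ψ ⊆ innerSet U (2 * ρ)) :
    κ.dual n ψ = superpose ψ (κ.cutPiece hρ n 0) := by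
  have hU : innerSet U (2 * ρ) ⊆ U := innerSet_subset (by positivity)
  ext y
  by_cases hy : y ∈ (U : Set (Sp d))
  · rw [RegKernel.dual, Set.indicator_of_mem hy, superpose]
    refine Eq.trans ?_
      (setIntegral_eq_integral_of_forall_compl_eq_zero (s := (U : Set (Sp d))) fun x hx => ?_)
    · refine setIntegral_congr_fun U.isOpen.measurableSet fun x _ => ?_
      by_cases hx : ψ x = 0
      · simp only [hx, mul_zero, zero_mul]
      · rw [cutPiece, cut_eq_one hρ (hs hx), Set.indicator_of_mem hy, pd_zero_eq, one_mul]
        exact mul_comm _ _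
    · have : ψ x = 0 := by by_contra h; exact hx (hU (hs h))
      rw [this, zero_mul]
  · rw [RegKernel.dual, Set.indicator_of_notMem hy, superpose]
    simp only [cutPiece, Set.indicator_of_notMem hy, mul_zero, integral_zero]

/-! ### Integration by parts -/

end RegKernel

lemma integrable_mul_of_tsupport {V : Set (Sp d)} (hV : IsOpen V) {f g : Sp d → ℝ}
    (hf : ContinuousOn f V) (hg : Continuous g) (hgc : HasCompactSupport g) (hgV : tsupport g ⊆ V) :
    Integrable fun x => f x * g x := by
  have h1 : tsupport (fun x => f x * g x) ⊆ tsupport g :=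
    closure_mono fun x hx => right_ne_zero_of_mul hx
  refine Continuous.integrable_of_hasCompactSupport ?_ (hgc.mono' ?_)
  · refine continuous_of_tsupport fun x hx => ?_
    exact (hf.continuousAt (hV.mem_nhds (hgV (h1 hx)))).mul hg.continuousAt
  · exact (subset_tsupport _).trans h1

/-- The iterated transposed derivative of a test function. -/
def adjDeriv {V : Opens (Sp d)} : ∀ {n : ℕ}, (Fin n → Sp d) → 𝓓(V, ℝ) → 𝓓(V, ℝ)
  | 0, _, χ => χ
  | _ + 1, v, χ => adjDeriv (Fin.tail v) (-(TestFunction.lineDerivCLM ℝ (v 0) χ : 𝓓(V, ℝ)))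

lemma iteratedLineDerivOp_apply {V : Opens (Sp d)} (T : 𝓓'(V, ℝ)) {n : ℕ} (v : Fin n → Sp d)
    (χ : 𝓓(V, ℝ)) : (∂^{v} T) χ = T (adjDeriv v χ) := by
  induction n generalizing χ with
  | zero => rfl
  | succ n ih =>
    rw [LineDeriv.iteratedLineDerivOp_succ_left, adjDeriv, ← ih, map_neg]
    exact Distribution.lineDerivCLM_apply

lemma lineDerivCLM_apply' {V : Opens (Sp d)} (v : Sp d) (χ : 𝓓(V, ℝ)) (x : Sp d) :
    (TestFunction.lineDerivCLM ℝ v χ : 𝓓(V, ℝ)) x = fderiv ℝ χ x v := by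
  have hd : DifferentiableAt ℝ χ x := (χ.contDiff.differentiable (by simp)).differentiableAt
  rw [← hd.lineDeriv_eq_fderiv]
  exact TestFunction.lineDerivCLM_apply_of_le (by simp)

/-- Repeated integration by parts. The function `u` is differentiable only on `V`, which suffices
because all products carry a factor supported in `V`. -/
lemma integral_mul_adjDeriv {V : Opens (Sp d)} {n : ℕ} {u : Sp d → ℝ} (hu : ContDiffOn ℝ n u V)
    (v : Fin n → Sp d) (χ : 𝓓(V, ℝ)) :
    ∫ x, u x * adjDeriv v χ x = ∫ x, iteratedFDeriv ℝ n u x v * χ x := by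
  induction n generalizing χ with
  | zero => simp [adjDeriv]
  | succ n ih =>
    have hD : DifferentiableOn ℝ (iteratedFDeriv ℝ n u) V := fun x hx =>
      ((hu.contDiffAt (V.isOpen.mem_nhds hx)).differentiableAt_iteratedFDeriv
        (by exact_mod_cast Nat.lt_succ_self n)).differentiableWithinAt
    set f : Sp d → ℝ := fun x => iteratedFDeriv ℝ n u x (Fin.tail v) with hf
    have hfd : ∀ x ∈ V, HasFDerivAt f
        ((ContinuousMultilinearMap.apply ℝ (fun _ : Fin n => Sp d) ℝ (Fin.tail v)).comp
          (fderiv ℝ (iteratedFDeriv ℝ n u) x)) x := fun x hx =>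
      (ContinuousMultilinearMap.apply ℝ (fun _ : Fin n => Sp d) ℝ
        (Fin.tail v)).hasFDerivAt.comp x
        ((hD x hx).differentiableAt (V.isOpen.mem_nhds hx)).hasFDerivAt
    have hf' : ∀ x ∈ V, fderiv ℝ f x (v 0) = iteratedFDeriv ℝ (n + 1) u x v := fun x hx => by
      rw [(hfd x hx).fderiv, iteratedFDeriv_succ_apply_left]
      rfl
    have hfc : ContinuousOn f V := fun x hx => (hfd x hx).continuousAt.continuousWithinAt
    have hf'c : ContinuousOn (fun x => fderiv ℝ f x (v 0)) V := by
      refine ContinuousOn.congr (f := fun x => iteratedFDeriv ℝ (n + 1) u x v) ?_ hf'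
      intro x hx
      have h1 : ContinuousAt (iteratedFDeriv ℝ (n + 1) u) x :=
        (hu.contDiffAt (V.isOpen.mem_nhds hx)).continuousAt_iteratedFDeriv le_rfl
      exact ((ContinuousMultilinearMap.apply ℝ (fun _ : Fin (n + 1) => Sp d) ℝ
        v).continuous.continuousAt.comp h1).continuousWithinAt
    have hdχ : Continuous fun x => fderiv ℝ χ x (v 0) := by
      have := (TestFunction.lineDerivCLM ℝ (v 0) χ : 𝓓(V, ℝ)).continuous
      simpa only [← lineDerivCLM_apply'] using this
    have hdχs : tsupport (fun x => fderiv ℝ χ x (v 0)) ⊆ tsupport χ :=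
      tsupport_fderiv_apply_subset ℝ (v 0)
    have hχd : Differentiable ℝ χ := χ.contDiff.differentiable (by simp)
    rw [adjDeriv, ih (hu.of_le (by exact_mod_cast Nat.le_succ n))]
    have e1 : ∀ x, iteratedFDeriv ℝ n u x (Fin.tail v) *
        (-(TestFunction.lineDerivCLM ℝ (v 0) χ : 𝓓(V, ℝ))) x = -(f x * fderiv ℝ χ x (v 0)) := by
      intro x
      have : (-(TestFunction.lineDerivCLM ℝ (v 0) χ : 𝓓(V, ℝ))) x = - fderiv ℝ χ x (v 0) := by
        rw [← lineDerivCLM_apply']; rfl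
      rw [this, mul_neg]
    simp only [e1]
    rw [integral_neg, integral_mul_fderiv_eq_neg_fderiv_mul_of_integrable
      (integrable_mul_of_tsupport V.isOpen hf'c χ.continuous χ.hasCompactSupport χ.tsupport_subset)
      (integrable_mul_of_tsupport V.isOpen hfc hdχ (χ.hasCompactSupport.mono'
        ((subset_tsupport _).trans hdχs)) (hdχs.trans χ.tsupport_subset))
      (integrable_mul_of_tsupport V.isOpen hfc χ.continuous χ.hasCompactSupport χ.tsupport_subset)
      (fun x hx => (hfd x (χ.tsupport_subset hx)).differentiableAt)
      (fun x _ => hχd x), neg_neg]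
    refine integral_congr_ae (Eventually.of_forall fun x => ?_)
    by_cases hx : χ x = 0
    · simp only [hx, mul_zero]
    · simp only
      rw [hf' x (χ.tsupport_subset (subset_tsupport _ hx))]

lemma tsupport_adjDeriv {V : Opens (Sp d)} {n : ℕ} (v : Fin n → Sp d) (χ : 𝓓(V, ℝ)) :
    tsupport (adjDeriv v χ) ⊆ tsupport χ := by
  induction n generalizing χ with
  | zero => exact subset_rfl
  | succ n ih =>
    rw [adjDeriv]
    refine (ih _ _).trans ?_
    have : ⇑(-(TestFunction.lineDerivCLM ℝ (v 0) χ : 𝓓(V, ℝ))) = fun x => - fderiv ℝ χ x (v 0) := by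
      ext x
      rw [← lineDerivCLM_apply']; rfl
    rw [this]
    refine closure_minimal (fun x hx => ?_) (isClosed_tsupport _)
    exact tsupport_fderiv_apply_subset ℝ (v 0) (subset_tsupport _ (neg_ne_zero.1 hx))

namespace RegKernel

variable {U : Opens (Sp d)} {β ρ : ℝ} {m p : ℕ} (κ : RegKernel U β m p ρ) (hρ : 0 < ρ)

/-- Integration by parts in the first kernel variable. It rewrites a derivative of the image as
pairings with the differentiated pieces, and conversely allows derivatives to be moved back to the
test function. On its support the cut-off equals one. -/
lemma superpose_adjDeriv {n : ℕ} {k : Fin d → ℕ} (hk : len k ≤ m)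
    (χ : 𝓓(shrink U (2 * ρ), ℝ)) :
    superpose (adjDeriv (dirs k) χ) (κ.cutPiece hρ n 0) = superpose χ (κ.cutPiece hρ n k) := by
  have hin : (shrink U (2 * ρ) : Set (Sp d)) ⊆ innerSet U (2 * ρ) :=
    shrink_subset_innerSet (by positivity)
  ext y
  by_cases hy : y ∈ (U : Set (Sp d))
  · have hu : ContDiffOn ℝ (∑ i, k i : ℕ) (fun x => κ.piece n x y) (shrink U (2 * ρ)) :=
      (((κ.regular n).fst y hy).mono (shrink_le U _)).of_le (by exact_mod_cast hk)
    have h1 := integral_mul_adjDeriv hu (dirs k) χ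
    rw [superpose, superpose]
    refine Eq.trans (integral_congr_ae (Eventually.of_forall fun x => ?_))
      (h1.trans (integral_congr_ae (Eventually.of_forall fun x => ?_)))
    · by_cases hx : adjDeriv (dirs k) χ x = 0
      · simp only [hx, mul_zero, zero_mul]
      · have hxV := χ.tsupport_subset (tsupport_adjDeriv _ _ (subset_tsupport _ hx))
        simp only [cutPiece]
        rw [cut_eq_one hρ (hin hxV), Set.indicator_of_mem hy, pd_zero_eq, one_mul, mul_comm]
    · by_cases hx : χ x = 0
      · simp only [hx, mul_zero, zero_mul]
      · have hxV := χ.tsupport_subset (subset_tsupport _ hx)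
        simp only [cutPiece]
        rw [cut_eq_one hρ (hin hxV), Set.indicator_of_mem hy, one_mul, mul_comm]
        rfl
  · simp only [superpose, cutPiece, Set.indicator_of_notMem hy, mul_zero, integral_zero]

end RegKernel

/-! ### Estimates based on moments -/

lemma pd_superpose {n : ℕ∞} {H : Sp d → Sp d → ℝ} (hH : SmoothFam n H) {ψ : Sp d → ℝ}
    (hψ : Continuous ψ) {A : Set (Sp d)} (hA : IsCompact A) (hs : Function.support ψ ⊆ A)
    {k : Fin d → ℕ} (hk : (len k : ℕ∞) ≤ n) (y : Sp d) :
    pd k (superpose ψ H) y = ∫ x in A, ψ x * pd k (H x) y := by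
  have hc : Continuous fun x => ψ x • iteratedFDeriv ℝ (∑ i, k i) (H x) y :=
    hψ.smul ((hH.2 _ hk).comp (continuous_id.prodMk continuous_const))
  have hi : IntegrableOn (fun x => ψ x • iteratedFDeriv ℝ (∑ i, k i) (H x) y) A :=
    hc.continuousOn.integrableOn_compact hA
  have h := (ContinuousMultilinearMap.apply ℝ (fun _ : Fin (∑ i, k i) => Sp d) ℝ
    (dirs k)).integral_comp_comm hi
  rw [pd, iteratedFDeriv_superpose hH hψ hA hs (j := ∑ i, k i)
    (show ((∑ i, k i : ℕ) : ℕ∞) ≤ n from hk)]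
  exact h.symm

lemma volume_real_le_of_subset {s : Set (Sp d)} {y : Sp d} {r : ℝ} (hr : 0 ≤ r)
    (h : s ⊆ Metric.closedBall y r) :
    volume.real s ≤ r ^ d * volume.real (Metric.closedBall (0 : Sp d) 1) := by
  rw [← volume_closedBall_le y hr]
  exact measureReal_mono h (isCompact_closedBall _ _).measure_lt_top.ne

lemma neg_prod_eq {j : ℕ} (f : Fin j → Fin d) (x y : Sp d) :
    ∏ a, (x - y) (f a) = (-1) ^ j * mono (cnt f) x y := by
  rw [mono_cnt]
  have : ∀ a, (x - y) (f a) = (-1) * (y - x) (f a) := fun a => by simp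
  simp only [this, Finset.prod_mul_distrib, Finset.prod_const, Finset.card_univ, Fintype.card_fin]

lemma apply_const_eq_sum_mono {j : ℕ} (T : Sp d [×j]→L[ℝ] ℝ) (x y : Sp d) :
    (T fun _ => x - y) =
      ∑ f : Fin j → Fin d, T (fun a => bv (f a)) * ((-1) ^ j * mono (cnt f) x y) := by
  conv_lhs => rw [eq_sum_coordML T]
  rw [sum_apply]
  refine Finset.sum_congr rfl fun f _ => ?_
  rw [smul_apply, coordML_apply, smul_eq_mul, neg_prod_eq]

lemma abs_apply_bv_le {j : ℕ} (T : Sp d [×j]→L[ℝ] ℝ) (f : Fin j → Fin d) :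
    |T fun a => bv (f a)| ≤ ‖T‖ := by
  have := T.le_opNorm fun a => bv (f a)
  simpa [norm_bv] using this

namespace RegKernel

variable {U : Opens (Sp d)} {β ρ : ℝ} {m p : ℕ} (κ : RegKernel U β m p ρ) (hρ : 0 < ρ)

lemma pd_snd_eq_zero {n : ℕ} {k : Fin d → ℕ} {x y : Sp d} (hx : x ∈ U) (hy : y ∈ U)
    (h : κ.range n < dist x y) : pd k (fun y' => κ.piece n x y') y = 0 := by
  rw [← pd_const_zero k y]
  refine pd_congr ?_
  have h1 : ∀ᶠ y' in 𝓝 y, κ.range n < dist x y' :=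
    (continuous_const.dist continuous_id).continuousAt.eventually_const_lt h
  filter_upwards [h1, U.isOpen.mem_nhds hy] with y' h2 h3
  by_contra h4
  exact absurd (κ.supp n x hx y' h3 h4) (not_le.2 h2)

lemma pd_cutPiece {n : ℕ} {k : Fin d → ℕ} {x y : Sp d} (hx : x ∈ innerSet U (2 * ρ)) (hy : y ∈ U) :
    pd k (κ.cutPiece hρ n 0 x) y = pd k (fun y' => κ.piece n x y') y := by
  refine pd_congr ?_
  filter_upwards [U.isOpen.mem_nhds hy] with y' hy'
  rw [cutPiece, cut_eq_one hρ hx, Set.indicator_of_mem hy', pd_zero_eq, one_mul]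

/-- The estimate from the bounds on the moments of the pieces. -/
lemma exists_norm_iteratedFDeriv_dual_le_succ (hb : Bornology.IsBounded (U : Set (Sp d))) :
    ∃ C : ℝ, 0 ≤ C ∧ ∀ n, 1 ≤ n → ∀ j, j ≤ p → ∀ ψ : Sp d → ℝ, ContDiff ℝ j ψ →
      ∀ A, IsCompact A → Function.support ψ ⊆ A → A ⊆ innerSet U (2 * ρ) → ∀ B,
      (∀ i, i ≤ j → ∀ y, ‖iteratedFDeriv ℝ i ψ y‖ ≤ B) →
      ∀ y, ‖iteratedFDeriv ℝ j (superpose ψ (κ.cutPiece hρ n 0)) y‖ ≤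
        C * 2 ^ (-β * n) * B := by
  obtain ⟨c, hc⟩ := κ.bound (innerSet U ρ) (isCompact_innerSet hb hρ) (innerSet_subset hρ)
  obtain ⟨c', hc'⟩ := κ.moment (innerSet U (3 * ρ / 2)) (isCompact_innerSet hb (by positivity))
    (innerSet_subset (by positivity))
  set v := volume.real (Metric.closedBall (0 : Sp d) 1)
  have hv : 0 ≤ v := measureReal_nonneg
  set D : ℝ := ∑ j ∈ Finset.range (p + 1), (coordConst d j *
    (ρ ^ j * |c| * ρ ^ d * v + ∑ i ∈ Finset.range j, (d : ℝ) ^ i * |c'|)) with hD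
  have hterm : ∀ j, 0 ≤ coordConst d j *
      (ρ ^ j * |c| * ρ ^ d * v + ∑ i ∈ Finset.range j, (d : ℝ) ^ i * |c'|) := fun j => by
    have := coordConst_nonneg d j
    have h2 : 0 ≤ ∑ i ∈ Finset.range j, (d : ℝ) ^ i * |c'| :=
      Finset.sum_nonneg fun i _ => by positivity
    positivity
  refine ⟨D, Finset.sum_nonneg fun j _ => hterm j,
    fun n hn j hj ψ hψ A hA hs hAin B hB y => ?_⟩
  have hB0 : 0 ≤ B := (norm_nonneg _).trans (hB 0 (Nat.zero_le j) y)
  have hfam := κ.smoothFam_cutPiece hρ (n := n) (k := 0) (by simp [len])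
  have hψc : Continuous ψ := hψ.continuous
  -- This uses `n ≥ 1`. From a support at distance `2ρ` one gets to points `y` at distance `3ρ/2`,
  -- and from there to points `x` at distance `ρ`, where the bound `hc` on the piece applies.
  have hrange : κ.range n ≤ ρ / 2 := by
    have : (2 : ℝ) ^ (-(n : ℝ)) ≤ 2⁻¹ := by
      rw [← Real.rpow_neg_one]
      refine Real.rpow_le_rpow_of_exponent_le (by norm_num) ?_
      have : (1 : ℝ) ≤ n := by exact_mod_cast hn
      linarith
    rw [range]
    nlinarith
  have hr0 := κ.range_pos hρ n
  have hfinal : coordConst d j * (ρ ^ j * |c| * ρ ^ d * v + ∑ i ∈ Finset.range j,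
      (d : ℝ) ^ i * |c'|) * 2 ^ (-β * n) * B ≤ D * 2 ^ (-β * n) * B := by
    have := Finset.single_le_sum (fun j _ => hterm j) (Finset.mem_range.2 (Nat.lt_succ_of_le hj))
    gcongr
  refine le_trans ?_ hfinal
  by_cases hy : y ∈ innerSet U (3 * ρ / 2)
  swap
  · have hsub : Function.support (superpose ψ (κ.cutPiece hρ n 0)) ⊆ innerSet U (3 * ρ / 2) := by
      refine ((κ.support_superpose_cutPiece hρ hs).trans inter_subset_left).trans ?_
      refine (cthickening_innerSet_subset hr0.le hA hAin).trans (innerSet_anti (by linarith))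
    rw [support_iteratedFDeriv_subset_of_isClosed (isClosed_innerSet U _) hsub j hy, norm_zero]
    have := hterm j
    positivity
  have hyU : y ∈ (U : Set (Sp d)) := innerSet_subset (by positivity) hy
  have hAU : A ⊆ U := hAin.trans (innerSet_subset (by positivity))
  rw [mul_assoc, mul_assoc]
  refine norm_iteratedFDeriv_le_of_pd ((contDiff_superpose hfam hψc hA hs).of_le
    (by exact_mod_cast hj)).contDiffAt fun k hk => ?_
  have hkp : len k ≤ p := hk ▸ hj
  set P : Sp d → ℝ := fun x => pd k (fun y' => κ.piece n x y') y with hP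
  -- Differentiating the piece `j` times costs `2^{jn}`. To recover it, `ψ` is split into its Taylor
  -- polynomial at `y` of degree below `j` and a remainder.
  set T : Sp d → ℝ := fun x => ∑ i ∈ Finset.range j, ((i.factorial : ℝ))⁻¹ *
    iteratedFDeriv ℝ i ψ y fun _ => x - y with hT
  have hT' : ∀ x, T x * P x = ∑ i ∈ Finset.range j, ∑ f : Fin i → Fin d,
      (((i.factorial : ℝ))⁻¹ * iteratedFDeriv ℝ i ψ y (fun a => bv (f a)) * (-1) ^ i) *
        (mono (cnt f) x y * P x) := by
    intro x
    simp only [hT, Finset.sum_mul, apply_const_eq_sum_mono, Finset.mul_sum]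
    refine Finset.sum_congr rfl fun i _ => Finset.sum_congr rfl fun f _ => by ring
  have hmono : ∀ i ∈ Finset.range j, ∀ f : Fin i → Fin d,
      IntegrableOn (fun x => mono (cnt f) x y * P x) U := fun i hi f =>
    κ.moment_integrable n k (cnt f) hkp (by
      rw [len_cnt]; exact (Finset.mem_range.1 hi).le.trans hj) y hyU
  have hTint : IntegrableOn (fun x => T x * P x) U := by
    simp only [hT']
    refine integrable_finsetSum _ fun i hi => integrable_finsetSum _ fun f _ => ?_
    exact (hmono i hi f).const_mul _
  -- The polynomial part is a combination of moments of the differentiated piece, each of order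
  -- `2^{-βn}` by hypothesis.
  have hTbound : |∫ x in (U : Set (Sp d)), T x * P x| ≤
      (∑ i ∈ Finset.range j, (d : ℝ) ^ i * |c'|) * (2 ^ (-β * n) * B) := by
    simp only [hT']
    rw [integral_finsetSum _ fun i hi => integrable_finsetSum _ fun f _ =>
      (hmono i hi f).const_mul _, Finset.sum_mul]
    refine (Finset.abs_sum_le_sum_abs _ _).trans (Finset.sum_le_sum fun i hi => ?_)
    rw [integral_finsetSum _ fun f _ => (hmono i hi f).const_mul _]
    refine (Finset.abs_sum_le_sum_abs _ _).trans ?_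
    have hone : ∀ f ∈ (Finset.univ : Finset (Fin i → Fin d)),
        |∫ x in (U : Set (Sp d)), (((i.factorial : ℝ))⁻¹ *
          iteratedFDeriv ℝ i ψ y (fun a => bv (f a)) * (-1) ^ i) * (mono (cnt f) x y * P x)| ≤
        |c'| * (2 ^ (-β * n) * B) := by
      intro f _
      have hij := (Finset.mem_range.1 hi).le
      rw [integral_const_mul, abs_mul, abs_mul, abs_mul, abs_pow, abs_neg, abs_one, one_pow,
        mul_one]
      have h1 : |((i.factorial : ℝ))⁻¹| ≤ 1 := by
        rw [abs_of_nonneg (by positivity)]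
        exact inv_le_one_of_one_le₀ (by exact_mod_cast Nat.one_le_iff_ne_zero.2 i.factorial_ne_zero)
      have h2 := (abs_apply_bv_le (iteratedFDeriv ℝ i ψ y) f).trans (hB i hij y)
      have h3 := hc' n k (cnt f) hkp (by rw [len_cnt]; exact hij.trans hj) y hy
      calc _ ≤ 1 * B * (c' * 2 ^ (-β * n)) := by gcongr
        _ ≤ 1 * B * (|c'| * 2 ^ (-β * n)) := by
          gcongr
          exact le_abs_self c'
        _ = _ := by ring
    refine (Finset.sum_le_sum hone).trans (le_of_eq ?_)
    rw [Finset.sum_const, Finset.card_univ, Fintype.card_fun, Fintype.card_fin, Fintype.card_fin,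
      nsmul_eq_mul]
    push_cast
    ring
  have hψP : ∀ x, ψ x * pd k (κ.cutPiece hρ n 0 x) y = ψ x * P x := by
    intro x
    by_cases hx : ψ x = 0
    · rw [hx, zero_mul, zero_mul]
    · rw [κ.pd_cutPiece hρ (hAin (hs hx)) hyU]
  have hψPint : IntegrableOn (fun x => ψ x * P x) U := by
    have hc1 : Continuous fun x => ψ x * P x := by
      simp only [← hψP]
      refine hψc.mul ?_
      have := (hfam.2 (∑ i, k i) (by exact_mod_cast hkp)).comp
        (continuous_id.prodMk (continuous_const (y := y)))
      exact (ContinuousMultilinearMap.apply ℝ (fun _ : Fin (∑ i, k i) => Sp d) ℝ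
        (dirs k)).continuous.comp this
    exact (hc1.integrable_of_hasCompactSupport (HasCompactSupport.of_support_subset_isCompact hA
      fun x hx => hs (left_ne_zero_of_mul hx))).integrableOn
  have hpd : pd k (superpose ψ (κ.cutPiece hρ n 0)) y = ∫ x in (U : Set (Sp d)), ψ x * P x := by
    rw [pd_superpose hfam hψc hA hs (by exact_mod_cast hkp)]
    simp only [hψP]
    refine (setIntegral_eq_of_subset_of_forall_sdiff_eq_zero U.isOpen.measurableSet hAU
      fun x hx => ?_).symm
    have : ψ x = 0 := by by_contra h; exact hx.2 (hs h)
    rw [this, zero_mul]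
  have hsplit : pd k (superpose ψ (κ.cutPiece hρ n 0)) y =
      (∫ x in (U : Set (Sp d)), (ψ x - T x) * P x) + ∫ x in (U : Set (Sp d)), T x * P x := by
    have hi : IntegrableOn (fun x => (ψ x - T x) * P x) U := by
      simp only [sub_mul]
      exact hψPint.sub hTint
    rw [hpd, ← integral_add hi hTint]
    refine integral_congr_ae (Eventually.of_forall fun x => ?_)
    simp only
    ring
  -- The remainder gains the `j`-th power of the range, the volume of the support gains its `d`-th
  -- power, and together they turn `2^{(d-β+j)n}` into `2^{-βn}`.
  have hR : |∫ x in (U : Set (Sp d)), (ψ x - T x) * P x| ≤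
      ρ ^ j * |c| * ρ ^ d * v * (2 ^ (-β * n) * B) := by
    have hball : ∫ x in (U : Set (Sp d)), (ψ x - T x) * P x =
        ∫ x in (U : Set (Sp d)) ∩ Metric.closedBall y (κ.range n), (ψ x - T x) * P x := by
      refine setIntegral_eq_of_subset_of_forall_sdiff_eq_zero U.isOpen.measurableSet
        inter_subset_left fun x hx => ?_
      have h1 : κ.range n < dist x y := by
        by_contra h
        exact hx.2 ⟨hx.1, not_lt.1 h⟩
      rw [hP]
      simp only
      rw [κ.pd_snd_eq_zero hx.1 hyU h1, mul_zero]
    have hq : (2 : ℝ) ^ (-(n : ℝ)) = (2 ^ (n : ℝ))⁻¹ := Real.rpow_neg (by norm_num) _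
    have hbd : ∀ x ∈ (U : Set (Sp d)) ∩ Metric.closedBall y (κ.range n),
        ‖(ψ x - T x) * P x‖ ≤ B * κ.range n ^ j * (|c| * 2 ^ (((d : ℝ) - β + j) * n)) := by
      intro x hx
      have hxy : dist x y ≤ κ.range n := hx.2
      have h1 := abs_sub_taylor_le (f := ψ) (x := y) (v := x - y) j (A := B)
        (fun t _ => hψ.contDiffAt) fun t _ => hB j le_rfl _
      rw [add_sub_cancel] at h1
      have h2 : ‖x - y‖ ≤ κ.range n := by rwa [← dist_eq_norm]
      have hxin : x ∈ innerSet U ρ :=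
        innerSet_anti (by linarith) (mem_innerSet_of_dist hy hxy)
      have h3 := hc n 0 k (by simp [len]) hkp x hxin y (innerSet_anti (by linarith) hy)
      simp only [pd_zero_eq] at h3
      have h0 : len (0 : Fin d → ℕ) = 0 := by simp [len]
      rw [hk, h0] at h3
      rw [norm_mul, Real.norm_eq_abs, Real.norm_eq_abs]
      refine mul_le_mul (h1.trans ?_) (h3.trans ?_) (abs_nonneg _) (by positivity)
      · gcongr
      · rw [Nat.cast_zero, add_zero]
        gcongr
        exact le_abs_self c
    rw [hball, ← Real.norm_eq_abs]
    have hfin : volume ((U : Set (Sp d)) ∩ Metric.closedBall y (κ.range n)) < ⊤ :=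
      (measure_mono inter_subset_right).trans_lt (isCompact_closedBall _ _).measure_lt_top
    refine (norm_setIntegral_le_of_norm_le_const hfin hbd).trans ?_
    refine (mul_le_mul_of_nonneg_left (volume_real_le_of_subset hr0.le inter_subset_right)
      (by positivity)).trans (le_of_eq ?_)
    have hpow : κ.range n ^ j * κ.range n ^ d * 2 ^ (((d : ℝ) - β + j) * n) =
        ρ ^ j * ρ ^ d * 2 ^ (-β * n) := by
      rw [range, mul_pow, mul_pow, ← Real.rpow_natCast (2 ^ (-(n : ℝ))) j,
        ← Real.rpow_natCast (2 ^ (-(n : ℝ))) d, ← Real.rpow_mul (by norm_num),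
        ← Real.rpow_mul (by norm_num)]
      have : (2 : ℝ) ^ (-β * n) = 2 ^ (-(n : ℝ) * j) * 2 ^ (-(n : ℝ) * d) *
          2 ^ (((d : ℝ) - β + j) * n) := by
        rw [← Real.rpow_add (by norm_num), ← Real.rpow_add (by norm_num)]
        congr 1; ring
      rw [this]
      ring
    calc B * κ.range n ^ j * (|c| * 2 ^ (((d : ℝ) - β + j) * n)) * (κ.range n ^ d * v)
        = B * |c| * v * (κ.range n ^ j * κ.range n ^ d * 2 ^ (((d : ℝ) - β + j) * n)) := by ring
      _ = _ := by rw [hpow]; ring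
  rw [hsplit, add_mul]
  exact (abs_add_le _ _).trans (add_le_add hR hTbound)

/-- The piece `n = 0` has range up to `ρ`, too large for the margins used for `n ≥ 1`. Being a
single term, it is covered by the crude bound through the `L^1` norm of `ψ`. -/
lemma exists_norm_iteratedFDeriv_dual_le (hb : Bornology.IsBounded (U : Set (Sp d))) :
    ∃ C : ℝ, 0 ≤ C ∧ ∀ n, ∀ j, j ≤ p → ∀ ψ : Sp d → ℝ, ContDiff ℝ j ψ →
      ∀ A, IsCompact A → Function.support ψ ⊆ A → A ⊆ innerSet U (2 * ρ) → ∀ B,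
      (∀ i, i ≤ j → ∀ y, ‖iteratedFDeriv ℝ i ψ y‖ ≤ B) →
      ∀ y, ‖iteratedFDeriv ℝ j (superpose ψ (κ.cutPiece hρ n 0)) y‖ ≤
        C * 2 ^ (-β * n) * B := by
  obtain ⟨C₁, hC₁, h₁⟩ := κ.exists_norm_iteratedFDeriv_dual_le_succ hρ hb
  obtain ⟨C₂, hC₂, h₂⟩ := κ.exists_norm_iteratedFDeriv_cutPiece_le hρ hb
  set w := volume.real (U : Set (Sp d)) with hw
  have hw0 : 0 ≤ w := measureReal_nonneg
  refine ⟨C₁ + C₂ * w, by positivity, fun n j hj ψ hψ A hA hs hAin B hB y => ?_⟩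
  have hB0 : 0 ≤ B := (norm_nonneg _).trans (hB 0 (Nat.zero_le j) y)
  rcases Nat.eq_zero_or_pos n with rfl | hn
  · have h3 := norm_iteratedFDeriv_superpose_le (κ.smoothFam_cutPiece hρ (n := 0) (k := 0)
      (by simp [len])) hψ.continuous hA hs (j := j) (by exact_mod_cast hj) y
      fun x _ => h₂ 0 0 (by simp [len]) j hj x y
    have h4 : ∫ x, |ψ x| ≤ B * w := by
      have hAU : A ⊆ U := hAin.trans (innerSet_subset (by positivity))
      have e : ∫ x, |ψ x| = ∫ x in (U : Set (Sp d)), |ψ x| := by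
        refine (setIntegral_eq_integral_of_forall_compl_eq_zero fun x hx => ?_).symm
        have : ψ x = 0 := by by_contra h; exact hx (hAU (hs h))
        rw [this, abs_zero]
      rw [e]
      refine (le_abs_self _).trans ?_
      rw [← Real.norm_eq_abs]
      refine norm_setIntegral_le_of_norm_le_const hb.measure_lt_top fun x _ => ?_
      have := hB 0 (Nat.zero_le j) x
      rw [norm_iteratedFDeriv_zero] at this
      simpa using this
    simp only [Nat.cast_zero, mul_zero, Real.rpow_zero, mul_one] at h3 ⊢
    refine h3.trans ((mul_le_mul_of_nonneg_left h4 hC₂).trans ?_)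
    nlinarith [mul_nonneg hC₁ hB0]
  · refine (h₁ n hn j hj ψ hψ A hA hs hAin B hB y).trans ?_
    gcongr
    nlinarith [mul_nonneg hC₂ hw0]

/-- Functions at the scale `λ` are mapped to functions at this scale by the dual pieces. -/
lemma exists_scaled_dual (hb : Bornology.IsBounded (U : Set (Sp d))) (lb : ℝ) :
    ∃ C : ℝ, 0 ≤ C ∧ ∀ n : ℕ, ∀ q, q ≤ p → ∀ ψ : Sp d → ℝ, ContDiff ℝ q ψ →
      ∀ A, IsCompact A → Function.support ψ ⊆ A → A ⊆ innerSet U (2 * ρ) → ∀ B l, l ∈ Ioc 0 lb →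
      Scaled q B l ψ → Scaled q (C * 2 ^ (-β * n) * B) l (superpose ψ (κ.cutPiece hρ n 0)) := by
  obtain ⟨C, hC, h⟩ := κ.exists_norm_iteratedFDeriv_dual_le hρ hb
  -- The moment estimate needs one bound for all derivatives up to order `j`. At scales `l ≤ lb`,
  -- the bounds on lower derivatives are at most `D` times the one for order `j`.
  set D := max 1 lb ^ p with hD
  refine ⟨C * D, by positivity, fun n q hq ψ hψ A hA hs hAin B l hl hsc j hj y => ?_⟩
  have hl0 : 0 < l := hl.1
  have hB0 := hsc.nonneg hl0
  have h1 := h n j (hj.trans hq) ψ (hψ.of_le (by exact_mod_cast hj)) A hA hs hAin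
    (D * B * (l ^ (d + j))⁻¹) (fun i hi y => (hsc i (hi.trans hj) y).trans ?_) y
  · refine h1.trans (le_of_eq ?_)
    ring
  · have h2 : l ^ (j - i) ≤ D := by
      have h3 : l ≤ max 1 lb := hl.2.trans (le_max_right _ _)
      refine (pow_le_pow_left₀ hl0.le h3 _).trans ?_
      exact pow_le_pow_right₀ (le_max_left _ _) (by omega)
    have h4 : (l ^ (d + i))⁻¹ = l ^ (j - i) * (l ^ (d + j))⁻¹ := by
      have : l ^ (d + j) = l ^ (j - i) * l ^ (d + i) := by rw [← pow_add]; congr 1; omega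
      rw [this, mul_inv]
      field_simp
    rw [h4, mul_comm D B, mul_assoc]
    gcongr

end RegKernel

/-! ### Taylor remainders of the pieces -/

lemma iteratedFDeriv_const_eq_sum {j : ℕ} {g : Sp d → ℝ} {x : Sp d} (hg : ContDiffAt ℝ j g x)
    (v : Sp d) : (iteratedFDeriv ℝ j g x fun _ => v) =
      ∑ f : Fin j → Fin d, pd (cnt f) g x * ∏ a, v (f a) := by
  conv_lhs => rw [eq_sum_coordML (iteratedFDeriv ℝ j g x)]
  rw [sum_apply]
  refine Finset.sum_congr rfl fun f _ => ?_
  rw [smul_apply, coordML_apply, smul_eq_mul, iteratedFDeriv_bv_eq_pd f hg]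

lemma mem_multiIndices {s : ℤ} {k : Fin d → ℕ} : k ∈ multiIndices d s ↔ (len k : ℤ) ≤ s := by
  rw [multiIndices, Finset.mem_filter, Fintype.mem_piFinset]
  refine ⟨fun h => h.2, fun h => ⟨fun i => ?_, h⟩⟩
  have : k i ≤ len k := Finset.single_le_sum (fun _ _ => Nat.zero_le _) (Finset.mem_univ i)
  rw [Finset.mem_range]
  omega

/-- Replaces the integer cutoff by a natural number of degrees, as Taylor's formula requires; for
negative `s` both sides are empty. -/
lemma multiIndices_eq (s : ℤ) : multiIndices d s = multiIndices d (((s + 1).toNat : ℤ) - 1) := by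
  ext k
  rw [mem_multiIndices, mem_multiIndices]
  omega

/-- The product of the factorials of a multi-index. -/
def fact (k : Fin d → ℕ) : ℝ := ∏ i, ((k i).factorial : ℝ)

lemma one_le_fact (k : Fin d → ℕ) : 1 ≤ fact k := by
  have : 0 < ∏ i, (k i).factorial := Finset.prod_pos fun i _ => (k i).factorial_pos
  rw [fact]
  exact_mod_cast this

lemma abs_coord_le (v : Sp d) (i : Fin d) : |v i| ≤ ‖v‖ := by
  rw [← Real.norm_eq_abs]
  exact PiLp.norm_apply_le v i

lemma abs_mono_le (k : Fin d → ℕ) (x z : Sp d) : |mono k x z| ≤ dist z x ^ len k := by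
  rw [mono, Finset.abs_prod, len, ← Finset.prod_pow_eq_pow_sum]
  refine Finset.prod_le_prod (fun _ _ => abs_nonneg _) fun i _ => ?_
  rw [abs_pow, dist_eq_norm]
  exact pow_le_pow_left₀ (abs_nonneg _) (abs_coord_le (z - x) i) _

lemma continuous_mono (k : Fin d → ℕ) (x : Sp d) : Continuous (mono k x) := by
  unfold mono
  fun_prop

namespace RegKernel

variable {U : Opens (Sp d)} {β ρ : ℝ} {m p : ℕ} (κ : RegKernel U β m p ρ) (hρ : 0 < ρ)

/-- The Taylor remainder of order `s` at `x`, in the first variable, of a piece. -/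
def remPiece (s : ℤ) (n : ℕ) (x z y : Sp d) : ℝ :=
  κ.cutPiece hρ n 0 z y -
    ∑ k ∈ multiIndices d s, mono k x z / fact k * κ.cutPiece hρ n k x y

lemma smoothFam_remPiece {s : ℤ} (hs : s ≤ m) (n : ℕ) (x : Sp d) :
    SmoothFam p (κ.remPiece hρ s n x) := by
  have h : κ.remPiece hρ s n x = fun z y => κ.cutPiece hρ n 0 z y +
      ∑ k ∈ multiIndices d s, (-(mono k x z / fact k)) • κ.cutPiece hρ n k x y := by
    ext z y
    rw [remPiece, sub_eq_add_neg, ← Finset.sum_neg_distrib]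
    simp only [smul_eq_mul, neg_mul]
  rw [h]
  refine (κ.smoothFam_cutPiece hρ (by simp [len])).add (SmoothFam.sum _ fun k hk => ?_)
  have hk' : len k ≤ m := by have := mem_multiIndices.1 hk; omega
  exact (SmoothFam.const (κ.contDiff_cutPiece hρ hk' x)).smul
    ((continuous_mono k x).div_const _).neg

/-- Taylor's formula in the first variable, for each fixed `y`. Convexity keeps the segment from `x`
to `z` where the cut-off is one, so that the cut pieces there are genuine derivatives of the kernel.
-/
lemma remPiece_eq_integral (hU : Convex ℝ (U : Set (Sp d))) {N n : ℕ} (hN : N + 1 ≤ m) {x z : Sp d}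
    (hx : x ∈ innerSet U (2 * ρ)) (hz : z ∈ innerSet U (2 * ρ)) :
    κ.remPiece hρ (((N + 1 : ℕ) : ℤ) - 1) n x z = fun y => ∫ t in Icc (0 : ℝ) 1,
      ∑ f : Fin (N + 1) → Fin d, ((1 - t) ^ N / N.factorial * ∏ a, (z - x) (f a)) •
        κ.cutPiece hρ n (cnt f) (x + t • (z - x)) y := by
  have hseg : ∀ t ∈ Icc (0 : ℝ) 1, x + t • (z - x) ∈ innerSet U (2 * ρ) := fun t ht =>
    (convex_innerSet hU _).add_smul_sub_mem hx hz ht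
  have hsub : innerSet U (2 * ρ) ⊆ U := innerSet_subset (by positivity)
  ext y
  by_cases hy : y ∈ (U : Set (Sp d))
  swap
  · have h0 : ∀ k x, κ.cutPiece hρ n k x y = 0 := fun k x => by
      rw [cutPiece, Set.indicator_of_notMem hy, mul_zero]
    simp [remPiece, h0]
  have hcut : ∀ k, ∀ w ∈ innerSet U (2 * ρ),
      κ.cutPiece hρ n k w y = pd k (fun x' => κ.piece n x' y) w := fun k w hw => by
    rw [cutPiece, cut_eq_one hρ hw, Set.indicator_of_mem hy, one_mul]
  have hd : ∀ i ≤ m, ∀ w ∈ innerSet U (2 * ρ), ContDiffAt ℝ i (fun x' => κ.piece n x' y) w :=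
    fun i hi w hw => (((κ.regular n).fst y hy).contDiffAt (U.isOpen.mem_nhds (hsub hw))).of_le
      (by exact_mod_cast hi)
  have ht := taylor_segment (f := fun x' => κ.piece n x' y) (x := x) (v := z - x) N
    fun t ht => hd _ hN _ (hseg t ht)
  rw [add_sub_cancel, intervalIntegral.integral_of_le zero_le_one,
    ← integral_Icc_eq_integral_Ioc] at ht
  have h1 : ∑ k ∈ multiIndices d (((N + 1 : ℕ) : ℤ) - 1),
      mono k x z / fact k * κ.cutPiece hρ n k x y = ∑ i ∈ Finset.range (N + 1),
        ((i.factorial : ℝ))⁻¹ * iteratedFDeriv ℝ i (fun x' => κ.piece n x' y) x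
          (fun _ => z - x) := by
    have h2 := sum_multiIndices_eq (N + 1) (fun k => pd k (fun x' => κ.piece n x' y) x)
      fun i => (z - x) i
    refine (Finset.sum_congr rfl fun k _ => ?_).trans (h2.trans
      (Finset.sum_congr rfl fun i hi => ?_))
    · rw [hcut k x hx, mono, fact]
      simp only [PiLp.sub_apply]
      ring
    · rw [iteratedFDeriv_const_eq_sum (hd i (by have := Finset.mem_range.1 hi; omega) x hx)]
  rw [remPiece, h1, hcut 0 z hz, pd_zero_eq, ht, add_sub_cancel_left]
  refine setIntegral_congr_fun measurableSet_Icc fun t ht => ?_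
  simp only
  rw [iteratedFDeriv_const_eq_sum (hd _ hN _ (hseg t ht)), Finset.mul_sum]
  refine Finset.sum_congr rfl fun f _ => ?_
  rw [hcut _ _ (hseg t ht), smul_eq_mul]
  ring

/-- The integral form of the remainder can be differentiated in `y` under the integral. Each term
then carries `(s + 1).toNat` derivatives in the first variable, bounded like any piece, and as many
factors `z - x`. In degree zero nothing is subtracted. -/
lemma exists_norm_iteratedFDeriv_remPiece_le (hb : Bornology.IsBounded (U : Set (Sp d)))
    (hU : Convex ℝ (U : Set (Sp d))) {s : ℤ} (hs : s + 1 ≤ m) :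
    ∃ C : ℝ, 0 ≤ C ∧ ∀ n : ℕ, ∀ j, j ≤ p → ∀ x ∈ innerSet U (2 * ρ), ∀ z ∈ innerSet U (2 * ρ),
      ∀ y, ‖iteratedFDeriv ℝ j (κ.remPiece hρ s n x z) y‖ ≤
        C * dist z x ^ (s + 1).toNat * 2 ^ (((d : ℝ) - β + j + (s + 1).toNat) * n) := by
  obtain ⟨C, hC, h⟩ := κ.exists_norm_iteratedFDeriv_cutPiece_le hρ hb
  have hrem : ∀ n x, κ.remPiece hρ s n x =
      κ.remPiece hρ (((s + 1).toNat : ℤ) - 1) n x := fun n x => by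
    ext z y
    rw [remPiece, remPiece, multiIndices_eq]
  simp only [hrem]
  have hNm : (s + 1).toNat ≤ m := by omega
  generalize (s + 1).toNat = N at hNm ⊢
  rcases N with _ | N
  · refine ⟨C, hC, fun n j hj x _ z _ y => ?_⟩
    have h0 : κ.remPiece hρ (((0 : ℕ) : ℤ) - 1) n x z = κ.cutPiece hρ n 0 z := by
      ext y
      have : multiIndices d (((0 : ℕ) : ℤ) - 1) = ∅ := by
        ext k
        rw [mem_multiIndices]
        simp only [Finset.notMem_empty, iff_false]
        omega
      rw [remPiece, this, Finset.sum_empty, sub_zero]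
    rw [h0, pow_zero, mul_one]
    have := h n 0 (by simp [len]) j hj z y
    simpa [len] using this
  · refine ⟨(d : ℝ) ^ (N + 1) * C, by positivity, fun n j hj x hx z hz y => ?_⟩
    rw [κ.remPiece_eq_integral hρ hU hNm hx hz]
    set w : (Fin (N + 1) → Fin d) → ℝ → ℝ :=
      fun f t => (1 - t) ^ N / N.factorial * ∏ a, (z - x) (f a) with hw
    have hfam : ∀ f : Fin (N + 1) → Fin d, SmoothFam p fun (q : Unit × ℝ) y =>
        w f q.2 • κ.cutPiece hρ n (cnt f) (x + q.2 • (z - x)) y := fun f =>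
      ((κ.smoothFam_cutPiece hρ (n := n) (k := cnt f) (by rw [len_cnt]; exact hNm)).comp
        (f := fun q : Unit × ℝ => x + q.2 • (z - x)) (by fun_prop)).smul (by fun_prop)
    have hsum := SmoothFam.sum Finset.univ fun f _ => hfam f
    have hw1 : ∀ f, ∀ t ∈ Icc (0 : ℝ) 1, |w f t| ≤ dist z x ^ (N + 1) := by
      intro f t ht
      rw [hw]
      simp only
      rw [abs_mul]
      have h1 : |(1 - t) ^ N / N.factorial| ≤ 1 := by
        have h2 : (0 : ℝ) ≤ 1 - t := by linarith [ht.2]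
        rw [abs_of_nonneg (by positivity)]
        refine (div_le_self (by positivity) (by exact_mod_cast N.factorial_pos)).trans ?_
        exact pow_le_one₀ h2 (by linarith [ht.1])
      have h3 : |∏ a, (z - x) (f a)| ≤ dist z x ^ (N + 1) := by
        rw [Finset.abs_prod]
        refine (Finset.prod_le_prod (fun _ _ => abs_nonneg _)
          fun a _ => abs_coord_le (z - x) (f a)).trans ?_
        rw [Finset.prod_const, Finset.card_univ, Fintype.card_fin, dist_eq_norm]
      calc _ ≤ 1 * dist z x ^ (N + 1) := by gcongr
        _ = _ := one_mul _
    have hterm : ∀ t ∈ Icc (0 : ℝ) 1, ‖iteratedFDeriv ℝ j (fun y => ∑ f : Fin (N + 1) → Fin d,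
        w f t • κ.cutPiece hρ n (cnt f) (x + t • (z - x)) y) y‖ ≤
        (d : ℝ) ^ (N + 1) * (dist z x ^ (N + 1) *
          (C * 2 ^ (((d : ℝ) - β + j + (N + 1 : ℕ)) * n))) := by
      intro t ht
      have hcd : ∀ f : Fin (N + 1) → Fin d,
          ContDiff ℝ j (κ.cutPiece hρ n (cnt f) (x + t • (z - x))) := fun f =>
        (κ.contDiff_cutPiece hρ (by rw [len_cnt]; exact hNm) _).of_le (by exact_mod_cast hj)
      have e := iteratedFDeriv_sum (𝕜 := ℝ) (i := j) (u := Finset.univ)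
        (f := fun (f : Fin (N + 1) → Fin d) y =>
          w f t • κ.cutPiece hρ n (cnt f) (x + t • (z - x)) y)
        fun f _ => (hcd f).const_smul (w f t)
      have e' := congrFun e y
      rw [e', Finset.sum_apply]
      refine (norm_sum_le _ _).trans ?_
      have hone : ∀ f ∈ (Finset.univ : Finset (Fin (N + 1) → Fin d)),
          ‖iteratedFDeriv ℝ j (fun y => w f t •
            κ.cutPiece hρ n (cnt f) (x + t • (z - x)) y) y‖ ≤
          dist z x ^ (N + 1) * (C * 2 ^ (((d : ℝ) - β + j + (N + 1 : ℕ)) * n)) := by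
        intro f _
        have e2 := iteratedFDeriv_const_smul_apply (a := w f t) ((hcd f).contDiffAt (x := y))
        have e3 : (fun y => w f t • κ.cutPiece hρ n (cnt f) (x + t • (z - x)) y) =
          w f t • κ.cutPiece hρ n (cnt f) (x + t • (z - x)) := rfl
        rw [e3, e2, norm_smul, Real.norm_eq_abs]
        have h4 := h n (cnt f) (by rw [len_cnt]; exact hNm) j hj (x + t • (z - x)) y
        rw [len_cnt] at h4
        exact mul_le_mul (hw1 f t ht) h4 (norm_nonneg _) (by positivity)
      refine (Finset.sum_le_sum hone).trans (le_of_eq ?_)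
      rw [Finset.sum_const, Finset.card_univ, Fintype.card_fun, Fintype.card_fin, Fintype.card_fin,
        nsmul_eq_mul]
      push_cast
      ring
    refine (hsum.norm_iteratedFDeriv_integral_le (μ := volume) (isCompact_Icc (a := (0 : ℝ))
      (b := 1)) () (by exact_mod_cast hj) y).trans ?_
    rw [← Real.norm_of_nonneg (integral_nonneg fun _ => norm_nonneg _)]
    refine (norm_setIntegral_le_of_norm_le_const (C := (d : ℝ) ^ (N + 1) *
      (dist z x ^ (N + 1) * (C * 2 ^ (((d : ℝ) - β + j + (N + 1 : ℕ)) * n)))) (by simp)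
      fun t ht => ?_).trans (le_of_eq ?_)
    · rw [norm_norm]
      exact hterm t ht
    · simp
      ring

end RegKernel

/-! ### Geometric sums centred at a scale -/

/-- The function `min ((2⁻ⁿ / l) ^ e, (l / 2⁻ⁿ) ^ e)`. -/
def peak (e l : ℝ) (n : ℕ) : ℝ := min ((2 ^ (-(n : ℝ)) / l) ^ e) ((l / 2 ^ (-(n : ℝ))) ^ e)

lemma peak_nonneg {e l : ℝ} (hl : 0 < l) (n : ℕ) : 0 ≤ peak e l n := by
  unfold peak
  positivity

/-- Extending the sum to all integers gives a bound that does not depend on the centre `k`. -/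
lemma exists_tsum_pow_natAbs_le {r : ℝ} (hr0 : 0 ≤ r) (hr1 : r < 1) : ∃ C : ℝ, 0 ≤ C ∧ ∀ k : ℤ,
    (Summable fun n : ℕ => r ^ ((n : ℤ) - k).natAbs) ∧
      ∑' n : ℕ, r ^ ((n : ℤ) - k).natAbs ≤ C := by
  have hsum : Summable fun n : ℤ => r ^ n.natAbs := by
    refine Summable.of_nat_of_neg ?_ ?_
    · simpa using summable_geometric_of_lt_one hr0 hr1
    · simpa using summable_geometric_of_lt_one hr0 hr1
  refine ⟨∑' n : ℤ, r ^ n.natAbs, tsum_nonneg fun n => pow_nonneg hr0 _, fun k => ?_⟩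
  have hi : Function.Injective fun n : ℕ => (n : ℤ) - k := fun a b h => by
    simp only at h
    omega
  exact ⟨hsum.comp_injective hi, tsum_comp_le_tsum_of_inj hsum (fun n => pow_nonneg hr0 _) hi⟩

/-- With `l = 2^{-s}` the terms are `2^{-e|n-s|}`, a two-sided geometric series centred at `s`.
Moving the centre to the integer `⌊s⌋` costs the factor `2^e`. -/
lemma exists_tsum_peak_le {e : ℝ} (he : 0 < e) : ∃ C : ℝ, 0 ≤ C ∧ ∀ l, 0 < l →
    Summable (peak e l) ∧ ∑' n, peak e l n ≤ C := by
  have hr1 : (2 : ℝ) ^ (-e) < 1 := Real.rpow_lt_one_of_one_lt_of_neg (by norm_num) (by linarith)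
  obtain ⟨C, hC, h⟩ := exists_tsum_pow_natAbs_le (r := (2 : ℝ) ^ (-e)) (by positivity) hr1
  refine ⟨2 ^ e * C, by positivity, fun l hl => ?_⟩
  obtain ⟨s, hls⟩ : ∃ s : ℝ, l = 2 ^ (-s) :=
    ⟨-Real.logb 2 l, by rw [neg_neg, Real.rpow_logb (by norm_num) (by norm_num) hl]⟩
  obtain ⟨k, h1, h2⟩ : ∃ k : ℤ, (k : ℝ) ≤ s ∧ s < k + 1 :=
    ⟨⌊s⌋, Int.floor_le s, Int.lt_floor_add_one s⟩
  obtain ⟨hk1, hk2⟩ := h k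
  have hle : ∀ n : ℕ, peak e l n ≤ 2 ^ e * ((2 : ℝ) ^ (-e)) ^ ((n : ℤ) - k).natAbs := by
    intro n
    have hab : ((((n : ℤ) - k).natAbs : ℕ) : ℝ) = |(n : ℝ) - k| := by
      rw [Nat.cast_natAbs]
      push_cast
      rfl
    have e1 : (2 : ℝ) ^ e * ((2 : ℝ) ^ (-e)) ^ ((n : ℤ) - k).natAbs =
        2 ^ (e * (1 - |(n : ℝ) - k|)) := by
      rw [← Real.rpow_natCast, hab, ← Real.rpow_mul (by norm_num), ← Real.rpow_add (by norm_num)]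
      congr 1; ring
    rw [e1, peak, hls, ← Real.rpow_sub (by norm_num), ← Real.rpow_sub (by norm_num),
      ← Real.rpow_mul (by norm_num), ← Real.rpow_mul (by norm_num)]
    rcases le_total (k : ℝ) n with h | h
    · refine (min_le_left _ _).trans (Real.rpow_le_rpow_of_exponent_le (by norm_num) ?_)
      rw [abs_of_nonneg (by linarith)]
      nlinarith
    · refine (min_le_right _ _).trans (Real.rpow_le_rpow_of_exponent_le (by norm_num) ?_)
      rw [abs_of_nonpos (by linarith)]
      nlinarith
  have hpk : Summable (peak e l) := Summable.of_nonneg_of_le (fun n => peak_nonneg hl n) hle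
    (hk1.mul_left _)
  refine ⟨hpk, (hpk.tsum_le_tsum hle (hk1.mul_left _)).trans ?_⟩
  rw [tsum_mul_left]
  exact mul_le_mul_of_nonneg_left hk2 (by positivity)

lemma rpow_div_le_peak_of_le {e e' l : ℝ} (hl : 0 < l) (he : 0 ≤ e) (h : e ≤ e') {n : ℕ}
    (hn : (2 : ℝ) ^ (-(n : ℝ)) ≤ l) : (2 ^ (-(n : ℝ)) / l) ^ e' ≤ peak e l n := by
  have h0 : (2 : ℝ) ^ (-(n : ℝ)) / l ≤ 1 := (div_le_one hl).2 hn
  have h1 : (0 : ℝ) < 2 ^ (-(n : ℝ)) / l := by positivity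
  refine le_min (Real.rpow_le_rpow_of_exponent_ge h1 h0 h) ?_
  refine (Real.rpow_le_one h1.le h0 (he.trans h)).trans (Real.one_le_rpow ?_ he)
  exact (one_le_div (by positivity)).2 hn

lemma rpow_div_le_peak_of_ge {e e' l : ℝ} (hl : 0 < l) (he : 0 ≤ e) (h : e ≤ e') {n : ℕ}
    (hn : l ≤ (2 : ℝ) ^ (-(n : ℝ))) : (l / 2 ^ (-(n : ℝ))) ^ e' ≤ peak e l n := by
  have h0 : l / (2 : ℝ) ^ (-(n : ℝ)) ≤ 1 := (div_le_one (by positivity)).2 hn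
  have h1 : (0 : ℝ) < l / 2 ^ (-(n : ℝ)) := by positivity
  refine le_min ?_ (Real.rpow_le_rpow_of_exponent_ge h1 h0 h)
  refine (Real.rpow_le_one h1.le h0 (he.trans h)).trans (Real.one_le_rpow ?_ he)
  exact (one_le_div hl).2 hn

/-! ### Pairings with the pieces of a kernel -/

lemma two_rpow_mul (c : ℝ) (n : ℕ) : (2 : ℝ) ^ (c * n) = (2 ^ (-(n : ℝ))) ^ (-c) := by
  rw [← Real.rpow_mul (by norm_num)]
  congr 1; ring

/-- Rereads the kernel bounds: a piece with `e` derivatives in the first variable is a function of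
scale `2^{-n}` with amplitude `2^{-n(β-e)}`. -/
lemma scaled_of_norm_le {p n : ℕ} {g : Sp d → ℝ} {A β e : ℝ}
    (h : ∀ j, j ≤ p → ∀ y, ‖iteratedFDeriv ℝ j g y‖ ≤ A * 2 ^ (((d : ℝ) - β + j + e) * n)) :
    Scaled p (A * (2 ^ (-(n : ℝ))) ^ (β - e)) (2 ^ (-(n : ℝ))) g := fun j hj y => by
  refine (h j hj y).trans (le_of_eq ?_)
  have hq := two_rpow_neg_pos n
  rw [two_rpow_mul, mul_assoc, ← Real.rpow_natCast, ← Real.rpow_neg hq.le,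
    ← Real.rpow_add hq]
  congr 2
  push_cast
  ring

lemma integral_abs_nonneg (ψ : Sp d → ℝ) : 0 ≤ ∫ x, |ψ x| := integral_nonneg fun _ => abs_nonneg _

namespace Setup

variable (S : Setup d) {β : ℝ} {m : ℕ} (κ : RegKernel S.U β m S.p S.ρ)

lemma innerSet_two_subset_Kt : innerSet S.U (2 * S.ρ) ⊆ S.Kt :=
  (innerSet_anti (by have := S.ρ_pos; linarith)).trans S.subset_Kt

/-- The amplitude `2^{-n(β-e)}` times the size `2^{-nγ}` of `F x - f` at scale `2^{-n}`. The radius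
`(1 + ρ) 2^{-n}` covers the range of the kernel and a test function of scale at most `2^{-n}`. -/
lemma exists_pair_rec_of_norm_le (β : ℝ) : ∃ C : ℝ, 0 ≤ C ∧ ∀ F f M, S.Bd F f M →
    ∀ x : S.U, (x : Sp d) ∈ S.Kt → ∀ (n : ℕ) (A e : ℝ), ∀ g, IsCp S.p S.Q g →
    Function.support g ⊆ Metric.closedBall (x : Sp d) ((1 + S.ρ) * 2 ^ (-(n : ℝ))) →
    (∀ j, j ≤ S.p → ∀ y, ‖iteratedFDeriv ℝ j g y‖ ≤ A * 2 ^ (((d : ℝ) - β + j + e) * n)) →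
    |pair (F x - f) g| ≤ C * M * A * (2 ^ (-(n : ℝ))) ^ (S.γ + β - e) := by
  have hρ := S.ρ_pos
  obtain ⟨C, hC, h⟩ := S.exists_pair_rec (Lm := 1 + S.ρ) (by positivity)
  refine ⟨C * (1 + S.ρ) ^ (d + S.p) * (1 + S.ρ) ^ S.γ, by positivity,
    fun F f M hB x hx n A e g hg hs hA => ?_⟩
  have hq := two_rpow_neg_pos n
  have hq1 := two_rpow_neg_le_one n
  set q : ℝ := 2 ^ (-(n : ℝ)) with hqdef
  have hsc := (scaled_of_norm_le hA).enlarge hq (κ := 1 + S.ρ) (by linarith)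
  refine (h F f M hB x hx _ _ (by positivity) (by nlinarith) g hg hs hsc).trans (le_of_eq ?_)
  rw [Real.mul_rpow (by positivity) hq.le, show S.γ + β - e = (β - e) + S.γ by ring,
    Real.rpow_add hq]
  ring

lemma exists_pair_coh_of_norm_le (β : ℝ) : ∃ C : ℝ, 0 ≤ C ∧ ∀ F f M, S.Bd F f M →
    ∀ x y : S.U, (x : Sp d) ∈ S.Kt → (y : Sp d) ∈ S.Kt → ∀ (n : ℕ) (A e : ℝ),
    ∀ g, IsCp S.p S.Q g →
    Function.support g ⊆ Metric.closedBall (x : Sp d) ((1 + S.ρ) * 2 ^ (-(n : ℝ))) →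
    (∀ j, j ≤ S.p → ∀ y, ‖iteratedFDeriv ℝ j g y‖ ≤ A * 2 ^ (((d : ℝ) - β + j + e) * n)) →
    |pair (F x - F y) g| ≤ C * M * A * ((2 ^ (-(n : ℝ))) ^ (S.a + β - e) *
      (2 ^ (-(n : ℝ)) + dist (x : Sp d) y) ^ (S.γ - S.a)) := by
  have hρ := S.ρ_pos
  have hγa : 0 ≤ S.γ - S.a := by have := S.a_le; linarith
  obtain ⟨C, hC, h⟩ := S.exists_pair_coh (Lm := 1 + S.ρ) (by positivity)
  refine ⟨C * (1 + S.ρ) ^ (d + S.p) * (1 + S.ρ) ^ S.a * (1 + S.ρ) ^ (S.γ - S.a), by positivity,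
    fun F f M hB x y hx hy n A e g hg hs hA => ?_⟩
  have hq := two_rpow_neg_pos n
  have hq1 := two_rpow_neg_le_one n
  have hM := hB.M_nonneg
  set q : ℝ := 2 ^ (-(n : ℝ)) with hqdef
  have hsc := (scaled_of_norm_le hA).enlarge hq (κ := 1 + S.ρ) (by linarith)
  have hA0 := hsc.nonneg (by positivity)
  refine (h F f M hB x y hx hy _ _ (by positivity) (by nlinarith) g hg hs hsc).trans ?_
  have hd : 0 ≤ dist (x : Sp d) y := dist_nonneg
  have h1 : ((1 + S.ρ) * q + dist (x : Sp d) y) ^ (S.γ - S.a) ≤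
      (1 + S.ρ) ^ (S.γ - S.a) * (q + dist (x : Sp d) y) ^ (S.γ - S.a) := by
    rw [← Real.mul_rpow (by positivity) (by positivity)]
    refine Real.rpow_le_rpow (by positivity) (by nlinarith) hγa
  refine (mul_le_mul_of_nonneg_left (mul_le_mul_of_nonneg_left h1 (by positivity))
    (by positivity)).trans (le_of_eq ?_)
  rw [Real.mul_rpow (by positivity) hq.le, show S.a + β - e = (β - e) + S.a by ring,
    Real.rpow_add hq]
  ring

/-- These are the `n`-th contributions to the Taylor coefficients of the image at `x`; they are
summable exactly in the degrees below `γ + β` that the lift subtracts. -/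
lemma exists_abs_coef_le : ∃ C : ℝ, 0 ≤ C ∧ ∀ F f M, S.Bd F f M →
    ∀ x : S.U, (x : Sp d) ∈ S.Kt → ∀ (n : ℕ) (k : Fin d → ℕ), len k ≤ m →
    |pair (F x - f) (κ.cutPiece S.ρ_pos n k x)| ≤
      C * M * (2 ^ (-(n : ℝ))) ^ (S.γ + β - len k) := by
  have hρ := S.ρ_pos
  obtain ⟨C₁, hC₁, h₁⟩ := κ.exists_norm_iteratedFDeriv_cutPiece_le hρ S.bdd
  obtain ⟨C₂, hC₂, h₂⟩ := S.exists_pair_rec_of_norm_le β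
  refine ⟨C₂ * C₁, by positivity, fun F f M hB x hx n k hk => ?_⟩
  refine (h₂ F f M hB x hx n C₁ (len k) _ (κ.isCp_cutPiece hρ hk x)
    (((κ.support_cutPiece hρ n k x).trans inter_subset_left).trans
      (Metric.closedBall_subset_closedBall ?_)) fun j hj y => h₁ n k hk j hj x y).trans
    (le_of_eq (by ring))
  rw [RegKernel.range]
  have := two_rpow_neg_pos n
  nlinarith

lemma support_superpose_subset_closedBall {n : ℕ} {k : Fin d → ℕ} {ψ : Sp d → ℝ} {x : Sp d} {l : ℝ}
    (hs : Function.support ψ ⊆ Metric.closedBall x l) :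
    Function.support (superpose ψ (κ.cutPiece S.ρ_pos n k)) ⊆
      Metric.closedBall x (l + S.ρ * 2 ^ (-(n : ℝ))) := by
  refine ((κ.support_superpose_cutPiece S.ρ_pos hs).trans inter_subset_left).trans ?_
  rw [RegKernel.range]
  have := RegKernel.range_pos κ S.ρ_pos n
  refine cthickening_subset_of_closedBall (isCompact_closedBall _ _) this.le fun y hy => ?_
  refine Metric.closedBall_subset_closedBall' ?_
  have : dist y x ≤ l := hy
  linarith

lemma closedBall_add_subset {n : ℕ} {l : ℝ} (hl : l ≤ 2 ^ (-(n : ℝ))) (x : Sp d) :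
    Metric.closedBall x (l + S.ρ * 2 ^ (-(n : ℝ))) ⊆
      Metric.closedBall x ((1 + S.ρ) * 2 ^ (-(n : ℝ))) :=
  Metric.closedBall_subset_closedBall (by linarith)

lemma norm_superpose_cutPiece_le {C : ℝ} {n : ℕ} {k : Fin d → ℕ} (hk : len k ≤ m)
    (h : ∀ j, j ≤ S.p → ∀ x y, ‖iteratedFDeriv ℝ j (κ.cutPiece S.ρ_pos n k x) y‖ ≤
        C * 2 ^ (((d : ℝ) - β + j + len k) * n)) {ψ : Sp d → ℝ} (hψ : Continuous ψ)
    {x : Sp d} {l : ℝ} (hs : Function.support ψ ⊆ Metric.closedBall x l) :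
    ∀ j, j ≤ S.p → ∀ y, ‖iteratedFDeriv ℝ j (superpose ψ (κ.cutPiece S.ρ_pos n k)) y‖ ≤
      (C * ∫ x, |ψ x|) * 2 ^ (((d : ℝ) - β + j + len k) * n) := fun j hj y => by
  refine (norm_iteratedFDeriv_superpose_le (κ.smoothFam_cutPiece S.ρ_pos hk) hψ
    (isCompact_closedBall x l) hs (by exact_mod_cast hj) y fun x _ => h j hj x y).trans
    (le_of_eq (by ring))

/-- The estimate of a pairing at scales larger than the one of the test function. -/
lemma exists_abs_pair_superpose_le : ∃ C : ℝ, 0 ≤ C ∧ ∀ F f M, S.Bd F f M →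
    ∀ x : S.U, (x : Sp d) ∈ S.Kt → ∀ (n : ℕ) (k : Fin d → ℕ), len k ≤ m → ∀ ψ : Sp d → ℝ,
    Continuous ψ → ∀ l, 0 ≤ l → l ≤ 2 ^ (-(n : ℝ)) →
    Function.support ψ ⊆ Metric.closedBall (x : Sp d) l →
    |pair (F x - f) (superpose ψ (κ.cutPiece S.ρ_pos n k))| ≤
      C * M * (∫ x, |ψ x|) * (2 ^ (-(n : ℝ))) ^ (S.γ + β - len k) := by
  have hρ := S.ρ_pos
  obtain ⟨C₁, hC₁, h₁⟩ := κ.exists_norm_iteratedFDeriv_cutPiece_le hρ S.bdd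
  obtain ⟨C₂, hC₂, h₂⟩ := S.exists_pair_rec_of_norm_le β
  refine ⟨C₂ * C₁, by positivity, fun F f M hB x hx n k hk ψ hψ l hl hln hs => ?_⟩
  exact (h₂ F f M hB x hx n _ (len k) _
    (κ.isCp_superpose hρ hk hψ (isCompact_closedBall _ _) hs)
    ((S.support_superpose_subset_closedBall κ hs).trans (S.closedBall_add_subset hln x))
    (S.norm_superpose_cutPiece_le κ hk (h₁ n k hk) hψ hs)).trans (le_of_eq (by ring))

/-- A test function narrower than `2^{-n}` is smeared out by the piece to scale `2^{-n}`, so only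
its `L^1` norm matters and coherence is applied at that scale. -/
lemma exists_abs_pair_coh_superpose_le : ∃ C : ℝ, 0 ≤ C ∧ ∀ F f M, S.Bd F f M →
    ∀ x y : S.U, (x : Sp d) ∈ S.Kt → (y : Sp d) ∈ S.Kt → ∀ (n : ℕ) (ψ : Sp d → ℝ),
    Continuous ψ → ∀ l, 0 ≤ l → l ≤ 2 ^ (-(n : ℝ)) →
    Function.support ψ ⊆ Metric.closedBall (x : Sp d) l →
    |pair (F x - F y) (superpose ψ (κ.cutPiece S.ρ_pos n 0))| ≤
      C * M * (∫ x, |ψ x|) * ((2 ^ (-(n : ℝ))) ^ (S.a + β) *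
        (2 ^ (-(n : ℝ)) + dist (x : Sp d) y) ^ (S.γ - S.a)) := by
  have hρ := S.ρ_pos
  obtain ⟨C₁, hC₁, h₁⟩ := κ.exists_norm_iteratedFDeriv_cutPiece_le hρ S.bdd
  obtain ⟨C₂, hC₂, h₂⟩ := S.exists_pair_coh_of_norm_le β
  have h0 : len (0 : Fin d → ℕ) = 0 := by simp [len]
  have hk : len (0 : Fin d → ℕ) ≤ m := by rw [h0]; exact Nat.zero_le m
  refine ⟨C₂ * C₁, by positivity, fun F f M hB x y hx hy n ψ hψ l hl hln hs => ?_⟩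
  refine (h₂ F f M hB x y hx hy n _ (len (0 : Fin d → ℕ)) _
    (κ.isCp_superpose hρ hk hψ (isCompact_closedBall _ _) hs)
    ((S.support_superpose_subset_closedBall κ hs).trans (S.closedBall_add_subset hln x))
    (S.norm_superpose_cutPiece_le κ hk (h₁ n 0 hk) hψ hs)).trans (le_of_eq ?_)
  rw [h0, Nat.cast_zero, sub_zero]
  ring

variable {S} in
lemma superpose_remPiece {s : ℤ} (n : ℕ) (x : Sp d) {ψ : Sp d → ℝ}
    (hψ : Continuous ψ) {A : Set (Sp d)} (hA : IsCompact A) (hψA : Function.support ψ ⊆ A) :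
    superpose ψ (κ.remPiece S.ρ_pos s n x) = fun y => superpose ψ (κ.cutPiece S.ρ_pos n 0) y -
      ∑ k ∈ multiIndices d s, ((∫ z, ψ z * mono k x z) / fact k) *
        κ.cutPiece S.ρ_pos n k x y := by
  ext y
  have h0 : Integrable fun z => ψ z * κ.cutPiece S.ρ_pos n 0 z y :=
    integrable_mul_fam (κ.smoothFam_cutPiece S.ρ_pos (by simp [len])) hψ hA hψA y
  have hm : ∀ k : Fin d → ℕ, Integrable fun z => ψ z * mono k x z := fun k =>
    (hψ.mul (continuous_mono k x)).integrable_of_hasCompactSupport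
      (HasCompactSupport.of_support_subset_isCompact hA fun z hz => hψA (left_ne_zero_of_mul hz))
  have e : ∀ z, ψ z * κ.remPiece S.ρ_pos s n x z y = ψ z * κ.cutPiece S.ρ_pos n 0 z y -
      ∑ k ∈ multiIndices d s, (ψ z * mono k x z) * (κ.cutPiece S.ρ_pos n k x y / fact k) := by
    intro z
    rw [RegKernel.remPiece, mul_sub, Finset.mul_sum]
    congr 1
    refine Finset.sum_congr rfl fun k _ => by ring
  simp only [superpose, e]
  rw [integral_sub h0 (integrable_finsetSum _ fun k _ => (hm k).mul_const _),
    integral_finsetSum _ fun k _ => (hm k).mul_const _]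
  congr 1
  refine Finset.sum_congr rfl fun k _ => ?_
  rw [integral_mul_const]
  ring

/-- The pairing with a Taylor remainder. -/
lemma pair_superpose_remPiece {G : 𝓓'(S.U, ℝ)} (hG : FinOrder G S.p S.Q) {s : ℤ} (hs : s ≤ m)
    (n : ℕ) (x : Sp d) {ψ : Sp d → ℝ} (hψ : Continuous ψ) {A : Set (Sp d)} (hA : IsCompact A)
    (hψA : Function.support ψ ⊆ A) :
    IsCp S.p S.Q (superpose ψ (κ.remPiece S.ρ_pos s n x)) ∧
    pair G (superpose ψ (κ.remPiece S.ρ_pos s n x)) =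
      pair G (superpose ψ (κ.cutPiece S.ρ_pos n 0)) -
      ∑ k ∈ multiIndices d s, ((∫ z, ψ z * mono k x z) / fact k) *
        pair G (κ.cutPiece S.ρ_pos n k x) := by
  have hρ := S.ρ_pos
  have h0 : IsCp S.p S.Q (superpose ψ (κ.cutPiece hρ n 0)) :=
    κ.isCp_superpose hρ (by simp [len]) hψ hA hψA
  have h1 : ∀ k ∈ multiIndices d s, IsCp S.p S.Q (κ.cutPiece hρ n k x) := fun k hk =>
    κ.isCp_cutPiece hρ (by have := mem_multiIndices.1 hk; omega) x
  have h2 := IsCp.sum (multiIndices d s) (f := fun k y =>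
    ((∫ z, ψ z * mono k x z) / fact k) * κ.cutPiece hρ n k x y) fun k hk => (h1 k hk).smul _
  rw [superpose_remPiece κ n x hψ hA hψA]
  refine ⟨?_, ?_⟩
  · have := h0.add (h2.smul (-1))
    simpa only [neg_mul, one_mul, ← sub_eq_add_neg] using this
  · rw [hG.pair_sub S.Q_subset h0 h2, hG.pair_sum S.Q_subset _ fun k hk => (h1 k hk).smul _]
    congr 1
    exact Finset.sum_congr rfl fun k hk => hG.pair_smul S.Q_subset (h1 k hk) _

/-- The estimate of the pairing with a Taylor remainder. -/
lemma exists_abs_pair_superpose_remPiece_le (hU : Convex ℝ (S.U : Set (Sp d))) {s : ℤ}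
    (hs : s + 1 ≤ m) : ∃ C : ℝ, 0 ≤ C ∧ ∀ F f M, S.Bd F f M →
    ∀ x : S.U, (x : Sp d) ∈ innerSet S.U (2 * S.ρ) → ∀ (n : ℕ) (ψ : Sp d → ℝ),
    Continuous ψ → ∀ l, 0 ≤ l → l ≤ 2 ^ (-(n : ℝ)) →
    Function.support ψ ⊆ Metric.closedBall (x : Sp d) l ∩ innerSet S.U (2 * S.ρ) →
    |pair (F x - f) (superpose ψ (κ.remPiece S.ρ_pos s n x))| ≤
      C * M * (∫ x, |ψ x|) * (l ^ (s + 1).toNat *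
        (2 ^ (-(n : ℝ))) ^ (S.γ + β - (s + 1).toNat)) := by
  have hρ := S.ρ_pos
  obtain ⟨C₁, hC₁, h₁⟩ := κ.exists_norm_iteratedFDeriv_remPiece_le hρ S.bdd hU hs
  obtain ⟨C₂, hC₂, h₂⟩ := S.exists_pair_rec_of_norm_le β
  refine ⟨C₂ * C₁, by positivity, fun F f M hB x hx n ψ hψ l hl hln hsupp => ?_⟩
  set N := (s + 1).toNat
  have hs1 := hsupp.trans inter_subset_left
  have hx' := S.innerSet_two_subset_Kt hx
  have hA : IsCompact (Metric.closedBall (x : Sp d) l ∩ innerSet S.U (2 * S.ρ)) :=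
    (isCompact_closedBall _ _).inter_right (isClosed_innerSet _ _)
  have hcp := (S.pair_superpose_remPiece κ (hB.finOrder hx') (by omega) n x hψ hA hsupp (s := s)).1
  refine (h₂ F f M hB x hx' n (C₁ * l ^ N * ∫ x, |ψ x|) N _ hcp ?_ fun j hj y => ?_).trans
    (le_of_eq (by ring))
  -- Although the remainder compares `x` with all `z` in the support of `ψ`, outside the enlarged
  -- ball the pieces at `x` and the superposition vanish separately.
  · intro y hy
    by_contra hy'
    have hy2 := mt (S.closedBall_add_subset hln (x : Sp d) ·) hy'
    refine hy ?_
    have e : ∀ k, κ.cutPiece hρ n k x y = 0 := fun k => κ.cutPiece_eq_zero hρ (by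
      rw [Metric.mem_closedBall, not_le] at hy2
      rw [RegKernel.range, dist_comm]
      linarith)
    have e2 : superpose ψ (κ.cutPiece hρ n 0) y = 0 := by
      by_contra h
      exact hy2 (S.support_superpose_subset_closedBall κ hs1 h)
    rw [superpose_remPiece κ n x hψ hA hsupp]
    simp only [e, e2, mul_zero, Finset.sum_const_zero, sub_zero]
  · refine (norm_iteratedFDeriv_superpose_le (κ.smoothFam_remPiece hρ (by omega) n x) hψ hA hsupp
      (by exact_mod_cast hj) y (B := C₁ * l ^ N * 2 ^ (((d : ℝ) - β + j + N) * n))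
      fun z hz => ?_).trans (le_of_eq (by ring))
    refine (h₁ n j hj x hx z hz.2 y).trans ?_
    have : dist z x ≤ l := hz.1
    gcongr

end Setup

/-! ### Bounds for the terms of the lifted germ -/

/-- For `l ≤ δ` a power of `l` may be traded for the same power of `δ`: at fixed homogeneity `w`,
lowering the exponent of the smaller scale only weakens the bound. -/
lemma rpow_mul_rpow_le {l δ a c w : ℝ} (hl : 0 < l) (hlδ : l ≤ δ) (h : a ≤ c) :
    l ^ c * δ ^ (w - c) ≤ l ^ a * δ ^ (w - a) := by
  have hδ : 0 < δ := hl.trans_le hlδ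
  have h1 : l ^ c = l ^ a * l ^ (c - a) := by rw [← Real.rpow_add hl]; congr 1; ring
  have h2 : δ ^ (w - a) = δ ^ (c - a) * δ ^ (w - c) := by rw [← Real.rpow_add hδ]; congr 1; ring
  rw [h1, h2, ← mul_assoc]
  have : l ^ (c - a) ≤ δ ^ (c - a) := Real.rpow_le_rpow hl.le hlδ (by linarith)
  gcongr

lemma abs_integral_mul_mono_le {ψ : Sp d → ℝ} (hψ : Continuous ψ) {x : Sp d} {r : ℝ}
    (hs : Function.support ψ ⊆ Metric.closedBall x r) (k : Fin d → ℕ) :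
    |∫ z, ψ z * mono k x z| ≤ (∫ z, |ψ z|) * r ^ len k := by
  have hc : HasCompactSupport ψ :=
    HasCompactSupport.of_support_subset_isCompact (isCompact_closedBall x r) hs
  rw [← integral_mul_const, ← Real.norm_eq_abs]
  refine norm_integral_le_of_norm_le
    ((hψ.abs.integrable_of_hasCompactSupport hc.norm).mul_const _)
    (Eventually.of_forall fun z => ?_)
  rw [norm_mul, Real.norm_eq_abs, Real.norm_eq_abs]
  by_cases hz : ψ z = 0
  · simp [hz]
  · have : dist z x ≤ r := hs hz
    have := abs_mono_le k x z
    have h2 : dist z x ^ len k ≤ r ^ len k := by gcongr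
    gcongr
    exact this.trans h2

lemma integral_abs_le_of_scaled {q : ℕ} {B l : ℝ} (hl : 0 < l) {ψ : Sp d → ℝ}
    (h : Scaled q B l ψ) {x : Sp d} (hs : Function.support ψ ⊆ Metric.closedBall x l) :
    ∫ z, |ψ z| ≤ volume.real (Metric.closedBall (0 : Sp d) 1) * B := by
  have h0 : ∀ z, ‖|ψ z|‖ ≤ B * (l ^ d)⁻¹ := fun z => by
    have := h 0 (Nat.zero_le q) z
    rw [norm_iteratedFDeriv_zero] at this
    simpa using this
  have e : ∫ z, |ψ z| = ∫ z in Metric.closedBall x l, |ψ z| := by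
    refine (setIntegral_eq_integral_of_forall_compl_eq_zero fun z hz => ?_).symm
    have : ψ z = 0 := by by_contra h; exact hz (hs h)
    rw [this, abs_zero]
  rw [e]
  refine (le_abs_self _).trans ?_
  rw [← Real.norm_eq_abs]
  refine (norm_setIntegral_le_of_norm_le_const (isCompact_closedBall x l).measure_lt_top
    fun z _ => h0 z).trans (le_of_eq ?_)
  rw [volume_closedBall_le x hl.le]
  field_simp

namespace Setup

variable (S : Setup d) {β : ℝ} {m : ℕ} (κ : RegKernel S.U β m S.p S.ρ)

/-- The Taylor polynomial part of the pairing with the `n`-th piece. -/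
def polyTerm (s : ℤ) (G : 𝓓'(S.U, ℝ)) (n : ℕ) (x : Sp d) (ψ : Sp d → ℝ) : ℝ :=
  ∑ k ∈ multiIndices d s, ((∫ z, ψ z * mono k x z) / fact k) * pair G (κ.cutPiece S.ρ_pos n k x)

/-- The pairing with the `n`-th piece minus its Taylor polynomial. -/
def remTerm (s : ℤ) (G : 𝓓'(S.U, ℝ)) (n : ℕ) (x : Sp d) (ψ : Sp d → ℝ) : ℝ :=
  pair G (superpose ψ (κ.cutPiece S.ρ_pos n 0)) - S.polyTerm κ s G n x ψ

/-- The estimate of the Taylor polynomials at small scales. -/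
lemma exists_abs_polyTerm_le {s : ℤ} (hs : s ≤ m) {e : ℝ} (he : 0 ≤ e)
    (hes : ∀ k : ℕ, (k : ℤ) ≤ s → e ≤ S.γ + β - k) : ∃ C : ℝ, 0 ≤ C ∧ ∀ F f M, S.Bd F f M →
    ∀ x : S.U, (x : Sp d) ∈ S.Kt → ∀ (n : ℕ) (ψ : Sp d → ℝ), Continuous ψ →
    ∀ r, (2 : ℝ) ^ (-(n : ℝ)) ≤ r → Function.support ψ ⊆ Metric.closedBall (x : Sp d) r →
    |S.polyTerm κ s (F x - f) n x ψ| ≤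
      C * M * (∫ x, |ψ x|) * (r ^ (S.γ + β) * peak e r n) := by
  obtain ⟨C, hC, h⟩ := S.exists_abs_coef_le κ
  refine ⟨(multiIndices d s).card * C, by positivity, fun F f M hB x hx n ψ hψ r hr hsupp => ?_⟩
  have hq := two_rpow_neg_pos n
  have hr0 : 0 < r := hq.trans_le hr
  have hM := hB.M_nonneg
  rw [polyTerm]
  refine (Finset.abs_sum_le_sum_abs _ _).trans ?_
  have hone : ∀ k ∈ multiIndices d s, |((∫ z, ψ z * mono k x z) / fact k) *
      pair (F x - f) (κ.cutPiece S.ρ_pos n k x)| ≤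
      C * M * (∫ x, |ψ x|) * (r ^ (S.γ + β) * peak e r n) := by
    intro k hk
    have hks := mem_multiIndices.1 hk
    have h1 : |(∫ z, ψ z * mono k x z) / fact k| ≤ (∫ z, |ψ z|) * r ^ len k := by
      rw [abs_div]
      refine (div_le_self (abs_nonneg _) ?_).trans (abs_integral_mul_mono_le hψ hsupp k)
      exact (one_le_fact k).trans (le_abs_self _)
    have h2 := h F f M hB x hx n k (by omega)
    have hI := integral_abs_nonneg ψ
    rw [abs_mul]
    refine (mul_le_mul h1 h2 (abs_nonneg _) (by positivity)).trans ?_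
    have h3 := rpow_div_le_peak_of_le hr0 he (hes (len k) hks) hr
    -- Extracting the total homogeneity leaves a positive power of `2^{-n}/r ≤ 1`, which `peak`
    -- dominates.
    have h4 : r ^ len k * (2 ^ (-(n : ℝ))) ^ (S.γ + β - len k) =
        r ^ (S.γ + β) * (2 ^ (-(n : ℝ)) / r) ^ (S.γ + β - len k) := by
      rw [Real.div_rpow hq.le hr0.le, ← Real.rpow_natCast, mul_div_assoc']
      rw [eq_div_iff (by positivity), mul_right_comm, ← Real.rpow_add hr0]
      congr 2
      ring
    calc _ = C * M * (∫ z, |ψ z|) *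
          (r ^ len k * (2 ^ (-(n : ℝ))) ^ (S.γ + β - len k)) := by ring
      _ ≤ _ := by
        rw [h4]
        gcongr
  refine (Finset.sum_le_sum hone).trans (le_of_eq ?_)
  rw [Finset.sum_const, nsmul_eq_mul]
  ring

lemma pair_superpose_remPiece_eq {G : 𝓓'(S.U, ℝ)} (hG : FinOrder G S.p S.Q) {s : ℤ} (hs : s ≤ m)
    (n : ℕ) (x : Sp d) {ψ : Sp d → ℝ} (hψ : Continuous ψ) {A : Set (Sp d)} (hA : IsCompact A)
    (hψA : Function.support ψ ⊆ A) :
    pair G (superpose ψ (κ.remPiece S.ρ_pos s n x)) = S.remTerm κ s G n x ψ :=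
  (S.pair_superpose_remPiece κ hG hs n x hψ hA hψA).2

/-- The estimate of the Taylor remainders at large scales. -/
lemma exists_abs_remTerm_le (hU : Convex ℝ (S.U : Set (Sp d))) {s : ℤ}
    (hs : s + 1 ≤ m) {e : ℝ} (he : 0 ≤ e) (hes : e ≤ ((s + 1).toNat : ℝ) - (S.γ + β)) :
    ∃ C : ℝ, 0 ≤ C ∧ ∀ F f M, S.Bd F f M →
    ∀ x : S.U, (x : Sp d) ∈ innerSet S.U (2 * S.ρ) → ∀ (n : ℕ) (ψ : Sp d → ℝ),
    Continuous ψ → ∀ r, 0 < r → r ≤ 2 ^ (-(n : ℝ)) →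
    Function.support ψ ⊆ Metric.closedBall (x : Sp d) r ∩ innerSet S.U (2 * S.ρ) →
    |S.remTerm κ s (F x - f) n x ψ| ≤
      C * M * (∫ x, |ψ x|) * (r ^ (S.γ + β) * peak e r n) := by
  obtain ⟨C, hC, h⟩ := S.exists_abs_pair_superpose_remPiece_le κ hU hs
  refine ⟨C, hC, fun F f M hB x hx n ψ hψ r hr hrn hsupp => ?_⟩
  have hq := two_rpow_neg_pos n
  have hM := hB.M_nonneg
  have hA : IsCompact (Metric.closedBall (x : Sp d) r ∩ innerSet S.U (2 * S.ρ)) :=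
    (isCompact_closedBall _ _).inter_right (isClosed_innerSet _ _)
  rw [← S.pair_superpose_remPiece_eq κ (hB.finOrder (S.innerSet_two_subset_Kt hx)) (by omega) n x hψ
    hA hsupp]
  refine (h F f M hB x hx n ψ hψ r hr.le hrn hsupp).trans ?_
  have hI := integral_abs_nonneg ψ
  have h3 := rpow_div_le_peak_of_ge hr he hes hrn
  -- Extracting the total homogeneity now leaves a nonnegative power of `r/2^{-n} ≤ 1`, since the
  -- degree of the remainder exceeds `γ + β`.
  have h4 : r ^ (s + 1).toNat * (2 ^ (-(n : ℝ))) ^ (S.γ + β - (s + 1).toNat) =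
      r ^ (S.γ + β) * (r / 2 ^ (-(n : ℝ))) ^ (((s + 1).toNat : ℝ) - (S.γ + β)) := by
    rw [Real.div_rpow hr.le hq.le, ← neg_sub (((s + 1).toNat : ℝ)), Real.rpow_neg hq.le,
      ← Real.rpow_natCast, ← mul_div_assoc, ← Real.rpow_add hr, div_eq_mul_inv]
    congr 2
    ring
  rw [h4]
  gcongr

/-- The dual pieces preserve the scale of test functions. -/
lemma exists_scaled_superpose {q : ℕ} (hq : q ≤ S.p) (lb : ℝ) : ∃ C : ℝ, 0 ≤ C ∧
    ∀ (n : ℕ) (ψ : Sp d → ℝ) (x : Sp d) (B l : ℝ), ContDiff ℝ q ψ → l ∈ Ioc 0 lb →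
    (2 : ℝ) ^ (-(n : ℝ)) ≤ l → Scaled q B l ψ →
    Function.support ψ ⊆ Metric.closedBall x l ∩ innerSet S.U (2 * S.ρ) →
    IsCp S.p S.Q (superpose ψ (κ.cutPiece S.ρ_pos n 0)) ∧
    Function.support (superpose ψ (κ.cutPiece S.ρ_pos n 0)) ⊆
      Metric.closedBall x (l + S.ρ * 2 ^ (-(n : ℝ))) ∧
    Scaled q (C * (2 ^ (-(n : ℝ))) ^ β * B) (l + S.ρ * 2 ^ (-(n : ℝ)))
      (superpose ψ (κ.cutPiece S.ρ_pos n 0)) := by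
  have hρ := S.ρ_pos
  obtain ⟨C, hC, h⟩ := κ.exists_scaled_dual hρ S.bdd lb
  refine ⟨C * (1 + S.ρ) ^ (d + q), by positivity, fun n ψ x B l hψ hl hnl hsc hs => ?_⟩
  have hs1 := hs.trans inter_subset_left
  have hA : IsCompact (Metric.closedBall x l ∩ innerSet S.U (2 * S.ρ)) :=
    (isCompact_closedBall _ _).inter_right (isClosed_innerSet _ _)
  have hqn := two_rpow_neg_pos n
  have hl0 : 0 < l := hl.1
  refine ⟨κ.isCp_superpose hρ (by simp [len]) hψ.continuous hA hs,
    S.support_superpose_subset_closedBall κ hs1, ?_⟩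
  have h1 := h n q hq ψ hψ _ hA hs inter_subset_right B l hl hsc
  -- The dual piece widens the support by `ρ 2^{-n} ≤ ρ l`; declaring the new scale to be `t * l`
  -- costs only a bounded factor, because `1 ≤ t ≤ 1 + ρ`.
  set t : ℝ := 1 + S.ρ * (2 ^ (-(n : ℝ)) / l) with ht
  have h5 : (2 : ℝ) ^ (-(n : ℝ)) / l ≤ 1 := (div_le_one hl0).2 hnl
  have h6 : 0 ≤ (2 : ℝ) ^ (-(n : ℝ)) / l := by positivity
  have htl : l + S.ρ * 2 ^ (-(n : ℝ)) = t * l := by rw [ht]; field_simp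
  have h2 := h1.enlarge hl0 (κ := t) (by rw [ht]; nlinarith)
  rw [htl]
  refine h2.mono (by rw [← htl]; positivity) ?_
  have hB := hsc.nonneg hl0
  have h7 : t ^ (d + q) ≤ (1 + S.ρ) ^ (d + q) :=
    pow_le_pow_left₀ (by positivity) (by rw [ht]; nlinarith) _
  rw [two_rpow_mul, neg_neg]
  calc _ = C * (2 ^ (-(n : ℝ))) ^ β * B * t ^ (d + q) := by ring
    _ ≤ C * (2 ^ (-(n : ℝ))) ^ β * B * (1 + S.ρ) ^ (d + q) := by gcongr
    _ = _ := by ring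

lemma pair_coh_eq {F : S.U → 𝓓'(S.U, ℝ)} {f : 𝓓'(S.U, ℝ)} {M : ℝ} (hB : S.Bd F f M) {x y : S.U}
    (hx : (x : Sp d) ∈ S.Kt) (hy : (y : Sp d) ∈ S.Kt) {g : Sp d → ℝ} (hg : IsCp S.p S.Q g) :
    pair (F x - F y) g = pair (F x - f) g - pair (F y - f) g := by
  rw [← (hB.finOrder hx).pair_sub_left (hB.finOrder hy) S.Q_subset hg, sub_sub_sub_cancel_right]

set_option maxHeartbeats 1000000 in
/-- The coherence bound for the terms of the lifted germ. -/
lemma exists_abs_remTerm_sub_le (hU : Convex ℝ (S.U : Set (Sp d))) {s : ℤ} (hs : s + 1 ≤ m)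
    {e a' b : ℝ} (he : 0 ≤ e) (heβ : e ≤ β) (hea : e ≤ -a')
    (hes : ∀ k : ℕ, (k : ℤ) ≤ s → e ≤ S.γ + β - k) (heN : e ≤ ((s + 1).toNat : ℝ) - (S.γ + β))
    (haa : a' ≤ S.a + β) (hb0 : b ≤ 0) (hbγ : b ≤ S.γ) (hab : a' ≤ b + β)
    {q : ℕ} (hq : q ≤ S.p) (lb : ℝ) : ∃ C : ℝ, 0 ≤ C ∧ ∀ F f M H, S.Bd F f M → 0 ≤ H →
    ∀ x y : S.U, (x : Sp d) ∈ innerSet S.U (2 * S.ρ) → (y : Sp d) ∈ innerSet S.U (2 * S.ρ) →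
    (∀ L A, 0 < L → L ≤ lb + S.ρ → ∀ g, IsCp S.p S.Q g →
      Function.support g ⊆ Metric.closedBall (x : Sp d) L → Scaled q A L g →
      |pair (F x - F y) g| ≤ H * A * (L ^ b * (L + dist (x : Sp d) y) ^ (S.γ - b))) →
    ∀ l ∈ Ioc 0 lb, ∀ (ψ : Sp d → ℝ) B, ContDiff ℝ q ψ →
    Function.support ψ ⊆ Metric.closedBall (x : Sp d) l ∩ innerSet S.U (2 * S.ρ) →
    Scaled q B l ψ → ∀ n,
    |S.remTerm κ s (F x - f) n x ψ - S.remTerm κ s (F y - f) n y ψ| ≤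
      C * (M + H) * B * (l ^ a' * (l + dist (x : Sp d) y) ^ (S.γ + β - a')) *
        (peak e l n + peak e (l + dist (x : Sp d) y) n) := by
  have hρ := S.ρ_pos
  obtain ⟨C₁, hC₁, h₁⟩ := S.exists_abs_polyTerm_le κ (show s ≤ m by omega) he hes
  obtain ⟨C₂, hC₂, h₂⟩ := S.exists_abs_remTerm_le κ hU hs he heN
  obtain ⟨C₃, hC₃, h₃⟩ := S.exists_scaled_superpose κ hq lb
  obtain ⟨C₄, hC₄, h₄⟩ := S.exists_abs_pair_coh_superpose_le κ
  set v := volume.real (Metric.closedBall (0 : Sp d) 1)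
  have hv : 0 ≤ v := measureReal_nonneg
  have hγb : 0 ≤ S.γ - b := by linarith
  have hγa : 0 ≤ S.γ - S.a := by have := S.a_le; linarith
  set c₃ := C₃ * (1 + S.ρ) ^ (S.γ - b) with hc₃
  set c₄ := C₄ * 2 ^ (S.γ - S.a) * v with hc₄
  have hc₃0 : 0 ≤ c₃ := by positivity
  have hc₄0 : 0 ≤ c₄ := by positivity
  refine ⟨2 * (C₁ * v) + 2 * (C₂ * v) + c₃ + c₄, by positivity,
    fun F f M H hB hH x y hx hy hpair l hl ψ B hψ hsupp hsc n => ?_⟩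
  have hx' := S.innerSet_two_subset_Kt hx
  have hy' := S.innerSet_two_subset_Kt hy
  have hl0 : 0 < l := hl.1
  have hB0 := hsc.nonneg hl0
  have hM := hB.M_nonneg
  have hqn := two_rpow_neg_pos n
  set δ := l + dist (x : Sp d) y with hδ
  have hd0 : 0 ≤ dist (x : Sp d) y := dist_nonneg
  have hlδ : l ≤ δ := by linarith
  have hδ0 : 0 < δ := hl0.trans_le hlδ
  have hs1 := hsupp.trans inter_subset_left
  have hsx : Function.support ψ ⊆ Metric.closedBall (x : Sp d) δ :=
    hs1.trans (Metric.closedBall_subset_closedBall hlδ)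
  have hsy : Function.support ψ ⊆ Metric.closedBall (y : Sp d) δ :=
    hs1.trans (Metric.closedBall_subset_closedBall' le_rfl)
  have hI := integral_abs_le_of_scaled hl0 hsc hs1
  have hI0 := integral_abs_nonneg ψ
  have hψc := hψ.continuous
  set D := l ^ a' * δ ^ (S.γ + β - a') with hD
  have hD0 : 0 ≤ D := by positivity
  have ha0 : a' ≤ 0 := by linarith
  have hδD : δ ^ (S.γ + β) ≤ D := by
    have := rpow_mul_rpow_le (w := S.γ + β) hl0 hlδ ha0
    simpa using this
  have hpk1 := peak_nonneg (e := e) hl0 n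
  have hpk2 := peak_nonneg (e := e) hδ0 n
  set pk := peak e l n + peak e δ n with hpk
  have hconv : ∀ c, 0 ≤ c → c * M * (∫ z, |ψ z|) * (δ ^ (S.γ + β) * peak e δ n) ≤
      c * v * ((M + H) * B * D * pk) := fun c hc => by
    calc c * M * (∫ z, |ψ z|) * (δ ^ (S.γ + β) * peak e δ n)
        ≤ c * (M + H) * (v * B) * (D * pk) := by
          gcongr
          · linarith
          · linarith
      _ = _ := by ring
  have hE0 : 0 ≤ (M + H) * B * D * pk := by positivity
  suffices h : |S.remTerm κ s (F x - f) n x ψ - S.remTerm κ s (F y - f) n y ψ| ≤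
      (2 * (C₁ * v) + 2 * (C₂ * v) + c₃ + c₄) * ((M + H) * B * D * pk) by
    refine h.trans (le_of_eq (by ring))
  have hA : IsCompact (Metric.closedBall (x : Sp d) l ∩ innerSet S.U (2 * S.ρ)) :=
    (isCompact_closedBall _ _).inter_right (isClosed_innerSet _ _)
  -- For pieces wider than `l + |x - y|` no cancellation between `x` and `y` is needed: `ψ` is
  -- supported in the balls of radius `δ` around both points, and each Taylor remainder is estimated
  -- separately.
  rcases le_or_gt δ (2 ^ (-(n : ℝ))) with hcase | hcase
  · have e1 := h₂ F f M hB x hx n ψ hψc δ hδ0 hcase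
      (subset_inter hsx (hsupp.trans inter_subset_right))
    have e2 := h₂ F f M hB y hy n ψ hψc δ hδ0 hcase
      (subset_inter hsy (hsupp.trans inter_subset_right))
    have e3 := hconv C₂ hC₂
    have e4 := abs_sub (S.remTerm κ s (F x - f) n x ψ) (S.remTerm κ s (F y - f) n y ψ)
    have e5 : 0 ≤ (2 * (C₁ * v) + c₃ + c₄) * ((M + H) * B * D * pk) := by positivity
    linarith
  -- For narrower pieces the two Taylor polynomials are estimated separately and only the pairings
  -- with `superpose ψ` are combined into one with `F x - F y`, which removes `f`.
  have p1 := (h₁ F f M hB x hx' n ψ hψc δ hcase.le hsx).trans (hconv C₁ hC₁)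
  have p2 := (h₁ F f M hB y hy' n ψ hψc δ hcase.le hsy).trans (hconv C₁ hC₁)
  have hcp : IsCp S.p S.Q (superpose ψ (κ.cutPiece hρ n 0)) :=
    κ.isCp_superpose hρ (by simp [len]) hψc hA hsupp
  have hsplit : S.remTerm κ s (F x - f) n x ψ - S.remTerm κ s (F y - f) n y ψ =
      pair (F x - F y) (superpose ψ (κ.cutPiece hρ n 0)) -
        (S.polyTerm κ s (F x - f) n x ψ - S.polyTerm κ s (F y - f) n y ψ) := by
    rw [S.pair_coh_eq hB hx' hy' hcp, remTerm, remTerm]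
    ring
  have hmain : |pair (F x - F y) (superpose ψ (κ.cutPiece hρ n 0))| ≤
      (c₃ + c₄) * ((M + H) * B * D * pk) := by
    -- Below the scale of `ψ` the dual piece keeps this scale and gains `2^{-βn}`. Here enters the
    -- hypothesis `hpair`, which asks for `q` derivatives only and has its own exponent `b`.
    rcases le_or_gt (2 ^ (-(n : ℝ))) l with hc | hc
    · obtain ⟨g1, g2, g3⟩ := h₃ n ψ x B l hψ hl hc hsc hsupp
      set L := l + S.ρ * 2 ^ (-(n : ℝ)) with hL
      have hlL : l ≤ L := by have := mul_pos hρ hqn; linarith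
      have hL0 : 0 < L := hl0.trans_le hlL
      have hq1 := two_rpow_neg_le_one n
      refine (hpair L _ hL0 (by have := hl.2; nlinarith) _ g1 g2 g3).trans ?_
      have e1 : L ^ b ≤ l ^ b := Real.rpow_le_rpow_of_nonpos hl0 hlL hb0
      have e2 : (L + dist (x : Sp d) y) ^ (S.γ - b) ≤ (1 + S.ρ) ^ (S.γ - b) * δ ^ (S.γ - b) := by
        rw [← Real.mul_rpow (by positivity) hδ0.le]
        refine Real.rpow_le_rpow (by positivity) ?_ hγb
        have : S.ρ * 2 ^ (-(n : ℝ)) ≤ S.ρ * δ := by gcongr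
        rw [hL, hδ] at *
        linarith
      have e3 : (2 ^ (-(n : ℝ))) ^ β * (l ^ b * δ ^ (S.γ - b)) ≤ peak e l n * D := by
        have e4 := rpow_div_le_peak_of_le hl0 he heβ hc
        have e5 := rpow_mul_rpow_le (w := S.γ + β) hl0 hlδ hab
        rw [show S.γ + β - (b + β) = S.γ - b by ring] at e5
        calc _ = (2 ^ (-(n : ℝ)) / l) ^ β * (l ^ (b + β) * δ ^ (S.γ - b)) := by
              rw [Real.div_rpow hqn.le hl0.le, Real.rpow_add hl0]
              field_simp
          _ ≤ _ := by gcongr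
      calc H * (C₃ * (2 ^ (-(n : ℝ))) ^ β * B) * (L ^ b * (L + dist (x : Sp d) y) ^ (S.γ - b))
          ≤ H * (C₃ * (2 ^ (-(n : ℝ))) ^ β * B) *
            (l ^ b * ((1 + S.ρ) ^ (S.γ - b) * δ ^ (S.γ - b))) := by gcongr
        _ = c₃ * H * B * ((2 ^ (-(n : ℝ))) ^ β * (l ^ b * δ ^ (S.γ - b))) := by rw [hc₃]; ring
        _ ≤ (c₃ + c₄) * (M + H) * B * (pk * D) :=
          mul_le_mul (by gcongr <;> linarith)
            (e3.trans (mul_le_mul_of_nonneg_right (by linarith) hD0)) (by positivity)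
            (by positivity)
        _ = _ := by ring
    -- In the window `l < 2^{-n} < δ`, coherence is used at scale `2^{-n}`. Lowering the exponent
    -- from `a + β` to `a' < 0` produces `(l/2^{-n})^{-a'}`, which makes the window summable.
    · refine (h₄ F f M hB x y hx' hy' n ψ hψc l hl0.le hc.le hs1).trans ?_
      have e2 : (2 ^ (-(n : ℝ)) + dist (x : Sp d) y) ^ (S.γ - S.a) ≤
          2 ^ (S.γ - S.a) * δ ^ (S.γ - S.a) := by
        rw [← Real.mul_rpow (by positivity) hδ0.le]
        refine Real.rpow_le_rpow (by positivity) ?_ hγa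
        linarith
      have e3 : (2 ^ (-(n : ℝ))) ^ (S.a + β) * δ ^ (S.γ - S.a) ≤ peak e l n * D := by
        have e4 := rpow_div_le_peak_of_ge hl0 he hea hc.le
        have e5 := rpow_mul_rpow_le (w := S.γ + β) hqn hcase.le haa
        rw [show S.γ + β - (S.a + β) = S.γ - S.a by ring] at e5
        refine e5.trans ?_
        calc _ = (l / 2 ^ (-(n : ℝ))) ^ (-a') * D := by
              rw [hD, Real.div_rpow hl0.le hqn.le, Real.rpow_neg hl0.le, Real.rpow_neg hqn.le]
              field_simp
          _ ≤ _ := by gcongr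
      calc C₄ * M * (∫ x, |ψ x|) * ((2 ^ (-(n : ℝ))) ^ (S.a + β) *
            (2 ^ (-(n : ℝ)) + dist (x : Sp d) y) ^ (S.γ - S.a))
          ≤ C₄ * M * (v * B) * ((2 ^ (-(n : ℝ))) ^ (S.a + β) *
            (2 ^ (S.γ - S.a) * δ ^ (S.γ - S.a))) := by gcongr
        _ = c₄ * M * B * ((2 ^ (-(n : ℝ))) ^ (S.a + β) * δ ^ (S.γ - S.a)) := by rw [hc₄]; ring
        _ ≤ (c₃ + c₄) * (M + H) * B * (pk * D) :=
          mul_le_mul (by gcongr <;> linarith)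
            (e3.trans (mul_le_mul_of_nonneg_right (by linarith) hD0)) (by positivity)
            (by positivity)
        _ = _ := by ring
  rw [hsplit]
  have e4 := abs_sub (pair (F x - F y) (superpose ψ (κ.cutPiece hρ n 0)))
    (S.polyTerm κ s (F x - f) n x ψ - S.polyTerm κ s (F y - f) n y ψ)
  have e6 := abs_sub (S.polyTerm κ s (F x - f) n x ψ) (S.polyTerm κ s (F y - f) n y ψ)
  have e5 : 0 ≤ (2 * (C₂ * v)) * ((M + H) * B * D * pk) := by positivity
  linarith

/-- The reconstruction bound for the terms of the lifted germ. -/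
lemma exists_abs_remTerm_rec_le (hU : Convex ℝ (S.U : Set (Sp d))) {s : ℤ} (hs : s + 1 ≤ m)
    {e : ℝ} (he : 0 ≤ e) (heβ : e ≤ β)
    (hes : ∀ k : ℕ, (k : ℤ) ≤ s → e ≤ S.γ + β - k) (heN : e ≤ ((s + 1).toNat : ℝ) - (S.γ + β))
    {lb : ℝ} (hlb : 0 < lb) : ∃ C : ℝ, 0 ≤ C ∧ ∀ F f M, S.Bd F f M →
    ∀ x : S.U, (x : Sp d) ∈ innerSet S.U (2 * S.ρ) →
    ∀ l ∈ Ioc 0 lb, ∀ (ψ : Sp d → ℝ) B, ContDiff ℝ S.p ψ →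
    Function.support ψ ⊆ Metric.closedBall (x : Sp d) l ∩ innerSet S.U (2 * S.ρ) →
    Scaled S.p B l ψ → ∀ n,
    |S.remTerm κ s (F x - f) n x ψ| ≤ C * M * B * l ^ (S.γ + β) * peak e l n := by
  have hρ := S.ρ_pos
  obtain ⟨C₁, hC₁, h₁⟩ := S.exists_abs_polyTerm_le κ (show s ≤ m by omega) he hes
  obtain ⟨C₂, hC₂, h₂⟩ := S.exists_abs_remTerm_le κ hU hs he heN
  obtain ⟨C₃, hC₃, h₃⟩ := S.exists_scaled_superpose κ le_rfl lb
  obtain ⟨C₄, hC₄, h₄⟩ := S.exists_pair_rec (Lm := lb + S.ρ) (by positivity)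
  set v := volume.real (Metric.closedBall (0 : Sp d) 1)
  have hv : 0 ≤ v := measureReal_nonneg
  -- Since `l ≤ L ≤ (1 + ρ) l`, this constant compares `L^γ` with `l^γ` for either sign of `γ`.
  set c := max 1 ((1 + S.ρ) ^ S.γ) with hc
  have hc0 : 0 ≤ c := zero_le_one.trans (le_max_left _ _)
  refine ⟨C₁ * v + C₂ * v + C₄ * C₃ * c, by positivity,
    fun F f M hB x hx l hl ψ B hψ hsupp hsc n => ?_⟩
  have hx' := S.innerSet_two_subset_Kt hx
  have hl0 : 0 < l := hl.1
  have hB0 := hsc.nonneg hl0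
  have hM := hB.M_nonneg
  have hqn := two_rpow_neg_pos n
  have hs1 := hsupp.trans inter_subset_left
  have hI := integral_abs_le_of_scaled hl0 hsc hs1
  have hI0 := integral_abs_nonneg ψ
  have hψc := hψ.continuous
  have hpk := peak_nonneg (e := e) hl0 n
  have hconv : ∀ c, 0 ≤ c → c * M * (∫ z, |ψ z|) * (l ^ (S.γ + β) * peak e l n) ≤
      c * v * (M * B * l ^ (S.γ + β) * peak e l n) := fun c hc => by
    calc c * M * (∫ z, |ψ z|) * (l ^ (S.γ + β) * peak e l n)
        ≤ c * M * (v * B) * (l ^ (S.γ + β) * peak e l n) := by gcongr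
      _ = _ := by ring
  have hE0 : 0 ≤ M * B * l ^ (S.γ + β) * peak e l n := by positivity
  suffices h : |S.remTerm κ s (F x - f) n x ψ| ≤
      (C₁ * v + C₂ * v + C₄ * C₃ * c) * (M * B * l ^ (S.γ + β) * peak e l n) by
    refine h.trans (le_of_eq (by ring))
  have t1 : 0 ≤ C₁ * v * (M * B * l ^ (S.γ + β) * peak e l n) := by positivity
  have t2 : 0 ≤ C₂ * v * (M * B * l ^ (S.γ + β) * peak e l n) := by positivity
  have t3 : 0 ≤ C₄ * C₃ * c * (M * B * l ^ (S.γ + β) * peak e l n) := by positivity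
  rcases le_or_gt l (2 ^ (-(n : ℝ))) with hcase | hcase
  · have e1 := (h₂ F f M hB x hx n ψ hψc l hl0 hcase hsupp).trans (hconv C₂ hC₂)
    linarith
  have p1 := (h₁ F f M hB x hx' n ψ hψc l hcase.le hs1).trans (hconv C₁ hC₁)
  obtain ⟨g1, g2, g3⟩ := h₃ n ψ x B l hψ hl hcase.le hsc hsupp
  set L := l + S.ρ * 2 ^ (-(n : ℝ)) with hL
  have hlL : l ≤ L := by have := mul_pos hρ hqn; linarith
  have hL0 : 0 < L := hl0.trans_le hlL
  have hq1 := two_rpow_neg_le_one n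
  have hmain := h₄ F f M hB x hx' L _ hL0 (by have := hl.2; nlinarith) _ g1 g2 g3
  have hLγ : L ^ S.γ ≤ c * l ^ S.γ := by
    rcases le_total 0 S.γ with h0 | h0
    · have : L ≤ (1 + S.ρ) * l := by rw [hL]; nlinarith
      calc L ^ S.γ ≤ ((1 + S.ρ) * l) ^ S.γ := Real.rpow_le_rpow hL0.le this h0
        _ = (1 + S.ρ) ^ S.γ * l ^ S.γ := Real.mul_rpow (by positivity) hl0.le
        _ ≤ _ := by
          gcongr
          exact le_max_right _ _
    · calc L ^ S.γ ≤ l ^ S.γ := Real.rpow_le_rpow_of_nonpos hl0 hlL h0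
        _ ≤ c * l ^ S.γ := le_mul_of_one_le_left (by positivity) (le_max_left _ _)
  have e3 : (2 ^ (-(n : ℝ))) ^ β * l ^ S.γ ≤ l ^ (S.γ + β) * peak e l n := by
    have e4 := rpow_div_le_peak_of_le hl0 he heβ hcase.le
    calc _ = l ^ (S.γ + β) * (2 ^ (-(n : ℝ)) / l) ^ β := by
          rw [Real.div_rpow hqn.le hl0.le, Real.rpow_add hl0]
          field_simp
      _ ≤ _ := by gcongr
  have hmain' : |pair (F x - f) (superpose ψ (κ.cutPiece hρ n 0))| ≤
      C₄ * C₃ * c * (M * B * l ^ (S.γ + β) * peak e l n) := by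
    refine hmain.trans ?_
    calc C₄ * M * (C₃ * (2 ^ (-(n : ℝ))) ^ β * B) * L ^ S.γ
        ≤ C₄ * M * (C₃ * (2 ^ (-(n : ℝ))) ^ β * B) * (c * l ^ S.γ) := by gcongr
      _ = C₄ * C₃ * c * M * B * ((2 ^ (-(n : ℝ))) ^ β * l ^ S.γ) := by ring
      _ ≤ C₄ * C₃ * c * M * B * (l ^ (S.γ + β) * peak e l n) := by gcongr
      _ = _ := by ring
  rw [remTerm]
  have := abs_sub (pair (F x - f) (superpose ψ (κ.cutPiece hρ n 0)))
    (S.polyTerm κ s (F x - f) n x ψ)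
  linarith

end Setup

/-! ### Existence of images and of pointwise derivatives -/

/-- A linear functional on test functions that is bounded by finitely many derivatives is a
distribution. -/
lemma exists_distribution_of_bound {V : Opens (Sp d)} (T : 𝓓(V, ℝ) → ℝ)
    (hadd : ∀ ψ χ, T (ψ + χ) = T ψ + T χ) (hsmul : ∀ (c : ℝ) ψ, T (c • ψ) = c * T ψ)
    {N : ℕ} {C : ℝ}
    (h : ∀ (ψ : 𝓓(V, ℝ)) (B : ℝ), (∀ i ≤ N, ∀ y, ‖iteratedFDeriv ℝ i ψ y‖ ≤ B) → |T ψ| ≤ C * B) :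
    ∃ G : 𝓓'(V, ℝ), ∀ ψ, G ψ = T ψ := by
  -- Continuity has to be checked only on each space of functions supported in a compact `Q`, and by
  -- additivity only at zero, where the jets tend to zero.
  refine ⟨TestFunction.mkCLM ℝ T hadd hsmul fun Q hQ => ?_, fun ψ => rfl⟩
  let L : 𝓓_{Q}(Sp d, ℝ) →+ ℝ :=
    { toFun := fun f => T (TestFunction.ofSupportedIn hQ f)
      map_zero' := by
        have := hsmul 0 (TestFunction.ofSupportedIn hQ 0)
        rw [zero_smul, zero_mul] at this
        exact this
      map_add' := fun f g => hadd (TestFunction.ofSupportedIn hQ f)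
        (TestFunction.ofSupportedIn hQ g) }
  refine continuous_of_continuousAt_zero L ?_
  have hb : ∀ f, ‖L f‖ ≤ C * ‖jet N f‖ := fun f => by
    refine h _ _ fun i hi y => ?_
    have h1 := jetEval_jet (N := N) ⟨i, Nat.lt_succ_of_le hi⟩ y f
    change ‖iteratedFDeriv ℝ i f y‖ ≤ _
    rw [← h1]
    exact ((jet N f ⟨i, Nat.lt_succ_of_le hi⟩).norm_coe_le_norm y).trans
      (norm_le_pi_norm (jet N f) ⟨i, Nat.lt_succ_of_le hi⟩)
  have h0 : jet N (0 : 𝓓_{Q}(Sp d, ℝ)) = 0 :=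
    funext fun i => map_zero (ContDiffMapSupportedIn.structureMapCLM ℝ ⊤ (i : ℕ))
  have ht : Tendsto (fun f : 𝓓_{Q}(Sp d, ℝ) => C * ‖jet N f‖) (𝓝 0) (𝓝 0) := by
    have := ((continuous_jet N (Q := Q)).norm.const_mul C).tendsto 0
    simpa [h0] using this
  rw [ContinuousAt, map_zero]
  exact squeeze_zero_norm hb ht

lemma summable_two_rpow {e : ℝ} (he : 0 < e) : Summable fun n : ℕ => ((2 : ℝ) ^ (-(n : ℝ))) ^ e := by
  have h : ∀ n : ℕ, ((2 : ℝ) ^ (-(n : ℝ))) ^ e = ((2 : ℝ) ^ (-e)) ^ n := fun n => by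
    rw [← Real.rpow_natCast, ← Real.rpow_mul (by norm_num), ← Real.rpow_mul (by norm_num)]
    congr 1; ring
  simp only [h]
  exact summable_geometric_of_lt_one (by positivity)
    (Real.rpow_lt_one_of_one_lt_of_neg (by norm_num) (by linarith))

lemma integral_rescale_mul (η : Sp d → ℝ) (x : Sp d) {ε : ℝ} (hε : 0 < ε) (h : Sp d → ℝ) :
    ∫ z, rescale η x ε z * h z = ∫ w, η w * h (x + ε • w) := by
  rw [← integral_add_left_eq_self (μ := (volume : Measure (Sp d))) _ x]
  have h2 := Measure.integral_comp_smul (volume : Measure (Sp d))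
    (fun z => rescale η x ε (x + z) * h (x + z)) ε
  have h3 : ∀ w, rescale η x ε (x + ε • w) * h (x + ε • w) =
      (ε ^ d)⁻¹ * (η w * h (x + ε • w)) := fun w => by
    rw [rescale, add_sub_cancel_left, smul_smul, inv_mul_cancel₀ hε.ne', one_smul, mul_assoc]
  simp only [h3] at h2
  rw [integral_const_mul, finrank_euclideanSpace_fin, smul_eq_mul, abs_of_pos (by positivity)] at h2
  exact (mul_left_cancel₀ (by positivity) h2).symm

lemma norm_iteratedFDeriv_adjDeriv_le {V : Opens (Sp d)} {n : ℕ} (v : Fin n → Sp d)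
    (hv : ∀ i, ‖v i‖ ≤ 1) (χ : 𝓓(V, ℝ)) {j : ℕ} {B : ℝ}
    (hB : ∀ y, ‖iteratedFDeriv ℝ (j + n) χ y‖ ≤ B) (y : Sp d) :
    ‖iteratedFDeriv ℝ j (adjDeriv v χ) y‖ ≤ B := by
  induction n generalizing χ with
  | zero => exact hB y
  | succ n ih =>
    rw [adjDeriv]
    refine ih _ (fun i => hv _) _ fun y => ?_
    have e : ⇑(-(TestFunction.lineDerivCLM ℝ (v 0) χ : 𝓓(V, ℝ))) =
        -fun x => fderiv ℝ χ x (v 0) := funext fun x => by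
      rw [Pi.neg_apply, ← lineDerivCLM_apply']
      rfl
    have hf : ContDiff ℝ (⊤ : ℕ∞) (fderiv ℝ χ) := χ.contDiff.fderiv_right (m := (⊤ : ℕ∞)) (by simp)
    rw [e, iteratedFDeriv_neg_apply, norm_neg]
    have h1 := norm_iteratedFDeriv_clm_apply_const (c := v 0) (n := j + n) (hf.contDiffAt (x := y))
      (by exact_mod_cast le_top)
    refine h1.trans ?_
    rw [norm_iteratedFDeriv_fderiv]
    calc _ ≤ 1 * ‖iteratedFDeriv ℝ (j + n + 1) χ y‖ := by gcongr; exact hv 0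
      _ ≤ B := by rw [one_mul]; exact hB y

lemma HasImage.unique {U V : Opens (Sp d)} {β : ℝ} {m p : ℕ} {ρ : ℝ}
    {κ : RegKernel U β m p ρ} {f : 𝓓'(U, ℝ)} {T T' : 𝓓'(V, ℝ)} (h : HasImage κ f T)
    (h' : HasImage κ f T') : T = T' := by
  ext ψ
  obtain ⟨c, hc, hT⟩ := h ψ
  obtain ⟨c', hc', hT'⟩ := h' ψ
  have : c = c' := funext fun n => (hc n).unique (hc' n)
  subst this
  exact tendsto_nhds_unique hT hT'

lemma HasImage.image_eq {U V : Opens (Sp d)} {β : ℝ} {m p : ℕ} {ρ : ℝ}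
    {κ : RegKernel U β m p ρ} {f : 𝓓'(U, ℝ)} {T : 𝓓'(V, ℝ)} (h : HasImage κ f T) :
    image V κ f = T := by
  have h' : ∃ T : 𝓓'(V, ℝ), HasImage κ f T := ⟨T, h⟩
  rw [image, dif_pos h']
  exact h'.choose_spec.unique h

lemma HasImage.add {U V : Opens (Sp d)} {β : ℝ} {m p : ℕ} {ρ : ℝ}
    {κ : RegKernel U β m p ρ} {f f' : 𝓓'(U, ℝ)} {T T' : 𝓓'(V, ℝ)} (h : HasImage κ f T)
    (h' : HasImage κ f' T') : HasImage κ (f + f') (T + T') := fun ψ => by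
  obtain ⟨c, hc, hT⟩ := h ψ
  obtain ⟨c', hc', hT'⟩ := h' ψ
  refine ⟨fun n => c n + c' n, fun n => (hc n).add (hc' n), ?_⟩
  simp only [Finset.sum_add_distrib]
  exact hT.add hT'

lemma HasImage.smul {U V : Opens (Sp d)} {β : ℝ} {m p : ℕ} {ρ : ℝ}
    {κ : RegKernel U β m p ρ} {f : 𝓓'(U, ℝ)} {T : 𝓓'(V, ℝ)} (h : HasImage κ f T)
    (a : ℝ) : HasImage κ (a • f) (a • T) := fun ψ => by
  obtain ⟨c, hc, hT⟩ := h ψ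
  refine ⟨fun n => a * c n, fun n => (hc n).smul a, ?_⟩
  simp only [← Finset.mul_sum]
  exact hT.const_mul a

lemma HasPtDeriv.unique {V : Opens (Sp d)} {f : 𝓓'(V, ℝ)} {k : Fin d → ℕ} {x : V} {c c' : ℝ}
    (h : HasPtDeriv f k x c) (h' : HasPtDeriv f k x c') : c = c' := by
  by_contra hne
  have hpos : 0 < |c - c'| := abs_pos.2 (sub_ne_zero.2 hne)
  obtain ⟨ε₁, hε₁, h₁⟩ := h (stdMoll d) (|c - c'| / 2) (by positivity)
  obtain ⟨ε₂, hε₂, h₂⟩ := h' (stdMoll d) (|c - c'| / 2) (by positivity)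
  have hm : 0 < min ε₁ ε₂ := lt_min hε₁ hε₂
  obtain ⟨χ, hχ, e⟩ := h₁ (min ε₁ ε₂ / 2) ⟨by positivity,
    (half_lt_self hm).trans_le (min_le_left _ _)⟩
  obtain ⟨χ', hχ', e'⟩ := h₂ (min ε₁ ε₂ / 2) ⟨by positivity,
    (half_lt_self hm).trans_le (min_le_right _ _)⟩
  have : χ = χ' := DFunLike.ext _ _ fun y => by rw [hχ, hχ']
  subst this
  rw [integral_stdMoll, mul_one] at e e'
  have := abs_sub_le c ((∂^{dirs k} f) χ) c'
  rw [abs_sub_comm c ((∂^{dirs k} f) χ)] at this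
  linarith

lemma HasPtDeriv.ptDeriv_eq {V : Opens (Sp d)} {f : 𝓓'(V, ℝ)} {k : Fin d → ℕ} {x : V} {c : ℝ}
    (h : HasPtDeriv f k x c) : ptDeriv f k x = c := by
  have h' : ∃ c, HasPtDeriv f k x c := ⟨c, h⟩
  rw [ptDeriv, dif_pos h']
  exact h'.choose_spec.unique h

lemma exists_rpow_le_of_mem (γ : ℝ) {ρ : ℝ} (hρ : 0 < ρ) : ∃ c : ℝ, 0 ≤ c ∧ ∀ l L, 0 < l → l ≤ L →
    L ≤ (1 + ρ) * l → L ^ γ ≤ c * l ^ γ := by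
  refine ⟨max 1 ((1 + ρ) ^ γ), zero_le_one.trans (le_max_left _ _), fun l L hl0 hlL hL => ?_⟩
  rcases le_total 0 γ with h0 | h0
  · calc L ^ γ ≤ ((1 + ρ) * l) ^ γ := Real.rpow_le_rpow (hl0.le.trans hlL) hL h0
      _ = (1 + ρ) ^ γ * l ^ γ := Real.mul_rpow (by positivity) hl0.le
      _ ≤ _ := by
        gcongr
        exact le_max_right _ _
  · calc L ^ γ ≤ l ^ γ := Real.rpow_le_rpow_of_nonpos hl0 hlL h0
      _ ≤ _ := le_mul_of_one_le_left (by positivity) (le_max_left _ _)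

lemma scaled_rescale {η : 𝓓(unitBall d, ℝ)} {c : ℝ} {q : ℕ}
    (h : ∀ j ≤ q, ∀ y, ‖iteratedFDeriv ℝ j η y‖ ≤ c) {ε : ℝ} (hε : 0 < ε) (x : Sp d) :
    Scaled q c ε (rescale η x ε) := fun j hj y => norm_iteratedFDeriv_rescale (h j hj) hε x y

namespace Setup

variable (S : Setup d) {β : ℝ} {m : ℕ} (κ : RegKernel S.U β m S.p S.ρ)

/-- The set on which the image is defined. -/
abbrev V : Opens (Sp d) := shrink S.U (2 * S.ρ)

lemma V_subset : (S.V : Set (Sp d)) ⊆ innerSet S.U (2 * S.ρ) :=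
  shrink_subset_innerSet (by have := S.ρ_pos; positivity)

lemma tsupport_subset (ψ : 𝓓(S.V, ℝ)) : tsupport ψ ⊆ innerSet S.U (2 * S.ρ) :=
  ψ.tsupport_subset.trans S.V_subset

lemma dual_coe_eq (n : ℕ) (ψ : 𝓓(S.V, ℝ)) :
    κ.dual n ψ = superpose ψ (κ.cutPiece S.ρ_pos n 0) :=
  κ.dual_eq S.ρ_pos ((subset_tsupport _).trans (S.tsupport_subset ψ))

lemma isCp_superpose_coe {k : Fin d → ℕ} (hk : len k ≤ m) (n : ℕ) (ψ : 𝓓(S.V, ℝ)) :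
    IsCp S.p S.Q (superpose ψ (κ.cutPiece S.ρ_pos n k)) :=
  κ.isCp_superpose S.ρ_pos hk ψ.contDiff.continuous ψ.hasCompactSupport (subset_tsupport _)

/-- Finite order combined with the moment estimate: every piece contributes `2^{-βn}`, and `β > 0`
will make the image of a distribution of finite order converge. -/
lemma exists_abs_pair_coe_le {G : 𝓓'(S.U, ℝ)} (hG : FinOrder G S.p S.Q) : ∃ C : ℝ, 0 ≤ C ∧
    ∀ (n : ℕ) (ψ : 𝓓(S.V, ℝ)) B, (∀ i ≤ S.p, ∀ y, ‖iteratedFDeriv ℝ i ψ y‖ ≤ B) →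
      |pair G (superpose ψ (κ.cutPiece S.ρ_pos n 0))| ≤ C * (2 ^ (-(n : ℝ))) ^ β * B := by
  obtain ⟨C₁, hC₁, h₁⟩ := κ.exists_norm_iteratedFDeriv_dual_le S.ρ_pos S.bdd
  obtain ⟨C₂, h₂⟩ := hG.exists_abs_pair_le S.Q_subset
  refine ⟨|C₂| * C₁, by positivity, fun n ψ B hB => ?_⟩
  have hB0 : 0 ≤ B := (norm_nonneg _).trans (hB 0 (Nat.zero_le _) 0)
  have h3 : ∀ j ≤ S.p, ∀ y, ‖iteratedFDeriv ℝ j (superpose ψ (κ.cutPiece S.ρ_pos n 0)) y‖ ≤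
      C₁ * 2 ^ (-β * n) * B := fun j hj y =>
    h₁ n j hj ψ (ψ.contDiff.of_le (by exact_mod_cast le_top)) _ ψ.hasCompactSupport
      (subset_tsupport _) (S.tsupport_subset ψ) B (fun i hi => hB i (hi.trans hj)) y
  refine (h₂ _ (S.isCp_superpose_coe κ (by simp [len]) n ψ) _ (fun y => ?_) (h3 _ le_rfl)).trans ?_
  · have := h3 0 (Nat.zero_le _) y
    rwa [norm_iteratedFDeriv_zero] at this
  · rw [two_rpow_mul, neg_neg, mul_assoc |C₂|, mul_assoc |C₂|]
    exact mul_le_mul_of_nonneg_right (le_abs_self _) (by positivity)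

/-- The image of a distribution of finite order. -/
lemma exists_hasImage (hβ : 0 < β) {G : 𝓓'(S.U, ℝ)} (hG : FinOrder G S.p S.Q) :
    ∃ T : 𝓓'(S.V, ℝ), HasImage κ G T ∧
      ∀ ψ : 𝓓(S.V, ℝ), HasSum (fun n => pair G (superpose ψ (κ.cutPiece S.ρ_pos n 0))) (T ψ) := by
  obtain ⟨C, hC, h⟩ := S.exists_abs_pair_coe_le κ hG
  have hB : ∀ ψ : 𝓓(S.V, ℝ), ∃ B, ∀ i ≤ S.p, ∀ y, ‖iteratedFDeriv ℝ i ψ y‖ ≤ B := fun ψ => by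
    obtain ⟨c, -, hc⟩ := exists_iteratedFDeriv_bound ψ.contDiff ψ.hasCompactSupport S.p
    exact ⟨c, hc⟩
  have hs := summable_two_rpow hβ
  have hsum : ∀ ψ : 𝓓(S.V, ℝ),
      Summable fun n => pair G (superpose ψ (κ.cutPiece S.ρ_pos n 0)) := fun ψ => by
    obtain ⟨B, hB⟩ := hB ψ
    exact ((hs.mul_left C).mul_right B).of_norm_bounded fun n => by
      rw [Real.norm_eq_abs]
      exact h n ψ B hB
  have hcp := fun n (ψ : 𝓓(S.V, ℝ)) =>
    S.isCp_superpose_coe κ (k := 0) (by simp [len]) n ψ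
  have hint : ∀ n (ψ : 𝓓(S.V, ℝ)) y, Integrable fun x => ψ x * κ.cutPiece S.ρ_pos n 0 x y :=
    fun n ψ y => integrable_mul_fam (κ.smoothFam_cutPiece S.ρ_pos (by simp [len]))
      ψ.contDiff.continuous ψ.hasCompactSupport (subset_tsupport _) y
  obtain ⟨T, hT⟩ := exists_distribution_of_bound
    (fun ψ : 𝓓(S.V, ℝ) => ∑' n, pair G (superpose ψ (κ.cutPiece S.ρ_pos n 0)))
    (fun ψ χ => by
      rw [← (hsum ψ).tsum_add (hsum χ)]
      congr 1
      ext n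
      rw [← hG.pair_add S.Q_subset (hcp n ψ) (hcp n χ)]
      congr 1
      ext y
      rw [superpose, superpose, superpose, ← integral_add (hint n ψ y) (hint n χ y)]
      refine integral_congr_ae (Eventually.of_forall fun x => ?_)
      exact add_mul _ _ _)
    (fun c ψ => by
      rw [← tsum_mul_left]
      congr 1
      ext n
      rw [← hG.pair_smul S.Q_subset (hcp n ψ), ← superpose_const_mul]
      rfl)
    (N := S.p) (C := C * ∑' n : ℕ, ((2 : ℝ) ^ (-(n : ℝ))) ^ β)
    (fun ψ B hB => by
      have h1 := tsum_of_norm_bounded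
        (f := fun n => pair G (superpose ψ (κ.cutPiece S.ρ_pos n 0)))
        ((hs.mul_left C).mul_right B).hasSum fun n => h n ψ B hB
      rwa [tsum_mul_right, tsum_mul_left] at h1)
  have hT' : ∀ ψ : 𝓓(S.V, ℝ),
      HasSum (fun n => pair G (superpose ψ (κ.cutPiece S.ρ_pos n 0))) (T ψ) := fun ψ => by
    rw [hT]
    exact (hsum ψ).hasSum
  refine ⟨T, fun ψ => ⟨_, fun n => ?_, (hT' ψ).tendsto_sum_nat⟩, hT'⟩
  rw [S.dual_coe_eq κ]
  exact hG.hasPairing S.Q_subset (hcp n ψ)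

/-- After substitution the superposition is an average of the pieces at `x + ε w`. This is a smooth
family up to and including `ε = 0`, along which the pairing is continuous. -/
lemma tendsto_pair_superpose_rescale {G : 𝓓'(S.U, ℝ)} (hG : FinOrder G S.p S.Q) {k : Fin d → ℕ}
    (hk : len k ≤ m) (n : ℕ) (x : Sp d) (η : 𝓓(unitBall d, ℝ)) :
    Tendsto (fun ε => pair G (superpose (rescale η x ε) (κ.cutPiece S.ρ_pos n k))) (𝓝[>] 0)
      (𝓝 ((∫ w, η w) * pair G (κ.cutPiece S.ρ_pos n k x))) := by
  have hρ := S.ρ_pos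
  set H : ℝ → Sp d → ℝ := fun ε y => ∫ w in Metric.closedBall (0 : Sp d) 1,
    η w * κ.cutPiece hρ n k (x + ε • w) y with hH
  have hfam : SmoothFam S.p H := by
    have h1 : SmoothFam S.p fun (q : ℝ × Sp d) y =>
        η q.2 • κ.cutPiece hρ n k (x + q.1 • q.2) y :=
      ((κ.smoothFam_cutPiece hρ (n := n) hk).comp (f := fun q : ℝ × Sp d => x + q.1 • q.2)
        (by fun_prop)).smul (η.contDiff.continuous.comp continuous_snd)
    exact h1.integral (μ := volume) (isCompact_closedBall (0 : Sp d) 1)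
  have hS : IsCompact (innerSet S.U (7 * S.ρ / 8)) := isCompact_innerSet S.bdd (by positivity)
  have hsupp : ∀ ε, Function.support (H ε) ⊆ innerSet S.U (7 * S.ρ / 8) := by
    intro ε y hy
    by_contra hy'
    refine hy ?_
    rw [hH]
    simp only
    refine integral_eq_zero_of_ae (Eventually.of_forall fun w => ?_)
    have : κ.cutPiece hρ n k (x + ε • w) y = 0 := by
      by_contra h
      exact hy' (κ.support_cutPiece hρ n k _ h).2
    simp [this]
  have hcont := hG.continuousAt_pair S.Q_subset hfam hS (p₀ := 0) (Eventually.of_forall hsupp)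
    (r := S.ρ / 8) (by positivity) (by
      refine (cthickening_innerSet_subset (by positivity) hS subset_rfl).trans (innerSet_anti ?_)
      linarith)
  have h0 : H 0 = fun y => (∫ w, η w) * κ.cutPiece hρ n k x y := by
    ext y
    rw [hH]
    simp only [zero_smul, add_zero]
    rw [setIntegral_mul_unitBall η fun _ => κ.cutPiece hρ n k x y, integral_mul_const]
  have h1 : ∀ ε ∈ Ioi (0 : ℝ), pair G (H ε) =
      pair G (superpose (rescale η x ε) (κ.cutPiece hρ n k)) := fun ε hε => by
    congr 1
    ext y
    rw [superpose, integral_rescale_mul _ _ hε, hH]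
    simp only
    rw [setIntegral_mul_unitBall η fun w => κ.cutPiece hρ n k (x + ε • w) y]
  have h2 : pair G (H 0) = (∫ w, η w) * pair G (κ.cutPiece hρ n k x) := by
    rw [h0, hG.pair_smul S.Q_subset (κ.isCp_cutPiece hρ hk x)]
  rw [← h2]
  refine Tendsto.congr' ?_ (hcont.tendsto.mono_left nhdsWithin_le_nhds)
  filter_upwards [self_mem_nhdsWithin] with ε hε using h1 ε hε

/-- A summable majorant independent of `ε`: depending on the sign of `γ - k`, the power of `ε` is at
most `1` or at most its value at `ε = q`. -/
lemma rpow_le_add_of_lt {q ε γ β k : ℝ} (hq : 0 < q) (hqε : q ≤ ε) (hε : ε ≤ 1) :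
    q ^ β * ε ^ (γ - k) ≤ q ^ (γ + β - k) + q ^ β := by
  have hε0 : 0 < ε := hq.trans_le hqε
  rcases le_total 0 (γ - k) with h | h
  · have h1 : ε ^ (γ - k) ≤ 1 := Real.rpow_le_one hε0.le hε h
    have h2 : 0 ≤ q ^ (γ + β - k) := by positivity
    have h3 : q ^ β * ε ^ (γ - k) ≤ q ^ β * 1 := by gcongr
    linarith
  · have h1 : ε ^ (γ - k) ≤ q ^ (γ - k) := Real.rpow_le_rpow_of_nonpos hq hqε h
    have h2 : 0 ≤ q ^ β := by positivity
    have h3 : q ^ β * ε ^ (γ - k) ≤ q ^ β * q ^ (γ - k) := by gcongr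
    rw [← Real.rpow_add hq, show β + (γ - k) = γ + β - k by ring] at h3
    linarith

/-- A bound for the pairings with rescaled test functions that is uniform in the scale. -/
lemma exists_abs_pair_superpose_rescale_le {F : S.U → 𝓓'(S.U, ℝ)} {f : 𝓓'(S.U, ℝ)} {M : ℝ}
    (hB : S.Bd F f M) {x : S.U} (hx : (x : Sp d) ∈ S.V) {k : Fin d → ℕ} (hk : len k ≤ m)
    (η : 𝓓(unitBall d, ℝ)) : ∃ C : ℝ, ∀ n : ℕ, ∀ ε ∈ Ioc (0 : ℝ) 1,
      Metric.closedBall (x : Sp d) ε ⊆ S.V →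
      |pair (F x - f) (superpose (rescale η x ε) (κ.cutPiece S.ρ_pos n k))| ≤
        C * ((2 ^ (-(n : ℝ))) ^ (S.γ + β - len k) + (2 ^ (-(n : ℝ))) ^ β) := by
  have hρ := S.ρ_pos
  have hM := hB.M_nonneg
  have hx' := S.innerSet_two_subset_Kt (S.V_subset hx)
  obtain ⟨c, hc, hη⟩ := exists_iteratedFDeriv_bound η.contDiff η.hasCompactSupport (S.p + len k)
  obtain ⟨C₁, hC₁, h₁⟩ := S.exists_abs_pair_superpose_le κ
  obtain ⟨C₃, hC₃, h₃⟩ := S.exists_scaled_superpose κ (le_refl S.p) 1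
  obtain ⟨C₄, hC₄, h₄⟩ := S.exists_pair_rec (Lm := 1 + S.ρ) (by positivity)
  obtain ⟨c', hc', h₅⟩ := exists_rpow_le_of_mem S.γ hρ
  set v := volume.real (Metric.closedBall (0 : Sp d) 1)
  have hv : 0 ≤ v := measureReal_nonneg
  refine ⟨C₁ * M * (v * c) + C₄ * M * (C₃ * c) * c', fun n ε hε hball => ?_⟩
  have hε0 : 0 < ε := hε.1
  have hq := two_rpow_neg_pos n
  have hsc : Scaled (S.p + len k) c ε (rescale η x ε) := scaled_rescale hη hε0 x
  have hs : Function.support (rescale η (x : Sp d) ε) ⊆ Metric.closedBall (x : Sp d) ε :=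
    (support_rescale_subset η _ hε0).trans Metric.ball_subset_closedBall
  have hI := integral_abs_le_of_scaled hε0 hsc hs
  have t1 : 0 ≤ C₁ * M * (v * c) * (2 ^ (-(n : ℝ))) ^ β := by positivity
  have t2 : 0 ≤ C₄ * M * (C₃ * c) * c' *
    ((2 ^ (-(n : ℝ))) ^ (S.γ + β - len k) + (2 ^ (-(n : ℝ))) ^ β) := by positivity
  have t3 : 0 ≤ C₁ * M * (v * c) *
    ((2 ^ (-(n : ℝ))) ^ (S.γ + β - len k) + (2 ^ (-(n : ℝ))) ^ β) := by positivity
  rcases le_or_gt ε (2 ^ (-(n : ℝ))) with hcase | hcase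
  · have e1 := h₁ F f M hB x hx' n k hk _ (contDiff_rescale η x ε).continuous ε hε0.le hcase hs
    have e2 : C₁ * M * (∫ z, |rescale η x ε z|) * (2 ^ (-(n : ℝ))) ^ (S.γ + β - len k) ≤
        C₁ * M * (v * c) * (2 ^ (-(n : ℝ))) ^ (S.γ + β - len k) := by gcongr
    linarith
  -- For `ε > 2^{-n}` the derivatives are moved from the piece to `η`, where they cost `ε^{-|k|}`;
  -- the moment estimate then applies to the undifferentiated piece and gives `2^{-βn}`.
  have hT : IsTest S.V (rescale η (x : Sp d) ε) := isTest_rescale η hε0 hball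
  set χ := toTest S.V (rescale η (x : Sp d) ε) with hχ
  have hχe : ⇑χ = rescale η (x : Sp d) ε := funext (toTest_apply hT)
  have hadj : superpose (rescale η (x : Sp d) ε) (κ.cutPiece hρ n k) =
      superpose (adjDeriv (dirs k) χ) (κ.cutPiece hρ n 0) := by
    rw [← hχe]
    exact (κ.superpose_adjDeriv hρ hk χ).symm
  have hts : tsupport χ ⊆ Metric.closedBall (x : Sp d) ε := by
    rw [hχe]
    exact closure_minimal hs Metric.isClosed_closedBall
  have hsadj : Function.support (adjDeriv (dirs k) χ) ⊆
      Metric.closedBall (x : Sp d) ε ∩ innerSet S.U (2 * S.ρ) := by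
    have h1 := (subset_tsupport _).trans (tsupport_adjDeriv (dirs k) χ)
    exact subset_inter (h1.trans hts) (h1.trans (S.tsupport_subset χ))
  have hscadj : Scaled S.p (c * (ε ^ len k)⁻¹) ε (adjDeriv (dirs k) χ) := by
    intro j hj y
    refine norm_iteratedFDeriv_adjDeriv_le (dirs k) (fun i => (norm_dirs k i).le) χ (fun y => ?_) y
    rw [hχe]
    refine (hsc (j + len k) (by omega) y).trans (le_of_eq ?_)
    rw [mul_assoc, ← mul_inv, ← pow_add]
    congr 3
    ring
  obtain ⟨g1, g2, g3⟩ := h₃ n _ x _ ε ((adjDeriv (dirs k) χ).contDiff.of_le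
    (by exact_mod_cast le_top)) hε hcase.le hscadj hsadj
  have hq1 := two_rpow_neg_le_one n
  have hL : ε ≤ ε + S.ρ * 2 ^ (-(n : ℝ)) := by have := mul_pos hρ hq; linarith
  have e1 := h₄ F f M hB x hx' _ _ (hε0.trans_le hL) (by have := hε.2; nlinarith) _ g1 g2 g3
  have e2 := h₅ ε _ hε0 hL (by nlinarith)
  rw [hadj]
  refine e1.trans ?_
  have e3 := rpow_le_add_of_lt (γ := S.γ) (β := β) (k := len k) hq hcase.le hε.2
  have e4 : (ε ^ len k)⁻¹ * ε ^ S.γ = ε ^ (S.γ - len k) := by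
    rw [Real.rpow_sub hε0, Real.rpow_natCast]
    field_simp
  calc C₄ * M * (C₃ * (2 ^ (-(n : ℝ))) ^ β * (c * (ε ^ len k)⁻¹)) *
        (ε + S.ρ * 2 ^ (-(n : ℝ))) ^ S.γ
      ≤ C₄ * M * (C₃ * (2 ^ (-(n : ℝ))) ^ β * (c * (ε ^ len k)⁻¹)) * (c' * ε ^ S.γ) := by gcongr
    _ = C₄ * M * (C₃ * c) * c' * ((2 ^ (-(n : ℝ))) ^ β * ((ε ^ len k)⁻¹ * ε ^ S.γ)) := by ring
    _ ≤ C₄ * M * (C₃ * c) * c' *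
        ((2 ^ (-(n : ℝ))) ^ (S.γ + β - len k) + (2 ^ (-(n : ℝ))) ^ β) := by
      rw [e4]
      gcongr
    _ ≤ _ := by linarith

lemma summable_coef {F : S.U → 𝓓'(S.U, ℝ)} {f : 𝓓'(S.U, ℝ)} {M : ℝ}
    (hB : S.Bd F f M) {x : S.U} (hx : (x : Sp d) ∈ S.V) {k : Fin d → ℕ} (hk : len k ≤ m)
    (hkγ : (len k : ℝ) < S.γ + β) :
    Summable fun n => pair (F x - f) (κ.cutPiece S.ρ_pos n k x) := by
  obtain ⟨C, hC, h⟩ := S.exists_abs_coef_le κ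
  exact ((summable_two_rpow (e := S.γ + β - len k) (by linarith)).mul_left
    (C * M)).of_norm_bounded fun n => h F f M hB x (S.innerSet_two_subset_Kt (S.V_subset hx)) n k hk

/-- The pointwise derivatives of the image. -/
lemma hasPtDeriv (hβ : 0 < β) {F : S.U → 𝓓'(S.U, ℝ)} {f : 𝓓'(S.U, ℝ)} {M : ℝ}
    (hB : S.Bd F f M) {x : S.U} (hx : (x : Sp d) ∈ S.V) {k : Fin d → ℕ} (hk : len k ≤ m)
    (hkγ : (len k : ℝ) < S.γ + β) {T : 𝓓'(S.V, ℝ)}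
    (hT : ∀ ψ : 𝓓(S.V, ℝ),
      HasSum (fun n => pair (F x - f) (superpose ψ (κ.cutPiece S.ρ_pos n 0))) (T ψ)) :
    HasPtDeriv T k ⟨x, hx⟩ (∑' n, pair (F x - f) (κ.cutPiece S.ρ_pos n k x)) := by
  intro η δ hδ
  obtain ⟨r, hr, hball⟩ := Metric.nhds_basis_closedBall.mem_iff.1 (S.V.isOpen.mem_nhds hx)
  obtain ⟨C, hC⟩ := S.exists_abs_pair_superpose_rescale_le κ hB hx hk η
  have hs := (summable_two_rpow (e := S.γ + β - len k) (by linarith)).add (summable_two_rpow hβ)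
  have hG := hB.finOrder (S.innerSet_two_subset_Kt (S.V_subset hx))
  have hsmall : ∀ᶠ ε in 𝓝[>] (0 : ℝ), ε ∈ Ioc 0 1 ∧ Metric.closedBall (x : Sp d) ε ⊆ S.V := by
    filter_upwards [Ioo_mem_nhdsGT (show 0 < min r 1 by positivity)] with ε hε
    exact ⟨⟨hε.1, hε.2.le.trans (min_le_right _ _)⟩,
      (Metric.closedBall_subset_closedBall (hε.2.le.trans (min_le_left _ _))).trans hball⟩
  -- Limit and sum are exchanged: each term converges, and the majorant is summable because both `γ
  -- + β - |k|` and `β` are positive.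
  have ht := tendsto_tsum_of_dominated_convergence (𝓕 := 𝓝[>] (0 : ℝ))
    (f := fun ε n => pair (F x - f) (superpose (rescale η x ε) (κ.cutPiece S.ρ_pos n k)))
    (hs.mul_left C) (fun n => S.tendsto_pair_superpose_rescale κ hG hk n x η)
    (by filter_upwards [hsmall] with ε hε n using hC n ε hε.1 hε.2)
  rw [tsum_mul_left] at ht
  have hev := (Metric.tendsto_nhds.1 ht δ hδ).and hsmall
  obtain ⟨ε₀, hε₀, hsub⟩ := mem_nhdsGT_iff_exists_Ioo_subset.1 hev
  refine ⟨ε₀, hε₀, fun ε hε => ?_⟩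
  obtain ⟨h1, h2, h3⟩ := hsub hε
  have hTt : IsTest S.V (rescale η (x : Sp d) ε) := isTest_rescale η h2.1 h3
  refine ⟨toTest S.V (rescale η (x : Sp d) ε), toTest_apply hTt, ?_⟩
  have e : (∂^{dirs k} T) (toTest S.V (rescale η (x : Sp d) ε)) =
      ∑' n, pair (F x - f) (superpose (rescale η x ε) (κ.cutPiece S.ρ_pos n k)) := by
    rw [iteratedLineDerivOp_apply, ← (hT _).tsum_eq]
    congr 1
    ext n
    have h4 := κ.superpose_adjDeriv S.ρ_pos hk (n := n) (toTest S.V (rescale η (x : Sp d) ε))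
    have h5 : ⇑(toTest S.V (rescale η (x : Sp d) ε)) = rescale η (x : Sp d) ε :=
      funext (toTest_apply hTt)
    rw [h5] at h4
    exact congrArg _ h4
  rw [e, mul_comm]
  exact h1

end Setup

/-! ### The lifted germ -/

/-- One decay rate serves all regimes: it stays below `β`, below `-a`, below the distance from `w`
down to the degrees subtracted and below that up to the next degree. Positivity is where `w` being
no natural number is used. -/
lemma exists_exponent {β w a : ℝ} (hβ : 0 < β) (ha : a < 0) (hw : ∀ n : ℕ, w ≠ n) :
    ∃ e : ℝ, 0 < e ∧ e ≤ β ∧ e ≤ -a ∧ (∀ k : ℕ, (k : ℤ) ≤ ⌊w⌋ → e ≤ w - k) ∧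
      e ≤ ((⌊w⌋ + 1).toNat : ℝ) - w := by
  have hN : 0 < ((⌊w⌋ + 1).toNat : ℝ) - w := by
    have h1 := Int.lt_floor_add_one w
    have h2 : ((⌊w⌋ + 1 : ℤ) : ℝ) ≤ ((⌊w⌋ + 1).toNat : ℝ) := by
      exact_mod_cast Int.self_le_toNat (⌊w⌋ + 1)
    push_cast at h2
    linarith
  rcases lt_or_ge w 0 with h0 | h0
  · refine ⟨min (min β (-a)) (((⌊w⌋ + 1).toNat : ℝ) - w),
      lt_min (lt_min hβ (by linarith)) hN, (min_le_left _ _).trans (min_le_left _ _),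
      (min_le_left _ _).trans (min_le_right _ _), fun k hk => ?_, min_le_right _ _⟩
    have := Int.le_floor.1 hk
    push_cast at this
    have h3 : (0 : ℝ) ≤ k := k.cast_nonneg
    linarith
  -- Only for `w ≥ 0` are there degrees to subtract; the largest is `⌊w⌋`, so this gap controls them
  -- all.
  · have hf : 0 < w - ⌊w⌋ := by
      refine sub_pos.2 (lt_of_le_of_ne (Int.floor_le w) fun h => ?_)
      have h1 : 0 ≤ ⌊w⌋ := Int.floor_nonneg.2 h0
      refine hw ⌊w⌋.toNat ?_
      have h2 : ((⌊w⌋.toNat : ℤ) : ℝ) = (⌊w⌋ : ℝ) := by rw [Int.toNat_of_nonneg h1]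
      exact h.symm.trans (by exact_mod_cast h2.symm)
    refine ⟨min (min β (-a)) (min (((⌊w⌋ + 1).toNat : ℝ) - w) (w - ⌊w⌋)),
      lt_min (lt_min hβ (by linarith)) (lt_min hN hf),
      (min_le_left _ _).trans (min_le_left _ _), (min_le_left _ _).trans (min_le_right _ _),
      fun k hk => ?_, (min_le_right _ _).trans (min_le_left _ _)⟩
    have h1 : (k : ℝ) ≤ ⌊w⌋ := by exact_mod_cast hk
    have := (min_le_right (min β (-a)) (min (((⌊w⌋ + 1).toNat : ℝ) - w) (w - ⌊w⌋))).trans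
      (min_le_right _ _)
    linarith

/-- A bound for the derivatives of the functions in `testBall d q`. -/
def testConst (d q : ℕ) : ℝ := ∑ j ∈ Finset.range (q + 1), coordConst d j

lemma scaled_of_mem_testBall {q q' : ℕ} (hq : q ≤ q') {φ : 𝓓(unitBall d, ℝ)} (h : φ ∈ testBall d q')
    {l : ℝ} (hl : 0 < l) (x : Sp d) : Scaled q (testConst d q) l (rescale φ x l) := by
  refine scaled_rescale (fun j hj y => ?_) hl x
  refine (norm_iteratedFDeriv_le_of_mem_testBall h (hj.trans hq) y).trans ?_
  exact Finset.single_le_sum (fun j _ => coordConst_nonneg d j) (Finset.mem_range.2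
    (Nat.lt_succ_of_le hj))

lemma monoDist_apply (V : Opens (Sp d)) (k : Fin d → ℕ) (x : Sp d) (ψ : 𝓓(V, ℝ)) :
    monoDist V k x ψ = ∫ z, ψ z * mono k x z := by
  have h : LocallyIntegrableOn (mono k x) (V : Set (Sp d)) volume :=
    (continuous_mono k x).locallyIntegrable.locallyIntegrableOn _
  exact TestFunction.integralAgainstBilinCLM_eq_integral h

lemma abs_tsum_le_of_peak {e l δ K C c : ℝ} (hl : 0 < l) (hδ : 0 < δ) (hK : 0 ≤ K)
    (hC : ∀ l, 0 < l → Summable (peak e l) ∧ ∑' n, peak e l n ≤ C) {t : ℕ → ℝ} (ht : HasSum t c)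
    (h : ∀ n, |t n| ≤ K * (peak e l n + peak e δ n)) : |c| ≤ K * (2 * C) := by
  obtain ⟨h1, h2⟩ := hC l hl
  obtain ⟨h3, h4⟩ := hC δ hδ
  have hs := (h1.add h3).mul_left K
  rw [← ht.tsum_eq]
  refine (tsum_of_norm_bounded (f := t) hs.hasSum fun n => by
    rw [Real.norm_eq_abs]; exact h n).trans ?_
  rw [tsum_mul_left, h1.tsum_add h3]
  gcongr
  linarith

namespace Setup

variable (S : Setup d) {β : ℝ} {m : ℕ} (κ : RegKernel S.U β m S.p S.ρ)

/-- The inclusion of the smaller open set. -/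
def incl (x : S.V) : S.U := ⟨x, shrink_le S.U _ x.2⟩

lemma incl_mem (x : S.V) : (S.incl x : Sp d) ∈ innerSet S.U (2 * S.ρ) := S.V_subset x.2

lemma incl_mem_Kt (x : S.V) : (S.incl x : Sp d) ∈ S.Kt := S.innerSet_two_subset_Kt (S.incl_mem x)

/-- The lifted germ. -/
def liftGerm (f : 𝓓'(S.U, ℝ)) (F : S.U → 𝓓'(S.U, ℝ)) : S.V → 𝓓'(S.V, ℝ) :=
  lift (shrink_le S.U (2 * S.ρ)) κ (S.γ + β) f F

variable {S κ}

/-- Only `F x - f` has controlled order, so the image of `F x` is obtained by adding the given image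
of `f` to that of the difference. -/
lemma hasImage_of_bd (hβ : 0 < β) {F : S.U → 𝓓'(S.U, ℝ)} {f : 𝓓'(S.U, ℝ)} {M : ℝ}
    (hB : S.Bd F f M) {Tf : 𝓓'(S.V, ℝ)} (hTf : HasImage κ f Tf) (x : S.V) :
    ∃ T : 𝓓'(S.V, ℝ), HasImage κ (F (S.incl x) - f) T ∧ HasImage κ (F (S.incl x)) (T + Tf) ∧
      (∀ ψ : 𝓓(S.V, ℝ), HasSum (fun n =>
        pair (F (S.incl x) - f) (superpose ψ (κ.cutPiece S.ρ_pos n 0))) (T ψ)) ∧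
      ∀ k, len k ≤ m → (len k : ℝ) < S.γ + β → HasPtDeriv T k x
        (∑' n, pair (F (S.incl x) - f) (κ.cutPiece S.ρ_pos n k x)) := by
  obtain ⟨T, h1, h2⟩ := S.exists_hasImage κ hβ (hB.finOrder (S.incl_mem_Kt x))
  refine ⟨T, h1, ?_, h2, fun k hk hkγ => S.hasPtDeriv κ hβ hB x.2 hk hkγ h2⟩
  have := h1.add hTf
  rwa [sub_add_cancel] at this

/-- The image of `F x` minus that of `f` is the image of `F x - f`, and the polynomial in the lift
is its Taylor polynomial, whose coefficients are sums over the pieces. Everything can therefore be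
regrouped piece by piece. This identity reduces both the coherence and the reconstruction bound to
`remTerm`. -/
lemma hasSum_liftGerm (hβ : 0 < β) (hγβ : ∀ n : ℕ, S.γ + β ≠ n) (hm : S.γ + β < m)
    {F : S.U → 𝓓'(S.U, ℝ)} {f : 𝓓'(S.U, ℝ)} {M : ℝ}
    (hB : S.Bd F f M) {Tf : 𝓓'(S.V, ℝ)} (hTf : HasImage κ f Tf) (x : S.V) (ψ : 𝓓(S.V, ℝ)) :
    HasSum (fun n => S.remTerm κ ⌊S.γ + β⌋ (F (S.incl x) - f) n x ψ)
      (S.liftGerm κ f F x ψ - Tf ψ) := by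
  obtain ⟨T, h1, h2, h3, h4⟩ := hasImage_of_bd hβ hB hTf x
  have hk : ∀ k ∈ multiIndices d ⌊S.γ + β⌋, len k ≤ m ∧ (len k : ℝ) < S.γ + β := fun k hk => by
    have h5 := Int.le_floor.1 (mem_multiIndices.1 hk)
    push_cast at h5
    refine ⟨?_, lt_of_le_of_ne h5 fun h => hγβ _ h.symm⟩
    exact_mod_cast (h5.trans hm.le)
  have e : S.liftGerm κ f F x ψ - Tf ψ = T ψ - ∑ k ∈ multiIndices d ⌊S.γ + β⌋,
      (∫ z, ψ z * mono k x z) / fact k *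
        ∑' n, pair (F (S.incl x) - f) (κ.cutPiece S.ρ_pos n k x) := by
    have e1 : S.liftGerm κ f F x = (T + Tf) - ∑ k ∈ multiIndices d ⌊S.γ + β⌋,
        ((∑' n, pair (F (S.incl x) - f) (κ.cutPiece S.ρ_pos n k x)) / fact k) •
          monoDist S.V k x := by
      have e2 : image S.V κ (F (S.incl x)) = T + Tf := h2.image_eq
      have e3 : image S.V κ (F (S.incl x) - f) = T := h1.image_eq
      rw [liftGerm, lift]
      change image S.V κ (F (S.incl x)) - ∑ k ∈ multiIndices d ⌊S.γ + β⌋,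
        (ptDeriv (image S.V κ (F (S.incl x) - f)) k x / ∏ i, ((k i).factorial : ℝ)) •
          monoDist S.V k x = _
      rw [e2, e3]
      congr 1
      refine Finset.sum_congr rfl fun k hk' => ?_
      rw [(h4 k (hk k hk').1 (hk k hk').2).ptDeriv_eq, fact]
    have e4 : ∀ (A B : 𝓓'(S.V, ℝ)), (A - B) ψ = A ψ - B ψ := fun A B => rfl
    have e5 : ∀ (A B : 𝓓'(S.V, ℝ)), (A + B) ψ = A ψ + B ψ := fun A B => rfl
    have e6 : ∀ (c : ℝ) (A : 𝓓'(S.V, ℝ)), (c • A) ψ = c * A ψ := fun c A => rfl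
    let ev : 𝓓'(S.V, ℝ) →+ ℝ :=
      { toFun := fun A => A ψ, map_zero' := rfl, map_add' := e5 }
    have e7 : ∀ A : (Fin d → ℕ) → 𝓓'(S.V, ℝ), (∑ k ∈ multiIndices d ⌊S.γ + β⌋, A k) ψ =
        ∑ k ∈ multiIndices d ⌊S.γ + β⌋, A k ψ := fun A => map_sum ev _ _
    rw [e1, e4, e5, e7, sub_right_comm, add_sub_cancel_right]
    congr 1
    refine Finset.sum_congr rfl fun k _ => ?_
    rw [e6, monoDist_apply]
    ring
  rw [e]
  refine (h3 ψ).sub (hasSum_sum fun k hk' => ?_)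
  exact (S.summable_coef κ hB x.2 (hk k hk').1 (hk k hk').2).hasSum.mul_left _

lemma floor_add_one_le {w : ℝ} (h : w < m) : ⌊w⌋ + 1 ≤ (m : ℤ) := by
  have : ⌊w⌋ < (m : ℤ) := Int.floor_lt.2 (by exact_mod_cast h)
  omega

/-- The coherence of the lifted germ. -/
lemma exists_cohNorm_liftGerm_le (hU : Convex ℝ (S.U : Set (Sp d))) (hβ : 0 < β)
    (hγβ : ∀ n : ℕ, S.γ + β ≠ n) (hm : S.γ + β < m) {a' b : ℝ} (ha' : a' < 0)
    (haa : a' ≤ S.a + β) (hb0 : b ≤ 0) (hbγ : b ≤ S.γ) (hab : a' ≤ b + β)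
    {q q' : ℕ} (hq : q ≤ S.p) (hqq : q ≤ q') {K : Set (Sp d)} (hK : K ⊆ S.V) {lb : ℝ}
    (hlb : AdmScale K S.V lb) : ∃ C : ℝ, 0 ≤ C ∧ ∀ F f M H Tf, S.Bd F f M →
    HasImage κ f (Tf : 𝓓'(S.V, ℝ)) → 0 ≤ H →
    (∀ x y : S.U, (x : Sp d) ∈ K → (y : Sp d) ∈ K → ∀ L A, 0 < L → L ≤ lb + S.ρ →
      ∀ g, IsCp S.p S.Q g →
      Function.support g ⊆ Metric.closedBall (x : Sp d) L → Scaled q A L g →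
      |pair (F x - F y) g| ≤ H * A * (L ^ b * (L + dist (x : Sp d) y) ^ (S.γ - b))) →
    cohNorm S.V a' (S.γ + β) q' K lb (S.liftGerm κ f F) ≤ ENNReal.ofReal (C * (M + H)) := by
  obtain ⟨e, he, heβ, hea, hes, heN⟩ := exists_exponent hβ ha' hγβ
  obtain ⟨C₁, hC₁, h₁⟩ := S.exists_abs_remTerm_sub_le κ hU (floor_add_one_le hm) he.le heβ hea hes
    heN haa hb0 hbγ hab hq lb
  obtain ⟨C₂, hC₂, h₂⟩ := exists_tsum_peak_le he
  have hB0 : 0 ≤ testConst d q := Finset.sum_nonneg fun j _ => coordConst_nonneg d j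
  refine ⟨C₁ * testConst d q * (2 * C₂), by positivity, fun F f M H Tf hB hTf hH hpair => ?_⟩
  rw [cohNorm_le_iff]
  intro x y hx hy l hl φ hφ χ hχ
  refine ENNReal.ofReal_le_ofReal ?_
  have hl0 : 0 < l := hl.1
  have hd0 : 0 ≤ dist (x : Sp d) y := dist_nonneg
  have hM := hB.M_nonneg
  rw [div_le_iff₀ (by positivity)]
  have hχe : ⇑χ = rescale φ (x : Sp d) l := funext hχ
  have hball : Metric.closedBall (x : Sp d) l ⊆ S.V :=
    (Metric.closedBall_subset_closedBall hl.2).trans (hlb.closedBall_subset hK hx)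
  have hs1 : Function.support χ ⊆ Metric.closedBall (x : Sp d) l := by
    rw [hχe]
    exact (support_rescale_subset φ _ hl0).trans Metric.ball_subset_closedBall
  have hs : Function.support χ ⊆ Metric.closedBall (x : Sp d) l ∩ innerSet S.U (2 * S.ρ) :=
    subset_inter hs1 (hs1.trans (hball.trans S.V_subset))
  have hsc : Scaled q (testConst d q) l χ := by
    rw [hχe]
    exact scaled_of_mem_testBall hqq hφ hl0 x
  have hsum := (hasSum_liftGerm hβ hγβ hm hB hTf x χ).sub
    (hasSum_liftGerm hβ hγβ hm hB hTf y χ)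
  have e1 : (S.liftGerm κ f F x χ - Tf χ) - (S.liftGerm κ f F y χ - Tf χ) =
      (S.liftGerm κ f F x - S.liftGerm κ f F y) χ := by
    rw [sub_sub_sub_cancel_right]
    rfl
  rw [e1] at hsum
  have hbd := h₁ F f M H hB hH (S.incl x) (S.incl y) (S.incl_mem x) (S.incl_mem y)
    (hpair _ _ hx hy) l hl χ _ (χ.contDiff.of_le (by exact_mod_cast le_top)) hs hsc
  refine (abs_tsum_le_of_peak hl0 (δ := l + dist (x : Sp d) y) (by positivity) ?_ h₂ hsum
    hbd).trans (le_of_eq ?_)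
  · change 0 ≤ C₁ * (M + H) * testConst d q *
      (l ^ a' * (l + dist (x : Sp d) y) ^ (S.γ + β - a'))
    positivity
  · change C₁ * (M + H) * testConst d q *
      (l ^ a' * (l + dist (x : Sp d) y) ^ (S.γ + β - a')) * (2 * C₂) = _
    ring

/-- The reconstruction bound for the lifted germ. -/
lemma exists_abs_sub_liftGerm_le (hU : Convex ℝ (S.U : Set (Sp d))) (hβ : 0 < β)
    (hγβ : ∀ n : ℕ, S.γ + β ≠ n) (hm : S.γ + β < m) {K : Set (Sp d)} (hK : K ⊆ S.V) {lb : ℝ}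
    (hlb : AdmScale K S.V lb) {F : S.U → 𝓓'(S.U, ℝ)} {f : 𝓓'(S.U, ℝ)} {M : ℝ} (hB : S.Bd F f M)
    {Tf : 𝓓'(S.V, ℝ)} (hTf : HasImage κ f Tf) {q : ℕ} (hq : S.p ≤ q) :
    ∃ C : ℝ, ∀ z : S.V, (z : Sp d) ∈ K → ∀ l ∈ Ioc 0 lb, ∀ φ ∈ testBall d q,
      ∀ χ : 𝓓(S.V, ℝ), (∀ y, χ y = rescale φ z l y) →
      |(Tf - S.liftGerm κ f F z) χ| ≤ C * l ^ (S.γ + β) := by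
  obtain ⟨e, he, heβ, -, hes, heN⟩ := exists_exponent (a := -1) hβ (by norm_num) hγβ
  obtain ⟨C₁, hC₁, h₁⟩ := S.exists_abs_remTerm_rec_le κ hU (floor_add_one_le hm) he.le heβ hes
    heN hlb.1
  obtain ⟨C₂, hC₂, h₂⟩ := exists_tsum_peak_le he
  have hB0 : 0 ≤ testConst d S.p := Finset.sum_nonneg fun j _ => coordConst_nonneg d j
  refine ⟨C₁ * M * testConst d S.p * (2 * C₂), fun z hz l hl φ hφ χ hχ => ?_⟩
  have hl0 : 0 < l := hl.1
  have hM := hB.M_nonneg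
  have hχe : ⇑χ = rescale φ (z : Sp d) l := funext hχ
  have hball : Metric.closedBall (z : Sp d) l ⊆ S.V :=
    (Metric.closedBall_subset_closedBall hl.2).trans (hlb.closedBall_subset hK hz)
  have hs1 : Function.support χ ⊆ Metric.closedBall (z : Sp d) l := by
    rw [hχe]
    exact (support_rescale_subset φ _ hl0).trans Metric.ball_subset_closedBall
  have hs : Function.support χ ⊆ Metric.closedBall (z : Sp d) l ∩ innerSet S.U (2 * S.ρ) :=
    subset_inter hs1 (hs1.trans (hball.trans S.V_subset))
  have hsc : Scaled S.p (testConst d S.p) l χ := by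
    rw [hχe]
    exact scaled_of_mem_testBall hq hφ hl0 z
  have hsum := hasSum_liftGerm hβ hγβ hm hB hTf z χ
  have hbd := h₁ F f M hB (S.incl z) (S.incl_mem z) l hl χ _
    (χ.contDiff.of_le (by exact_mod_cast le_top)) hs hsc
  have e1 : |(Tf - S.liftGerm κ f F z) χ| = |S.liftGerm κ f F z χ - Tf χ| := abs_sub_comm _ _
  rw [e1]
  have hK0 : 0 ≤ C₁ * M * testConst d S.p * l ^ (S.γ + β) := by positivity
  refine (abs_tsum_le_of_peak hl0 hl0 hK0 h₂ hsum fun n => (hbd n).trans ?_).trans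
    (le_of_eq (by ring))
  have := peak_nonneg (e := e) hl0 n
  gcongr
  linarith

/-- Measurability of the germ concerns smooth test functions; for `C^p` functions the pairing is a
pointwise limit along mollifications at the scales `1/(j+1)`. -/
lemma measurable_pair {F : S.U → 𝓓'(S.U, ℝ)} (hF : F ∈ germs S.U) {f : 𝓓'(S.U, ℝ)} {M : ℝ}
    (hB : S.Bd F f M) {g : Sp d → ℝ} (hg : IsCp S.p S.Q g) :
    Measurable fun x : S.V => pair (F (S.incl x) - f) g := by
  have ht : Tendsto (fun j : ℕ => 1 / ((j : ℝ) + 1)) atTop (𝓝[>] 0) :=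
    tendsto_nhdsWithin_iff.2 ⟨tendsto_one_div_add_atTop_nhds_zero_nat,
      Eventually.of_forall fun j => by rw [mem_Ioi]; positivity⟩
  refine measurable_of_tendsto_metrizable (f := fun (j : ℕ) (x : S.V) =>
    (F (S.incl x) - f) (toTest S.U (moll (stdMoll d) (1 / ((j : ℝ) + 1)) g))) (fun j => ?_)
    (tendsto_pi_nhds.2 fun x => ((hB.finOrder (S.incl_mem_Kt x)).tendsto_pair S.Q_subset hg
      (integral_stdMoll d)).comp ht)
  have hi : Measurable S.incl := (measurable_subtype_coe).subtype_mk
  exact ((hF _).comp hi).sub_const _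

lemma measurable_diag {V : Opens (Sp d)} {u : Sp d → V → ℝ} (hc : ∀ x, Continuous fun z => u z x)
    (hz : ∀ z, Measurable (u z)) : Measurable fun x : V => u x x :=
  (measurable_uncurry_of_continuous_of_measurable hc hz).comp
    (measurable_subtype_coe.prodMk measurable_id)

/-- The point `x` enters twice, through the germ and as base point of the piece. The pairing is
measurable in the first and continuous in the second, hence jointly measurable, and is restricted to
the diagonal. -/
lemma measurable_coef {F : S.U → 𝓓'(S.U, ℝ)} (hF : F ∈ germs S.U) {f : 𝓓'(S.U, ℝ)} {M : ℝ}
    (hB : S.Bd F f M) {k : Fin d → ℕ} (hk : len k ≤ m) (n : ℕ) :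
    Measurable fun x : S.V => pair (F (S.incl x) - f) (κ.cutPiece S.ρ_pos n k x) := by
  have hρ := S.ρ_pos
  have hS : IsCompact (innerSet S.U (7 * S.ρ / 8)) := isCompact_innerSet S.bdd (by positivity)
  have hc : ∀ x : S.V, Continuous fun z : Sp d =>
      pair (F (S.incl x) - f) (κ.cutPiece hρ n k z) := fun x =>
    continuous_iff_continuousAt.2 fun z =>
      (hB.finOrder (S.incl_mem_Kt x)).continuousAt_pair S.Q_subset (κ.smoothFam_cutPiece hρ hk) hS
        (Eventually.of_forall fun z => (κ.support_cutPiece hρ n k z).trans inter_subset_right)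
        (r := S.ρ / 8) (by positivity)
        ((cthickening_innerSet_subset (by positivity) hS subset_rfl).trans
          (innerSet_anti (by linarith)))
  have hz : ∀ z : Sp d, Measurable fun x : S.V =>
      pair (F (S.incl x) - f) (κ.cutPiece hρ n k z) := fun z =>
    measurable_pair hF hB (κ.isCp_cutPiece hρ hk z)
  exact measurable_diag hc hz

lemma measurable_integral_mul_mono {V : Opens (Sp d)} (k : Fin d → ℕ) (ψ : 𝓓(V, ℝ)) :
    Measurable fun x : V => ∫ z, ψ z * mono k x z := by
  have hc : Continuous fun q : V × Sp d => ψ q.2 * mono k (q.1 : Sp d) q.2 := by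
    refine (ψ.contDiff.continuous.comp continuous_snd).mul ?_
    unfold mono
    fun_prop
  exact (StronglyMeasurable.integral_prod_right hc.stronglyMeasurable).measurable

lemma measurable_liftGerm (hβ : 0 < β) (hγβ : ∀ n : ℕ, S.γ + β ≠ n) (hm : S.γ + β < m)
    {F : S.U → 𝓓'(S.U, ℝ)} (hF : F ∈ germs S.U) {f : 𝓓'(S.U, ℝ)} {M : ℝ}
    (hB : S.Bd F f M) {Tf : 𝓓'(S.V, ℝ)} (hTf : HasImage κ f Tf) :
    S.liftGerm κ f F ∈ germs S.V := fun ψ => by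
  have h : Measurable fun x : S.V => S.liftGerm κ f F x ψ - Tf ψ := by
    refine measurable_of_tendsto_metrizable (f := fun (N : ℕ) (x : S.V) =>
      ∑ n ∈ Finset.range N, S.remTerm κ ⌊S.γ + β⌋ (F (S.incl x) - f) n x ψ) (fun N => ?_)
      (tendsto_pi_nhds.2 fun x => (hasSum_liftGerm hβ hγβ hm hB hTf x ψ).tendsto_sum_nat)
    refine Finset.measurable_fun_sum _ fun n _ => ?_
    refine (measurable_pair hF hB (S.isCp_superpose_coe κ (by simp [len]) n ψ)).sub ?_
    refine Finset.measurable_fun_sum _ fun k hk => ?_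
    have hkm : len k ≤ m := by
      have h1 := mem_multiIndices.1 hk
      have h2 := floor_add_one_le (m := m) hm
      omega
    exact ((measurable_integral_mul_mono k ψ).div_const _).mul (measurable_coef hF hB hkm n)
  simpa using h.add_const (Tf ψ)

/-- Additivity of the pairing in the distribution follows from uniqueness in `HasPairing`. -/
lemma remTerm_add {G G' : 𝓓'(S.U, ℝ)} (hG : FinOrder G S.p S.Q) (hG' : FinOrder G' S.p S.Q)
    (hGG : FinOrder (G + G') S.p S.Q) {s : ℤ} (hs : s ≤ m) (n : ℕ) (x : Sp d) (ψ : 𝓓(S.V, ℝ)) :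
    S.remTerm κ s (G + G') n x ψ = S.remTerm κ s G n x ψ + S.remTerm κ s G' n x ψ := by
  have h : ∀ g, IsCp S.p S.Q g → pair (G + G') g = pair G g + pair G' g := fun g hg =>
    (hGG.hasPairing S.Q_subset hg).unique
      ((hG.hasPairing S.Q_subset hg).add (hG'.hasPairing S.Q_subset hg))
  rw [remTerm, remTerm, remTerm, h _ (S.isCp_superpose_coe κ (by simp [len]) n ψ), polyTerm,
    polyTerm, polyTerm, sub_add_sub_comm, ← Finset.sum_add_distrib]
  congr 1
  refine Finset.sum_congr rfl fun k hk => ?_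
  have hkm : len k ≤ m := by have h1 := mem_multiIndices.1 hk; omega
  rw [h _ (κ.isCp_cutPiece S.ρ_pos hkm x)]
  ring

lemma remTerm_smul {G : 𝓓'(S.U, ℝ)} (hG : FinOrder G S.p S.Q) (c : ℝ)
    (hGG : FinOrder (c • G) S.p S.Q) {s : ℤ} (hs : s ≤ m) (n : ℕ) (x : Sp d) (ψ : 𝓓(S.V, ℝ)) :
    S.remTerm κ s (c • G) n x ψ = c * S.remTerm κ s G n x ψ := by
  have h : ∀ g, IsCp S.p S.Q g → pair (c • G) g = c * pair G g := fun g hg =>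
    (hGG.hasPairing S.Q_subset hg).unique ((hG.hasPairing S.Q_subset hg).smul c)
  rw [remTerm, remTerm, h _ (S.isCp_superpose_coe κ (by simp [len]) n ψ), polyTerm,
    polyTerm, mul_sub, Finset.mul_sum]
  congr 1
  refine Finset.sum_congr rfl fun k hk => ?_
  have hkm : len k ≤ m := by have h1 := mem_multiIndices.1 hk; omega
  rw [h _ (κ.isCp_cutPiece S.ρ_pos hkm x)]
  ring

/-- The lift minus the image of the reconstruction is a convergent sum of terms linear in `F x - f`;
uniqueness of sums gives additivity without examining images or pointwise derivatives again. -/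
lemma liftGerm_add (hβ : 0 < β) (hγβ : ∀ n : ℕ, S.γ + β ≠ n) (hm : S.γ + β < m)
    {F F' : S.U → 𝓓'(S.U, ℝ)} {f f' : 𝓓'(S.U, ℝ)} {M M' M'' : ℝ} (hB : S.Bd F f M)
    (hB' : S.Bd F' f' M') (hB'' : S.Bd (F + F') (f + f') M'') {T T' : 𝓓'(S.V, ℝ)}
    (hT : HasImage κ f T) (hT' : HasImage κ f' T') :
    S.liftGerm κ (f + f') (F + F') = S.liftGerm κ f F + S.liftGerm κ f' F' := by
  funext x
  ext ψ
  have h1 := hasSum_liftGerm hβ hγβ hm hB'' (hT.add hT') x ψ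
  have h2 := (hasSum_liftGerm hβ hγβ hm hB hT x ψ).add (hasSum_liftGerm hβ hγβ hm hB' hT' x ψ)
  have e : (F + F') (S.incl x) - (f + f') = (F (S.incl x) - f) + (F' (S.incl x) - f') :=
    add_sub_add_comm _ _ _ _
  have hx := S.incl_mem_Kt x
  have hG := hB''.finOrder hx
  rw [e] at h1 hG
  have hs : ⌊S.γ + β⌋ ≤ (m : ℤ) := by have := floor_add_one_le (m := m) hm; omega
  simp only [remTerm_add (hB.finOrder hx) (hB'.finOrder hx) hG hs] at h1
  have h3 := h1.unique h2
  have e2 : (T + T') ψ = T ψ + T' ψ := rfl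
  have e3 : (S.liftGerm κ f F + S.liftGerm κ f' F') x ψ =
    S.liftGerm κ f F x ψ + S.liftGerm κ f' F' x ψ := rfl
  rw [e3]
  rw [e2] at h3
  linarith

lemma liftGerm_smul (hβ : 0 < β) (hγβ : ∀ n : ℕ, S.γ + β ≠ n) (hm : S.γ + β < m) (c : ℝ)
    {F : S.U → 𝓓'(S.U, ℝ)} {f : 𝓓'(S.U, ℝ)} {M M' : ℝ} (hB : S.Bd F f M)
    (hB' : S.Bd (c • F) (c • f) M') {T : 𝓓'(S.V, ℝ)} (hT : HasImage κ f T) :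
    S.liftGerm κ (c • f) (c • F) = c • S.liftGerm κ f F := by
  funext x
  ext ψ
  have h1 := hasSum_liftGerm hβ hγβ hm hB' (hT.smul c) x ψ
  have h2 := (hasSum_liftGerm hβ hγβ hm hB hT x ψ).mul_left c
  have e : (c • F) (S.incl x) - c • f = c • (F (S.incl x) - f) := by
    rw [smul_sub]; rfl
  have hx := S.incl_mem_Kt x
  have hG := hB'.finOrder hx
  rw [e] at h1 hG
  have hs : ⌊S.γ + β⌋ ≤ (m : ℤ) := by have := floor_add_one_le (m := m) hm; omega
  simp only [remTerm_smul (hB.finOrder hx) c hG hs] at h1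
  have h3 := h1.unique h2
  have e2 : (c • T) ψ = c * T ψ := rfl
  have e3 : (c • S.liftGerm κ f F) x ψ = c * S.liftGerm κ f F x ψ := rfl
  rw [e3]
  rw [e2] at h3
  linarith

end Setup

/-! ### Uniqueness of the reconstruction -/

lemma testBall_anti {q q' : ℕ} (h : q ≤ q') : testBall d q' ⊆ testBall d q :=
  fun _ hφ k hk => hφ k (hk.trans h)

/-- The difference of two reconstructions is `O(l^γ)` on mollifiers of scale `l` near the support of
`ψ`. Writing its value at `ψ` as a limit of averages of such values, `γ > 0` forces it to vanish. -/
lemma IsReconstruction.unique {V : Opens (Sp d)} {α : Set (Sp d) → ℝ} {γ : ℝ} (hγ : 0 < γ)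
    {r : Set (Sp d) → ℕ} {F : V → 𝓓'(V, ℝ)} {f f' : 𝓓'(V, ℝ)}
    (h : IsReconstruction V α γ r F f) (h' : IsReconstruction V α γ r F f') : f = f' := by
  ext ψ
  obtain ⟨t, ht, htV⟩ := (show IsCompact (tsupport ψ) from
    ψ.hasCompactSupport).exists_cthickening_subset_open V.isOpen ψ.tsupport_subset
  set ε₀ := t / 3 with hε₀
  have hε₀0 : 0 < ε₀ := by positivity
  set K := Metric.cthickening ε₀ (tsupport ψ) with hK
  have hKc : IsCompact K := IsCompact.cthickening ψ.hasCompactSupport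
  have hK2 : Metric.cthickening (2 * ε₀) (tsupport ψ) ⊆ V :=
    (Metric.cthickening_mono (by linarith) _).trans htV
  have hKt : ∀ s, 0 ≤ s → s ≤ ε₀ → Metric.cthickening s K ⊆ V := fun s hs hsε =>
    (Metric.cthickening_cthickening_subset hs hε₀0.le _).trans
      ((Metric.cthickening_mono (by linarith) _).trans hK2)
  have hKV : K ⊆ V := (Metric.self_subset_cthickening K).trans (hKt 0 le_rfl hε₀0.le)
  have hKin : K ⊆ innerSet V ε₀ := fun x hx => (Metric.ball_subset_closedBall).trans
    ((closedBall_subset_cthickening' hx ε₀).trans (hKt ε₀ hε₀0.le le_rfl))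
  have hadm : AdmScale K V (ε₀ / 2) :=
    admScale_of_subset_innerSet (by positivity) (by linarith) hKin
  obtain ⟨K₁, -, -, -, C₁, h₁⟩ := h K hKc hKV _ hadm
  obtain ⟨K₂, -, -, -, C₂, h₂⟩ := h' K hKc hKV _ hadm
  -- The two reconstructions may come with different enlarged compact sets, hence different orders;
  -- the larger order is admissible for both.
  obtain ⟨c, hc, hcb⟩ := exists_abs_apply_rescale_le (stdMoll d)
    (max (recOrder α r K₁) (recOrder α r K₂))
  have hG : ∀ z ∈ K, ∀ l ∈ Ioc 0 (ε₀ / 2),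
      |(f - f') (toTest V (rescale (stdMoll d) z l))| ≤ c * ((C₁ + C₂) * l ^ γ) := by
    intro z hz l hl
    refine hcb V (f - f') z l _ hl.1 ((Metric.closedBall_subset_closedBall hl.2).trans
      (hadm.closedBall_subset hKV hz)) fun φ hφ χ hχ => ?_
    have e1 := h₁ ⟨z, hKV hz⟩ hz l hl φ (testBall_anti (le_max_left _ _) hφ) χ hχ
    have e2 := h₂ ⟨z, hKV hz⟩ hz l hl φ (testBall_anti (le_max_right _ _) hφ) χ hχ
    rw [recRate, if_neg hγ.ne'] at e1 e2
    have e3 : (f - f') χ = (f - F ⟨z, hKV hz⟩) χ - (f' - F ⟨z, hKV hz⟩) χ := by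
      change f χ - f' χ = (f χ - F ⟨z, hKV hz⟩ χ) - (f' χ - F ⟨z, hKV hz⟩ χ)
      ring
    rw [e3]
    refine (abs_sub _ _).trans ?_
    linarith
  obtain ⟨A, -, hA⟩ := exists_iteratedFDeriv_bound ψ.contDiff ψ.hasCompactSupport 0
  have hA' : ∀ y, |ψ y| ≤ A := fun y => by
    have := hA 0 le_rfl y
    rwa [norm_iteratedFDeriv_zero] at this
  set e : ℕ → ℝ := fun j => ε₀ * (1 / ((j : ℝ) + 1)) with he
  have he0 : Tendsto e atTop (𝓝 0) := by
    have := (tendsto_one_div_add_atTop_nhds_zero_nat (𝕜 := ℝ)).const_mul ε₀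
    rwa [mul_zero] at this
  have hepos : ∀ j, 0 < e j := fun j => by rw [he]; positivity
  have hele : ∀ j, e j ≤ ε₀ := fun j => by
    refine mul_le_of_le_one_right hε₀0.le ?_
    rw [div_le_one (by positivity)]
    have : (0 : ℝ) ≤ j := j.cast_nonneg
    linarith
  have hlim := tendsto_apply_moll_moll (f - f') (integral_stdMoll d) ψ.contDiff
    ψ.hasCompactSupport (subset_tsupport _) hε₀0 hK2 (fun j => ⟨(hepos j).le, hele j⟩) he0
  rw [toTest_coe] at hlim
  -- The outer mollification turns the pairing into an integral over the compact set `K` of values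
  -- at mollifiers of scale `e j / 2`, weighted by the bounded function `moll (stdMoll d) (e j) ψ`.
  have hbd : ∀ j, ‖(f - f') (toTest V (moll (stdMoll d) (e j / 2) (moll (stdMoll d) (e j) ψ)))‖ ≤
      A * l1 (stdMoll d) * (c * ((C₁ + C₂) * (e j / 2) ^ γ)) * volume.real K := by
    intro j
    have hs : Function.support (moll (stdMoll d) (e j) ψ) ⊆ K := by
      have := support_moll_subset (stdMoll d) (subset_tsupport ψ) (ε := e j) (r := ε₀)
        (by rw [abs_of_pos (hepos j)]; exact hele j)
      exact this
    have hcont : Continuous (moll (stdMoll d) (e j) ψ) :=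
      (contDiff_moll (stdMoll d) (e j) ψ.contDiff).continuous
    have hj2 : e j / 2 ≤ ε₀ / 2 := by have := hele j; linarith
    rw [apply_moll (f - f') (stdMoll d) (half_pos (hepos j)) hcont hKc hs
      (hKt _ (half_pos (hepos j)).le (by linarith))]
    refine norm_setIntegral_le_of_norm_le_const hKc.measure_lt_top fun z hz => ?_
    rw [norm_mul, Real.norm_eq_abs, Real.norm_eq_abs]
    have e1 := abs_moll_le (stdMoll d) (e j) hA' z
    have e2 := hG z hz (e j / 2) ⟨half_pos (hepos j), hj2⟩
    exact mul_le_mul e1 e2 (abs_nonneg _) ((abs_nonneg _).trans e1)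
  have hzero : Tendsto (fun j => A * l1 (stdMoll d) * (c * ((C₁ + C₂) * (e j / 2) ^ γ)) *
      volume.real K) atTop (𝓝 0) := by
    have h1 : Tendsto (fun j => (e j / 2) ^ γ) atTop (𝓝 0) := by
      have := (he0.div_const 2).rpow_const (p := γ) (Or.inr hγ.le)
      simpa [Real.zero_rpow hγ.ne'] using this
    have := (((h1.const_mul (C₁ + C₂)).const_mul c).const_mul (A * l1 (stdMoll d))).mul_const
      (volume.real K)
    simpa using this
  have := tendsto_nhds_unique hlim (squeeze_zero_norm hbd hzero)
  exact sub_eq_zero.1 this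

lemma exists_linearMap_of_mem {E G : Type*} [AddCommGroup E] [Module ℝ E] [AddCommGroup G]
    [Module ℝ G] (W : Submodule ℝ E) (N : Submodule ℝ G) (Φ : E → G)
    (hadd : ∀ x ∈ W, ∀ y ∈ W, Φ (x + y) = Φ x + Φ y) (hsmul : ∀ (c : ℝ), ∀ x ∈ W, Φ (c • x) = c • Φ x)
    (hmem : ∀ x ∈ W, Φ x ∈ N) : ∃ L : W →ₗ[ℝ] N, ∀ x : W, (L x : G) = Φ x :=
  ⟨{ toFun := fun x => ⟨Φ x, hmem x x.2⟩
     map_add' := fun x y => Subtype.ext (hadd x x.2 y y.2)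
     map_smul' := fun c x => Subtype.ext (hsmul c x x.2) }, fun _ => rfl⟩

namespace Setup

variable {S : Setup d} {β : ℝ} {m : ℕ} {κ : RegKernel S.U β m S.p S.ρ}

lemma len_le_of_mem_multiIndices {w : ℝ} (hw : ∀ n : ℕ, w ≠ n) (hm : w < m) {k : Fin d → ℕ}
    (hk : k ∈ multiIndices d ⌊w⌋) : len k ≤ m ∧ (len k : ℝ) < w := by
  have h := Int.le_floor.1 (mem_multiIndices.1 hk)
  push_cast at h
  refine ⟨?_, lt_of_le_of_ne h fun h' => hw _ h'.symm⟩
  exact_mod_cast (h.trans hm.le)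

/-- The constant `M` is the coherence seminorm itself, so that every later bound linear in `M` is a
continuity statement. -/
lemma bd_of_cohNorm_lt_top (hγ : S.γ ≠ 0) {F : S.U → 𝓓'(S.U, ℝ)} {f : 𝓓'(S.U, ℝ)}
    (hF : cohNorm S.U S.a S.γ S.qt S.Kt S.lt F < ∞)
    (h : ∀ z : S.U, (z : Sp d) ∈ innerSet S.U (S.ρ / 2) → ∀ l ∈ Ioc 0 (S.ρ / 4),
      ∀ φ ∈ testBall d S.qR, ∀ χ : 𝓓(S.U, ℝ), (∀ y, χ y = rescale φ z l y) →
      ENNReal.ofReal |(f - F z) χ| ≤ ENNReal.ofReal S.CR *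
        cohNorm S.U S.a S.γ S.qt S.Kt S.lt F * ENNReal.ofReal (recRate S.γ l)) :
    S.Bd F f (cohNorm S.U S.a S.γ S.qt S.Kt S.lt F).toReal where
  M_nonneg := ENNReal.toReal_nonneg
  coh _ _ hx hy _ hl _ hφ _ hχ := cohNorm_bound hF hx hy hl hφ hχ
  recon z hz l hl φ hφ χ hχ := by
    have hl0 : 0 < l := hl.1
    have h1 := h z hz l hl φ hφ χ hχ
    rw [recRate, if_neg hγ, ← ENNReal.ofReal_toReal hF.ne, ← ENNReal.ofReal_mul S.CR_nonneg,
      ← ENNReal.ofReal_mul (mul_nonneg S.CR_nonneg ENNReal.toReal_nonneg)] at h1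
    have hC := S.CR_nonneg
    have h0 : 0 ≤ (cohNorm S.U S.a S.γ S.qt S.Kt S.lt F).toReal := ENNReal.toReal_nonneg
    exact (ENNReal.ofReal_le_ofReal_iff (by positivity)).1 h1

/-- With `q₀` derivatives at hand, the moment-based estimate works when `q₀` reaches `S.p`, and
otherwise the localized one when `q₀` reaches `S.qt`; in both cases the bound is by the data on
`S.Kt` alone. -/
lemma exists_pair_coh_scaled {q₀ : ℕ} (hq : S.p ≤ q₀ ∨ S.qt ≤ q₀) {Lm : ℝ} (hLm : 0 < Lm) :
    ∃ q, q ≤ S.p ∧ q ≤ q₀ ∧ ∃ C : ℝ, 0 ≤ C ∧ ∀ F f M, S.Bd F f M →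
      ∀ x y : S.U, (x : Sp d) ∈ S.Kt → (y : Sp d) ∈ S.Kt → ∀ L A, 0 < L → L ≤ Lm →
      ∀ g, IsCp S.p S.Q g →
      Function.support g ⊆ Metric.closedBall (x : Sp d) L → Scaled q A L g →
      |pair (F x - F y) g| ≤ C * M * A *
        (L ^ S.a * (L + dist (x : Sp d) y) ^ (S.γ - S.a)) := by
  by_cases h : S.p ≤ q₀
  · exact ⟨S.p, le_rfl, h, S.exists_pair_coh hLm⟩
  · have h' := hq.resolve_left h
    exact ⟨S.qt, h'.trans (not_le.1 h).le, h', S.exists_pair_coh_of_order (by omega) hLm⟩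

/-- Continuity of the lift. -/
lemma exists_cohNorm_liftGerm_le_mul (hU : Convex ℝ (S.U : Set (Sp d))) (hβ : 0 < β)
    (hγβ : ∀ n : ℕ, S.γ + β ≠ n) (hm : S.γ + β < m) {a' b : ℝ} (ha' : a' < 0)
    (haa : a' ≤ S.a + β) (hb0 : b ≤ 0) (hbγ : b ≤ S.γ) (hab : a' ≤ b + β) (q₀ : ℕ)
    {K : Set (Sp d)} (hK : K ⊆ S.V) {lb : ℝ} (hlb : AdmScale K S.V lb) :
    ∃ C : ℝ≥0, ∀ F f Tf, cohNorm S.U S.a S.γ S.qt S.Kt S.lt F < ∞ →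
      S.Bd F f (cohNorm S.U S.a S.γ S.qt S.Kt S.lt F).toReal →
      HasImage κ f (Tf : 𝓓'(S.V, ℝ)) →
      cohNorm S.U b S.γ q₀ (convexHull ℝ K) (lb + 3 * S.ρ / 2) F < ∞ →
      cohNorm S.V a' (S.γ + β) q₀ K lb (S.liftGerm κ f F) ≤
        C * (cohNorm S.U b S.γ q₀ (convexHull ℝ K) (lb + 3 * S.ρ / 2) F +
          cohNorm S.U S.a S.γ S.qt S.Kt S.lt F) ∧
      (S.qt ≤ q₀ → cohNorm S.V a' (S.γ + β) q₀ K lb (S.liftGerm κ f F) ≤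
        C * cohNorm S.U S.a S.γ S.qt S.Kt S.lt F) := by
  have hρ := S.ρ_pos
  have hlb0 := hlb.1
  have hco : convexHull ℝ K ⊆ S.Kt :=
    (convexHull_min hK (convex_shrink hU (by positivity))).trans
      (S.V_subset.trans S.innerSet_two_subset_Kt)
  have hKt : K ⊆ S.Kt := (subset_convexHull ℝ K).trans hco
  -- If test functions carry enough derivatives, the seminorm on `S.Kt` suffices; this case yields
  -- the stronger conclusion of the last clause.
  by_cases hq : S.p ≤ q₀ ∨ S.qt ≤ q₀
  · obtain ⟨q, hqp, hqq, C₁, hC₁, h₁⟩ := S.exists_pair_coh_scaled hq (Lm := lb + S.ρ)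
      (by positivity)
    obtain ⟨C, hC, h⟩ := exists_cohNorm_liftGerm_le (κ := κ) hU hβ hγβ hm ha' haa S.a_nonpos
      S.a_le haa hqp hqq hK hlb
    have key : ∀ F f Tf, cohNorm S.U S.a S.γ S.qt S.Kt S.lt F < ∞ →
        S.Bd F f (cohNorm S.U S.a S.γ S.qt S.Kt S.lt F).toReal →
        HasImage κ f (Tf : 𝓓'(S.V, ℝ)) →
        cohNorm S.V a' (S.γ + β) q₀ K lb (S.liftGerm κ f F) ≤
          (C * (1 + C₁)).toNNReal * cohNorm S.U S.a S.γ S.qt S.Kt S.lt F := by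
      intro F f Tf hF hB hT
      refine (h F f _ _ Tf hB hT (mul_nonneg hC₁ hB.M_nonneg) fun x y hx hy L A hL hLl g hg hs hA =>
        h₁ F f _ hB x y (hKt hx) (hKt hy) L A hL hLl g hg hs hA).trans (le_of_eq ?_)
      rw [← one_add_mul, ← mul_assoc, ENNReal.ofReal_mul (by positivity),
        ENNReal.ofReal_toReal hF.ne]
      rfl
    refine ⟨(C * (1 + C₁)).toNNReal, fun F f Tf hF hB hT _ => ?_⟩
    have h2 := key F f Tf hF hB hT
    exact ⟨h2.trans (mul_le_mul_right le_add_self _), fun _ => h2⟩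
  -- Now the order `q₀` of the hull is smaller than `S.p` and `S.qt`, so the coherence seminorm on
  -- the hull itself has to enter.
  · push Not at hq
    -- The dual pieces raise scales to at most `lb + ρ`; the extra `ρ/2` is the slack factor
    -- required by `exists_pair_coh_of_compact`.
    set k : ℝ := (lb + 3 * S.ρ / 2) / (lb + S.ρ) with hk
    obtain ⟨C₁, hC₁, h₁⟩ := S.exists_pair_coh_of_compact hq.1.le hbγ hco (lb := lb + 3 * S.ρ / 2)
      (κ := k) (by rw [hk, one_lt_div (by positivity)]; linarith)
    obtain ⟨C, hC, h⟩ := exists_cohNorm_liftGerm_le (κ := κ) hU hβ hγβ hm ha' haa hb0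
      hbγ hab hq.1.le le_rfl hK hlb
    refine ⟨(C * (1 + C₁)).toNNReal, fun F f Tf hF hB hT hc => ⟨?_, fun hq' =>
      absurd hq' (not_le.2 hq.2)⟩⟩
    have hc0 : 0 ≤ (cohNorm S.U b S.γ q₀ (convexHull ℝ K) (lb + 3 * S.ρ / 2) F).toReal :=
      ENNReal.toReal_nonneg
    have hM := hB.M_nonneg
    refine (h F f _ _ Tf hB hT (mul_nonneg hC₁ hc0) fun x y hx hy L A hL hLl g hg hs hA =>
      h₁ F f _ hB hc x y (subset_convexHull ℝ K hx) (subset_convexHull ℝ K hy) L A hL ?_ g hg hs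
        hA).trans ?_
    · rw [hk, div_mul_eq_mul_div, div_le_iff₀ (by positivity)]
      gcongr
    · have e : ((C * (1 + C₁)).toNNReal : ℝ≥0∞) = ENNReal.ofReal (C * (1 + C₁)) := rfl
      rw [e, ← ENNReal.ofReal_toReal hc.ne, ← ENNReal.ofReal_toReal hF.ne,
        ← ENNReal.ofReal_add hc0 hM, ← ENNReal.ofReal_mul (by positivity),
        ENNReal.toReal_ofReal hc0, ENNReal.toReal_ofReal hM]
      refine ENNReal.ofReal_le_ofReal ?_
      rw [mul_assoc]
      refine mul_le_mul_of_nonneg_left ?_ hC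
      nlinarith [mul_nonneg hC₁ hM]

/-- Collects the estimates for one fixed `S`, whose compact set comes from applying the
reconstruction operator once. The assumption `a' ≤ -p` is used twice: it lies below all exponents `α
K + β`, and it forces the order of test functions in the reconstruction bound up to `p`. -/
lemma exists_lift (hU : Convex ℝ (S.U : Set (Sp d))) (hγ : S.γ ≠ 0) (hβ : 0 < β)
    (hγβ : ∀ n : ℕ, S.γ + β ≠ n) (hm : S.γ + β < m) {α : Set (Sp d) → ℝ} {r : Set (Sp d) → ℕ}
    (hα : ∀ K, IsCompact K → K ⊆ S.U → α K ≤ min 0 S.γ)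
    (hp : ∀ K, IsCompact K → K ⊆ S.U → -α K < S.p) (hKt : IsCompact S.Kt)
    (hlt : AdmScale S.Kt S.U S.lt) (ha : S.a = α S.Kt) (hqt : S.qt = r S.Kt) {a' : ℝ}
    (ha' : a' < 0) (hap : a' ≤ -S.p) (R : coherentGerms S.U α S.γ r →ₗ[ℝ] 𝓓'(S.U, ℝ))
    (hR : ∀ F : coherentGerms S.U α S.γ r, ∀ z : S.U, (z : Sp d) ∈ innerSet S.U (S.ρ / 2) →
      ∀ l ∈ Ioc 0 (S.ρ / 4), ∀ φ ∈ testBall d S.qR, ∀ χ : 𝓓(S.U, ℝ),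
      (∀ y, χ y = rescale φ z l y) →
      ENNReal.ofReal |(R F - (F : S.U → 𝓓'(S.U, ℝ)) z) χ| ≤ ENNReal.ofReal S.CR *
        cohNorm S.U S.a S.γ S.qt S.Kt S.lt F * ENNReal.ofReal (recRate S.γ l))
    (W : Submodule ℝ (coherentGerms S.U α S.γ r))
    (hW : ∀ F ∈ W, ∃ T : 𝓓'(S.V, ℝ), HasImage κ (R F) T) :
    (∀ F ∈ W, ∀ x : S.V,
      (∃ T : 𝓓'(S.V, ℝ), HasImage κ (F.1 (S.incl x)) T) ∧
      (∃ T : 𝓓'(S.V, ℝ), HasImage κ (F.1 (S.incl x) - R F) T) ∧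
      ∀ k ∈ multiIndices d ⌊S.γ + β⌋,
        ∃ c, HasPtDeriv (image S.V κ (F.1 (S.incl x) - R F)) k x c) ∧
    ∃ L : W →ₗ[ℝ] coherentGerms S.V (fun _ => a') (S.γ + β) (fun K => r (convexHull ℝ K)),
      (∀ F : W, (L F).1 = S.liftGerm κ (R F.1) F.1.1) ∧
      (∀ K, IsCompact K → K ⊆ S.V → ∀ lb, AdmScale K S.V lb →
        ∃ l₁ : ℝ, AdmScale (convexHull ℝ K) S.U l₁ ∧
        ∃ C : ℝ≥0, ∀ F : W,
          cohNorm S.V a' (S.γ + β) (r (convexHull ℝ K)) K lb (L F).1 ≤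
            C * (cohNorm S.U (α (convexHull ℝ K)) S.γ (r (convexHull ℝ K)) (convexHull ℝ K) l₁
              F.1.1 + cohNorm S.U (α S.Kt) S.γ (r S.Kt) S.Kt S.lt F.1.1) ∧
          (r S.Kt ≤ r (convexHull ℝ K) →
            cohNorm S.V a' (S.γ + β) (r (convexHull ℝ K)) K lb (L F).1 ≤
              C * cohNorm S.U (α S.Kt) S.γ (r S.Kt) S.Kt S.lt F.1.1)) ∧
      ∀ F : W, IsReconstruction S.V (fun _ => a') (S.γ + β) (fun K => r (convexHull ℝ K)) (L F).1
        (image S.V κ (R F.1)) := by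
  have hfin : ∀ F : coherentGerms S.U α S.γ r,
      cohNorm S.U S.a S.γ S.qt S.Kt S.lt F.1 < ∞ := fun F => by
    rw [ha, hqt]
    exact F.2.2 _ hKt S.Kt_subset _ hlt
  have hBd : ∀ F : coherentGerms S.U α S.γ r, S.Bd F.1 (R F)
      (cohNorm S.U S.a S.γ S.qt S.Kt S.lt F.1).toReal := fun F =>
    bd_of_cohNorm_lt_top hγ (hfin F) (hR F)
  choose! T hT using hW
  have hρ := S.ρ_pos
  -- From `-α K < p` and `β > 0`: `a' ≤ -p < α K < α K + β`.
  have haK : ∀ K, IsCompact K → K ⊆ S.U → a' ≤ α K + β := fun K hK hKU => by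
    have := hp K hK hKU
    linarith
  have hcoK : ∀ K : Set (Sp d), IsCompact K → K ⊆ S.V →
      IsCompact (convexHull ℝ K) ∧ convexHull ℝ K ⊆ (S.U : Set (Sp d)) := fun K hK hKV =>
    ⟨isCompact_convexHull hK, (convexHull_min hKV (convex_shrink hU
      (mul_pos two_pos hρ))).trans (shrink_le _ _)⟩
  have hcont : ∀ K, IsCompact K → K ⊆ S.V → ∀ lb, AdmScale K S.V lb →
      ∃ l₁ : ℝ, AdmScale (convexHull ℝ K) S.U l₁ ∧
      ∃ C : ℝ≥0, ∀ F ∈ W,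
        cohNorm S.V a' (S.γ + β) (r (convexHull ℝ K)) K lb (S.liftGerm κ (R F) F.1) ≤
          C * (cohNorm S.U (α (convexHull ℝ K)) S.γ (r (convexHull ℝ K)) (convexHull ℝ K) l₁
            F.1 + cohNorm S.U (α S.Kt) S.γ (r S.Kt) S.Kt S.lt F.1) ∧
        (r S.Kt ≤ r (convexHull ℝ K) →
          cohNorm S.V a' (S.γ + β) (r (convexHull ℝ K)) K lb (S.liftGerm κ (R F) F.1) ≤
            C * cohNorm S.U (α S.Kt) S.γ (r S.Kt) S.Kt S.lt F.1) := by
    intro K hK hKV lb hlb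
    obtain ⟨hc, hcU⟩ := hcoK K hK hKV
    -- Passing from `V` to `U` gains `2ρ`; of this `ρ` is consumed by the range of the kernel, and
    -- `ρ/2` is kept as slack.
    have hl₁ : AdmScale (convexHull ℝ K) S.U (lb + 3 * S.ρ / 2) :=
      hlb.convexHull_shrink hU (by positivity) hKV (by have := hlb.1; positivity) (by linarith)
    have haKt := haK _ hKt S.Kt_subset
    rw [← ha] at haKt
    obtain ⟨C, hC⟩ := exists_cohNorm_liftGerm_le_mul (κ := κ) hU hβ hγβ hm ha' haKt
      ((hα _ hc hcU).trans (min_le_left _ _)) ((hα _ hc hcU).trans (min_le_right _ _))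
      (haK _ hc hcU) (r (convexHull ℝ K)) hKV hlb
    rw [← ha, ← hqt]
    exact ⟨_, hl₁, C, fun F hF => hC F.1 (R F) (T F) (hfin F) (hBd F) (hT F hF)
      (F.2.2 _ hc hcU _ hl₁)⟩
  have hmem : ∀ F ∈ W, S.liftGerm κ (R F) F.1 ∈
      coherentGerms S.V (fun _ => a') (S.γ + β) (fun K => r (convexHull ℝ K)) := fun F hF => by
    refine ⟨measurable_liftGerm hβ hγβ hm F.2.1 (hBd F) (hT F hF), fun K hK hKV lb hlb => ?_⟩
    obtain ⟨l₁, hl₁, C, hC⟩ := hcont K hK hKV lb hlb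
    obtain ⟨hc, hcU⟩ := hcoK K hK hKV
    exact (hC F hF).1.trans_lt (ENNReal.mul_lt_top ENNReal.coe_lt_top (ENNReal.add_lt_top.2
      ⟨F.2.2 _ hc hcU _ hl₁, F.2.2 _ hKt S.Kt_subset _ hlt⟩))
  have hadd : ∀ F ∈ W, ∀ G ∈ W, S.liftGerm κ (R (F + G)) (F + G).1 =
      S.liftGerm κ (R F) F.1 + S.liftGerm κ (R G) G.1 := fun F hF G hG => by
    have h := hBd (F + G)
    rw [map_add, Submodule.coe_add] at h
    rw [map_add, Submodule.coe_add]
    exact liftGerm_add hβ hγβ hm (hBd F) (hBd G) h (hT F hF) (hT G hG)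
  have hsmul : ∀ c : ℝ, ∀ F ∈ W, S.liftGerm κ (R (c • F)) (c • F).1 =
      c • S.liftGerm κ (R F) F.1 := fun c F hF => by
    have h := hBd (c • F)
    rw [map_smul, Submodule.coe_smul] at h
    rw [map_smul, Submodule.coe_smul]
    exact liftGerm_smul hβ hγβ hm c (hBd F) h (hT F hF)
  obtain ⟨L, hL⟩ := exists_linearMap_of_mem W _ _ hadd hsmul hmem
  refine ⟨fun F hF x => ?_, L, hL, fun K hK hKV lb hlb => ?_, fun F => ?_⟩
  · obtain ⟨T', h1, h2, -, h4⟩ := hasImage_of_bd hβ (hBd F) (hT F hF) x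
    refine ⟨⟨_, h2⟩, ⟨_, h1⟩, fun k hk => ?_⟩
    rw [h1.image_eq]
    obtain ⟨h5, h6⟩ := len_le_of_mem_multiIndices hγβ hm hk
    exact ⟨_, h4 k h5 h6⟩
  · obtain ⟨l₁, hl₁, C, hC⟩ := hcont K hK hKV lb hlb
    refine ⟨l₁, hl₁, C, fun F => ?_⟩
    rw [hL]
    exact hC F.1 F.2
  · rw [hL]
    intro K hK hKV lb hlb
    -- Since `-a' + 1 ≥ p`, the floor in `recOrder` already exceeds `p`. So the test functions have
    -- the `p` derivatives needed, and `K` itself can serve as the enlarged compact set.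
    have hq : S.p ≤ recOrder (fun _ => a') (fun K => r (convexHull ℝ K)) K :=
      (Nat.le_floor (by linarith)).trans (le_max_left _ _)
    obtain ⟨C, hC⟩ := exists_abs_sub_liftGerm_le hU hβ hγβ hm hKV hlb (hBd F.1) (hT F.1 F.2) hq
    refine ⟨K, hK, subset_rfl, hKV, C, fun z hz l hl φ hφ χ hχ => ?_⟩
    have h0 : S.γ + β ≠ 0 := by simpa using hγβ 0
    rw [(hT F.1 F.2).image_eq, recRate, if_neg h0]
    exact hC z hz l hl φ hφ χ hχ

end Setup

end Germs

end

/-! ### The proposition: choice of the exponents and of the compact set -/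

theorem mainTheorem5 {d : ℕ} (hd : 1 ≤ d) (U : Opens (Germs.Sp d))
    (hconv : Convex ℝ (U : Set (Germs.Sp d))) (hbdd : Bornology.IsBounded (U : Set (Germs.Sp d)))
    (γ β ρ : ℝ) (hγ : γ ≠ 0) (hβ : 0 < β) (hρ : 0 < ρ)
    (α : Set (Germs.Sp d) → ℝ) (r : Set (Germs.Sp d) → ℕ)
    (hα : ∀ K, IsCompact K → K ⊆ U → α K ≤ min 0 γ)
    (hαβ : ∀ K, IsCompact K → K ⊆ U → α K + β ≠ 0)
    (hγβ : ∀ n : ℕ, γ + β ≠ n)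
    (m p : ℕ) (hm : γ + β < m) (hp : ∀ K, IsCompact K → K ⊆ U → -α K < p) :
    ∃ α' : Set (Germs.Sp d) → ℝ,
      (∀ K, IsCompact K → K ⊆ Germs.shrink U (2 * ρ) → α' K ≤ min 0 (γ + β)) ∧
      ∀ (κ : Germs.RegKernel U β m p ρ)
        (R : Germs.coherentGerms U α γ r →ₗ[ℝ] 𝓓'(U, ℝ)),
        Germs.IsReconstructionOperator U α γ r R →
      ∀ W : Submodule ℝ (Germs.coherentGerms U α γ r),
        (∀ F ∈ W, ∃ T : 𝓓'(Germs.shrink U (2 * ρ), ℝ), Germs.HasImage κ (R F) T) →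
      (∀ F ∈ W, ∀ x : Germs.shrink U (2 * ρ),
        (∃ T : 𝓓'(Germs.shrink U (2 * ρ), ℝ),
          Germs.HasImage κ (F.1 ⟨x, Germs.shrink_le U (2 * ρ) x.2⟩) T) ∧
        (∃ T : 𝓓'(Germs.shrink U (2 * ρ), ℝ),
          Germs.HasImage κ (F.1 ⟨x, Germs.shrink_le U (2 * ρ) x.2⟩ - R F) T) ∧
        ∀ k ∈ Germs.multiIndices d ⌊γ + β⌋, ∃ c, Germs.HasPtDeriv
          (Germs.image (Germs.shrink U (2 * ρ)) κ
            (F.1 ⟨x, Germs.shrink_le U (2 * ρ) x.2⟩ - R F)) k x c) ∧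
      ∃ L : W →ₗ[ℝ] Germs.coherentGerms (Germs.shrink U (2 * ρ)) α' (γ + β)
          (fun K => r (convexHull ℝ K)),
        (∀ F : W, (L F).1 =
          Germs.lift (Germs.shrink_le U (2 * ρ)) κ (γ + β) (R F.1) F.1.1) ∧
        (∀ K, IsCompact K → K ⊆ Germs.shrink U (2 * ρ) →
          ∃ Kt, IsCompact Kt ∧ convexHull ℝ K ⊆ Kt ∧ Kt ⊆ U ∧
          ∀ lb, Germs.AdmScale K (Germs.shrink U (2 * ρ)) lb →
          ∃ l₁ l₂ : ℝ, Germs.AdmScale (convexHull ℝ K) U l₁ ∧ Germs.AdmScale Kt U l₂ ∧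
          ∃ C : ℝ≥0, ∀ F : W,
            Germs.cohNorm (Germs.shrink U (2 * ρ)) (α' K) (γ + β) (r (convexHull ℝ K)) K lb
                (L F).1 ≤
              C * (Germs.cohNorm U (α (convexHull ℝ K)) γ (r (convexHull ℝ K))
                  (convexHull ℝ K) l₁ F.1.1 + Germs.cohNorm U (α Kt) γ (r Kt) Kt l₂ F.1.1) ∧
            (r Kt ≤ r (convexHull ℝ K) →
              Germs.cohNorm (Germs.shrink U (2 * ρ)) (α' K) (γ + β) (r (convexHull ℝ K)) K lb
                  (L F).1 ≤
                C * Germs.cohNorm U (α Kt) γ (r Kt) Kt l₂ F.1.1)) ∧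
        (∀ F : W,
          Germs.IsReconstruction (Germs.shrink U (2 * ρ)) α' (γ + β)
            (fun K => r (convexHull ℝ K)) (L F).1
            (Germs.image (Germs.shrink U (2 * ρ)) κ (R F.1)) ∧
          (0 < γ + β → ∀ f : 𝓓'(Germs.shrink U (2 * ρ), ℝ),
            Germs.IsReconstruction (Germs.shrink U (2 * ρ)) α' (γ + β)
              (fun K => r (convexHull ℝ K)) (L F).1 f →
            f = Germs.image (Germs.shrink U (2 * ρ)) κ (R F.1))) := by
  -- Boundedness of `U` makes the set of all points at distance `ρ/2` from the complement compact.
  -- Using it once gives an enlarged set that does not depend on `K` or on the scale.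
  have hK₀ : IsCompact (Germs.innerSet U (ρ / 2)) := Germs.isCompact_innerSet hbdd (by positivity)
  have hK₀U : Germs.innerSet U (ρ / 2) ⊆ U := Germs.innerSet_subset (by positivity)
  have hadm : Germs.AdmScale (Germs.innerSet U (ρ / 2)) U (ρ / 4) :=
    Germs.admScale_of_subset_innerSet (by positivity) (by linarith) subset_rfl
  have hp0 : (0 : ℝ) ≤ p := p.cast_nonneg
  have h1 : min (-(p : ℝ)) (γ + β) ≤ -p := min_le_left _ _
  have h2 : min (-(p : ℝ)) (γ + β) ≤ γ + β := min_le_right _ _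
  -- The exponent must precede the kernel and the operator, so it uses only `p`, `γ` and `β`. The
  -- minimum puts it below `-p` and `γ + β`, and subtracting `1` makes it strictly negative, as
  -- required for decay between `l` and `l + |x - y|`.
  refine ⟨fun _ => min (-(p : ℝ)) (γ + β) - 1, fun _ _ _ =>
    le_min (by dsimp only; linarith) (by dsimp only; linarith),
    fun κ R hR W hW => ?_⟩
  obtain ⟨Kt, hKt, hsub, hKtU, lt, hlt, C, hC⟩ := hR _ hK₀ hK₀U _ hadm
  have hαK := hα Kt hKt hKtU
  let S : Germs.Setup d :=
    { U := U, Kt := Kt, ρ := ρ, γ := γ, a := α Kt, lt := lt, CR := C, p := p, qt := r Kt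
      qR := Germs.recOrder α r Kt
      bdd := hbdd
      ρ_pos := hρ
      a_nonpos := hαK.trans (min_le_left _ _)
      a_le := hαK.trans (min_le_right _ _)
      a_add_pos := by have := hp Kt hKt hKtU; linarith
      Kt_subset := hKtU
      subset_Kt := hsub
      lt_pos := hlt.1
      closedBall_subset := fun _ hz => hlt.closedBall_subset hKtU hz
      CR_nonneg := C.2 }
  obtain ⟨hwd, L, hL, hcont, hrec⟩ := Germs.Setup.exists_lift (S := S) (κ := κ) hconv hγ hβ hγβ hm
    hα hp hKt hlt rfl rfl (a' := min (-(p : ℝ)) (γ + β) - 1) (by linarith)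
    (show min (-(p : ℝ)) (γ + β) - 1 ≤ -p by linarith) R
    (fun F z hz l hl φ hφ χ hχ => by
      have h := hC F z hz l hl φ hφ χ hχ
      rwa [← ENNReal.ofReal_coe_nnreal] at h) W hW
  refine ⟨hwd, L, hL, fun K hK hKV => ⟨Kt, hKt, ?_, hKtU, fun lb hlb => ?_⟩, fun F => ⟨hrec F,
    fun h0 f hf => hf.unique h0 (hrec F)⟩⟩
  · exact (convexHull_min hKV (Germs.convex_shrink hconv (by positivity))).trans
      (S.V_subset.trans S.innerSet_two_subset_Kt)
  · obtain ⟨l₁, hl₁, C', hC'⟩ := hcont K hK hKV lb hlb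
    exact ⟨l₁, lt, hl₁, hlt, C', hC'⟩
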